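/- Let $\mathcal A$ be the free associative unital algebra over $\mathbb C$ on the letters $u_n,v_n$ ($n\ge 0$; $u=u_0$, $v=v_0$, $u_x=u_1$, $u_{xx}=u_2$, etc.), let $D$ be its derivation with $D(u_n)=u_{n+1}$, $D(v_n)=v_{n+1}$, also written $(\cdot)_x$, and $[a,b]=ab-ba$. A non-Abelian system $u_t=F_1,\ v_t=F_2$ with $F_i\in\mathcal A$ is identified with the derivation $D_t$ of $\mathcal A$ that commutes with $D$ and satisfies $D_t(u)=F_1$, $D_t(v)=F_2$; a symmetry is another such system, $u_\tau=G_1,\ v_\tau=G_2$, with $[D_t,D_\tau]=0$; its order is the largest $n$ such that $u_n$ or $v_n$ is involved in $G_1,G_2$. Scalar (commutative polynomial) systems and their symmetries are defined in the same way over the commutative polynomial algebra on the $u_n,v_n$. A system is homogeneous with weights $\mu,\nu_1,\nu_2\in\mathbb R$ if it admits the scaling group $(x,t,u,v)\mapsto(\tau^{-1}x,\tau^{-\mu}t,\tau^{\nu_1}u,\tau^{\nu_2}v)$, $\tau>0$. The minimal order of a scalar system below is the least $n>2$ for which it has a polynomial symmetry of order $n$ that is homogeneous with $\mu=n$ and with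 all $(\nu_1,\nu_2)$ with which the system is homogeneous. A non-Abelian system is called an analog of a scalar system $f$ of minimal order $n$ if: it turns into $f$ for commuting variables; it is homogeneous with the same weights as $f$ (with all of them, if the weights of $f$ contain an arbitrary parameter); and it has a symmetry of order $n$ which is homogeneous with $\mu=n$ and the same $\nu_1,\nu_2$, and which for commuting variables turns into a symmetry of $f$ of order $n$ homogeneous with the same weights. Two non-Abelian systems are equivalent if one is obtained from the other by a scaling $u\mapsto c_1u$, $v\mapsto c_2v$ ($c_1,c_2\in\mathbb C\setminus\{0\}$), possibly combined with the $\mathbb C$-linear involution of $\mathcal A$ that fixes the letters and reverses products. Consider the scalar systems (here $\alpha,\beta\in\mathbb C$) - $S_1$: $u_t=u_{xx}+2u^2v$, $v_t=-v_{xx}-2v^2u$; - $S_2$: $u_t=u_{xx}+2uu_x+2vu_x+2uv_x$, $v_t=-v_{xx}+2vv_x+2vu_x+2uv_x$; - $S_3$: $u_t=u_{xx}+2u_xv+2uv_x$, $v_t=-v_{xx}+2vv_x+2u_x$; - $S_4$: $u_t=u_{xx}+2(u+v)u_x$, $v_t=-v_{xx}+2(u+v)v_x$; - $S_5(\alpha,\beta)$,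 $(\alpha,\beta)\neq(0,0)$: $u_t=u_{xx}+2\alpha u^2v_x+2\beta uvu_x+\alpha(\beta-2\alpha)u^3v^2$, $v_t=-v_{xx}+2\alpha v^2u_x+2\beta uvv_x-\alpha(\beta-2\alpha)u^2v^3$; - $B_1$: $u_t=u_{xx}+(u+v)^2$, $v_t=-v_{xx}-(u+v)^2$; - $B_2$: $u_t=u_{xx}+2vv_x$, $v_t=-v_{xx}+u_x$; - $B_3$: $u_t=u_{xx}+6(u+v)v_x-6(u+v)^3$, $v_t=-v_{xx}+6(u+v)u_x+6(u+v)^3$; - $B_4$: $u_t=u_{xx}+2vv_x$, $v_t=-v_{xx}+2uu_x$; - $L_1$: $u_t=u_{xx}+2uu_x+2vu_x+2uv_x+2u^2v+2uv^2$, $v_t=-v_{xx}-2vv_x-2vu_x-2uv_x-2u^2v-2uv^2$; - $L_2$: $u_t=u_{xx}+2u_xv+2uv_x+2uv^2+u^2$, $v_t=-v_{xx}-2vv_x-u_x$; - $L_3(\alpha,\beta)$, $\alpha\ne0$: $u_t=u_{xx}+2\alpha u^2v_x+2\alpha uvu_x-\alpha\beta u^3v^2$, $v_t=-v_{xx}+2\beta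 v^2u_x+2\beta uvv_x+\alpha\beta u^2v^3$; - $L_4$: $u_t=u_{xx}+4uvu_x+4u^2v_x+3vv_x+2u^3v^2+uv^3$, $v_t=-v_{xx}-2v^2u_x-2uvv_x-2u^2v^3-v^4$; - $L_5$: $u_t=u_{xx}+4uu_x+2vv_x$, $v_t=-v_{xx}-2vu_x-2uv_x-3u^2v-v^3$; and the non-Abelian systems - $S_1'$: $u_t=u_{xx}+2uvu$, $v_t=-v_{xx}-2vuv$; - $S_2'$: $u_t=u_{xx}+2u_xu+2(vu)_x+2[vu,u]$, $v_t=-v_{xx}+2v_xv+2(uv)_x+2[v,uv]$; - $S_2''$: $u_t=u_{xx}+2uu_x+2(vu)_x+2[u,vu]$, $v_t=-v_{xx}+2v_xv+2(vu)_x+2[v,vu]$; - $S_3'$: $u_t=u_{xx}+2(vu)_x$, $v_t=-v_{xx}+2v_xv+2u_x+2[v,u]$; - $S_4'$: $u_t=u_{xx}+2u_x(u+v)$, $v_t=-v_{xx}+2(u+v)v_x$; - $S_4''$: $u_t=u_{xx}+2(u+v)u_x+2[v_x,u]-2u^2v+4uvu-2vu^2$, $v_t=-v_{xx}+2v_x(u+v)+2[v,u_x]+2uv^2-4vuv+2v^2u$;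 - $S_5'(1,2)$: $u_t=u_{xx}+2(uvu)_x$, $v_t=-v_{xx}+2(vuv)_x$; - $S_5''(1,2)$: $u_t=u_{xx}+2u^2v_x+2u_xuv+2u_xvu+2[u^2v^2,u]$, $v_t=-v_{xx}+2u_xv^2+2uvv_x+2vuv_x-2[v,u^2v^2]$; - $S_5'(0,1)$: $u_t=u_{xx}+2uvu_x$, $v_t=-v_{xx}+2v_xuv$; - $S_5''(0,1)$: $u_t=u_{xx}+2vuu_x+2[v_xu-v[v,u]u,u]$, $v_t=-v_{xx}+2v_xvu+2[v,vu_x+v[v,u]u]$; - $S_5'''(0,1)$: $u_t=u_{xx}+2u_xvu+2[uv,u_x]+2[uv_x,u]-2u(u^2v-2uvu+vu^2)v$, $v_t=-v_{xx}+2vuv_x+2[v_x,uv]+2[v,u_xv]+2u(uv^2-2vuv+v^2u)v$; - $S_5'(1,0)$: $u_t=u_{xx}+2uv_xu-2uvuvu$, $v_t=-v_{xx}+2vu_xv+2vuvuv$; - $S_5''(1,0)$: $u_t=u_{xx}+2u^2v_x-2u^3v^2+2[u_x+u^2v,uv]$, $v_t=-v_{xx}+2u_xv^2+2u^2v^3-2[v_x-uv^2,uv]$;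 - $B_2'$: $u_t=u_{xx}+v_xv+vv_x+\frac{i\sqrt3}{3}[u-v_x,v]$, $v_t=-v_{xx}+u_x$; - $B_3'$: $u_t=u_{xx}+3(u+v)v_x+3v_x(u+v)-6(u+v)^3+i\sqrt3[u+v,v_x]$, $v_t=-v_{xx}+3(u+v)u_x+3u_x(u+v)+6(u+v)^3-i\sqrt3[u+v,u_x]$; - $B_3''$: $u_t=u_{xx}+3(u+v)v_x+3v_x(u+v)-6(u^3+3uvu+uv^2+vuv+v^2u+v^3)+i\sqrt3\bigl([v_x,u-v]+2[u+v,u_x]+6[u^2,v]+6[u,v^2]\bigr)$, $v_t=-v_{xx}+3(u+v)u_x+3u_x(u+v)+6(u^3+u^2v+uvu+vu^2+3vuv+v^3)+i\sqrt3\bigl([u_x,u-v]-2[u+v,v_x]-6[u^2,v]-6[u,v^2]\bigr)$; - $B_4'$: $u_t=u_{xx}+vv_x+v_xv+\frac{i\sqrt3}{3}[v,u^2-v_x]-\frac13(u^2v-2uvu+vu^2)$, $v_t=-v_{xx}+uu_x+u_xu+\frac{i\sqrt3}{3}[u,v^2+u_x]+\frac13(uv^2-2vuv+v^2u)$; - $B_4''$: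 $u_t=u_{xx}+vv_x+v_xv+u^2v-2uvu+vu^2-\frac{i\sqrt3}{3}\bigl(2[u+v,u_x]+[v-2u,v_x]+[u^2,v]+2[u,v^2]\bigr)$, $v_t=-v_{xx}+uu_x+u_xu-uv^2+2vuv-v^2u+\frac{i\sqrt3}{3}\bigl([u-2v,u_x]+2[u+v,v_x]+2[u^2,v]+[u,v^2]\bigr)$; - $L_1'$: $u_t=u_{xx}+2u_xu+2(uv)_x+2uv(u+v)$, $v_t=-v_{xx}-2v_xv-2(vu)_x-2vu(u+v)$; - $L_2'$: $u_t=u_{xx}+2(uv)_x+u^2+2uv^2$, $v_t=-v_{xx}-u_x-2v_xv-[u,v]$; - $L_3'(1,0)$: $u_t=u_{xx}+2uv_xu+2u_xvu$, $v_t=-v_{xx}$; - $L_3''(1,0)$: $u_t=u_{xx}+2u_xuv+2u^2v_x-2u^2[u,v]v$, $v_t=-v_{xx}+2[uv,v_x-uv^2]+2[u_xv+u^2v^2,v]$. Then the 22 non-Abelian systems listed are pairwise non-equivalent, and a non-Abelian system that turns into the scalar system $f$ for commuting variables is an analog of $f$ if and only if it is equivalent to one of the following: - $S_1'$ for $f=S_1$;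 $S_2'$ or $S_2''$ for $S_2$; $S_3'$ for $S_3$; $S_4'$ or $S_4''$ for $S_4$; - $S_5'(1,2)$ or $S_5''(1,2)$ for $S_5(\alpha,2\alpha)$, $\alpha\ne0$; $S_5'(0,1)$, $S_5''(0,1)$ or $S_5'''(0,1)$ for $S_5(0,\beta)$, $\beta\neq0$; $S_5'(1,0)$ or $S_5''(1,0)$ for $S_5(\alpha,0)$, $\alpha\ne0$; - $B_2'$ for $B_2$; $B_3'$ or $B_3''$ for $B_3$; $B_4'$ or $B_4''$ for $B_4$; - $L_1'$ for $L_1$; $L_2'$ for $L_2$; $L_3'(1,0)$ or $L_3''(1,0)$ for $L_3(\alpha,0)$, $\alpha\neq0$. The remaining scalar systems, that is, $S_5(\alpha,\beta)$ with $\alpha\ne0$, $\beta\neq0$, $\beta\ne2\alpha$, the system $B_1$, $L_3(\alpha,\beta)$ with $\alpha\neq0$, $\beta\ne0$, and the systems $L_4$, $L_5$, have no non-Abelian analogs. -/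

import Mathlib

namespace NonAbelian

/-! ### Differential polynomials

The index `(0, n)` stands for the `n`-th `x`-derivative of the first unknown `u`, the index `(1, n)`
for the `n`-th `x`-derivative of the second unknown `v`. -/

/-- Noncommutative differential polynomials: the free associative unital algebra over `ℂ` on
`u, v, u_x, v_x, u_xx, v_xx, …`. -/
abbrev NPoly : Type := FreeAlgebra ℂ (Fin 2 × ℕ)

/-- Commutative differential polynomials in `u, v, u_x, v_x, u_xx, v_xx, …`. -/
abbrev CPoly : Type := MvPolynomial (Fin 2 × ℕ) ℂ

/-- The right-hand sides `(F 0, F 1)` of a non-Abelian system `u_t = F 0`, `v_t = F 1`. -/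
abbrev NSystem : Type := Fin 2 → NPoly

/-- The right-hand sides `(f 0, f 1)` of a scalar system `u_t = f 0`, `v_t = f 1`. -/
abbrev CSystem : Type := Fin 2 → CPoly

/-- Noncommuting `u_n`. -/
noncomputable def u (n : ℕ) : NPoly := FreeAlgebra.ι ℂ ((0 : Fin 2), n)

/-- Noncommuting `v_n`. -/
noncomputable def v (n : ℕ) : NPoly := FreeAlgebra.ι ℂ ((1 : Fin 2), n)

/-- Commuting `u_n`. -/
noncomputable def cu (n : ℕ) : CPoly := MvPolynomial.X ((0 : Fin 2), n)

/-- Commuting `v_n`. -/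
noncomputable def cv (n : ℕ) : CPoly := MvPolynomial.X ((1 : Fin 2), n)

/-- Substitution of commuting variables instead of noncommuting ones. -/
noncomputable def abelianize : NPoly →ₐ[ℂ] CPoly :=
  FreeAlgebra.lift ℂ (fun p : Fin 2 × ℕ => (MvPolynomial.X p : CPoly))

/-- The scalar system obtained from a non-Abelian one. -/
noncomputable def NSystem.ab (F : NSystem) : CSystem := fun k => abelianize (F k)

/-! ### Derivations -/

/-- The derivation of the free algebra that sends the generator `p` to `h p` (built as the second
component of an algebra homomorphism into the square-zero extension). -/
noncomputable def der (h : Fin 2 × ℕ → NPoly) : NPoly →ₗ[ℂ] NPoly :=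
  (TrivSqZeroExt.sndHom NPoly NPoly).restrictScalars ℂ ∘ₗ
    (FreeAlgebra.lift ℂ (fun p : Fin 2 × ℕ =>
      (TrivSqZeroExt.inl (FreeAlgebra.ι ℂ p) + TrivSqZeroExt.inr (h p) :
        TrivSqZeroExt NPoly NPoly))).toLinearMap

theorem der_ι (h : Fin 2 × ℕ → NPoly) (p : Fin 2 × ℕ) : der h (FreeAlgebra.ι ℂ p) = h p := by
  simp [der]

theorem der_mul (h : Fin 2 × ℕ → NPoly) (a b : NPoly) :
    der h (a * b) = der h a * b + a * der h b := by
  have key : (TrivSqZeroExt.fstHom ℂ NPoly NPoly).comp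
      (FreeAlgebra.lift ℂ (fun p : Fin 2 × ℕ =>
        (TrivSqZeroExt.inl (FreeAlgebra.ι ℂ p) + TrivSqZeroExt.inr (h p) :
          TrivSqZeroExt NPoly NPoly))) = AlgHom.id ℂ NPoly := by
    ext p
    simp
  have fst_lift : ∀ c : NPoly, (FreeAlgebra.lift ℂ (fun p : Fin 2 × ℕ =>
        (TrivSqZeroExt.inl (FreeAlgebra.ι ℂ p) + TrivSqZeroExt.inr (h p) :
          TrivSqZeroExt NPoly NPoly)) c).fst = c := fun c => DFunLike.congr_fun key c
  simp only [der, LinearMap.comp_apply, AlgHom.toLinearMap_apply, LinearMap.restrictScalars_apply,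
    TrivSqZeroExt.sndHom_apply, map_mul, TrivSqZeroExt.snd_mul, fst_lift, smul_eq_mul,
    MulOpposite.smul_eq_mul_unop, MulOpposite.unop_op]
  exact add_comm _ _

/-- The total `x`-derivative of noncommutative differential polynomials. -/
noncomputable def D : NPoly →ₗ[ℂ] NPoly := der (fun p => FreeAlgebra.ι ℂ (p.1, p.2 + 1))

/-- The derivation `D_t` of the free algebra given by the system `u_t = F 0`, `v_t = F 1`: it is
determined by `D_t u = F 0`, `D_t v = F 1` and by commuting with `D`. -/
noncomputable def NSystem.flow (F : NSystem) : NPoly →ₗ[ℂ] NPoly :=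
  der (fun p => (D ^ p.2) (F p.1))

/-- The total `x`-derivative of commutative differential polynomials. -/
noncomputable def cD : Derivation ℂ CPoly CPoly :=
  MvPolynomial.mkDerivation ℂ (fun p : Fin 2 × ℕ => (MvPolynomial.X (p.1, p.2 + 1) : CPoly))

/-- The derivation `D_t` given by the scalar system `u_t = f 0`, `v_t = f 1`. -/
noncomputable def CSystem.flow (f : CSystem) : Derivation ℂ CPoly CPoly :=
  MvPolynomial.mkDerivation ℂ (fun p : Fin 2 × ℕ => cD^[p.2] (f p.1))

/-! ### Homogeneity -/

/-- The action of `(x, u, v) ↦ (τ⁻¹ x, τ ^ ν₀ u, τ ^ ν₁ v)` on noncommutative differential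
polynomials: `u_n ↦ τ ^ (ν₀ + n) u_n`, `v_n ↦ τ ^ (ν₁ + n) v_n`. -/
noncomputable def nScale (ν : Fin 2 → ℝ) (τ : ℝ) : NPoly →ₐ[ℂ] NPoly :=
  FreeAlgebra.lift ℂ (fun p : Fin 2 × ℕ =>
    ((τ ^ (ν p.1 + p.2) : ℝ) : ℂ) • FreeAlgebra.ι ℂ p)

/-- The same action on commutative differential polynomials. -/
noncomputable def cScale (ν : Fin 2 → ℝ) (τ : ℝ) : CPoly →ₐ[ℂ] CPoly :=
  MvPolynomial.aeval (fun p : Fin 2 × ℕ =>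
    ((τ ^ (ν p.1 + p.2) : ℝ) : ℂ) • (MvPolynomial.X p : CPoly))

/-- The system admits the scaling group
`(x, t, u, v) ↦ (τ⁻¹ x, τ ^ (-μ) t, τ ^ ν₀ u, τ ^ ν₁ v)`. -/
def NSystem.IsHomogeneous (F : NSystem) (μ : ℝ) (ν : Fin 2 → ℝ) : Prop :=
  ∀ τ : ℝ, 0 < τ → ∀ k, nScale ν τ (F k) = ((τ ^ (μ + ν k) : ℝ) : ℂ) • F k

/-- The scalar system admits the scaling group
`(x, t, u, v) ↦ (τ⁻¹ x, τ ^ (-μ) t, τ ^ ν₀ u, τ ^ ν₁ v)`. -/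
def CSystem.IsHomogeneous (f : CSystem) (μ : ℝ) (ν : Fin 2 → ℝ) : Prop :=
  ∀ τ : ℝ, 0 < τ → ∀ k, cScale ν τ (f k) = ((τ ^ (μ + ν k) : ℝ) : ℂ) • f k

/-! ### Order, symmetries, analogs -/

/-- The right-hand sides involve derivatives up to order exactly `n`. -/
def NSystem.HasOrder (F : NSystem) (n : ℕ) : Prop :=
  (∀ k, F k ∈ Algebra.adjoin ℂ {a | ∃ p : Fin 2 × ℕ, p.2 ≤ n ∧ a = FreeAlgebra.ι ℂ p}) ∧
  ¬ ∀ k, F k ∈ Algebra.adjoin ℂ {a | ∃ p : Fin 2 × ℕ, p.2 < n ∧ a = FreeAlgebra.ι ℂ p}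

/-- The right-hand sides involve derivatives up to order exactly `n`. -/
def CSystem.HasOrder (f : CSystem) (n : ℕ) : Prop :=
  (∀ k, f k ∈ Algebra.adjoin ℂ {a | ∃ p : Fin 2 × ℕ, p.2 ≤ n ∧ a = MvPolynomial.X p}) ∧
  ¬ ∀ k, f k ∈ Algebra.adjoin ℂ {a | ∃ p : Fin 2 × ℕ, p.2 < n ∧ a = MvPolynomial.X p}

/-- `G` is a symmetry of `F`: the derivations `D_t` and `D_τ` commute. -/
def NSystem.IsSymmetry (F G : NSystem) : Prop := ∀ a, F.flow (G.flow a) = G.flow (F.flow a)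

/-- `g` is a symmetry of the scalar system `f`. -/
def CSystem.IsSymmetry (f g : CSystem) : Prop := ∀ a, f.flow (g.flow a) = g.flow (f.flow a)

/-- `g` is a polynomial symmetry of `f` of order `n` that is homogeneous with respect to all weights
of `u, v` with respect to which `f` is homogeneous (the weight of `∂_τ` being the order `n`). -/
def CSystem.IsHomSymmetry (f : CSystem) (n : ℕ) (g : CSystem) : Prop :=
  f.IsSymmetry g ∧ g.HasOrder n ∧ ∀ μ ν, f.IsHomogeneous μ ν → g.IsHomogeneous n ν

/-- `n` is the minimal order of a higher symmetry of the (second order) scalar system `f`. -/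
def CSystem.IsMinOrder (f : CSystem) (n : ℕ) : Prop :=
  IsLeast {m : ℕ | 2 < m ∧ ∃ g, f.IsHomSymmetry m g} n

/-- `F` is a non-Abelian analog of the scalar system `f`: it turns into `f` for commuting variables,
it is homogeneous with the same weights as `f` (with all of them if the weights of `f` contain an
arbitrary parameter), and it has a symmetry `G` of the same minimal order `n` as `f`, homogeneous
with the same weights, which turns into a symmetry of `f` of this order for commuting variables. -/
def IsAnalog (f : CSystem) (F : NSystem) : Prop :=
  F.ab = f ∧ (∀ μ ν, f.IsHomogeneous μ ν → F.IsHomogeneous μ ν) ∧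
  ∃ (n : ℕ) (G : NSystem), f.IsMinOrder n ∧ F.IsSymmetry G ∧ G.HasOrder n ∧
    (∀ μ ν, f.IsHomogeneous μ ν → G.IsHomogeneous n ν) ∧ f.IsHomSymmetry n G.ab

/-! ### Equivalence -/

/-- The system satisfied by `(c 0 * u, c 1 * v)` when `(u, v)` satisfies the system `F`. -/
noncomputable def NSystem.rescale (c : Fin 2 → ℂ) (F : NSystem) : NSystem := fun k =>
  c k • FreeAlgebra.lift ℂ (fun p : Fin 2 × ℕ => (c p.1)⁻¹ • FreeAlgebra.ι ℂ p) (F k)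

/-- The system obtained by the `ℂ`-linear involution of the free algebra that fixes the generators
and reverses products; this is `star` on `FreeAlgebra` (it does not conjugate the coefficients). -/
noncomputable def NSystem.involution (F : NSystem) : NSystem := fun k => star (F k)

/-- Equivalence of non-Abelian systems: up to a scaling of the unknowns and the involution. -/
def Equivalent (F G : NSystem) : Prop :=
  ∃ c : Fin 2 → ℂ, (∀ k, c k ≠ 0) ∧ (F = G.rescale c ∨ F = (G.rescale c).involution)

/-- The non-Abelian analogs of `f` are exactly the systems equivalent to a member of the list `l`
(and having the scalar reduction `f`). -/
def AnalogsAre (f : CSystem) (l : List NSystem) : Prop :=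
  ∀ F : NSystem, IsAnalog f F ↔ F.ab = f ∧ ∃ G ∈ l, Equivalent F G

/-- The scalar system `f` has no non-Abelian analogs. -/
def NoAnalogs (f : CSystem) : Prop := ∀ F : NSystem, ¬ IsAnalog f F

/-! ### Scalar systems -/

noncomputable def S1 : CSystem :=
  ![cu 2 + 2 * cu 0 * cv 0 * cu 0,
    -cv 2 - 2 * cv 0 * cu 0 * cv 0]

noncomputable def S2 : CSystem :=
  ![cu 2 + 2 * cu 0 * cu 1 + 2 * cv 0 * cu 1 + 2 * cu 0 * cv 1,
    -cv 2 + 2 * cv 0 * cv 1 + 2 * cv 0 * cu 1 + 2 * cu 0 * cv 1]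

noncomputable def S3 : CSystem :=
  ![cu 2 + 2 * cu 1 * cv 0 + 2 * cu 0 * cv 1,
    -cv 2 + 2 * cv 0 * cv 1 + 2 * cu 1]

noncomputable def S4 : CSystem :=
  ![cu 2 + 2 * (cu 0 + cv 0) * cu 1,
    -cv 2 + 2 * (cu 0 + cv 0) * cv 1]

noncomputable def S5 (α β : ℂ) : CSystem :=
  ![cu 2 + (2 * α) • (cu 0 ^ 2 * cv 1) + (2 * β) • (cu 0 * cv 0 * cu 1)
      + (α * (β - 2 * α)) • (cu 0 ^ 3 * cv 0 ^ 2),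
    -cv 2 + (2 * α) • (cv 0 ^ 2 * cu 1) + (2 * β) • (cu 0 * cv 0 * cv 1)
      - (α * (β - 2 * α)) • (cu 0 ^ 2 * cv 0 ^ 3)]

noncomputable def B1 : CSystem :=
  ![cu 2 + (cu 0 + cv 0) ^ 2,
    -cv 2 - (cu 0 + cv 0) ^ 2]

noncomputable def B2 : CSystem :=
  ![cu 2 + 2 * cv 0 * cv 1,
    -cv 2 + cu 1]

noncomputable def B3 : CSystem :=
  ![cu 2 + 6 * (cu 0 + cv 0) * cv 1 - 6 * (cu 0 + cv 0) ^ 3,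
    -cv 2 + 6 * (cu 0 + cv 0) * cu 1 + 6 * (cu 0 + cv 0) ^ 3]

noncomputable def B4 : CSystem :=
  ![cu 2 + 2 * cv 0 * cv 1,
    -cv 2 + 2 * cu 0 * cu 1]

noncomputable def L1 : CSystem :=
  ![cu 2 + 2 * cu 0 * cu 1 + 2 * cv 0 * cu 1 + 2 * cu 0 * cv 1
      + 2 * cu 0 ^ 2 * cv 0 + 2 * cu 0 * cv 0 ^ 2,
    -cv 2 - 2 * cv 0 * cv 1 - 2 * cv 0 * cu 1 - 2 * cu 0 * cv 1
      - 2 * cu 0 ^ 2 * cv 0 - 2 * cu 0 * cv 0 ^ 2]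

noncomputable def L2 : CSystem :=
  ![cu 2 + 2 * cu 1 * cv 0 + 2 * cu 0 * cv 1 + 2 * cu 0 * cv 0 ^ 2 + cu 0 ^ 2,
    -cv 2 - 2 * cv 0 * cv 1 - cu 1]

noncomputable def L3 (α β : ℂ) : CSystem :=
  ![cu 2 + (2 * α) • (cu 0 ^ 2 * cv 1) + (2 * α) • (cu 0 * cv 0 * cu 1)
      - (α * β) • (cu 0 ^ 3 * cv 0 ^ 2),
    -cv 2 + (2 * β) • (cv 0 ^ 2 * cu 1) + (2 * β) • (cu 0 * cv 0 * cv 1)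
      + (α * β) • (cu 0 ^ 2 * cv 0 ^ 3)]

noncomputable def L4 : CSystem :=
  ![cu 2 + 4 * cu 0 * cv 0 * cu 1 + 4 * cu 0 ^ 2 * cv 1 + 3 * cv 0 * cv 1
      + 2 * cu 0 ^ 3 * cv 0 ^ 2 + cu 0 * cv 0 ^ 3,
    -cv 2 - 2 * cv 0 ^ 2 * cu 1 - 2 * cu 0 * cv 0 * cv 1 - 2 * cu 0 ^ 2 * cv 0 ^ 3 - cv 0 ^ 4]

noncomputable def L5 : CSystem :=
  ![cu 2 + 4 * cu 0 * cu 1 + 2 * cv 0 * cv 1,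
    -cv 2 - 2 * cv 0 * cu 1 - 2 * cu 0 * cv 1 - 3 * cu 0 ^ 2 * cv 0 - cv 0 ^ 3]

/-! ### Non-Abelian systems -/

/-- The complex number `i √3`. -/
noncomputable def iSqrt3 : ℂ := Complex.I * (Real.sqrt 3 : ℂ)

noncomputable def S1' : NSystem :=
  ![u 2 + 2 * (u 0 * v 0 * u 0),
    -v 2 - 2 * (v 0 * u 0 * v 0)]

noncomputable def S2' : NSystem :=
  ![u 2 + 2 * (u 1 * u 0) + 2 * D (v 0 * u 0) + 2 * ⁅v 0 * u 0, u 0⁆,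
    -v 2 + 2 * (v 1 * v 0) + 2 * D (u 0 * v 0) + 2 * ⁅v 0, u 0 * v 0⁆]

noncomputable def S2'' : NSystem :=
  ![u 2 + 2 * (u 0 * u 1) + 2 * D (v 0 * u 0) + 2 * ⁅u 0, v 0 * u 0⁆,
    -v 2 + 2 * (v 1 * v 0) + 2 * D (v 0 * u 0) + 2 * ⁅v 0, v 0 * u 0⁆]

noncomputable def S3' : NSystem :=
  ![u 2 + 2 * D (v 0 * u 0),
    -v 2 + 2 * (v 1 * v 0) + 2 * u 1 + 2 * ⁅v 0, u 0⁆]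

noncomputable def S4' : NSystem :=
  ![u 2 + 2 * (u 1 * (u 0 + v 0)),
    -v 2 + 2 * ((u 0 + v 0) * v 1)]

noncomputable def S4'' : NSystem :=
  ![u 2 + 2 * ((u 0 + v 0) * u 1) + 2 * ⁅v 1, u 0⁆
      - 2 * (u 0 ^ 2 * v 0) + 4 * (u 0 * v 0 * u 0) - 2 * (v 0 * u 0 ^ 2),
    -v 2 + 2 * (v 1 * (u 0 + v 0)) + 2 * ⁅v 0, u 1⁆
      + 2 * (u 0 * v 0 ^ 2) - 4 * (v 0 * u 0 * v 0) + 2 * (v 0 ^ 2 * u 0)]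

/-- First analog of `S5 1 2`. -/
noncomputable def S512' : NSystem :=
  ![u 2 + 2 * D (u 0 * v 0 * u 0),
    -v 2 + 2 * D (v 0 * u 0 * v 0)]

/-- Second analog of `S5 1 2`. -/
noncomputable def S512'' : NSystem :=
  ![u 2 + 2 * (u 0 ^ 2 * v 1) + 2 * (u 1 * u 0 * v 0) + 2 * (u 1 * v 0 * u 0)
      + 2 * ⁅u 0 ^ 2 * v 0 ^ 2, u 0⁆,
    -v 2 + 2 * (u 1 * v 0 ^ 2) + 2 * (u 0 * v 0 * v 1) + 2 * (v 0 * u 0 * v 1)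
      - 2 * ⁅v 0, u 0 ^ 2 * v 0 ^ 2⁆]

/-- First analog of `S5 0 1`. -/
noncomputable def S501' : NSystem :=
  ![u 2 + 2 * (u 0 * v 0 * u 1),
    -v 2 + 2 * (v 1 * u 0 * v 0)]

/-- Second analog of `S5 0 1`. -/
noncomputable def S501'' : NSystem :=
  ![u 2 + 2 * (v 0 * u 0 * u 1) + 2 * ⁅v 1 * u 0 - v 0 * ⁅v 0, u 0⁆ * u 0, u 0⁆,
    -v 2 + 2 * (v 1 * v 0 * u 0) + 2 * ⁅v 0, v 0 * u 1 + v 0 * ⁅v 0, u 0⁆ * u 0⁆]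

/-- Third analog of `S5 0 1`. -/
noncomputable def S501''' : NSystem :=
  ![u 2 + 2 * (u 1 * v 0 * u 0) + 2 * ⁅u 0 * v 0, u 1⁆ + 2 * ⁅u 0 * v 1, u 0⁆
      - 2 * (u 0 * (u 0 ^ 2 * v 0 - 2 * (u 0 * v 0 * u 0) + v 0 * u 0 ^ 2) * v 0),
    -v 2 + 2 * (v 0 * u 0 * v 1) + 2 * ⁅v 1, u 0 * v 0⁆ + 2 * ⁅v 0, u 1 * v 0⁆
      + 2 * (u 0 * (u 0 * v 0 ^ 2 - 2 * (v 0 * u 0 * v 0) + v 0 ^ 2 * u 0) * v 0)]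

/-- First analog of `S5 1 0`. -/
noncomputable def S510' : NSystem :=
  ![u 2 + 2 * (u 0 * v 1 * u 0) - 2 * (u 0 * v 0 * u 0 * v 0 * u 0),
    -v 2 + 2 * (v 0 * u 1 * v 0) + 2 * (v 0 * u 0 * v 0 * u 0 * v 0)]

/-- Second analog of `S5 1 0`. -/
noncomputable def S510'' : NSystem :=
  ![u 2 + 2 * (u 0 ^ 2 * v 1) - 2 * (u 0 ^ 3 * v 0 ^ 2)
      + 2 * ⁅u 1 + u 0 ^ 2 * v 0, u 0 * v 0⁆,
    -v 2 + 2 * (u 1 * v 0 ^ 2) + 2 * (u 0 ^ 2 * v 0 ^ 3)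
      - 2 * ⁅v 1 - u 0 * v 0 ^ 2, u 0 * v 0⁆]

noncomputable def B2' : NSystem :=
  ![u 2 + v 1 * v 0 + v 0 * v 1 + (iSqrt3 / 3) • ⁅u 0 - v 1, v 0⁆,
    -v 2 + u 1]

noncomputable def B3' : NSystem :=
  ![u 2 + 3 * ((u 0 + v 0) * v 1) + 3 * (v 1 * (u 0 + v 0)) - 6 * (u 0 + v 0) ^ 3
      + iSqrt3 • ⁅u 0 + v 0, v 1⁆,
    -v 2 + 3 * ((u 0 + v 0) * u 1) + 3 * (u 1 * (u 0 + v 0)) + 6 * (u 0 + v 0) ^ 3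
      - iSqrt3 • ⁅u 0 + v 0, u 1⁆]

noncomputable def B3'' : NSystem :=
  ![u 2 + 3 * ((u 0 + v 0) * v 1) + 3 * (v 1 * (u 0 + v 0))
      - 6 * (u 0 ^ 3 + 3 * (u 0 * v 0 * u 0) + u 0 * v 0 ^ 2 + v 0 * u 0 * v 0
        + v 0 ^ 2 * u 0 + v 0 ^ 3)
      + iSqrt3 • (⁅v 1, u 0 - v 0⁆ + 2 * ⁅u 0 + v 0, u 1⁆
        + 6 * ⁅u 0 ^ 2, v 0⁆ + 6 * ⁅u 0, v 0 ^ 2⁆),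
    -v 2 + 3 * ((u 0 + v 0) * u 1) + 3 * (u 1 * (u 0 + v 0))
      + 6 * (u 0 ^ 3 + u 0 ^ 2 * v 0 + u 0 * v 0 * u 0 + v 0 * u 0 ^ 2
        + 3 * (v 0 * u 0 * v 0) + v 0 ^ 3)
      + iSqrt3 • (⁅u 1, u 0 - v 0⁆ - 2 * ⁅u 0 + v 0, v 1⁆
        - 6 * ⁅u 0 ^ 2, v 0⁆ - 6 * ⁅u 0, v 0 ^ 2⁆)]

noncomputable def B4' : NSystem :=
  ![u 2 + v 0 * v 1 + v 1 * v 0 + (iSqrt3 / 3) • ⁅v 0, u 0 ^ 2 - v 1⁆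
      - (1 / 3 : ℂ) • (u 0 ^ 2 * v 0 - 2 * (u 0 * v 0 * u 0) + v 0 * u 0 ^ 2),
    -v 2 + u 0 * u 1 + u 1 * u 0 + (iSqrt3 / 3) • ⁅u 0, v 0 ^ 2 + u 1⁆
      + (1 / 3 : ℂ) • (u 0 * v 0 ^ 2 - 2 * (v 0 * u 0 * v 0) + v 0 ^ 2 * u 0)]

noncomputable def B4'' : NSystem :=
  ![u 2 + v 0 * v 1 + v 1 * v 0 + u 0 ^ 2 * v 0 - 2 * (u 0 * v 0 * u 0) + v 0 * u 0 ^ 2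
      - (iSqrt3 / 3) • (2 * ⁅u 0 + v 0, u 1⁆ + ⁅v 0 - 2 * u 0, v 1⁆
        + ⁅u 0 ^ 2, v 0⁆ + 2 * ⁅u 0, v 0 ^ 2⁆),
    -v 2 + u 0 * u 1 + u 1 * u 0 - u 0 * v 0 ^ 2 + 2 * (v 0 * u 0 * v 0) - v 0 ^ 2 * u 0
      + (iSqrt3 / 3) • (⁅u 0 - 2 * v 0, u 1⁆ + 2 * ⁅u 0 + v 0, v 1⁆
        + 2 * ⁅u 0 ^ 2, v 0⁆ + ⁅u 0, v 0 ^ 2⁆)]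

noncomputable def L1' : NSystem :=
  ![u 2 + 2 * (u 1 * u 0) + 2 * D (u 0 * v 0) + 2 * (u 0 * v 0 * (u 0 + v 0)),
    -v 2 - 2 * (v 1 * v 0) - 2 * D (v 0 * u 0) - 2 * (v 0 * u 0 * (u 0 + v 0))]

noncomputable def L2' : NSystem :=
  ![u 2 + 2 * D (u 0 * v 0) + u 0 ^ 2 + 2 * (u 0 * v 0 ^ 2),
    -v 2 - u 1 - 2 * (v 1 * v 0) - ⁅u 0, v 0⁆]

/-- First analog of `L3 1 0`. -/
noncomputable def L310' : NSystem :=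
  ![u 2 + 2 * (u 0 * v 1 * u 0) + 2 * (u 1 * v 0 * u 0),
    -v 2]

/-- Second analog of `L3 1 0`. -/
noncomputable def L310'' : NSystem :=
  ![u 2 + 2 * (u 1 * u 0 * v 0) + 2 * (u 0 ^ 2 * v 1) - 2 * (u 0 ^ 2 * ⁅u 0, v 0⁆ * v 0),
    -v 2 + 2 * ⁅u 0 * v 0, v 1 - u 0 * v 0 ^ 2⁆
      + 2 * ⁅u 1 * v 0 + u 0 ^ 2 * v 0 ^ 2, v 0⁆]

end NonAbelian

namespace NonAbelian

/-! ### Forced evaluation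

The kernel evaluates lazily; `seqN n k` is `k n`, but makes it compute `n` first. -/

def seqN {α : Type} (n : ℕ) (k : ℕ → α) : α :=
  Nat.rec (k 0) (fun m _ => k (Nat.succ m)) n

def seqZ {α : Type} (n : ℤ) (k : ℤ → α) : α :=
  match n with
  | .ofNat m => seqN m fun m => k (.ofNat m)
  | .negSucc m => seqN m fun m => k (.negSucc m)

/-- The rational number `(pos - neg) / (den + 1)`. -/
structure Q : Type where
  pos : ℕ
  neg : ℕ
  den : ℕ

namespace Q

def seq {α : Type} (a : Q) (k : Q → α) : α :=
  seqN a.pos fun p => seqN a.neg fun n => seqN a.den fun d => k ⟨p, n, d⟩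

def ofInt (n : ℤ) : Q :=
  match n with
  | .ofNat m => ⟨m, 0, 0⟩
  | .negSucc m => ⟨0, Nat.succ m, 0⟩

def one : Q := ⟨1, 0, 0⟩

def add (a b : Q) : Q :=
  bif Nat.beq a.den b.den then ⟨Nat.add a.pos b.pos, Nat.add a.neg b.neg, a.den⟩
  else seqN (Nat.gcd (Nat.succ a.den) (Nat.succ b.den)) fun g =>
    seqN (Nat.div (Nat.succ b.den) g) fun x => seqN (Nat.div (Nat.succ a.den) g) fun y =>
      ⟨Nat.add (Nat.mul a.pos x) (Nat.mul b.pos y), Nat.add (Nat.mul a.neg x) (Nat.mul b.neg y),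
        Nat.pred (Nat.mul (Nat.succ a.den) x)⟩

def mul (a b : Q) : Q :=
  ⟨Nat.add (Nat.mul a.pos b.pos) (Nat.mul a.neg b.neg),
    Nat.add (Nat.mul a.pos b.neg) (Nat.mul a.neg b.pos),
    Nat.pred (Nat.mul (Nat.succ a.den) (Nat.succ b.den))⟩

def neg' (a : Q) : Q := ⟨a.neg, a.pos, a.den⟩

/-- The number `a` in lowest terms. -/
def norm (a : Q) : Q :=
  seqN (Nat.sub a.pos a.neg) fun p => seqN (Nat.sub a.neg a.pos) fun n =>
    seqN (Nat.gcd (Nat.add p n) (Nat.succ a.den)) fun g =>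
      ⟨Nat.div p g, Nat.div n g, Nat.pred (Nat.div (Nat.succ a.den) g)⟩

/-- The number `a b` in lowest terms, passed to `k`. -/
def mulK {α : Type} (a b : Q) (k : Q → α) : α :=
  seqN (Nat.sub (Nat.add (Nat.mul a.pos b.pos) (Nat.mul a.neg b.neg))
    (Nat.add (Nat.mul a.pos b.neg) (Nat.mul a.neg b.pos))) fun p =>
  seqN (Nat.sub (Nat.add (Nat.mul a.pos b.neg) (Nat.mul a.neg b.pos))
    (Nat.add (Nat.mul a.pos b.pos) (Nat.mul a.neg b.neg))) fun n =>
  seqN (Nat.mul (Nat.succ a.den) (Nat.succ b.den)) fun d =>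
  seqN (Nat.gcd (Nat.add p n) d) fun g =>
    bif Nat.beq g 1 then k ⟨p, n, Nat.pred d⟩ else
      seqN (Nat.div p g) fun p => seqN (Nat.div n g) fun n =>
        seqN (Nat.pred (Nat.div d g)) fun d => k ⟨p, n, d⟩

/-- The number `1 / a`, for `a ≠ 0`. -/
def inv (a : Q) : Q :=
  seqN (Nat.sub a.pos a.neg) fun p => seqN (Nat.sub a.neg a.pos) fun n =>
    bif Nat.beq n 0 then ⟨Nat.succ a.den, 0, Nat.pred p⟩ else ⟨0, Nat.succ a.den, Nat.pred n⟩

def isZero (a : Q) : Bool := Nat.beq a.pos a.neg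

end Q

/-! ### Polynomials in the unknown coefficients

A monomial is encoded by a natural number, its indeterminates by prime numbers; a polynomial is a
list of monomials with rational coefficients, in descending order. -/

abbrev Poly : Type := List (ℕ × Q)

namespace Poly

/-- `p` with coefficients in lowest terms. -/
def seq {α : Type} (p : Poly) (k : Poly → α) : α :=
  List.rec (motive := fun _ => (Poly → α) → α) (fun k => k [])
    (fun e _ ih k => seqN e.1 fun m => e.2.norm.seq fun c => ih fun t => k ((m, c) :: t)) p k

def const (c : ℤ) : Poly := [(1, Q.ofInt c)]

/-- The polynomial `c m p + q`, passed to `k`. -/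
def addMulK {α : Type} (m : ℕ) (c : Q) (p : Poly) : Poly → (Poly → α) → α :=
  List.rec (motive := fun _ => Poly → (Poly → α) → α) (fun q k => k q)
    (fun a _ ih q k => seqN (Nat.mul m a.1) fun x => (fun f : Q → α => f (Q.mul c a.2)) fun y =>
      List.rec (motive := fun _ => (Poly → α) → α) (fun k => ih [] fun t => k ((x, y) :: t))
        (fun b q ihq k => bif Nat.blt x b.1 then ihq fun t => k (b :: t) else
          bif Nat.blt b.1 x then ih (b :: q) fun t => k ((x, y) :: t) else
            (fun f : Q → α => f (Q.add y b.2)) fun s => bif s.isZero then ih q k else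
              ih q fun t => k ((x, s) :: t)) q k) p

def addMul (m : ℕ) (c : Q) (p q : Poly) : Poly := addMulK m c p q id

/-- The polynomial `c p` with coefficients in lowest terms, passed to `k`. -/
def scaleK {α : Type} (c : Q) (p : Poly) (k : Poly → α) : α :=
  List.rec (motive := fun _ => (Poly → α) → α) (fun k => k [])
    (fun e _ ih k => seqN e.1 fun m => Q.mulK c e.2 fun y => ih fun t => k ((m, y) :: t)) p k

def add (p q : Poly) : Poly := addMul 1 Q.one p q

/-- The polynomial `p q + r`. -/
def mulAdd (p q r : Poly) : Poly :=
  List.rec (motive := fun _ => Poly) r (fun e _ ih => addMul e.1 e.2 q ih) p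

def mul (p q : Poly) : Poly := mulAdd p q []

def neg (p : Poly) : Poly := p.map fun e => (e.1, e.2.neg')

def divides (a b : ℕ) : Bool := Nat.beq (Nat.mod b a) 0

/-- The substitution of the polynomial `q` for the indeterminate `m`. -/
def subst (m : ℕ) (q p : Poly) : Poly :=
  List.rec (motive := fun _ => Poly) [] (fun e _ ih =>
    bif divides m e.1 then addMul (Nat.div e.1 m) e.2 q ih else addMul e.1 e.2 [(1, Q.one)] ih) p

/-- One pass of the substitution of `-3` for the square of the indeterminate `2`. -/
def redStep (p : Poly) : Poly :=
  List.rec (motive := fun _ => Poly) [] (fun e _ ih =>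
    bif divides 4 e.1 then addMul (Nat.div e.1 4) e.2 [(1, ⟨0, 3, 0⟩)] ih else e :: ih) p

def red (p : Poly) : Poly :=
  Nat.rec (motive := fun _ => Poly → Poly) (fun p => p) (fun _ ih p =>
    bif p.any (fun e => divides 4 e.1) then (redStep p).seq ih else p) 12 p

def substRed {α : Type} (m : ℕ) (q p : Poly) (k : Poly → α) : α :=
  Nat.rec (motive := fun _ => Poly → α) k (fun _ ih p =>
    bif List.rec (motive := fun _ => Bool) false (fun e _ ih => divides m e.1 || ih) p
    then (subst m q p).seq fun p => (red p).seq ih else k p) 8 p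

def isEmpty (p : Poly) : Bool := List.rec true (fun _ _ _ => false) p

/-- The polynomial that equals the indeterminate `m` when `p` vanishes. -/
def solve (m : ℕ) (p : Poly) : Option Poly :=
  match p.find? fun e => Nat.beq e.1 m with
  | none => none
  | some e => bif e.2.isZero then none else
      some (mul [(1, e.2.inv.neg')] (add p [(m, e.2.neg')]))

end Poly


/-! ### Symbols -/

/-- A word; the letters `u_n` and `v_n` have the codes `2 n` and `2 n + 1`. -/
abbrev Word : Type := List ℕ

/-- A sequence of letters (`0` for `u`, `1` for `v`) with numbers standing for the derivative. -/
abbrev Pt : Type := List (ℕ × ℤ)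

namespace Pt

def seq {α : Type} (M : Pt) (k : Pt → α) : α :=
  List.rec (motive := fun _ => (Pt → α) → α) (fun k => k [])
    (fun e _ ih k => seqN e.1 fun c => seqZ e.2 fun x => ih fun t => k ((c, x) :: t)) M k

/-- The list `M.reverse ++ N`, passed to `k`. -/
def rev {α : Type} (M N : Pt) (k : Pt → α) : α :=
  List.rec (motive := fun _ => Pt → α) k (fun e _ ih N => ih (e :: N)) M N

def sum (M : Pt) : ℤ := List.rec (motive := fun _ => ℤ) 0 (fun e _ ih => Int.add e.2 ih) M

def sgn (c : ℕ) : ℤ := bif Nat.beq c 0 then 1 else -1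

def squares (M : Pt) : ℤ :=
  List.rec (motive := fun _ => ℤ) 0
    (fun e _ ih => Int.add (Int.mul (sgn e.1) (Int.mul e.2 e.2)) ih) M

def quad (k : ℕ) (M : Pt) : ℤ :=
  seqZ M.sum fun s => Int.sub (Int.mul (sgn k) (Int.mul s s)) M.squares

/-- The decompositions of `M` into a nonempty initial part and a rest. -/
def splits (M : Pt) : List (Pt × Pt) :=
  List.rec (motive := fun _ => List (Pt × Pt)) []
    (fun m M ih => ([m], M) :: ih.map fun e => (m :: e.1, e.2)) M

/-- The decompositions of `M` into three parts, the second one nonempty. -/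
def splits₃ (M : Pt) : List (Pt × Pt × Pt) :=
  List.rec (motive := fun _ => List (Pt × Pt × Pt)) []
    (fun m M ih => (splits (m :: M)).map (fun e => ([], e.1, e.2)) ++
      ih.map fun e => (m :: e.1, e.2.1, e.2.2)) M

/-- The point with parameter `t` on a line through `M`. -/
def shift (t : ℕ) (M : Pt) : Pt :=
  List.map (fun e => (e.1, Int.add e.2 (Int.mul (Int.ofNat t)
    (Int.add (Int.mul e.2 e.2) (Int.ofNat (Nat.succ e.1)))))) M

def unzigzag (n : ℕ) : ℤ :=
  bif Nat.beq (Nat.mod n 2) 0 then Int.ofNat (Nat.div n 2) else Int.negSucc (Nat.div n 2)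

def decode (n : ℕ) : Pt :=
  Nat.rec (motive := fun _ => ℕ → Pt) (fun _ => []) (fun _ ih n =>
    bif Nat.ble n 1 then [] else
      seqN (Nat.mod n 64) fun e => seqN (Nat.div n 64) fun m =>
        (Nat.mod e 2, unzigzag (Nat.div e 2)) :: ih m) 12 n

end Pt

def ipow (x : ℤ) (n : ℕ) : ℤ := Nat.rec (motive := fun _ => ℤ) 1 (fun _ ih => Int.mul x ih) n

/-- The value at `M` of the symbol of the word `w`, the letters being those of `M`. -/
def wordVal (w : Word) (M : Pt) : ℤ :=
  List.rec (motive := fun _ => Pt → ℤ) (fun _ => 1) (fun l _ ih M =>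
    List.rec (motive := fun _ => ℤ) 1 (fun e M _ => Int.mul (ipow e.2 (Nat.div l 2)) (ih M)) M) w M

/-- Words with coefficients, sorted by the sequence of their letters `u`, `v`. -/
inductive Trie : Type
  | nil : Trie
  | node (here : List (Word × Poly)) (l r : Trie) : Trie

noncomputable section

namespace Trie

def find (T : Trie) : Pt → List (Word × Poly) :=
  Trie.rec (motive := fun _ => Pt → List (Word × Poly)) (fun _ => [])
    (fun here _ _ ihl ihr M => List.rec (motive := fun _ => List (Word × Poly)) here
      (fun e M _ => bif Nat.beq e.1 0 then ihl M else ihr M) M) T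

/-- The value of a linear combination of words at `M`, passed to `k`. -/
def valueAt {α : Type} (M : Pt) (L : List (Word × Poly)) : (Poly → α) → α :=
  List.rec (motive := fun _ => (Poly → α) → α) (fun k => k [])
    (fun e _ ih k => seqZ (wordVal e.1 M) fun c => bif (Q.ofInt c).isZero then ih k
      else ih fun q => Poly.addMulK 1 (Q.ofInt c) e.2 q k) L

def _root_.List.value {α : Type} (L : List (Word × Poly)) (M : (Pt → α) → α) (acc : α)
    (k : Poly → α → α) : α :=
  List.rec (motive := fun _ => α) acc
    (fun a L _ => M fun M => k (valueAt M (a :: L) id) acc) L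

def look (T : Trie) (M : Pt) : Poly := valueAt M (T.find M) id

def head (T : Trie) : List (Word × Poly) :=
  Trie.rec (motive := fun _ => List (Word × Poly)) [] (fun h _ _ _ _ => h) T

def desc (T : Trie) (c : ℕ) : Trie :=
  Trie.rec (motive := fun _ => Trie) nil (fun _ l r _ _ => bif Nat.beq c 0 then l else r) T

def force {α : Type} (T : Trie) (k : Trie → α) : α :=
  Trie.rec (motive := fun _ => α) (k nil) (fun h l r _ _ => k (node h l r)) T

def walk (T : Trie) (M : Pt) : Trie :=
  List.rec (motive := fun _ => Trie → Trie) (fun T => T)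
    (fun e _ ih T => Trie.rec (motive := fun _ => Trie) nil
      (fun _ l r _ _ => bif Nat.beq e.1 0 then ih l else ih r) T) M T

def insert (w : Word) (p : Poly) : Word → Trie → Trie := fun x =>
  List.rec (motive := fun _ => Trie → Trie)
    (fun T => Trie.rec (motive := fun _ => Trie) (node [(w, p)] nil nil)
      (fun here l r _ _ => node ((w, p) :: here) l r) T)
    (fun a _ ih T => Trie.rec (motive := fun _ => Trie)
      (bif Nat.beq (Nat.mod a 2) 0 then node [] (ih nil) nil else node [] nil (ih nil))
      (fun here l r _ _ => bif Nat.beq (Nat.mod a 2) 0 then node here (ih l) r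
        else node here l (ih r)) T) x

def ofList (L : List (Word × Poly)) : Trie :=
  List.rec (motive := fun _ => Trie) nil (fun e _ ih => insert e.1 e.2 e.1 ih) L

def terms (T : Trie) : List (Word × Poly) :=
  Trie.rec (motive := fun _ => List (Word × Poly)) []
    (fun here _ _ ihl ihr => (here.filter fun e => !e.2.isEmpty) ++ (ihl ++ ihr)) T

def substL {α : Type} (m : ℕ) (q : Poly) (L : List (Word × Poly))
    (k : List (Word × Poly) → α) : α :=
  List.rec (motive := fun _ => (List (Word × Poly) → α) → α) (fun k => k [])
    (fun e _ ih k => Poly.substRed m q e.2 fun p => ih fun t => k ((e.1, p) :: t)) L k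

def subst {α : Type} (m : ℕ) (q : Poly) (T : Trie) (k : Trie → α) : α :=
  Trie.rec (motive := fun _ => (Trie → α) → α) (fun k => k nil)
    (fun here _ _ ihl ihr k => substL m q here fun h => ihl fun l => ihr fun r => k (node h l r)) T k

end Trie

/-! ### Symbols of a symmetry -/

/-- The weights `p`, `q` of `u`, `v` and `r` of the derivation; if `bal`, then the words contain one
letter `u` more than `v` in the first equation, one less in the second. -/
structure Weights : Type where
  p : ℕ
  q : ℕ
  r : ℕ
  bal : Bool

namespace Weights

def letter (W : Weights) (c : ℕ) : ℕ := bif Nat.beq c 0 then W.p else W.q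

def total (W : Weights) (n k : ℕ) : ℕ := Nat.add (Nat.mul W.r n) (W.letter k)

def ofPt (W : Weights) (M : Pt) : ℕ :=
  List.rec (motive := fun _ => ℕ) 0 (fun e _ ih => Nat.add (W.letter e.1) ih) M

def countU (M : Pt) : ℕ :=
  List.rec (motive := fun _ => ℕ) 0 (fun e _ ih => bif Nat.beq e.1 0 then Nat.succ ih else ih) M

def balanced (k : ℕ) (M : Pt) : Bool :=
  bif Nat.beq k 0 then Nat.beq (Nat.mul 2 (countU M)) (Nat.succ M.length)
  else Nat.beq (Nat.succ (Nat.mul 2 (countU M))) M.length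

/-- A strict bound for the degrees of the symbols of the words with the letters of `M`. -/
def bound (W : Weights) (n k : ℕ) (M : Pt) : ℕ :=
  bif W.bal && !balanced k M then 0 else
  seqN (W.total n k) fun t => seqN (W.ofPt M) fun s =>
    bif Nat.blt t s then 0 else
      bif Nat.beq (Nat.mod (Nat.sub t s) W.r) 0 then Nat.succ (Nat.div (Nat.sub t s) W.r) else 0

end Weights

/-- The current knowledge: the words of the system besides `u_xx`, `-v_xx`, and the coefficients of
`u_n`, `v_n` in the symmetry. -/
structure Know : Type where
  F : Trie × Trie
  a : Poly × Poly

namespace Know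

def sys (s : Know) (c : ℕ) : Trie := bif Nat.beq c 0 then s.F.1 else s.F.2

def lead (s : Know) (c : ℕ) : Poly := bif Nat.beq c 0 then s.a.1 else s.a.2

end Know

def addProd (p : Poly) (g acc : Option Poly) : Option Poly :=
  match p with
  | [] => acc
  | a :: p => match g with
    | none => none
    | some g => match acc with
      | none => none
      | some r => some (Poly.mulAdd (a :: p) g r)

def forceO (g : Option Poly) : Option Poly :=
  match g with
  | none => none
  | some p => p.seq some

def residStep (G : ℕ → Pt → Option Poly) (k : ℕ) (pre : Pt) (K : Trie) (t : ℤ)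
    (mid post : Pt) (c : ℕ) (T : Trie) (acc : Option Poly) : Option Poly :=
  T.head.value (fun M => mid.rev [] M) (((K.desc c).walk post).head.value
      (fun M => pre.rev ((c, t) :: post) M) acc fun y acc =>
        addProd y.neg (mid.rev [] fun M => G c M) acc) fun x acc =>
    addProd x (pre.rev ((c, t) :: post) fun N => G k N) acc

def residInner (G : ℕ → Pt → Option Poly) (k : ℕ) (pre : Pt) (K : Trie) (M : Pt) :
    Trie → Trie → ℤ → Pt → Option Poly → Option Poly :=
  List.rec (motive := fun _ => Trie → Trie → ℤ → Pt → Option Poly → Option Poly)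
    (fun _ _ _ _ acc => acc)
    (fun e post ih T₀ T₁ t mid acc =>
      (T₀.desc e.1).force fun T₀ => (T₁.desc e.1).force fun T₁ => seqZ (Int.add t e.2) fun t =>
        ih T₀ T₁ t (e :: mid) (residStep G k pre K t (e :: mid) post 0 T₀
            (residStep G k pre K t (e :: mid) post 1 T₁ acc))) M

def resid (s : Know) (G : ℕ → Pt → Option Poly) (k : ℕ) (M : Pt) : Option Poly :=
  List.rec (motive := fun _ => Pt → Trie → Option Poly) (fun _ _ => some [])
    (fun m M ih pre K => residInner G k pre K (m :: M) s.F.1 s.F.2 0 []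
      ((K.desc m.1).force fun K' => ih (m :: pre) K')) M [] (s.sys k)

/-- The sum of `(-1) ^ t * (N choose t) * G (M.shift t)` over `1 ≤ t ≤ j`. -/
def diffSum (G : Pt → Option Poly) (M : Pt) (N j : ℕ) : Option Poly :=
  Nat.rec (motive := fun _ => Option Poly) (some []) (fun t ih =>
    Pt.seq (M.shift (Nat.succ t)) fun P =>
      addProd
        (Poly.const (Int.mul (bif Nat.beq (Nat.mod t 2) 0 then -1 else 1)
          (Int.ofNat (Nat.choose N (Nat.succ t))))) (G P) ih) j

def scale (c : Q) (g : Option Poly) : Option Poly :=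
  match g with
  | none => none
  | some p => bif c.isZero then some [] else c.seq fun c => Poly.scaleK c p some

def symbol (W : Weights) (n : ℕ) (s : Know) (fuel : ℕ) : ℕ → Pt → Option Poly :=
  Nat.rec (motive := fun _ => ℕ → Pt → Option Poly) (fun _ _ => none) (fun _ ih k M =>
    bif Nat.beq M.length 1 && Nat.beq (M.headD (0, 0)).1 k then
      scale (Q.ofInt (ipow (M.headD (0, 0)).2 n)) (some (s.lead k))
    else seqZ (M.quad k) fun q => bif (Q.ofInt q).isZero then
        scale (Q.ofInt (-1)) (seqN (W.bound n k M) fun N => diffSum (ih k) M N N)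
      else scale (Q.ofInt q).inv (resid s ih k M)) fuel

/-- A linear relation for the symbols of a symmetry (code modulo `2`: the index of the symbol;
then: `0` for the vanishing of the right-hand side where it is known to vanish, `1` for the
vanishing of a finite difference). -/
def relation (W : Weights) (n : ℕ) (s : Know) (code : ℕ) : Option Poly :=
  seqN (Nat.mod code 2) fun k => Pt.seq (Pt.decode (Nat.div code 4)) fun M =>
    bif Nat.beq M.length 0 then none else
    bif Nat.beq (Nat.mod (Nat.div code 2) 2) 0 then
      bif (Q.ofInt (M.quad k)).isZero || Nat.beq (W.bound n k M) 0
      then resid s (symbol W n s 30) k M else none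
    else seqN (W.bound n k M) fun N =>
      addProd (Poly.const 1) (symbol W n s 30 k M) (diffSum (symbol W n s 30 k) M N N)

def combine (W : Weights) (n : ℕ) (s : Know) (L : List (ℕ × ℕ × ℕ)) : Option Poly :=
  List.rec (motive := fun _ => Option Poly) (some []) (fun e _ ih =>
    forceO (addProd [(1, (⟨(Q.ofInt (Pt.unzigzag e.1)).pos, (Q.ofInt (Pt.unzigzag e.1)).neg, e.2.1⟩ : Q))] (relation W n s e.2.2) ih)) L

/-- Certificates. -/
inductive Cert : Type
  | leaf (i : ℕ) : Cert
  | contra : Cert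
  | eval (L : List (ℕ × ℕ × ℕ)) (t : Cert) : Cert
  | solve (m : ℕ) (t : Cert) : Cert
  | mul (p : Poly) (t : Cert) : Cert
  | split (p q : Poly) (t₁ t₂ : Cert) : Cert
  | root (c : Q) (p : Poly) (t : Cert) : Cert

namespace Cert

def isConst (p : Poly) : Bool :=
  match p with
  | [(m, c)] => Nat.beq m 1 && !c.isZero
  | _ => false

def eqv (p q : Poly) : Bool := (Poly.red (Poly.add p q.neg)).isEmpty

def beqN (l m : List ℕ) : Bool :=
  List.rec (motive := fun _ => List ℕ → Bool) (fun m => m.isEmpty) (fun a _ ih m =>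
    List.rec (motive := fun _ => Bool) false (fun b m _ => Nat.beq a b && ih m) m) l m

def same (L K : List (Word × Poly)) : Bool :=
  List.rec (motive := fun _ => List (Word × Poly) → Bool) (fun K => K.isEmpty) (fun a _ ih K =>
    List.rec (motive := fun _ => Bool) false
      (fun b K _ => beqN a.1 b.1 && eqv a.2 b.2 && ih K) K) L K

abbrev Sys : Type := List (Word × Poly) × List (Word × Poly)

def check (W : Weights) (n : ℕ) (targets : List Sys) (C : Cert) : Know → Poly → Bool :=
  Cert.rec (motive := fun _ => Know → Poly → Bool)
    (fun i s _ => match targets[i]? with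
      | none => false
      | some T => same s.F.1.terms T.1 && same s.F.2.terms T.2)
    (fun _ p => isConst p)
    (fun L _ ih s _ => match combine W n s L with
      | none => false
      | some p => (Poly.red p).seq fun p => ih s p)
    (fun m _ ih s p => match Poly.solve m p with
      | none => false
      | some q => (Poly.red q).seq fun q =>
          s.F.1.subst m q fun f => s.F.2.subst m q fun g =>
          Poly.substRed m q s.a.1 fun a => Poly.substRed m q s.a.2 fun b =>
            ih ⟨(f, g), (a, b)⟩ [])
    (fun q _ ih s p => (Poly.red (Poly.mul q p)).seq fun p => ih s p)
    (fun p q _ _ ih₁ ih₂ s r => eqv (Poly.mul p q) r && (ih₁ s p && ih₂ s q))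
    (fun c p _ ih s r => !c.isZero && (eqv (Poly.mul [(1, c)] (Poly.mul p p)) r && ih s p)) C

end Cert

end


@[simp] theorem seqN_eq {α : Type} (n : ℕ) (k : ℕ → α) : seqN n k = k n := by
  cases n <;> rfl

@[simp] theorem seqZ_eq {α : Type} (n : ℤ) (k : ℤ → α) : seqZ n k = k n := by
  cases n <;> simp [seqZ]

namespace Q

/-- The value of a rational number. -/
noncomputable def val (a : Q) : ℂ := ((a.pos : ℂ) - a.neg) / (a.den + 1)

@[simp] theorem seq_eq {α : Type} (a : Q) (k : Q → α) : a.seq k = k a := by simp [seq]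

@[simp] theorem val_ofInt (n : ℤ) : (ofInt n).val = n := by
  cases n with
  | ofNat m => simp [ofInt, val]
  | negSucc m => simp [ofInt, val, Int.cast_negSucc]

@[simp] theorem val_one : one.val = 1 := by simp [one, val]

@[simp] theorem val_neg' (a : Q) : a.neg'.val = -a.val := by
  simp only [neg', val]; ring

theorem succ_pred_mul (a b : ℕ) :
    ((Nat.pred (Nat.mul (Nat.succ a) (Nat.succ b)) : ℕ) : ℂ) + 1 = (a + 1) * (b + 1) := by
  have h : Nat.pred (Nat.mul (Nat.succ a) (Nat.succ b)) + 1 = (a + 1) * (b + 1) :=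
    Nat.succ_pred_eq_of_pos (Nat.mul_pos (Nat.succ_pos a) (Nat.succ_pos b))
  exact_mod_cast h

theorem val_mul (a b : Q) : (mul a b).val = a.val * b.val := by
  have h₁ : (a.den : ℂ) + 1 ≠ 0 := Nat.cast_add_one_ne_zero _
  have h₂ : (b.den : ℂ) + 1 ≠ 0 := Nat.cast_add_one_ne_zero _
  simp only [mul, val, succ_pred_mul]
  simp only [Nat.add_eq, Nat.mul_eq]
  push_cast
  field_simp
  ring

theorem val_add (a b : Q) : (add a b).val = a.val + b.val := by
  have h₁ : (a.den : ℂ) + 1 ≠ 0 := Nat.cast_add_one_ne_zero _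
  have h₂ : (b.den : ℂ) + 1 ≠ 0 := Nat.cast_add_one_ne_zero _
  unfold add
  cases h : Nat.beq a.den b.den with
  | true =>
    have h : a.den = b.den := Nat.eq_of_beq_eq_true h
    simp only [cond_true, val, Nat.add_eq, ← h]
    push_cast
    ring
  | false =>
    simp only [cond_false, seqN_eq, val]
    set g := Nat.gcd (Nat.succ a.den) (Nat.succ b.den) with hg
    have hg0 : 0 < g := Nat.gcd_pos_of_pos_left _ (Nat.succ_pos _)
    obtain ⟨x, hx⟩ : g ∣ Nat.succ b.den := Nat.gcd_dvd_right _ _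
    obtain ⟨y, hy⟩ : g ∣ Nat.succ a.den := Nat.gcd_dvd_left _ _
    have ex : Nat.div (Nat.succ b.den) g = x := by
      rw [hx]; exact Nat.mul_div_cancel_left x hg0
    have ey : Nat.div (Nat.succ a.den) g = y := by
      rw [hy]; exact Nat.mul_div_cancel_left y hg0
    rw [ex, ey]
    have hx0 : 0 < x := Nat.pos_of_ne_zero fun h0 => by simp [h0] at hx
    have hp : ((Nat.pred (Nat.mul (Nat.succ a.den) x) : ℕ) : ℂ) + 1 = (a.den + 1) * x := by
      have : Nat.pred (Nat.mul (Nat.succ a.den) x) + 1 = (a.den + 1) * x :=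
        Nat.succ_pred_eq_of_pos (Nat.mul_pos (Nat.succ_pos _) hx0)
      exact_mod_cast this
    rw [hp]
    have hxc : (x : ℂ) ≠ 0 := by exact_mod_cast hx0.ne'
    have hgc : (g : ℂ) ≠ 0 := by exact_mod_cast hg0.ne'
    have cx : (b.den : ℂ) + 1 = g * x := by exact_mod_cast hx
    have cy : (a.den : ℂ) + 1 = g * y := by exact_mod_cast hy
    have hyc : (y : ℂ) ≠ 0 := by
      rintro h0; rw [h0, mul_zero] at cy; exact h₁ cy
    rw [cx, cy]
    simp only [Nat.add_eq, Nat.mul_eq]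
    push_cast
    field_simp
    ring

theorem val_eq_zero {a : Q} (h : a.isZero = true) : a.val = 0 := by
  have : a.pos = a.neg := Nat.eq_of_beq_eq_true h
  simp [val, this]

theorem val_ne_zero {a : Q} (h : a.isZero = false) : a.val ≠ 0 := by
  have : a.pos ≠ a.neg := Nat.ne_of_beq_eq_false h
  have h' : (a.pos : ℂ) - a.neg ≠ 0 := sub_ne_zero.mpr (by exact_mod_cast this)
  exact div_ne_zero h' (Nat.cast_add_one_ne_zero _)

theorem cast_sub_sub (p n : ℕ) :
    ((Nat.sub p n : ℕ) : ℂ) - (Nat.sub n p : ℕ) = (p : ℂ) - n := by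
  rcases le_total p n with h | h
  · have : Nat.sub p n = 0 := Nat.sub_eq_zero_of_le h
    rw [this, show Nat.sub n p = n - p from rfl, Nat.cast_sub h]; simp
  · have : Nat.sub n p = 0 := Nat.sub_eq_zero_of_le h
    rw [this, show Nat.sub p n = p - n from rfl, Nat.cast_sub h]; simp

theorem val_reduce (p n d : ℕ) (hd : 0 < d) (h : p = 0 ∨ n = 0) :
    (⟨Nat.div p (Nat.gcd (Nat.add p n) d), Nat.div n (Nat.gcd (Nat.add p n) d),
      Nat.pred (Nat.div d (Nat.gcd (Nat.add p n) d))⟩ : Q).val = ((p : ℂ) - n) / d := by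
  have hg0 : 0 < Nat.gcd (Nat.add p n) d := Nat.gcd_pos_of_pos_right _ hd
  have hpn : Nat.gcd (Nat.add p n) d ∣ p + n := Nat.gcd_dvd_left _ _
  have hgd : Nat.gcd (Nat.add p n) d ∣ d := Nat.gcd_dvd_right _ _
  generalize Nat.gcd (Nat.add p n) d = g at *
  have hgc : (g : ℂ) ≠ 0 := by exact_mod_cast hg0.ne'
  have hp : g ∣ p := by rcases h with h | h <;> simp_all
  have hn : g ∣ n := by rcases h with h | h <;> simp_all
  obtain ⟨x, hx⟩ := hp
  obtain ⟨y, hy⟩ := hn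
  obtain ⟨z, hz⟩ := hgd
  have ex : Nat.div p g = x := by rw [hx]; exact Nat.mul_div_cancel_left x hg0
  have ey : Nat.div n g = y := by rw [hy]; exact Nat.mul_div_cancel_left y hg0
  have ez : Nat.div d g = z := by rw [hz]; exact Nat.mul_div_cancel_left z hg0
  have hz0 : 0 < z := Nat.pos_of_ne_zero fun h0 => by simp [h0] at hz; omega
  have hzc : (z : ℂ) ≠ 0 := by exact_mod_cast hz0.ne'
  have hp1 : ((Nat.pred z : ℕ) : ℂ) + 1 = z := by exact_mod_cast Nat.succ_pred_eq_of_pos hz0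
  simp only [val, ex, ey, ez, hp1]
  rw [hx, hy, hz]
  push_cast
  field_simp

theorem sub_zero_or (p n : ℕ) : Nat.sub p n = 0 ∨ Nat.sub n p = 0 := by
  rcases le_total p n with h | h
  · exact Or.inl (Nat.sub_eq_zero_of_le h)
  · exact Or.inr (Nat.sub_eq_zero_of_le h)

theorem val_norm (a : Q) : a.norm.val = a.val := by
  simp only [norm, seqN_eq]
  rw [val_reduce _ _ _ (Nat.succ_pos _) (sub_zero_or _ _), cast_sub_sub]
  simp [val]

theorem mulK_eq (a b : Q) : ∃ r : Q, r.val = a.val * b.val ∧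
    ∀ (α : Type) (k : Q → α), mulK a b k = k r := by
  set X := Nat.add (Nat.mul a.pos b.pos) (Nat.mul a.neg b.neg) with hX
  set Y := Nat.add (Nat.mul a.pos b.neg) (Nat.mul a.neg b.pos) with hY
  set d := Nat.mul (Nat.succ a.den) (Nat.succ b.den) with hd
  have hd0 : 0 < d := Nat.mul_pos (Nat.succ_pos _) (Nat.succ_pos _)
  have key : ((X : ℂ) - Y) / d = a.val * b.val := by
    rw [← val_mul]
    simp only [mul, val, succ_pred_mul]
    rw [hX, hY, hd]
    simp only [Nat.mul_eq, Nat.succ_eq_add_one]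
    push_cast
    ring
  cases h : Nat.beq (Nat.gcd (Nat.add (Nat.sub X Y) (Nat.sub Y X)) d) 1 with
  | true =>
    refine ⟨⟨Nat.sub X Y, Nat.sub Y X, Nat.pred d⟩, ?_, fun α k => ?_⟩
    · rw [← key, ← cast_sub_sub]
      have : ((Nat.pred d : ℕ) : ℂ) + 1 = d := by exact_mod_cast Nat.succ_pred_eq_of_pos hd0
      simp only [val, this]
    · simp only [mulK, seqN_eq, ← hX, ← hY, ← hd, h, cond_true]
  | false =>
    refine ⟨_, (val_reduce (Nat.sub X Y) (Nat.sub Y X) d hd0 (sub_zero_or _ _)).trans ?_,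
      fun α k => ?_⟩
    · rw [cast_sub_sub, key]
    · simp only [mulK, seqN_eq, ← hX, ← hY, ← hd, h, cond_false]

theorem val_inv {a : Q} (h : a.isZero = false) : a.inv.val = a.val⁻¹ := by
  have hne : a.pos ≠ a.neg := Nat.ne_of_beq_eq_false h
  simp only [inv, seqN_eq]
  rcases lt_or_gt_of_ne hne with hlt | hlt
  · have h0 : Nat.sub a.pos a.neg = 0 := Nat.sub_eq_zero_of_le hlt.le
    have h1 : 0 < Nat.sub a.neg a.pos := Nat.sub_pos_of_lt hlt
    have h2 : Nat.beq (Nat.sub a.neg a.pos) 0 = false := by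
      cases hb : Nat.beq (Nat.sub a.neg a.pos) 0 with
      | false => rfl
      | true => have := Nat.eq_of_beq_eq_true hb; omega
    have h3 : ((Nat.pred (Nat.sub a.neg a.pos) : ℕ) : ℂ) + 1 = (Nat.sub a.neg a.pos : ℕ) := by
      exact_mod_cast Nat.succ_pred_eq_of_pos h1
    rw [h2]
    simp only [cond_false, val, h3]
    rw [← cast_sub_sub a.pos a.neg, h0, inv_div]
    push_cast
    rw [zero_sub, zero_sub, div_neg, neg_div]
  · have h0 : Nat.sub a.neg a.pos = 0 := Nat.sub_eq_zero_of_le hlt.le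
    have h1 : 0 < Nat.sub a.pos a.neg := Nat.sub_pos_of_lt hlt
    have h3 : ((Nat.pred (Nat.sub a.pos a.neg) : ℕ) : ℂ) + 1 = (Nat.sub a.pos a.neg : ℕ) := by
      exact_mod_cast Nat.succ_pred_eq_of_pos h1
    rw [h0]
    simp only [show Nat.beq 0 0 = true from rfl, cond_true, val, h3]
    rw [← cast_sub_sub a.pos a.neg, h0, inv_div]
    push_cast
    simp

end Q

namespace Poly

variable (χ : ℕ →* ℂ)

/-- The value of a polynomial. -/
noncomputable def ev (p : Poly) : ℂ := (p.map fun e => e.2.val * χ e.1).sum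

@[simp] theorem ev_nil : ev χ [] = 0 := rfl

@[simp] theorem ev_cons (e : ℕ × Q) (p : Poly) : ev χ (e :: p) = e.2.val * χ e.1 + ev χ p := by
  simp [ev]

theorem seq_eq (p : Poly) : ∃ r : Poly, ev χ r = ev χ p ∧
    ∀ (α : Type) (k : Poly → α), p.seq k = k r := by
  induction p with
  | nil => exact ⟨[], rfl, fun _ _ => rfl⟩
  | cons e p ih =>
    obtain ⟨r, hr, h⟩ := ih
    refine ⟨(e.1, e.2.norm) :: r, by simp [hr, Q.val_norm], fun α k => ?_⟩
    have : Poly.seq (e :: p) k = seqN e.1 fun m => e.2.norm.seq fun c =>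
      Poly.seq p fun t => k ((m, c) :: t) := rfl
    rw [this]
    simp [h]

@[simp] theorem ev_const (c : ℤ) : ev χ (const c) = c := by simp [const, ev]

theorem addMulK_eq (m : ℕ) (c : Q) (p q : Poly) : ∃ r : Poly,
    ev χ r = c.val * χ m * ev χ p + ev χ q ∧
      ∀ (α : Type) (k : Poly → α), addMulK m c p q k = k r := by
  induction p generalizing q with
  | nil => exact ⟨q, by simp, fun _ _ => rfl⟩
  | cons a p ih =>
    have hx : ∀ q, c.val * χ m * ev χ (a :: p) + ev χ q =
        (Q.mul c a.2).val * χ (Nat.mul m a.1) + (c.val * χ m * ev χ p + ev χ q) := fun q => by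
      rw [ev_cons, Q.val_mul, Nat.mul_eq, map_mul]; ring
    induction q with
    | nil =>
      obtain ⟨r, hr, h⟩ := ih []
      refine ⟨(Nat.mul m a.1, Q.mul c a.2) :: r, by rw [hx, ev_cons, hr], fun α k => ?_⟩
      have : addMulK m c (a :: p) [] k = seqN (Nat.mul m a.1) fun x =>
        addMulK m c p [] fun t => k ((x, Q.mul c a.2) :: t) := rfl
      rw [this, seqN_eq, h]
    | cons b q ihq =>
      have hk : ∀ (α : Type) (k : Poly → α), addMulK m c (a :: p) (b :: q) k =
        bif Nat.blt (Nat.mul m a.1) b.1 then addMulK m c (a :: p) q fun t => k (b :: t) else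
          bif Nat.blt b.1 (Nat.mul m a.1) then
            addMulK m c p (b :: q) fun t => k ((Nat.mul m a.1, Q.mul c a.2) :: t) else
          bif (Q.add (Q.mul c a.2) b.2).isZero then addMulK m c p q k else
            addMulK m c p q fun t => k ((Nat.mul m a.1, Q.add (Q.mul c a.2) b.2) :: t) := by
        intro α k
        have h₁ : addMulK m c (a :: p) (b :: q) k = seqN (Nat.mul m a.1) fun x =>
          bif Nat.blt x b.1 then
            List.rec (motive := fun _ => (Poly → α) → α)
              (fun k => addMulK m c p [] fun t => k ((x, Q.mul c a.2) :: t))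
              (fun b q ihq k => bif Nat.blt x b.1 then ihq fun t => k (b :: t) else
                bif Nat.blt b.1 x then addMulK m c p (b :: q) fun t => k ((x, Q.mul c a.2) :: t)
                else bif (Q.add (Q.mul c a.2) b.2).isZero then addMulK m c p q k else
                  addMulK m c p q fun t => k ((x, Q.add (Q.mul c a.2) b.2) :: t)) q
              (fun t => k (b :: t)) else
          bif Nat.blt b.1 x then
            addMulK m c p (b :: q) fun t => k ((x, Q.mul c a.2) :: t) else
          bif (Q.add (Q.mul c a.2) b.2).isZero then addMulK m c p q k else
            addMulK m c p q fun t => k ((x, Q.add (Q.mul c a.2) b.2) :: t) := rfl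
        have h₂ : ∀ k' : Poly → α, addMulK m c (a :: p) q k' = seqN (Nat.mul m a.1) fun x =>
            List.rec (motive := fun _ => (Poly → α) → α)
              (fun k => addMulK m c p [] fun t => k ((x, Q.mul c a.2) :: t))
              (fun b q ihq k => bif Nat.blt x b.1 then ihq fun t => k (b :: t) else
                bif Nat.blt b.1 x then addMulK m c p (b :: q) fun t => k ((x, Q.mul c a.2) :: t)
                else bif (Q.add (Q.mul c a.2) b.2).isZero then addMulK m c p q k else
                  addMulK m c p q fun t => k ((x, Q.add (Q.mul c a.2) b.2) :: t)) q k' :=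
          fun k' => rfl
        rw [h₁, seqN_eq, h₂, seqN_eq]
      cases h1 : Nat.blt (Nat.mul m a.1) b.1 with
      | true =>
        obtain ⟨r, hr, h⟩ := ihq
        refine ⟨b :: r, ?_, fun α k => by rw [hk, h1, cond_true, h]⟩
        rw [ev_cons, hr, ev_cons _ b]; ring
      | false =>
        cases h2 : Nat.blt b.1 (Nat.mul m a.1) with
        | true =>
          obtain ⟨r, hr, h⟩ := ih (b :: q)
          refine ⟨_ :: r, ?_, fun α k => by rw [hk, h1, h2, cond_false, cond_true, h]⟩
          rw [ev_cons, hr, hx]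
        | false =>
          have he : Nat.mul m a.1 = b.1 := by
            have e1 : ¬ Nat.mul m a.1 < b.1 := fun hl => by
              rw [show Nat.blt (Nat.mul m a.1) b.1 = true from Nat.ble_eq.mpr hl] at h1
              cases h1
            have e2 : ¬ b.1 < Nat.mul m a.1 := fun hl => by
              rw [show Nat.blt b.1 (Nat.mul m a.1) = true from Nat.ble_eq.mpr hl] at h2
              cases h2
            omega
          obtain ⟨r, hr, h⟩ := ih q
          have hs : c.val * χ m * ev χ (a :: p) + ev χ (b :: q) =
              (Q.add (Q.mul c a.2) b.2).val * χ (Nat.mul m a.1) + ev χ r := by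
            rw [hx, hr, Q.val_add, ev_cons, he]; ring
          cases h3 : (Q.add (Q.mul c a.2) b.2).isZero with
          | true =>
            refine ⟨r, ?_, fun α k => by rw [hk, h1, h2, h3, cond_false, cond_false, cond_true, h]⟩
            rw [hs, Q.val_eq_zero h3]; ring
          | false =>
            refine ⟨_ :: r, ?_,
              fun α k => by rw [hk, h1, h2, h3, cond_false, cond_false, cond_false, h]⟩
            rw [hs, ev_cons]

@[simp] theorem ev_addMul (m : ℕ) (c : Q) (p q : Poly) :
    ev χ (addMul m c p q) = c.val * χ m * ev χ p + ev χ q := by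
  obtain ⟨r, hr, h⟩ := addMulK_eq χ m c p q
  rw [addMul, h, id, hr]

theorem scaleK_eq (c : Q) (p : Poly) : ∃ r : Poly, ev χ r = c.val * ev χ p ∧
    ∀ (α : Type) (k : Poly → α), scaleK c p k = k r := by
  induction p with
  | nil => exact ⟨[], by simp, fun _ _ => rfl⟩
  | cons e p ih =>
    obtain ⟨r, hr, h⟩ := ih
    obtain ⟨s, hs, h'⟩ := Q.mulK_eq c e.2
    refine ⟨(e.1, s) :: r, by simp [hr, hs]; ring, fun α k => ?_⟩
    have : scaleK c (e :: p) k = seqN e.1 fun m => Q.mulK c e.2 fun y =>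
      scaleK c p fun t => k ((m, y) :: t) := rfl
    rw [this, seqN_eq, h', h]

@[simp] theorem ev_add (p q : Poly) : ev χ (add p q) = ev χ p + ev χ q := by
  simp [add]

@[simp] theorem ev_mulAdd (p q r : Poly) : ev χ (mulAdd p q r) = ev χ p * ev χ q + ev χ r := by
  induction p with
  | nil => simp [mulAdd]
  | cons e p ih =>
    have : mulAdd (e :: p) q r = addMul e.1 e.2 q (mulAdd p q r) := rfl
    rw [this, ev_addMul, ih, ev_cons]; ring

@[simp] theorem ev_mul (p q : Poly) : ev χ (mul p q) = ev χ p * ev χ q := by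
  simp [mul]

@[simp] theorem ev_neg (p : Poly) : ev χ p.neg = -ev χ p := by
  induction p with
  | nil => simp [neg]
  | cons e p ih =>
    have : neg (e :: p) = (e.1, e.2.neg') :: neg p := rfl
    rw [this, ev_cons, ih, ev_cons, Q.val_neg']; ring

theorem dvd_of_divides {a b : ℕ} (h : divides a b = true) : a ∣ b :=
  Nat.dvd_of_mod_eq_zero (Nat.eq_of_beq_eq_true h)

theorem ev_subst {m : ℕ} {q : Poly} (h : χ m = ev χ q) (p : Poly) :
    ev χ (subst m q p) = ev χ p := by
  induction p with
  | nil => rfl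
  | cons e p ih =>
    have : subst m q (e :: p) = bif divides m e.1 then addMul (Nat.div e.1 m) e.2 q (subst m q p)
      else addMul e.1 e.2 [(1, Q.one)] (subst m q p) := rfl
    rw [this]
    cases hd : divides m e.1 with
    | true =>
      have : Nat.div e.1 m * m = e.1 := Nat.div_mul_cancel (dvd_of_divides hd)
      rw [cond_true, ev_addMul, ih, ev_cons, ← this, map_mul, ← h, this]; ring
    | false => simp [ih]

variable {χ}

theorem ev_redStep (h : χ 4 = -3) (p : Poly) : ev χ (redStep p) = ev χ p := by
  induction p with
  | nil => rfl
  | cons e p ih =>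
    have : redStep (e :: p) = bif divides 4 e.1 then
      addMul (Nat.div e.1 4) e.2 [(1, ⟨0, 3, 0⟩)] (redStep p) else e :: redStep p := rfl
    rw [this]
    cases hd : divides 4 e.1 with
    | true =>
      have h4 : Nat.div e.1 4 * 4 = e.1 := Nat.div_mul_cancel (dvd_of_divides hd)
      have h5 : χ e.1 = χ (Nat.div e.1 4) * -3 := by rw [← h, ← map_mul, h4]
      rw [cond_true, ev_addMul, ih, ev_cons χ e p, h5]
      simp [Q.val]; ring
    | false => simp [ih]

theorem ev_red (h : χ 4 = -3) (p : Poly) : ev χ (red p) = ev χ p := by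
  have : ∀ n p, ev χ (Nat.rec (motive := fun _ => Poly → Poly) (fun p => p) (fun _ ih p =>
    bif p.any (fun e => divides 4 e.1) then (redStep p).seq ih else p) n p) = ev χ p := by
    intro n
    induction n with
    | zero => intro p; rfl
    | succ n ih =>
      intro p
      obtain ⟨r, hr, hk⟩ := seq_eq χ (redStep p)
      simp only
      cases p.any (fun e => divides 4 e.1) with
      | true => rw [cond_true, hk, ih, hr, ev_redStep h]
      | false => rfl
  exact this 12 p

theorem substRed_eq (h : χ 4 = -3) {m : ℕ} {q : Poly} (hq : χ m = ev χ q) (p : Poly) :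
    ∃ r : Poly, ev χ r = ev χ p ∧ ∀ (α : Type) (k : Poly → α), substRed m q p k = k r := by
  have : ∀ (n : ℕ) (p : Poly), ∃ r : Poly, ev χ r = ev χ p ∧ ∀ (α : Type) (k : Poly → α),
      (Nat.rec (motive := fun _ => Poly → α) k (fun _ ih p =>
        bif List.rec (motive := fun _ => Bool) false (fun e _ ih => divides m e.1 || ih) p
        then (subst m q p).seq fun p => (red p).seq ih else k p) n p : α) = k r := by
    intro n
    induction n with
    | zero => intro p; exact ⟨p, rfl, fun _ _ => rfl⟩
    | succ n ih =>
      intro p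
      obtain ⟨r, hr, hk⟩ := seq_eq χ (subst m q p)
      obtain ⟨s, hs, hk'⟩ := seq_eq χ (red r)
      obtain ⟨t, ht, hk''⟩ := ih s
      cases hb : (List.rec (motive := fun _ => Bool) false (fun e _ ih => divides m e.1 || ih) p :
        Bool) with
      | true =>
        refine ⟨t, by rw [ht, hs, ev_red h, hr, ev_subst χ hq], fun α k => ?_⟩
        simp only [hb, cond_true, hk, hk', hk'']
      | false => exact ⟨p, rfl, fun α k => by simp only [hb, cond_false]⟩
  exact this 8 p

theorem ev_solve {m : ℕ} {p q : Poly} (h : solve m p = some q) (hp : ev χ p = 0) :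
    χ m = ev χ q := by
  unfold solve at h
  split at h
  · cases h
  · rename_i e he
    cases hz : e.2.isZero with
    | true => rw [hz] at h; cases h
    | false =>
      rw [hz, cond_false] at h
      cases h
      have hm : e.1 = m := Nat.eq_of_beq_eq_true (by simpa using List.find?_some he)
      have := Q.val_ne_zero hz
      simp only [ev_mul, ev_cons, ev_nil, ev_add, Q.val_neg', Q.val_inv hz, map_one, hp]
      field_simp
      ring

theorem ev_isEmpty {p : Poly} (h : p.isEmpty = true) : ev χ p = 0 := by
  cases p with
  | nil => rfl
  | cons e p => cases h

end Poly


/-! ### Words and symbols -/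

abbrev Letter : Type := Fin 2 × ℕ

/-- The product of the letters `w`. -/
noncomputable def word (w : List Letter) : NPoly := (w.map (FreeAlgebra.ι ℂ)).prod

@[simp] theorem word_nil : word [] = 1 := rfl

@[simp] theorem word_cons (p : Letter) (w : List Letter) :
    word (p :: w) = FreeAlgebra.ι ℂ p * word w := by simp [word]

theorem word_append (w x : List Letter) : word (w ++ x) = word w * word x := by simp [word]

noncomputable def wordBasis : Module.Basis (List Letter) ℂ NPoly :=
  (FreeAlgebra.basisFreeMonoid ℂ Letter).reindex FreeMonoid.toList

@[simp] theorem wordBasis_apply (w : List Letter) : wordBasis w = word w := by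
  have h : ∀ w : FreeMonoid Letter, FreeAlgebra.equivMonoidAlgebraFreeMonoid (word w.toList) =
      MonoidAlgebra.of ℂ (FreeMonoid Letter) w := by
    intro w
    induction w using FreeMonoid.inductionOn' with
    | one =>
      change FreeAlgebra.equivMonoidAlgebraFreeMonoid (word []) = _
      rw [word_nil, map_one, map_one]
    | of_mul p w ih =>
      rw [FreeMonoid.toList_of_mul, word_cons, map_mul, ih, map_mul]
      congr 1
      simp [FreeAlgebra.equivMonoidAlgebraFreeMonoid]
  rw [wordBasis, Module.Basis.reindex_apply, FreeAlgebra.basisFreeMonoid, Module.Basis.map_apply,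
    LinearEquiv.symm_apply_eq]
  have := h (FreeMonoid.ofList w)
  rw [FreeMonoid.toList_ofList] at this
  rw [LinearEquiv.trans_apply]
  change _ = MonoidAlgebra.coeffLinearEquiv ℂ (FreeAlgebra.equivMonoidAlgebraFreeMonoid (word w))
  rw [this]
  rfl

theorem word_ext {V : Type*} [AddCommMonoid V] [Module ℂ V] {f g : NPoly →ₗ[ℂ] V}
    (h : ∀ w, f (word w) = g (word w)) : f = g :=
  wordBasis.ext fun w => by simpa using h w

/-- Linear maps are equal if they agree on `1` and on the products that begin with a letter. -/
theorem linear_induction {V : Type*} [AddCommMonoid V] [Module ℂ V] {f g : NPoly →ₗ[ℂ] V}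
    (h1 : f 1 = g 1)
    (h : ∀ p w, f (word w) = g (word w) →
      f (FreeAlgebra.ι ℂ p * word w) = g (FreeAlgebra.ι ℂ p * word w)) : f = g :=
  word_ext fun w => by
    induction w with
    | nil => exact h1
    | cons p w ih => rw [word_cons]; exact h p w ih

/-- The unknown with the code `c`. -/
def par (c : ℕ) : Fin 2 := if c = 0 then 0 else 1

def wordValue : Pt → List Letter → ℂ
  | [], [] => 1
  | e :: M, p :: w => if p.1 = par e.1 then (e.2 : ℂ) ^ p.2 * wordValue M w else 0
  | [], _ :: _ => 0
  | _ :: _, [] => 0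

/-- The value at `M` of the symbol of the part of a polynomial with the letters of `M`. -/
noncomputable def sym (M : Pt) : NPoly →ₗ[ℂ] ℂ := wordBasis.constr ℂ (wordValue M)

@[simp] theorem sym_word (M : Pt) (w : List Letter) : sym M (word w) = wordValue M w := by
  rw [← wordBasis_apply, sym, Module.Basis.constr_basis]

theorem sym_nil_one : sym [] 1 = 1 := sym_word [] []

theorem sym_cons_one (e : ℕ × ℤ) (M : Pt) : sym (e :: M) 1 = 0 := sym_word (e :: M) []

theorem sym_nil_mul (p : Letter) (a : NPoly) : sym [] (FreeAlgebra.ι ℂ p * a) = 0 := by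
  suffices h : sym [] ∘ₗ LinearMap.mulLeft ℂ (FreeAlgebra.ι ℂ p) = 0 from DFunLike.congr_fun h a
  exact word_ext fun w => by
    simp only [LinearMap.comp_apply, LinearMap.mulLeft_apply, ← word_cons, sym_word]; rfl

theorem sym_cons_mul (e : ℕ × ℤ) (M : Pt) (p : Letter) (a : NPoly) :
    sym (e :: M) (FreeAlgebra.ι ℂ p * a) =
      (if p.1 = par e.1 then (e.2 : ℂ) ^ p.2 else 0) * sym M a := by
  suffices h : sym (e :: M) ∘ₗ LinearMap.mulLeft ℂ (FreeAlgebra.ι ℂ p) =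
    (if p.1 = par e.1 then (e.2 : ℂ) ^ p.2 else 0) • sym M from DFunLike.congr_fun h a
  refine word_ext fun w => ?_
  simp only [LinearMap.comp_apply, LinearMap.mulLeft_apply, ← word_cons, sym_word,
    LinearMap.smul_apply, smul_eq_mul, wordValue]
  split_ifs <;> simp

theorem sym_single (c : ℕ) (x : ℤ) (p : Letter) :
    sym [(c, x)] (FreeAlgebra.ι ℂ p) = if p.1 = par c then (x : ℂ) ^ p.2 else 0 := by
  rw [← mul_one (FreeAlgebra.ι ℂ p), sym_cons_mul, sym_nil_one, mul_one]

namespace Pt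

@[simp] theorem sum_nil : sum [] = 0 := rfl

@[simp] theorem sum_cons (e : ℕ × ℤ) (M : Pt) : sum (e :: M) = e.2 + sum M := rfl

@[simp] theorem squares_nil : squares [] = 0 := rfl

@[simp] theorem squares_cons (e : ℕ × ℤ) (M : Pt) :
    squares (e :: M) = sgn e.1 * (e.2 * e.2) + squares M := rfl

end Pt

theorem sym_D (M : Pt) (a : NPoly) : sym M (D a) = M.sum * sym M a := by
  suffices h : sym M ∘ₗ D = (M.sum : ℂ) • sym M from DFunLike.congr_fun h a
  have h1 : D 1 = 0 := by
    have := der_mul (fun p => FreeAlgebra.ι ℂ (p.1, p.2 + 1)) 1 1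
    simpa [D] using this
  refine word_ext fun w => ?_
  simp only [LinearMap.comp_apply, LinearMap.smul_apply, smul_eq_mul]
  induction w generalizing M with
  | nil =>
    rw [word_nil, h1, map_zero]
    cases M <;> simp [sym_cons_one]
  | cons p w ih =>
    rw [word_cons, show D (FreeAlgebra.ι ℂ p * word w) = FreeAlgebra.ι ℂ (p.1, p.2 + 1) * word w +
      FreeAlgebra.ι ℂ p * D (word w) by rw [D, der_mul, der_ι], map_add]
    cases M with
    | nil => simp [sym_nil_mul]
    | cons e M =>
      rw [sym_cons_mul, sym_cons_mul, sym_cons_mul, ih]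
      simp only [Pt.sum_cons]
      push_cast
      split_ifs
      · ring
      · ring

theorem sym_D_pow (M : Pt) (n : ℕ) (a : NPoly) :
    sym M ((D ^ n) a) = (M.sum : ℂ) ^ n * sym M a := by
  induction n with
  | zero => simp
  | succ n ih => rw [pow_succ', Module.End.mul_apply, sym_D, ih]; ring

/-- The sum of `h` over the decompositions of `M` into two parts, the first one nonempty and preceded
by `mid` in reverse order, `t` being the sum over `mid`. -/
def splitSum (h : ℤ → Pt → Pt → ℂ) : ℤ → Pt → Pt → ℂ
  | _, _, [] => 0
  | t, mid, e :: M => h (t + e.2) (e :: mid) M + splitSum h (t + e.2) (e :: mid) M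

/-- The sum of `h` over the decompositions of `M` into three parts, the second one nonempty. -/
def splitSum₃ (h : Pt → ℤ → Pt → Pt → ℂ) : Pt → Pt → ℂ
  | _, [] => 0
  | pre, e :: M => splitSum (h pre) 0 [] (e :: M) + splitSum₃ h (e :: pre) M

theorem splitSum_shift (h : ℤ → Pt → Pt → ℂ) (s t : ℤ) (L mid M : Pt) :
    splitSum h (t + s) (mid ++ L) M =
      splitSum (fun t mid post => h (t + s) (mid ++ L) post) t mid M := by
  induction M generalizing mid t with
  | nil => rfl
  | cons e M ih =>
    rw [splitSum, splitSum, show t + s + e.2 = t + e.2 + s by ring, ← List.cons_append, ih]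

theorem splitSum_congr {h h' : ℤ → Pt → Pt → ℂ} {t : ℤ} {mid M : Pt} (ht : t = Pt.sum mid.reverse)
    (H : ∀ mid post, h (Pt.sum mid.reverse) mid post = h' (Pt.sum mid.reverse) mid post) :
    splitSum h t mid M = splitSum h' t mid M := by
  have hs : ∀ (M : Pt) (e : ℕ × ℤ), Pt.sum (M ++ [e]) = Pt.sum M + e.2 := by
    intro M e
    induction M with
    | nil => simp
    | cons f M ih => rw [List.cons_append, Pt.sum_cons, ih, Pt.sum_cons]; ring
  induction M generalizing mid t with
  | nil => rfl
  | cons e M ih =>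
    have ht' : t + e.2 = Pt.sum (e :: mid).reverse := by rw [List.reverse_cons, hs, ht]
    rw [splitSum, splitSum, ih ht', ht', H]

theorem splitSum_mul (c : ℂ) (h : ℤ → Pt → Pt → ℂ) (t : ℤ) (mid M : Pt) :
    splitSum (fun t mid post => c * h t mid post) t mid M = c * splitSum h t mid M := by
  induction M generalizing mid t with
  | nil => simp [splitSum]
  | cons e M ih => rw [splitSum, splitSum, ih]; ring

theorem splitSum_sub (h h' : ℤ → Pt → Pt → ℂ) (t : ℤ) (mid M : Pt) :
    splitSum (fun t mid post => h t mid post - h' t mid post) t mid M =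
      splitSum h t mid M - splitSum h' t mid M := by
  induction M generalizing mid t with
  | nil => simp [splitSum]
  | cons e M ih => rw [splitSum, splitSum, splitSum, ih]; ring

theorem splitSum₃_shift (h : Pt → ℤ → Pt → Pt → ℂ) (L pre M : Pt) :
    splitSum₃ h (pre ++ L) M = splitSum₃ (fun pre => h (pre ++ L)) pre M := by
  induction M generalizing pre with
  | nil => rfl
  | cons e M ih => rw [splitSum₃, splitSum₃, ← ih]; rfl

theorem splitSum₃_mul (c : ℂ) (h : Pt → ℤ → Pt → Pt → ℂ) (pre M : Pt) :
    splitSum₃ (fun pre t mid post => c * h pre t mid post) pre M = c * splitSum₃ h pre M := by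
  induction M generalizing pre with
  | nil => simp [splitSum₃]
  | cons e M ih => rw [splitSum₃, splitSum₃, ih, splitSum_mul]; ring

theorem splitSum₃_sub (h h' : Pt → ℤ → Pt → Pt → ℂ) (pre M : Pt) :
    splitSum₃ (fun pre t mid post => h pre t mid post - h' pre t mid post) pre M =
      splitSum₃ h pre M - splitSum₃ h' pre M := by
  induction M generalizing pre with
  | nil => simp [splitSum₃]
  | cons e M ih => rw [splitSum₃, splitSum₃, splitSum₃, ih, splitSum_sub]; ring

theorem sym_mul (M : Pt) (a b : NPoly) : sym M (a * b) =
    sym [] a * sym M b + splitSum (fun _ mid post => sym mid.reverse a * sym post b) 0 [] M := by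
  have hlin : ∀ (M mid : Pt) (t : ℤ), ∃ f : NPoly →ₗ[ℂ] ℂ, ∀ a, f a =
      splitSum (fun _ mid post => sym mid.reverse a * sym post b) t mid M := by
    intro M
    induction M with
    | nil => exact fun mid t => ⟨0, fun a => rfl⟩
    | cons e M ih =>
      intro mid t
      obtain ⟨f, hf⟩ := ih (e :: mid) (t + e.2)
      exact ⟨(sym M b) • sym (e :: mid).reverse + f, fun a => by
        simp [splitSum, hf]; ring⟩
  obtain ⟨f, hf⟩ := hlin M [] 0
  suffices h : sym M ∘ₗ LinearMap.mulRight ℂ b = (sym M b) • sym [] + f by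
    have := DFunLike.congr_fun h a
    simp only [LinearMap.comp_apply, LinearMap.mulRight_apply, LinearMap.add_apply,
      LinearMap.smul_apply, smul_eq_mul, hf] at this
    rw [this]; ring
  clear a
  refine word_ext fun w => ?_
  simp only [LinearMap.comp_apply, LinearMap.mulRight_apply, LinearMap.add_apply,
      LinearMap.smul_apply, smul_eq_mul, hf]
  clear hf f hlin
  induction w generalizing M with
  | nil =>
    have : ∀ (M mid : Pt) (t : ℤ),
        splitSum (fun _ mid post => sym mid.reverse 1 * sym post b) t mid M = 0 := by
      intro M
      induction M with
      | nil => exact fun _ _ => rfl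
      | cons e M ih =>
        intro mid t
        have h0 : sym (e :: mid).reverse 1 = 0 := by
          rw [List.reverse_cons]
          cases mid.reverse <;> exact sym_cons_one _ _
        rw [splitSum, ih, h0]; ring
    rw [word_nil, this, sym_nil_one, one_mul, mul_one, add_zero]
  | cons p w ih =>
    rw [word_cons, sym_nil_mul, mul_assoc]
    cases M with
    | nil => simp [sym_nil_mul, splitSum]
    | cons e M =>
      rw [sym_cons_mul, ih, splitSum, List.reverse_singleton, sym_cons_mul,
        ← zero_add (0 + e.2), ← List.nil_append [e], splitSum_shift]
      simp only [List.reverse_append, List.reverse_singleton, List.singleton_append,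
        sym_cons_mul, mul_assoc, splitSum_mul]
      ring

/-- The summand of the symbol of `flow F b`. -/
noncomputable def flowTerm (F : NSystem) (b : NPoly) (pre : Pt) (t : ℤ) (mid post : Pt) : ℂ :=
  sym mid.reverse (F 0) * sym (pre.reverse ++ (0, t) :: post) b +
    sym mid.reverse (F 1) * sym (pre.reverse ++ (1, t) :: post) b

theorem flow_ι (F : NSystem) (p : Letter) : F.flow (FreeAlgebra.ι ℂ p) = (D ^ p.2) (F p.1) := by
  rw [NSystem.flow, der_ι]

theorem flow_mul (F : NSystem) (a b : NPoly) : F.flow (a * b) = F.flow a * b + a * F.flow b :=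
  der_mul _ a b

theorem flow_one (F : NSystem) : F.flow 1 = 0 := by
  have := flow_mul F 1 1
  simpa using this

theorem sym_flow (F : NSystem) (hF : ∀ k, sym [] (F k) = 0) (M : Pt) (b : NPoly) :
    sym M (F.flow b) = splitSum₃ (flowTerm F b) [] M := by
  have hlin2 : ∀ (pre M mid : Pt) (t : ℤ), ∃ f : NPoly →ₗ[ℂ] ℂ, ∀ b, f b =
      splitSum (flowTerm F b pre) t mid M := by
    intro pre M
    induction M with
    | nil => exact fun mid t => ⟨0, fun a => rfl⟩
    | cons e M ih =>
      intro mid t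
      obtain ⟨f, hf⟩ := ih (e :: mid) (t + e.2)
      exact ⟨(sym (e :: mid).reverse (F 0)) • sym (pre.reverse ++ (0, t + e.2) :: M) +
        (sym (e :: mid).reverse (F 1)) • sym (pre.reverse ++ (1, t + e.2) :: M) + f, fun a => by
        simp [splitSum, hf, flowTerm]⟩
  have hlin : ∀ M pre : Pt, ∃ f : NPoly →ₗ[ℂ] ℂ, ∀ b, f b =
      splitSum₃ (flowTerm F b) pre M := by
    intro M
    induction M with
    | nil => exact fun mid => ⟨0, fun a => rfl⟩
    | cons e M ih =>
      intro pre
      obtain ⟨f, hf⟩ := ih (e :: pre)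
      obtain ⟨g, hg⟩ := hlin2 pre (e :: M) [] 0
      exact ⟨g + f, fun a => by simp [splitSum₃, hf, hg]⟩
  obtain ⟨f, hf⟩ := hlin M []
  rw [← hf, ← LinearMap.comp_apply]
  refine DFunLike.congr_fun (word_ext fun w => ?_) b
  rw [LinearMap.comp_apply, hf]
  clear hf f hlin hlin2
  induction w generalizing M with
  | nil =>
    have h2 : ∀ (pre M mid : Pt) (t : ℤ), splitSum (flowTerm F 1 pre) t mid M = 0 := by
      intro pre M
      induction M with
      | nil => exact fun _ _ => rfl
      | cons e M ih =>
        intro mid t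
        have h0 : ∀ c, sym (pre.reverse ++ (c, t + e.2) :: M) 1 = 0 := fun c => by
          cases pre.reverse <;> exact sym_cons_one _ _
        rw [splitSum, ih, flowTerm, h0, h0]; ring
    have h3 : ∀ M pre : Pt, splitSum₃ (flowTerm F 1) pre M = 0 := by
      intro M
      induction M with
      | nil => exact fun _ => rfl
      | cons e M ih => intro pre; rw [splitSum₃, ih, h2, add_zero]
    rw [word_nil, flow_one, map_zero, h3]
  | cons p w ih =>
    rw [word_cons, flow_mul, map_add, flow_ι]
    cases M with
    | nil =>
      rw [sym_nil_mul, sym_mul, sym_D_pow, hF]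
      simp [splitSum, splitSum₃]
    | cons e M =>
      rw [sym_cons_mul, ih, sym_mul, sym_D_pow, hF, splitSum₃, ← List.nil_append [e],
        splitSum₃_shift, ← splitSum₃_mul]
      congr 1
      · rw [mul_zero, zero_mul, zero_add]
        refine splitSum_congr rfl fun mid post => ?_
        rw [sym_D_pow, flowTerm, List.reverse_nil, List.nil_append, List.nil_append, sym_cons_mul,
          sym_cons_mul]
        obtain ⟨c, n⟩ := p
        fin_cases c <;> simp [par] <;> ring
      · congr 1
        funext pre t mid post
        rw [flowTerm, flowTerm, List.reverse_append, List.reverse_singleton,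
          List.singleton_append, List.cons_append, List.cons_append, sym_cons_mul, sym_cons_mul]
        ring


/-! ### The equations for the symbols of a symmetry -/

/-- The system `u_t = u_xx`, `v_t = -v_xx`. -/
noncomputable def heat : NSystem := fun k => if k = 0 then u 2 else -v 2

theorem heat_apply (k : Fin 2) :
    heat k = (if k = 0 then 1 else -1 : ℂ) • FreeAlgebra.ι ℂ (k, 2) := by
  fin_cases k <;> simp [heat, u, v]

@[simp] theorem beq_succ_zero (n : ℕ) : Nat.beq (n + 1) 0 = false := rfl

theorem sgn_eq (c : ℕ) : ((Pt.sgn c : ℤ) : ℂ) = if par c = 0 then 1 else -1 := by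
  cases c <;> simp [Pt.sgn, par]

theorem flow_add (F F' : NSystem) (a : NPoly) : (F + F').flow a = F.flow a + F'.flow a := by
  rw [← LinearMap.add_apply]
  refine DFunLike.congr_fun (word_ext fun w => ?_) a
  rw [LinearMap.add_apply]
  induction w with
  | nil => simp [flow_one]
  | cons p w ih =>
    simp only [word_cons, flow_mul, flow_ι, ih, Pi.add_apply, map_add]
    noncomm_ring

theorem sym_flow_heat (M : Pt) (a : NPoly) :
    sym M (heat.flow a) = (M.squares : ℂ) * sym M a := by
  suffices h : sym M ∘ₗ heat.flow = (M.squares : ℂ) • sym M from DFunLike.congr_fun h a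
  refine word_ext fun w => ?_
  simp only [LinearMap.comp_apply, LinearMap.smul_apply, smul_eq_mul]
  induction w generalizing M with
  | nil =>
    rw [word_nil, flow_one, map_zero]
    cases M <;> simp [sym_cons_one]
  | cons p w ih =>
    have hD : ∀ n p, (D ^ n) (FreeAlgebra.ι ℂ p) = FreeAlgebra.ι ℂ (p.1, p.2 + n) := by
      intro n p
      induction n with
      | zero => simp
      | succ n ih => rw [pow_succ', Module.End.mul_apply, ih, D, der_ι, add_assoc]
    rw [word_cons, flow_mul, flow_ι, heat_apply, map_smul, hD, map_add, smul_mul_assoc, map_smul]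
    cases M with
    | nil => simp [sym_nil_mul]
    | cons e M =>
      rw [sym_cons_mul, sym_cons_mul, sym_cons_mul, ih]
      simp only [Pt.squares_cons]
      push_cast
      rw [sgn_eq, smul_eq_mul]
      by_cases h : p.1 = par e.1
      · simp only [h, if_true]; ring
      · simp [h]

theorem quad_mul_sym {F G : NSystem} (hs : (heat + F).IsSymmetry G) (hF : ∀ k, sym [] (F k) = 0)
    (hG : ∀ k, sym [] (G k) = 0) (k : ℕ) (M : Pt) :
    (M.quad k : ℂ) * sym M (G (par k)) = splitSum₃ (fun pre t mid post =>
      flowTerm F (G (par k)) pre t mid post - flowTerm G (F (par k)) pre t mid post) [] M := by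
  have h := congrArg (sym M) (hs (FreeAlgebra.ι ℂ (par k, 0)))
  rw [flow_ι, flow_ι, pow_zero, Module.End.one_apply, Module.End.one_apply, flow_add, map_add,
    sym_flow_heat, sym_flow F hF, Pi.add_apply, map_add, map_add, heat_apply, map_smul, map_smul,
    flow_ι, sym_D_pow, sym_flow G hG, ← sgn_eq] at h
  rw [splitSum₃_sub]
  simp only [Pt.quad, seqZ_eq]
  simp only [smul_eq_mul] at h
  have : ((Int.sub ((Pt.sgn k).mul (Int.mul M.sum M.sum)) M.squares : ℤ) : ℂ) =
      Pt.sgn k * (M.sum * M.sum) - M.squares := by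
    change ((Pt.sgn k * (M.sum * M.sum) - M.squares : ℤ) : ℂ) = _
    push_cast; rfl
  rw [this]
  linear_combination -h

theorem sym_single_word (c : ℕ) (x : ℤ) (w : List Letter) (h : w.length ≠ 1) :
    sym [(c, x)] (word w) = 0 := by
  rw [sym_word]
  match w, h with
  | [], _ => rfl
  | [_], h => exact absurd rfl h
  | _ :: _ :: _, _ => simp [wordValue]

/-! ### Words of given weight -/

namespace Weights

def ofWord (W : Weights) (w : List Letter) : ℕ :=
  (w.map fun p => W.letter p.1 + W.r * p.2).sum

/-- The word `w` may occur in the equation `k` of a symmetry of order `n`. -/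
def Admits (W : Weights) (n k : ℕ) (w : List Letter) : Prop :=
  W.ofWord w = W.total n k ∧ (W.bal = true → if k = 0 then
    2 * w.countP (fun p => p.1 = 0) = w.length + 1 else
      2 * w.countP (fun p => p.1 = 0) + 1 = w.length)

/-- The linear combinations of the words that may occur in the equation `k` of a symmetry of
order `n`. -/
def space (W : Weights) (n k : ℕ) : Submodule ℂ NPoly :=
  Submodule.span ℂ (word '' {w | W.Admits n k w})

end Weights

theorem par_val (p : Fin 2) (c : ℕ) (h : p = par c) (W : Weights) : W.letter p = W.letter c := by
  subst h
  cases c <;> simp [par, Weights.letter]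

theorem wordValue_shift (M : Pt) (w : List Letter) : ∃ P : Polynomial ℂ,
    (∀ t : ℕ, wordValue (M.shift t) w = P.eval (t : ℂ)) ∧
      (P = 0 ∨ P.natDegree ≤ (w.map Prod.snd).sum ∧ w.map Prod.fst = M.map fun e => par e.1) := by
  induction M generalizing w with
  | nil =>
    cases w with
    | nil => exact ⟨1, fun t => by simp [Pt.shift, wordValue], Or.inr (by simp)⟩
    | cons p w => exact ⟨0, fun t => by simp [Pt.shift, wordValue], Or.inl rfl⟩
  | cons e M ih =>
    cases w with
    | nil => exact ⟨0, fun t => by simp [Pt.shift, wordValue], Or.inl rfl⟩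
    | cons p w =>
      obtain ⟨P, hP, hd⟩ := ih w
      by_cases h : p.1 = par e.1
      · refine ⟨(Polynomial.C (e.2 : ℂ) + Polynomial.X * Polynomial.C (e.2 * e.2 + (e.1 + 1 : ℂ))) ^
          p.2 * P, fun t => ?_, ?_⟩
        · have := hP t
          simp only [Pt.shift] at this
          simp only [Pt.shift, List.map_cons, wordValue, h, if_true, this, Polynomial.eval_mul,
            Polynomial.eval_pow, Polynomial.eval_add, Polynomial.eval_C, Polynomial.eval_X]
          congr 2
          change ((e.2 + (t : ℤ) * (e.2 * e.2 + ((e.1 + 1 : ℕ) : ℤ)) : ℤ) : ℂ) = _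
          push_cast; ring
        · rcases hd with rfl | ⟨hd, hw⟩
          · simp
          · refine Or.inr ⟨?_, by simp [h, hw]⟩
            refine Polynomial.natDegree_mul_le.trans ?_
            rw [List.map_cons, List.sum_cons]
            refine add_le_add (Polynomial.natDegree_pow_le.trans ?_) hd
            refine (Nat.mul_le_mul_left _ ?_).trans (mul_one _).le
            exact Polynomial.natDegree_add_le_of_degree_le (by simp)
              ((Polynomial.natDegree_mul_C_le _ _).trans Polynomial.natDegree_X_le)
      · exact ⟨0, fun t => by simp [Pt.shift, wordValue, h], Or.inl rfl⟩

theorem countU_eq (M : Pt) (w : List Letter) (h : w.map Prod.fst = M.map fun e => par e.1) :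
    Weights.countU M = w.countP (fun p => p.1 = 0) := by
  induction M generalizing w with
  | nil => simp_all [Weights.countU]
  | cons e M ih =>
    cases w with
    | nil => simp at h
    | cons p w =>
      simp only [List.map_cons, List.cons.injEq] at h
      have : Weights.countU (e :: M) = bif Nat.beq e.1 0 then Nat.succ (Weights.countU M)
        else Weights.countU M := rfl
      rw [this, ih w h.2, List.countP_cons]
      obtain ⟨c, x⟩ := e
      cases c <;> simp [h.1, par]

theorem ofPt_eq (W : Weights) (M : Pt) (w : List Letter)
    (h : w.map Prod.fst = M.map fun e => par e.1) :
    W.ofWord w = W.ofPt M + W.r * (w.map Prod.snd).sum := by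
  induction M generalizing w with
  | nil => simp_all [Weights.ofWord, Weights.ofPt]
  | cons e M ih =>
    cases w with
    | nil => simp at h
    | cons p w =>
      simp only [List.map_cons, List.cons.injEq] at h
      have : W.ofPt (e :: M) = W.letter e.1 + W.ofPt M := rfl
      have ih := ih w h.2
      simp only [Weights.ofWord, List.map_cons, List.sum_cons, this] at ih ⊢
      rw [ih, par_val _ _ h.1]; ring

theorem bound_eq (W : Weights) (hr : 0 < W.r) {n k : ℕ} {M : Pt} {w : List Letter}
    (hw : W.Admits n k w) (h : w.map Prod.fst = M.map fun e => par e.1) :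
    W.bound n k M = (w.map Prod.snd).sum + 1 := by
  have hl : w.length = M.length := by simpa using congrArg List.length h
  have hb : (W.bal && !Weights.balanced k M) = false := by
    cases hb : W.bal with
    | false => rfl
    | true =>
      have := hw.2 hb
      rw [← countU_eq M w h, hl] at this
      cases k with
      | zero => simpa [Weights.balanced] using this
      | succ k => simpa [Weights.balanced] using this
  have ht := hw.1
  rw [ofPt_eq W M w h] at ht
  have h1 : Nat.blt (W.total n k) (W.ofPt M) = false := by
    rw [Bool.eq_false_iff]
    intro hlt
    have : W.total n k < W.ofPt M := Nat.ble_eq.mp hlt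
    omega
  have h2 : Nat.sub (W.total n k) (W.ofPt M) = W.r * (w.map Prod.snd).sum := by
    change W.total n k - W.ofPt M = _
    omega
  simp only [Weights.bound, seqN_eq, hb, h1, h2, cond_false]
  have h3 : Nat.mod (W.r * (w.map Prod.snd).sum) W.r = 0 := Nat.mul_mod_right _ _
  have h4 : Nat.div (W.r * (w.map Prod.snd).sum) W.r = (w.map Prod.snd).sum :=
    Nat.mul_div_cancel_left _ hr
  rw [h3, h4]; rfl

theorem shift_zero (M : Pt) : M.shift 0 = M := by
  have : ∀ e : ℕ × ℤ, (e.1, Int.add e.2 (Int.mul (Int.ofNat 0)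
      (Int.add (Int.mul e.2 e.2) (Int.ofNat (Nat.succ e.1))))) = e := fun e => by
    refine Prod.ext rfl ?_
    change e.2 + (0 : ℤ) * _ = e.2
    simp
  rw [Pt.shift, List.map_congr_left fun e _ => this e, List.map_id']

/-- The finite differences of sufficiently high order of a symbol vanish. -/
theorem sum_shift_eq_zero (W : Weights) (hr : 0 < W.r) {n k : ℕ} {a : NPoly}
    (ha : a ∈ W.space n k) (M : Pt) :
    ∑ t ∈ Finset.range (W.bound n k M + 1), (-1) ^ t * (Nat.choose (W.bound n k M) t : ℂ) *
      sym (M.shift t) a = 0 := by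
  induction ha using Submodule.span_induction with
  | zero => simp
  | add a b _ _ ha hb =>
    simp only [map_add, mul_add, Finset.sum_add_distrib, ha, hb, add_zero]
  | smul c a _ ha =>
    have : ∀ t, (-1) ^ t * (Nat.choose (W.bound n k M) t : ℂ) * sym (M.shift t) (c • a) =
      c * ((-1) ^ t * (Nat.choose (W.bound n k M) t : ℂ) * sym (M.shift t) a) := fun t => by
      rw [map_smul, smul_eq_mul]; ring
    simp only [this, ← Finset.mul_sum, ha, mul_zero]
  | mem a ha =>
    obtain ⟨w, hw, rfl⟩ := ha
    obtain ⟨P, hP, h⟩ := wordValue_shift M w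
    simp only [sym_word, hP]
    rcases h with rfl | ⟨hd, h⟩
    · simp
    · have hN := bound_eq W hr hw h
      have := congrFun (Polynomial.fwdDiff_iter_eq_zero_of_degree_lt (P := P)
        (n := W.bound n k M) (by omega)) 0
      rw [fwdDiff_iter_eq_sum_shift, Pi.zero_apply] at this
      rw [← neg_one_pow_mul_eq_zero_iff (n := W.bound n k M), Finset.mul_sum, ← this]
      refine Finset.sum_congr rfl fun t ht => ?_
      have ht : t ≤ W.bound n k M := Nat.lt_succ_iff.mp (Finset.mem_range.mp ht)
      simp only [zero_add, nsmul_eq_mul, mul_one, zsmul_eq_mul]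
      push_cast
      rw [← mul_assoc, ← mul_assoc]
      congr 2
      obtain ⟨s, hs⟩ := Nat.exists_eq_add_of_le ht
      rw [hs, Nat.add_sub_cancel_left, pow_add, mul_right_comm, ← pow_add, ← two_mul, pow_mul]
      simp

theorem sym_eq_zero_of_bound (W : Weights) (hr : 0 < W.r) {n k : ℕ} {a : NPoly}
    (ha : a ∈ W.space n k) {M : Pt} (h : W.bound n k M = 0) : sym M a = 0 := by
  have := sum_shift_eq_zero W hr ha M
  simpa [h, shift_zero] using this


open NonAbelian.Poly

/-! ### Soundness of the computation of symbols -/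

def toLetter (l : ℕ) : Letter := (par (l % 2), l / 2)

variable {χ : ℕ →* ℂ}

namespace Pt

theorem seq_eq {α : Type} (M : Pt) (k : Pt → α) : M.seq k = k M := by
  induction M generalizing k with
  | nil => rfl
  | cons e M ih =>
    have : Pt.seq (e :: M) k = seqN e.1 fun c => seqZ e.2 fun x =>
      Pt.seq M fun t => k ((c, x) :: t) := rfl
    rw [this, seqN_eq, seqZ_eq, ih]

theorem rev_eq {α : Type} (M N : Pt) (k : Pt → α) : M.rev N k = k (M.reverse ++ N) := by
  induction M generalizing N with
  | nil => rfl
  | cons e M ih =>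
    have : Pt.rev (e :: M) N k = Pt.rev M (e :: N) k := rfl
    rw [this, ih]; simp

end Pt

theorem ipow_eq (x : ℤ) (n : ℕ) : ipow x n = x ^ n := by
  induction n with
  | zero => exact (pow_zero x).symm
  | succ n ih =>
    have : ipow x (n + 1) = x * ipow x n := rfl
    rw [this, ih, pow_succ']

/-- The value of the linear combination `L` at `M`. -/
noncomputable def lsum (χ : ℕ →* ℂ) (M : Pt) (L : List (Word × Poly)) : ℂ :=
  (L.map fun e => (wordVal e.1 M : ℂ) * ev χ e.2).sum

@[simp] theorem lsum_nil (M : Pt) : lsum χ M [] = 0 := rfl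

@[simp] theorem lsum_cons (M : Pt) (e : Word × Poly) (L : List (Word × Poly)) :
    lsum χ M (e :: L) = wordVal e.1 M * ev χ e.2 + lsum χ M L := by simp [lsum]

namespace Trie

theorem valueAt_eq (χ : ℕ →* ℂ) (M : Pt) (L : List (Word × Poly)) : ∃ r : Poly,
    ev χ r = lsum χ M L ∧ ∀ (α : Type) (k : Poly → α), valueAt M L k = k r := by
  induction L with
  | nil => exact ⟨[], rfl, fun _ _ => rfl⟩
  | cons e L ih =>
    obtain ⟨r, hr, h⟩ := ih
    have hk : ∀ (α : Type) (k : Poly → α), valueAt M (e :: L) k =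
      seqZ (wordVal e.1 M) fun c => bif (Q.ofInt c).isZero then valueAt M L k
        else valueAt M L fun q => addMulK 1 (Q.ofInt c) e.2 q k := fun α k => rfl
    cases hz : (Q.ofInt (wordVal e.1 M)).isZero with
    | true =>
      refine ⟨r, ?_, fun α k => by rw [hk, seqZ_eq, hz, cond_true, h]⟩
      have := Q.val_eq_zero hz
      rw [Q.val_ofInt] at this
      rw [lsum_cons, this, hr]; ring
    | false =>
      obtain ⟨s, hs, h'⟩ := addMulK_eq χ 1 (Q.ofInt (wordVal e.1 M)) e.2 r
      refine ⟨s, ?_, fun α k => by rw [hk, seqZ_eq, hz, cond_false, h, h']⟩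
      rw [lsum_cons, hs, hr, Q.val_ofInt, map_one]; ring

theorem force_eq {α : Type} (T : Trie) (k : Trie → α) : T.force k = k T := by
  cases T <;> rfl

theorem walk_nil (M : Pt) : walk nil M = nil := by cases M <;> rfl

theorem walk_cons (T : Trie) (e : ℕ × ℤ) (M : Pt) : T.walk (e :: M) = (T.desc e.1).walk M := by
  cases T with
  | nil => exact (walk_nil M).symm
  | node h l r =>
    have h1 : (node h l r).walk (e :: M) = bif Nat.beq e.1 0 then l.walk M else r.walk M := rfl
    have h2 : (node h l r).desc e.1 = bif Nat.beq e.1 0 then l else r := rfl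
    rw [h1, h2]
    cases Nat.beq e.1 0 <;> rfl

theorem walk_append (T : Trie) (M N : Pt) : T.walk (M ++ N) = (T.walk M).walk N := by
  induction M generalizing T with
  | nil => rfl
  | cons e M ih => rw [List.cons_append, walk_cons, walk_cons, ih]

/-- The value at `M` of the symbol of the part of `T` with the letters of `M`. -/
noncomputable def symbolAt (χ : ℕ →* ℂ) (T : Trie) (M : Pt) : ℂ := lsum χ M (T.walk M).head

noncomputable def value (χ : ℕ →* ℂ) : Trie → NPoly
  | nil => 0
  | node h l r => (h.map fun e => ev χ e.2 • word (e.1.map toLetter)).sum + (value χ l + value χ r)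

theorem value_terms (T : Trie) :
    (T.terms.map fun e => ev χ e.2 • word (e.1.map toLetter)).sum = T.value χ := by
  induction T with
  | nil => rfl
  | node h l r ihl ihr =>
    have : (node h l r).terms = (h.filter fun e => !e.2.isEmpty) ++ (l.terms ++ r.terms) := rfl
    rw [this, List.map_append, List.map_append, List.sum_append, List.sum_append, ihl, ihr, value]
    congr 1
    induction h with
    | nil => rfl
    | cons e h ih =>
      cases hz : e.2.isEmpty with
      | true =>
        rw [List.filter_cons_of_neg (by simp [hz]), ih rfl, List.map_cons, List.sum_cons,
          ev_isEmpty hz, zero_smul, zero_add]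
      | false =>
        rw [List.filter_cons_of_pos (by simp [hz]), List.map_cons, List.sum_cons, ih rfl,
          List.map_cons, List.sum_cons]

theorem value_insert (w : Word) (p : Poly) (x : Word) (T : Trie) :
    (insert w p x T).value χ = ev χ p • word (w.map toLetter) + T.value χ := by
  induction x generalizing T with
  | nil =>
    cases T with
    | nil => simp [insert, value]
    | node h l r => simp [insert, value, add_assoc]
  | cons a x ih =>
    cases T with
    | nil =>
      have : insert w p (a :: x) nil = bif Nat.beq (Nat.mod a 2) 0 then
        node [] (insert w p x nil) nil else node [] nil (insert w p x nil) := rfl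
      rw [this]
      cases Nat.beq (Nat.mod a 2) 0 <;> simp [value, ih]
    | node h l r =>
      have : insert w p (a :: x) (node h l r) = bif Nat.beq (Nat.mod a 2) 0 then
        node h (insert w p x l) r else node h l (insert w p x r) := rfl
      rw [this]
      cases Nat.beq (Nat.mod a 2) 0 <;> simp only [value, ih, cond_true, cond_false] <;> abel

theorem symbolAt_nil (M : Pt) : symbolAt χ nil M = 0 := by simp [symbolAt, walk_nil, head]

theorem symbolAt_cons (T : Trie) (e : ℕ × ℤ) (M : Pt) (f : Pt) :
    lsum χ f (T.walk (e :: M)).head = lsum χ f ((T.desc e.1).walk M).head := by rw [walk_cons]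

theorem lsum_insert (w : Word) (p : Poly) (x : Word) (T : Trie) (N M : Pt) :
    lsum χ N ((insert w p x T).walk M).head =
      (if x.map (fun a => par (a % 2)) = M.map (fun e => par e.1) then wordVal w N * ev χ p else 0) +
        lsum χ N (T.walk M).head := by
  have hb : ∀ a b : ℕ, (Nat.beq a 0 = Nat.beq b 0) ↔ par a = par b := by
    intro a b; cases a <;> cases b <;> simp [par]
  have hnil : ∀ M, lsum χ N (walk nil M).head = 0 := fun M => by simp [walk_nil, head]
  induction x generalizing T M with
  | nil =>
    cases M with
    | nil => cases T <;> simp [insert, walk, head]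
    | cons e M =>
      have : desc (insert w p [] T) e.1 = desc T e.1 := by
        cases T with
        | nil => simp only [insert, desc]; cases Nat.beq e.1 0 <;> rfl
        | node h l r => rfl
      rw [walk_cons, this, walk_cons]; simp
  | cons a x ih =>
    cases M with
    | nil =>
      have : head (insert w p (a :: x) T) = head T := by
        cases T with
        | nil =>
          have : insert w p (a :: x) nil = bif Nat.beq (Nat.mod a 2) 0 then
            node [] (insert w p x nil) nil else node [] nil (insert w p x nil) := rfl
          rw [this]; cases Nat.beq (Nat.mod a 2) 0 <;> rfl
        | node h l r =>
          have : insert w p (a :: x) (node h l r) = bif Nat.beq (Nat.mod a 2) 0 then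
            node h (insert w p x l) r else node h l (insert w p x r) := rfl
          rw [this]; cases Nat.beq (Nat.mod a 2) 0 <;> rfl
      change lsum χ N (head (insert w p (a :: x) T)) = _
      rw [this]; simp [walk]
    | cons e M =>
      have h1 : desc (insert w p (a :: x) T) e.1 =
          if par (a % 2) = par e.1 then insert w p x (desc T e.1) else desc T e.1 := by
        simp only [← hb]
        have hd : ∀ h l r, desc (node h l r) e.1 = bif Nat.beq e.1 0 then l else r :=
          fun _ _ _ => rfl
        cases T with
        | nil =>
          have h2 : insert w p (a :: x) nil = bif Nat.beq (a % 2) 0 then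
            node [] (insert w p x nil) nil else node [] nil (insert w p x nil) := rfl
          rw [h2]
          cases Nat.beq (a % 2) 0 <;> cases h3 : Nat.beq e.1 0 <;> simp [h3, desc]
        | node h l r =>
          have h2 : insert w p (a :: x) (node h l r) = bif Nat.beq (a % 2) 0 then
            node h (insert w p x l) r else node h l (insert w p x r) := rfl
          rw [h2]
          cases Nat.beq (a % 2) 0 <;> cases h3 : Nat.beq e.1 0 <;> simp [hd, h3]
      rw [walk_cons, h1, walk_cons]
      by_cases h : par (a % 2) = par e.1
      · simp [h, ih]
      · simp [h]

theorem wordVal_eq (w : Word) (M : Pt)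
    (h : w.map (fun a => par (a % 2)) = M.map fun e => par e.1) :
    (wordVal w M : ℂ) = wordValue M (w.map toLetter) := by
  induction w generalizing M with
  | nil =>
    cases M with
    | nil => simp [wordVal, wordValue]
    | cons e M => simp at h
  | cons a w ih =>
    cases M with
    | nil => simp at h
    | cons e M =>
      simp only [List.map_cons, List.cons.injEq] at h
      have : wordVal (a :: w) (e :: M) = ipow e.2 (a / 2) * wordVal w M := rfl
      rw [this]
      push_cast
      rw [ih M h.2, ipow_eq]
      simp [wordValue, toLetter, h.1]

theorem wordValue_eq_zero (w : Word) (M : Pt)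
    (h : ¬ w.map (fun a => par (a % 2)) = M.map fun e => par e.1) :
    wordValue M (w.map toLetter) = 0 := by
  induction w generalizing M with
  | nil =>
    cases M with
    | nil => simp at h
    | cons e M => rfl
  | cons a w ih =>
    cases M with
    | nil => rfl
    | cons e M =>
      simp only [List.map_cons, List.cons.injEq, not_and] at h
      simp only [List.map_cons, wordValue, toLetter]
      split_ifs with h'
      · rw [ih M (h h'), mul_zero]
      · rfl

theorem symbolAt_ofList (L : List (Word × Poly)) (M : Pt) :
    symbolAt χ (ofList L) M = sym M ((ofList L).value χ) := by
  induction L with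
  | nil => simp [ofList, symbolAt_nil, value]
  | cons e L ih =>
    have : ofList (e :: L) = insert e.1 e.2 e.1 (ofList L) := rfl
    rw [this, value_insert, map_add, ← ih, symbolAt, lsum_insert, symbolAt, map_smul, sym_word]
    congr 1
    split_ifs with h
    · rw [wordVal_eq _ _ h, smul_eq_mul, mul_comm]
    · rw [wordValue_eq_zero _ _ h, smul_zero]

theorem value_ofList (L : List (Word × Poly)) :
    (ofList L).value χ = (L.map fun e => ev χ e.2 • word (e.1.map toLetter)).sum := by
  induction L with
  | nil => rfl
  | cons e L ih =>
    have : ofList (e :: L) = insert e.1 e.2 e.1 (ofList L) := rfl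
    rw [this, value_insert, ih, List.map_cons, List.sum_cons]

theorem substL_eq (h : χ 4 = -3) {m : ℕ} {q : Poly} (hq : χ m = ev χ q) (L : List (Word × Poly)) :
    ∃ L' : List (Word × Poly), (∀ M, lsum χ M L' = lsum χ M L) ∧
      (L'.map fun e => ev χ e.2 • word (e.1.map toLetter)).sum =
        (L.map fun e => ev χ e.2 • word (e.1.map toLetter)).sum ∧
      ∀ (α : Type) (k : List (Word × Poly) → α), substL m q L k = k L' := by
  induction L with
  | nil => exact ⟨[], fun _ => rfl, rfl, fun _ _ => rfl⟩
  | cons e L ih =>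
    obtain ⟨L', h1, h2, h3⟩ := ih
    obtain ⟨r, hr, hk⟩ := substRed_eq h hq e.2
    refine ⟨(e.1, r) :: L', fun M => by simp [h1, hr], by simp only [List.map_cons, List.sum_cons,
      h2, hr], fun α k => ?_⟩
    have : substL m q (e :: L) k = substRed m q e.2 fun p => substL m q L fun t =>
      k ((e.1, p) :: t) := rfl
    rw [this, hk, h3]

theorem subst_eq (h : χ 4 = -3) {m : ℕ} {q : Poly} (hq : χ m = ev χ q) (T : Trie) :
    ∃ T' : Trie, (∀ N M, lsum χ N (T'.walk M).head = lsum χ N (T.walk M).head) ∧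
      T'.value χ = T.value χ ∧
      ∀ (α : Type) (k : Trie → α), subst m q T k = k T' := by
  induction T with
  | nil => exact ⟨nil, fun _ _ => rfl, rfl, fun _ _ => rfl⟩
  | node s l r ihl ihr =>
    obtain ⟨s', hs1, hs2, hs3⟩ := substL_eq h hq s
    obtain ⟨l', hl1, hl2, hl3⟩ := ihl
    obtain ⟨r', hr1, hr2, hr3⟩ := ihr
    refine ⟨node s' l' r', fun N M => ?_, by simp only [value, hs2, hl2, hr2], fun α k => ?_⟩
    · cases M with
      | nil => exact hs1 N
      | cons e M =>
        have hd : ∀ h l r, desc (node h l r) e.1 = bif Nat.beq e.1 0 then l else r :=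
          fun _ _ _ => rfl
        rw [walk_cons, walk_cons, hd, hd]
        cases Nat.beq e.1 0
        · exact hr1 N M
        · exact hl1 N M
    · have : subst m q (node s l r) k = substL m q s fun h => subst m q l fun l =>
        subst m q r fun r => k (node h l r) := rfl
      rw [this, hs3, hl3, hr3]

end Trie

/-- The polynomial `o`, if there is one, has the value `z`. -/
def Has (χ : ℕ →* ℂ) (o : Option Poly) (z : ℂ) : Prop := ∀ p, o = some p → ev χ p = z

theorem has_some {p : Poly} {z : ℂ} (h : ev χ p = z) : Has χ (some p) z := by
  intro q hq; cases hq; exact h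

theorem has_none (z : ℂ) : Has χ none z := fun _ h => by cases h

theorem Has.addProd {p : Poly} {g acc : Option Poly} {x y z : ℂ} (hp : ev χ p = x)
    (hg : Has χ g y) (ha : Has χ acc z) : Has χ (addProd p g acc) (x * y + z) := by
  cases p with
  | nil =>
    have : x = 0 := hp.symm
    rw [this, zero_mul, zero_add]
    exact ha
  | cons a p =>
    cases g with
    | none => exact has_none _
    | some g =>
      cases acc with
      | none => exact has_none _
      | some r =>
        refine has_some ?_
        rw [ev_mulAdd, hp, hg g rfl, ha r rfl]

theorem Has.forceO {g : Option Poly} {z : ℂ} (h : Has χ g z) : Has χ (forceO g) z := by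
  cases g with
  | none => exact has_none _
  | some p =>
    obtain ⟨r, hr, hk⟩ := seq_eq χ p
    have : NonAbelian.forceO (some p) = p.seq some := rfl
    rw [this, hk]
    exact has_some (hr.trans (h p rfl))

theorem Has.scale {g : Option Poly} {z : ℂ} (c : Q) (h : Has χ g z) :
    Has χ (scale c g) (c.val * z) := by
  cases g with
  | none => exact has_none _
  | some p =>
    have : NonAbelian.scale c (some p) = bif c.isZero then some [] else
      c.seq fun c => Poly.scaleK c p some := rfl
    rw [this]
    cases hz : c.isZero with
    | true => exact has_some (by rw [Q.val_eq_zero hz]; simp)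
    | false =>
      obtain ⟨r, hr, hk⟩ := scaleK_eq χ c p
      rw [cond_false, Q.seq_eq, hk]
      exact has_some (by rw [hr, h p rfl])

theorem Has.value {α : Type} (L : List (Word × Poly)) (M : (Pt → Option α) → Option α) (M₀ : Pt)
    (hM : ∀ f, M f = f M₀) (acc : Option α) (k : Poly → Option α → Option α) :
    (L.value M acc k = acc ∧ lsum χ M₀ L = 0) ∨
      ∃ r, ev χ r = lsum χ M₀ L ∧ L.value M acc k = k r acc := by
  cases L with
  | nil => exact Or.inl ⟨rfl, rfl⟩
  | cons e L =>
    obtain ⟨r, hr, h⟩ := Trie.valueAt_eq χ M₀ (e :: L)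
    refine Or.inr ⟨r, hr, ?_⟩
    have : (e :: L).value M acc k = M fun M => k (Trie.valueAt M (e :: L) id) acc := rfl
    rw [this, hM, h, id]

/-- The data `s` describe the system `F` up to the terms `u_xx`, `-v_xx` and the coefficients `a` of
the derivatives of order `n` in a symmetry. -/
structure Know.Models (χ : ℕ →* ℂ) (s : Know) (F : NSystem) (a : Fin 2 → ℂ) : Prop where
  symbolAt : ∀ k M, (s.sys k).symbolAt χ M = sym M (F (par k))
  value : ∀ k, (s.sys k).value χ = F (par k)
  lead : ∀ k, ev χ (s.lead k) = a (par k)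

section

variable {s : Know} {F G : NSystem} {a : Fin 2 → ℂ} {g : ℕ → Pt → Option Poly}

theorem has_residStep (hs : s.Models χ F a) (hg : ∀ k M, Has χ (g k M) (sym M (G (par k))))
    (k : ℕ) (pre : Pt) (t : ℤ) (mid post : Pt) (c : ℕ) {acc : Option Poly} {z : ℂ}
    (ha : Has χ acc z) :
    Has χ (residStep g k pre ((s.sys k).walk pre.reverse) t mid post c
      ((s.sys c).walk mid.reverse) acc)
      (sym mid.reverse (F (par c)) * sym (pre.reverse ++ (c, t) :: post) (G (par k)) -
        sym mid.reverse (G (par c)) * sym (pre.reverse ++ (c, t) :: post) (F (par k)) + z) := by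
  have h1 : ∀ f : Pt → Option Poly, mid.rev [] f = f mid.reverse := fun f => by
    rw [Pt.rev_eq, List.append_nil]
  have h2 : ∀ f : Pt → Option Poly, pre.rev ((c, t) :: post) f =
    f (pre.reverse ++ (c, t) :: post) := fun f => Pt.rev_eq _ _ _
  have hF := hs.symbolAt c mid.reverse
  have hK := hs.symbolAt k (pre.reverse ++ (c, t) :: post)
  rw [Trie.symbolAt, Trie.walk_append, Trie.walk_cons] at hK
  rw [Trie.symbolAt] at hF
  have hin : Has χ (((((s.sys k).walk pre.reverse).desc c).walk post).head.value
      (fun M => pre.rev ((c, t) :: post) M) acc fun y acc =>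
        addProd y.neg (mid.rev [] fun M => g c M) acc)
      (-(sym mid.reverse (G (par c)) * sym (pre.reverse ++ (c, t) :: post) (F (par k))) + z) := by
    rcases Has.value (χ := χ) _ _ _ h2 acc
      (fun y acc => addProd y.neg (mid.rev [] fun M => g c M) acc) with ⟨h, h0⟩ | ⟨r, hr, h⟩
    · rw [h, ← hK, h0, mul_zero, neg_zero, zero_add]; exact ha
    · rw [h, h1, mul_comm, ← neg_mul, ← hK]
      exact (Has.addProd (by rw [ev_neg, hr]) (hg _ _) ha)
  rw [sub_eq_add_neg, add_assoc]
  rcases Has.value (χ := χ) ((s.sys c).walk mid.reverse).head (fun M => mid.rev [] M) _ h1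
    (((((s.sys k).walk pre.reverse).desc c).walk post).head.value
      (fun M => pre.rev ((c, t) :: post) M) acc fun y acc =>
        addProd y.neg (mid.rev [] fun M => g c M) acc) (fun x acc =>
    addProd x (pre.rev ((c, t) :: post) fun N => g k N) acc) with ⟨h, h0⟩ | ⟨r, hr, h⟩
  · rw [residStep, h, ← hF, h0, zero_mul, zero_add]; exact hin
  · rw [residStep, h, h2, ← hF]
    exact (Has.addProd hr (hg _ _) hin)

theorem has_residInner (hs : s.Models χ F a) (hg : ∀ k M, Has χ (g k M) (sym M (G (par k))))
    (k : ℕ) (pre M : Pt) (t : ℤ) (mid : Pt) {acc : Option Poly} {z : ℂ} (ha : Has χ acc z) :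
    Has χ (residInner g k pre ((s.sys k).walk pre.reverse) M ((s.sys 0).walk mid.reverse)
      ((s.sys 1).walk mid.reverse) t mid acc)
      (splitSum (fun t mid post => flowTerm F (G (par k)) pre t mid post -
        flowTerm G (F (par k)) pre t mid post) t mid M + z) := by
  induction M generalizing t mid acc z with
  | nil => rw [splitSum, zero_add]; exact ha
  | cons e M ih =>
    have hd : ∀ c, ((s.sys c).walk mid.reverse).desc e.1 = (s.sys c).walk (e :: mid).reverse :=
      fun c => by rw [List.reverse_cons, Trie.walk_append, Trie.walk_cons]; rfl
    have : residInner g k pre ((s.sys k).walk pre.reverse) (e :: M) ((s.sys 0).walk mid.reverse)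
        ((s.sys 1).walk mid.reverse) t mid acc =
      (((s.sys 0).walk mid.reverse).desc e.1).force fun T₀ =>
        (((s.sys 1).walk mid.reverse).desc e.1).force fun T₁ => seqZ (Int.add t e.2) fun t =>
        residInner g k pre ((s.sys k).walk pre.reverse) M T₀ T₁ t (e :: mid)
          (residStep g k pre ((s.sys k).walk pre.reverse) t (e :: mid) M 0 T₀
            (residStep g k pre ((s.sys k).walk pre.reverse) t (e :: mid) M 1 T₁ acc)) := rfl
    rw [this, Trie.force_eq, Trie.force_eq, seqZ_eq, hd, hd]
    have h := ih (t.add e.2) (e :: mid) (has_residStep hs hg k pre (t.add e.2) (e :: mid) M 0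
      (has_residStep hs hg k pre (t.add e.2) (e :: mid) M 1 ha))
    convert h using 1
    rw [splitSum, flowTerm, flowTerm]
    change _ = splitSum _ (t + e.2) _ _ + _
    have h0 : par 0 = 0 := rfl
    have h1 : par 1 = 1 := rfl
    have h2 : t.add e.2 = t + e.2 := rfl
    rw [h0, h1, h2]
    ring

theorem has_resid (hs : s.Models χ F a) (hg : ∀ k M, Has χ (g k M) (sym M (G (par k))))
    (k : ℕ) (M : Pt) :
    Has χ (resid s g k M) (splitSum₃ (fun pre t mid post =>
      flowTerm F (G (par k)) pre t mid post - flowTerm G (F (par k)) pre t mid post) [] M) := by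
  let R : Pt → Pt → Trie → Option Poly := fun M =>
    List.rec (motive := fun _ => Pt → Trie → Option Poly) (fun _ _ => some [])
      (fun m M ih pre K => residInner g k pre K (m :: M) s.F.1 s.F.2 0 []
        ((K.desc m.1).force fun K' => ih (m :: pre) K')) M
  have hR : ∀ m M pre K, R (m :: M) pre K = residInner g k pre K (m :: M) s.F.1 s.F.2 0 []
        ((K.desc m.1).force fun K' => R M (m :: pre) K') := fun _ _ _ _ => rfl
  have : ∀ M pre : Pt, Has χ (R M pre ((s.sys k).walk pre.reverse))
      (splitSum₃ (fun pre t mid post =>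
      flowTerm F (G (par k)) pre t mid post - flowTerm G (F (par k)) pre t mid post) pre M) := by
    intro M
    induction M with
    | nil => exact fun pre => has_some rfl
    | cons m M ih =>
      intro pre
      have hd : ((s.sys k).walk pre.reverse).desc m.1 = (s.sys k).walk (m :: pre).reverse := by
        rw [List.reverse_cons, Trie.walk_append, Trie.walk_cons]; rfl
      rw [hR, Trie.force_eq, hd]
      exact has_residInner hs hg k pre (m :: M) 0 [] (ih (m :: pre))
  exact this M []

theorem has_diffSum {f : Pt → Option Poly} {y : Pt → ℂ} (hf : ∀ M, Has χ (f M) (y M)) (M : Pt)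
    (N j : ℕ) : Has χ (diffSum f M N j)
      (∑ t ∈ Finset.range j, (-1) ^ (t + 1) * (Nat.choose N (t + 1) : ℂ) * y (M.shift (t + 1))) := by
  induction j with
  | zero => exact has_some (by simp)
  | succ j ih =>
    have : diffSum f M N (j + 1) = Pt.seq (M.shift (Nat.succ j)) fun P => addProd
        (Poly.const (Int.mul (bif Nat.beq (Nat.mod j 2) 0 then -1 else 1)
          (Int.ofNat (Nat.choose N (Nat.succ j))))) (f P) (diffSum f M N j) := rfl
    rw [this, Pt.seq_eq, Finset.sum_range_succ, add_comm]
    refine Has.addProd ?_ (hf _) ih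
    rw [ev_const]
    have hm : ((-1 : ℂ)) ^ (j + 1) = ((bif Nat.beq (Nat.mod j 2) 0 then -1 else 1 : ℤ) : ℂ) := by
      change _ = ((bif Nat.beq (j % 2) 0 then -1 else 1 : ℤ) : ℂ)
      rcases Nat.even_or_odd j with h | h
      · rw [pow_succ, h.neg_one_pow, Nat.even_iff.mp h]; simp
      · rw [pow_succ, h.neg_one_pow, Nat.odd_iff.mp h]; simp
    rw [hm]
    change ((_ * ((Nat.choose N (j + 1) : ℕ) : ℤ) : ℤ) : ℂ) = _
    push_cast
    rfl

end


open NonAbelian.Poly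

variable {χ : ℕ →* ℂ}

/-- `G` is a symmetry of the system `heat + F` of the form admitted by the weights, and `a` are the
coefficients of the derivatives of order `n` in it. -/
structure SymmetryData (χ : ℕ →* ℂ) (W : Weights) (n : ℕ) (F G : NSystem) (a : Fin 2 → ℂ) :
    Prop where
  four : χ 4 = -3
  r_pos : 0 < W.r
  symm : (heat + F).IsSymmetry G
  sym_F : ∀ k, sym [] (F k) = 0
  sym_G : ∀ k, sym [] (G k) = 0
  mem : ∀ k, G (par k) ∈ W.space n k
  lead : ∀ (k : ℕ) (x : ℤ), sym [(k, x)] (G (par k)) = a (par k) * (x : ℂ) ^ n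

variable {W : Weights} {n : ℕ} {F G : NSystem} {a : Fin 2 → ℂ} {s : Know}

theorem sum_shift (H : SymmetryData χ W n F G a) (k : ℕ) (M : Pt) :
    sym M (G (par k)) + ∑ t ∈ Finset.range (W.bound n k M),
      (-1) ^ (t + 1) * (Nat.choose (W.bound n k M) (t + 1) : ℂ) *
        sym (M.shift (t + 1)) (G (par k)) = 0 := by
  have := sum_shift_eq_zero W H.r_pos (H.mem k) M
  rw [Finset.sum_range_succ'] at this
  simpa [shift_zero, add_comm] using this

theorem has_symbol (H : SymmetryData χ W n F G a) (hs : s.Models χ F a) (fuel k : ℕ) (M : Pt) :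
    Has χ (symbol W n s fuel k M) (sym M (G (par k))) := by
  induction fuel generalizing k M with
  | zero => exact has_none _
  | succ fuel ih =>
    have : symbol W n s (fuel + 1) k M =
        bif Nat.beq M.length 1 && Nat.beq (M.headD (0, 0)).1 k then
          scale (Q.ofInt (ipow (M.headD (0, 0)).2 n)) (some (s.lead k))
        else seqZ (M.quad k) fun q => bif (Q.ofInt q).isZero then
          scale (Q.ofInt (-1)) (seqN (W.bound n k M) fun N => diffSum (symbol W n s fuel k) M N N)
        else scale (Q.ofInt q).inv (resid s (symbol W n s fuel) k M) := rfl
    rw [this]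
    cases h : (Nat.beq M.length 1 && Nat.beq (M.headD (0, 0)).1 k) with
    | true =>
      rw [Bool.and_eq_true] at h
      have h1 := Nat.eq_of_beq_eq_true h.1
      have h2 := Nat.eq_of_beq_eq_true h.2
      obtain ⟨⟨c, x⟩, rfl⟩ := List.length_eq_one_iff.mp h1
      change c = k at h2
      subst h2
      have := Has.scale (Q.ofInt (ipow x n)) (has_some (hs.lead c))
      rw [Q.val_ofInt] at this
      have hx : ((ipow x n : ℤ) : ℂ) = (x : ℂ) ^ n := by rw [ipow_eq]; push_cast; rfl
      rw [hx] at this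
      rw [H.lead, cond_true, mul_comm]
      exact this
    | false =>
      rw [cond_false, seqZ_eq]
      cases hq : (Q.ofInt (M.quad k)).isZero with
      | true =>
        have := Has.scale (Q.ofInt (-1)) (has_diffSum (ih k) M (W.bound n k M) (W.bound n k M))
        rw [cond_true, seqN_eq]
        convert this using 1
        rw [Q.val_ofInt]
        push_cast
        linear_combination sum_shift H k M
      | false =>
        have h0 := Q.val_ne_zero hq
        have := Has.scale (Q.ofInt (M.quad k)).inv (has_resid hs ih k M)
        rw [cond_false]
        convert this using 1
        rw [← quad_mul_sym H.symm H.sym_F H.sym_G, Q.val_inv hq]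
        rw [Q.val_ofInt] at h0 ⊢
        field_simp

theorem has_relation (H : SymmetryData χ W n F G a) (hs : s.Models χ F a) (code : ℕ) :
    Has χ (relation W n s code) 0 := by
  simp only [relation, seqN_eq, Pt.seq_eq]
  set k := Nat.mod code 2
  set M := Pt.decode (Nat.div code 4)
  cases Nat.beq M.length 0 with
  | true => exact has_none _
  | false =>
    rw [cond_false]
    cases Nat.beq (Nat.mod (Nat.div code 2) 2) 0 with
    | true =>
      rw [cond_true]
      cases hc : ((Q.ofInt (M.quad k)).isZero || Nat.beq (W.bound n k M) 0) with
      | false => exact has_none _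
      | true =>
        rw [cond_true]
        convert has_resid hs (has_symbol H hs 30) k M using 1
        rw [← quad_mul_sym H.symm H.sym_F H.sym_G]
        rw [Bool.or_eq_true] at hc
        rcases hc with hc | hc
        · have := Q.val_eq_zero hc
          rw [Q.val_ofInt] at this
          rw [this, zero_mul]
        · rw [sym_eq_zero_of_bound W H.r_pos (H.mem k) (Nat.eq_of_beq_eq_true hc), mul_zero]
    | false =>
      rw [cond_false]
      have := Has.addProd (p := Poly.const 1) (ev_const χ 1) (has_symbol H hs 30 k M)
        (has_diffSum (has_symbol H hs 30 k) M (W.bound n k M) (W.bound n k M))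
      convert this using 1
      rw [← sum_shift H k M]
      push_cast
      ring

theorem has_combine (H : SymmetryData χ W n F G a) (hs : s.Models χ F a) (L : List (ℕ × ℕ × ℕ)) :
    Has χ (combine W n s L) 0 := by
  induction L with
  | nil => exact has_some rfl
  | cons e L ih =>
    have := Has.forceO (Has.addProd (p := [(1, (⟨(Q.ofInt (Pt.unzigzag e.1)).pos,
      (Q.ofInt (Pt.unzigzag e.1)).neg, e.2.1⟩ : Q))]) rfl (has_relation H hs e.2.2) ih)
    rw [mul_zero, zero_add] at this
    exact this

/-- The right-hand sides given by lists of words with coefficients. -/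
noncomputable def combo (χ : ℕ →* ℂ) (L : List (Word × Poly)) : NPoly :=
  (L.map fun e => ev χ e.2 • word (e.1.map toLetter)).sum

namespace Cert

theorem ev_eqv (h4 : χ 4 = -3) {p q : Poly} (h : eqv p q = true) : ev χ p = ev χ q := by
  have := ev_isEmpty (χ := χ) h
  rw [ev_red h4, ev_add, ev_neg] at this
  linear_combination this

theorem beqN_eq {l m : List ℕ} (h : beqN l m = true) : l = m := by
  induction l generalizing m with
  | nil =>
    cases m with
    | nil => rfl
    | cons b m => cases h
  | cons a l ih =>
    cases m with
    | nil => cases h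
    | cons b m =>
      have : beqN (a :: l) (b :: m) = (Nat.beq a b && beqN l m) := rfl
      rw [this, Bool.and_eq_true] at h
      rw [Nat.eq_of_beq_eq_true h.1, ih h.2]

theorem combo_same (h4 : χ 4 = -3) {L K : List (Word × Poly)} (h : same L K = true) :
    combo χ L = combo χ K := by
  induction L generalizing K with
  | nil =>
    cases K with
    | nil => rfl
    | cons b K => cases h
  | cons a L ih =>
    cases K with
    | nil => cases h
    | cons b K =>
      have : same (a :: L) (b :: K) = (beqN a.1 b.1 && eqv a.2 b.2 && same L K) := rfl
      rw [this, Bool.and_eq_true, Bool.and_eq_true] at h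
      have ih := ih h.2
      simp only [combo, List.map_cons, List.sum_cons] at ih ⊢
      rw [ih, beqN_eq h.1.1, ev_eqv h4 h.1.2]

/-- A certificate that is accepted by `check` proves that the system is one of the `targets`. -/
theorem check_sound (H : SymmetryData χ W n F G a) (targets : List Sys) (C : Cert) :
    ∀ (s : Know) (p : Poly), s.Models χ F a → ev χ p = 0 → check W n targets C s p = true →
      ∃ T ∈ targets, F 0 = combo χ T.1 ∧ F 1 = combo χ T.2 := by
  induction C with
  | leaf i =>
    intro s p hs _ h
    change (match targets[i]? with
      | none => false
      | some T => same s.F.1.terms T.1 && same s.F.2.terms T.2) = true at h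
    split at h
    · cases h
    · rename_i T hT
      rw [Bool.and_eq_true] at h
      refine ⟨T, List.mem_of_getElem? hT, ?_, ?_⟩
      · rw [← combo_same H.four h.1]
        exact (hs.value 0).symm.trans (Trie.value_terms _).symm
      · rw [← combo_same H.four h.2]
        exact (hs.value 1).symm.trans (Trie.value_terms _).symm
  | contra =>
    intro s p _ hp h
    change isConst p = true at h
    unfold isConst at h
    split at h
    · rename_i m c
      rw [Bool.and_eq_true, Bool.not_eq_true'] at h
      have h1 := Nat.eq_of_beq_eq_true h.1
      subst h1
      refine absurd hp ?_
      simpa using Q.val_ne_zero h.2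
    · cases h
  | eval L t ih =>
    intro s p hs _ h
    change (match combine W n s L with
      | none => false
      | some p => (Poly.red p).seq fun p => check W n targets t s p) = true at h
    split at h
    · cases h
    · rename_i q hq
      obtain ⟨r, hr, hk⟩ := seq_eq χ (Poly.red q)
      rw [hk] at h
      exact ih s r hs (by rw [hr, ev_red H.four, has_combine H hs L q hq]) h
  | solve m t ih =>
    intro s p hs hp h
    change (match Poly.solve m p with
      | none => false
      | some q => (Poly.red q).seq fun q =>
          s.F.1.subst m q fun f => s.F.2.subst m q fun g =>
          Poly.substRed m q s.a.1 fun a => Poly.substRed m q s.a.2 fun b =>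
            check W n targets t ⟨(f, g), (a, b)⟩ []) = true at h
    split at h
    · cases h
    · rename_i q hq
      obtain ⟨r, hr, hk⟩ := seq_eq χ (Poly.red q)
      have hm : χ m = ev χ r := by rw [hr, ev_red H.four, ev_solve (χ := χ) hq hp]
      obtain ⟨f, hf1, hf2, hf3⟩ := Trie.subst_eq H.four hm s.F.1
      obtain ⟨g, hg1, hg2, hg3⟩ := Trie.subst_eq H.four hm s.F.2
      obtain ⟨b, hb1, hb2⟩ := substRed_eq H.four hm s.a.1
      obtain ⟨c, hc1, hc2⟩ := substRed_eq H.four hm s.a.2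
      rw [hk, hf3, hg3, hb2, hc2] at h
      refine ih ⟨(f, g), (b, c)⟩ [] ⟨fun k M => ?_, fun k => ?_, fun k => ?_⟩ rfl h
      · rw [← hs.symbolAt k M]
        cases k with
        | zero => exact hf1 M M
        | succ k => exact hg1 M M
      · rw [← hs.value k]
        cases k with
        | zero => exact hf2
        | succ k => exact hg2
      · rw [← hs.lead k]
        cases k with
        | zero => exact hb1
        | succ k => exact hc1
  | mul q t ih =>
    intro s p hs hp h
    change ((Poly.red (Poly.mul q p)).seq fun p => check W n targets t s p) = true at h
    obtain ⟨r, hr, hk⟩ := seq_eq χ (Poly.red (Poly.mul q p))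
    rw [hk] at h
    exact ih s r hs (by rw [hr, ev_red H.four, ev_mul, hp, mul_zero]) h
  | split p q t₁ t₂ ih₁ ih₂ =>
    intro s r hs hr h
    change (eqv (Poly.mul p q) r && (check W n targets t₁ s p && check W n targets t₂ s q)) =
      true at h
    rw [Bool.and_eq_true, Bool.and_eq_true] at h
    have := ev_eqv H.four h.1
    rw [hr, ev_mul, mul_eq_zero] at this
    rcases this with h0 | h0
    · exact ih₁ s p hs h0 h.2.1
    · exact ih₂ s q hs h0 h.2.2
  | root c p t ih =>
    intro s r hs hr h
    change (!c.isZero && (eqv (Poly.mul [(1, c)] (Poly.mul p p)) r && check W n targets t s p)) =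
      true at h
    rw [Bool.and_eq_true, Bool.and_eq_true, Bool.not_eq_true'] at h
    have := ev_eqv H.four h.2.1
    rw [hr, ev_mul, ev_mul] at this
    have hc := Q.val_ne_zero h.1
    refine ih s p hs ?_ h.2.2
    simpa [hc] using this

end Cert


open NonAbelian.Poly

/-! ### Homogeneous polynomials -/

def code (p : Letter) : ℕ := 2 * p.2 + p.1.val

@[simp] theorem toLetter_code (p : Letter) : toLetter (code p) = p := by
  obtain ⟨c, n⟩ := p
  fin_cases c
  · simp [toLetter, code, par]
  · simp [toLetter, code, par, Nat.add_mod, Nat.add_div]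

@[simp] theorem code_toLetter (l : ℕ) : code (toLetter l) = l := by
  rcases Nat.mod_two_eq_zero_or_one l with h | h <;>
    simp [toLetter, code, par, h] <;> omega

theorem map_toLetter_code (w : List Letter) : (w.map code).map toLetter = w := by
  simp [Function.comp_def]

theorem map_code_toLetter (w : Word) : (w.map toLetter).map code = w := by
  simp [Function.comp_def]

theorem map_toLetter_injective : Function.Injective (List.map toLetter) :=
  Function.LeftInverse.injective (g := List.map code) map_code_toLetter

/-- The exponent with which the scaling group acts on a word. -/
def degree (ν : Fin 2 → ℝ) (w : List Letter) : ℝ := (w.map fun p => ν p.1 + p.2).sum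

theorem nScale_word (ν : Fin 2 → ℝ) {τ : ℝ} (hτ : 0 < τ) (w : List Letter) :
    nScale ν τ (word w) = ((τ ^ degree ν w : ℝ) : ℂ) • word w := by
  induction w with
  | nil => simp [degree]
  | cons p w ih =>
    rw [word_cons, map_mul, ih]
    simp only [nScale, FreeAlgebra.lift_ι_apply, degree, List.map_cons, List.sum_cons]
    rw [Real.rpow_add hτ (ν p.1 + p.2), Complex.ofReal_mul, smul_mul_smul_comm]

theorem cScale_abelianize (ν : Fin 2 → ℝ) (τ : ℝ) (a : NPoly) :
    cScale ν τ (abelianize a) = abelianize (nScale ν τ a) := by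
  rw [← AlgHom.comp_apply, ← AlgHom.comp_apply]
  refine DFunLike.congr_fun ?_ a
  refine FreeAlgebra.hom_ext (funext fun p => ?_)
  simp only [Function.comp_apply, AlgHom.comp_apply, cScale, abelianize, nScale,
    FreeAlgebra.lift_ι_apply, MvPolynomial.aeval_X, map_smul]

theorem repr_word (w : List Letter) : wordBasis.repr (word w) = Finsupp.single w 1 := by
  rw [← wordBasis_apply, Module.Basis.repr_self]

theorem degree_eq_of_repr {ν : Fin 2 → ℝ} {a : NPoly} {d : ℝ}
    (h : ∀ τ : ℝ, 0 < τ → nScale ν τ a = ((τ ^ d : ℝ) : ℂ) • a) {w : List Letter}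
    (hw : wordBasis.repr a w ≠ 0) : degree ν w = d := by
  have key : ∀ τ : ℝ, 0 < τ → ∀ a, wordBasis.repr (nScale ν τ a) w =
      ((τ ^ degree ν w : ℝ) : ℂ) * wordBasis.repr a w := by
    intro τ hτ a
    suffices h : (Finsupp.lapply w ∘ₗ wordBasis.repr.toLinearMap) ∘ₗ (nScale ν τ).toLinearMap =
        ((τ ^ degree ν w : ℝ) : ℂ) • (Finsupp.lapply w ∘ₗ wordBasis.repr.toLinearMap) from
      DFunLike.congr_fun h a
    refine word_ext fun x => ?_
    simp only [LinearMap.comp_apply, AlgHom.toLinearMap_apply, nScale_word ν hτ, map_smul,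
      LinearMap.smul_apply]
    by_cases hx : x = w
    · rw [hx]
    · simp [repr_word, hx]
  have h2 := key 2 two_pos a
  rw [h 2 two_pos, map_smul, Finsupp.smul_apply, smul_eq_mul] at h2
  have h3 := mul_right_cancel₀ hw h2
  have h4 : (2 : ℝ) ^ d = 2 ^ degree ν w := by exact_mod_cast h3
  have := congrArg (Real.logb 2) h4
  simpa using this.symm

theorem sum_repr (a : NPoly) : a = (wordBasis.repr a).sum fun w c => c • word w := by
  conv_lhs => rw [← wordBasis.linearCombination_repr a]
  simp [Finsupp.linearCombination_apply]

namespace Weights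

/-- The weights as real numbers, shifted by `e`. -/
noncomputable def real (W : Weights) (e : ℝ) : Fin 2 → ℝ :=
  ![W.p / W.r + e, W.q / W.r - e]

theorem degree_real (W : Weights) (hr : 0 < W.r) (e : ℝ) (w : List Letter) :
    degree (W.real e) w = W.ofWord w / W.r +
      e * (2 * w.countP (fun p => p.1 = 0) - w.length) := by
  have hr' : (W.r : ℝ) ≠ 0 := by exact_mod_cast hr.ne'
  induction w with
  | nil => simp [degree, ofWord]
  | cons p w ih =>
    simp only [degree, ofWord, List.map_cons, List.sum_cons, List.countP_cons,
      List.length_cons] at ih ⊢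
    rw [ih]
    obtain ⟨c, m⟩ := p
    fin_cases c
    · simp [real, letter]; field_simp; ring
    · simp [real, letter]; field_simp; ring

theorem admits_iff (W : Weights) (hr : 0 < W.r) (n : ℕ) (k : Fin 2) (w : List Letter) :
    W.Admits n k w ↔ ∀ e : ℝ, (W.bal = false → e = 0) →
      degree (W.real e) w = n + W.real e k := by
  have hr' : (W.r : ℝ) ≠ 0 := by exact_mod_cast hr.ne'
  have ht : ((W.total n k : ℕ) : ℝ) / W.r = n + W.real 0 k := by
    have : W.total n k = W.r * n + W.letter k := rfl
    rw [this]
    fin_cases k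
    · simp [real, letter]; field_simp
    · simp [real, letter]; field_simp
  have he : ∀ e, W.real e k = W.real 0 k + e * (if (k : ℕ) = 0 then 1 else -1) := fun e => by
    fin_cases k <;> simp [real] ; ring
  constructor
  · rintro ⟨h1, h2⟩ e hb
    rw [degree_real W hr, h1, ht, he e, add_assoc]
    congr 1
    congr 1
    cases hbal : W.bal with
    | false => simp [hb hbal]
    | true =>
      have := h2 hbal
      congr 1
      split_ifs at this ⊢
      · have h : ((2 * w.countP (fun p => p.1 = 0) : ℕ) : ℝ) = (w.length + 1 : ℕ) := by rw [this]
        push_cast at h; linarith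
      · have h : ((2 * w.countP (fun p => p.1 = 0) + 1 : ℕ) : ℝ) = (w.length : ℕ) := by rw [this]
        push_cast at h; linarith
  · intro h
    have h0 := h 0 fun _ => rfl
    rw [degree_real W hr, zero_mul, add_zero, ← ht] at h0
    refine ⟨by exact_mod_cast (div_left_inj' hr').mp h0, fun hb => ?_⟩
    have h1 := h 1 fun h => by rw [hb] at h; cases h
    rw [degree_real W hr, h0, ht, he 1, one_mul, one_mul] at h1
    have h2 : (2 * w.countP (fun p => p.1 = 0) - w.length : ℝ) = if (k : ℕ) = 0 then 1 else -1 := by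
      linarith
    split_ifs at h2 ⊢
    · have : ((2 * w.countP (fun p => p.1 = 0) : ℕ) : ℝ) = (w.length + 1 : ℕ) := by
        push_cast; linarith
      exact_mod_cast this
    · have : ((2 * w.countP (fun p => p.1 = 0) + 1 : ℕ) : ℝ) = (w.length : ℕ) := by
        push_cast; linarith
      exact_mod_cast this

theorem admits_of_repr (W : Weights) (hr : 0 < W.r) {n : ℕ} {F : NSystem}
    (h : ∀ e : ℝ, (W.bal = false → e = 0) → F.IsHomogeneous n (W.real e)) (k : Fin 2)
    {w : List Letter} (hw : wordBasis.repr (F k) w ≠ 0) : W.Admits n k w :=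
  (W.admits_iff hr n k w).2 fun e he => degree_eq_of_repr (fun τ hτ => h e he τ hτ k) hw

theorem mem_space (W : Weights) (hr : 0 < W.r) {n : ℕ} {F : NSystem}
    (h : ∀ e : ℝ, (W.bal = false → e = 0) → F.IsHomogeneous n (W.real e)) (k : Fin 2) :
    F k ∈ W.space n k := by
  rw [sum_repr (F k)]
  refine Submodule.sum_mem _ fun w hw => Submodule.smul_mem _ _ (Submodule.subset_span ?_)
  exact ⟨w, W.admits_of_repr hr h k (Finsupp.mem_support_iff.mp hw), rfl⟩

/-! ### Enumeration of words -/

def ofCode (W : Weights) (l : ℕ) : ℕ := W.letter (l % 2) + W.r * (l / 2)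

/-- The words of weight `t`. -/
def words (W : Weights) (fuel : ℕ) : ℕ → List Word :=
  Nat.rec (motive := fun _ => ℕ → List Word) (fun t => bif Nat.beq t 0 then [[]] else [])
    (fun _ ih t => bif Nat.beq t 0 then [[]] else
      ((List.range (2 * (t + 1))).filter fun l => Nat.ble (W.ofCode l) t).flatMap fun l =>
        (ih (t - W.ofCode l)).map fun w => l :: w) fuel

theorem mem_words (W : Weights) (hp : 0 < W.p) (hq : 0 < W.q) (hr : 0 < W.r) (fuel t : ℕ) (w : Word)
    (hw : (w.map W.ofCode).sum = t) (ht : t ≤ fuel) : w ∈ W.words fuel t := by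
  have hpos : ∀ l, 0 < W.ofCode l := fun l => by
    have : 0 < W.letter (l % 2) := by
      rcases Nat.mod_two_eq_zero_or_one l with h | h <;> rw [h] <;> assumption
    exact Nat.lt_of_lt_of_le this (Nat.le_add_right _ _)
  induction fuel generalizing t w with
  | zero =>
    obtain rfl : t = 0 := by omega
    cases w with
    | nil => simp [words]
    | cons l w => have := hpos l; simp at hw; omega
  | succ fuel ih =>
    have hs : W.words (fuel + 1) t = bif Nat.beq t 0 then [[]] else
      ((List.range (2 * (t + 1))).filter fun l => Nat.ble (W.ofCode l) t).flatMap fun l =>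
        (W.words fuel (t - W.ofCode l)).map fun w => l :: w := rfl
    rw [hs]
    cases w with
    | nil => simp at hw; subst hw; simp
    | cons l w =>
      have h1 := hpos l
      simp only [List.map_cons, List.sum_cons] at hw
      have h0 : Nat.beq t 0 = false := by cases t <;> [omega; rfl]
      rw [h0, cond_false, List.mem_flatMap]
      refine ⟨l, ?_, ?_⟩
      · rw [List.mem_filter, List.mem_range]
        have : 1 * (l / 2) ≤ W.r * (l / 2) := Nat.mul_le_mul_right _ hr
        simp only [ofCode] at hw h1 ⊢
        exact ⟨by omega, Nat.ble_eq.mpr (by omega)⟩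
      · exact List.mem_map.mpr ⟨w, ih _ w (by omega) (by omega), rfl⟩

theorem ofWord_code (W : Weights) (w : List Letter) :
    W.ofWord w = ((w.map code).map W.ofCode).sum := by
  rw [ofWord, List.map_map]
  congr 2
  funext p
  obtain ⟨c, m⟩ := p
  fin_cases c
  · simp [ofCode, code, letter]
  · simp [ofCode, code, letter, Nat.add_mod, Nat.add_div]

/-- The condition of `Admits` on the number of letters `u`. -/
def isBalanced (W : Weights) (k : ℕ) (w : Word) : Bool :=
  !W.bal || bif Nat.beq k 0 then
    Nat.beq (2 * w.countP fun l => Nat.beq (l % 2) 0) (w.length + 1) else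
    Nat.beq (2 * (w.countP fun l => Nat.beq (l % 2) 0) + 1) w.length

theorem countP_code (w : List Letter) :
    ((w.map code).countP fun l => Nat.beq (l % 2) 0) = w.countP (fun p => p.1 = 0) := by
  rw [List.countP_map]
  congr 1
  funext p
  obtain ⟨c, m⟩ := p
  fin_cases c
  · simp [code]
  · simp [code, Nat.add_mod]

/-- The words that may occur in the equation `k` of a symmetry of order `n`. -/
def admitted (W : Weights) (n k : ℕ) : List Word :=
  (W.words (W.total n k) (W.total n k)).filter (W.isBalanced k)

theorem Admits.mem {W : Weights} (hp : 0 < W.p) (hq : 0 < W.q) (hr : 0 < W.r) {n k : ℕ}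
    {w : List Letter} (h : W.Admits n k w) : w.map code ∈ W.admitted n k := by
  refine List.mem_filter.mpr
    ⟨W.mem_words hp hq hr _ _ _ (by rw [← ofWord_code, h.1]) le_rfl, ?_⟩
  simp only [isBalanced]
  cases hb : W.bal with
  | false => rfl
  | true =>
    have := h.2 hb
    rw [countP_code, List.length_map]
    cases k with
    | zero => simpa using this
    | succ k => simpa using this

theorem admits_of_check {W : Weights} {n k : ℕ} {w : Word}
    (h : (Nat.beq (w.map W.ofCode).sum (W.total n k) && W.isBalanced k w) = true) :
    W.Admits n k (w.map toLetter) := by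
  rw [Bool.and_eq_true] at h
  refine ⟨?_, fun hb => ?_⟩
  · rw [ofWord_code, map_code_toLetter]; exact Nat.eq_of_beq_eq_true h.1
  · have h2 := h.2
    rw [← countP_code, map_code_toLetter, List.length_map]
    simp only [isBalanced, hb] at h2
    cases k with
    | zero => simpa using h2
    | succ k => simpa using h2

end Weights


open NonAbelian.Poly

/-! ### Multiplicative maps with given values -/

theorem exists_monoidHom (L : List (ℕ × ℂ)) (hp : ∀ e ∈ L, e.1.Prime)
    (hn : (L.map Prod.fst).Nodup) : ∃ χ : ℕ →* ℂ, ∀ e ∈ L, χ e.1 = e.2 := by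
  let f : ℕ → ℂ := fun p => ((L.find? fun e => e.1 == p).map Prod.snd).getD 0
  refine ⟨⟨⟨fun n => if n = 0 then 0 else n.factorization.prod fun p k => f p ^ k, by simp⟩,
    fun m n => ?_⟩, fun e he => ?_⟩
  · by_cases hm : m = 0
    · simp [hm]
    by_cases hn : n = 0
    · simp [hn]
    simp only [hm, hn, mul_eq_zero, or_self, if_false, Nat.factorization_mul hm hn]
    exact Finsupp.prod_add_index' (fun _ => pow_zero _) fun _ _ _ => pow_add _ _ _
  · have hpe := hp e he
    have h : L.find? (fun x => x.1 == e.1) = some e := by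
      clear hp hpe f
      induction L with
      | nil => cases he
      | cons a L ih =>
        rw [List.map_cons, List.nodup_cons] at hn
        rcases List.mem_cons.mp he with rfl | he
        · simp
        · have : a.1 ≠ e.1 := fun h => hn.1 (h ▸ List.mem_map_of_mem he)
          rw [List.find?_cons_of_neg (by simpa using this)]
          exact ih hn.2 he
    change (if e.1 = 0 then (0 : ℂ) else e.1.factorization.prod fun p k => f p ^ k) = e.2
    rw [if_neg hpe.ne_zero, hpe.factorization]
    refine (Finsupp.prod_single_index (h := fun p k => f p ^ k) (pow_zero _)).trans ?_
    rw [pow_one]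
    simp [f, h]

/-! ### The scalar reduction -/

variable {χ : ℕ →* ℂ}

theorem abelianize_word (w : List Letter) : abelianize (word w) =
    MvPolynomial.monomial (Multiset.toFinsupp (w : Multiset Letter)) 1 := by
  induction w with
  | nil => simp
  | cons p w ih =>
    have : abelianize (FreeAlgebra.ι ℂ p) = MvPolynomial.X p := by simp [abelianize]
    rw [word_cons, map_mul, ih, this, ← Multiset.cons_coe, ← Multiset.singleton_add, map_add,
      Multiset.toFinsupp_singleton, MvPolynomial.X, MvPolynomial.monomial_mul, one_mul]

/-- The coefficient in the scalar reduction of the monomial with the letters of `w`. -/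
noncomputable def coeffAt (w : Word) (f : CPoly) : ℂ :=
  f.coeff (Multiset.toFinsupp ((w.map toLetter : List Letter) : Multiset Letter))

theorem coeffAt_add (w : Word) (f g : CPoly) : coeffAt w (f + g) = coeffAt w f + coeffAt w g :=
  MvPolynomial.coeff_add _ _ _

theorem coeffAt_smul (w : Word) (c : ℂ) (f : CPoly) : coeffAt w (c • f) = c * coeffAt w f :=
  MvPolynomial.coeff_smul _ _ _

/-- `w` is a permutation of `x`. -/
def similar (w x : Word) : Bool := w.isPerm x

theorem coeffAt_word (w x : Word) :
    coeffAt w (abelianize (word (x.map toLetter))) = if similar w x then 1 else 0 := by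
  rw [abelianize_word, coeffAt, MvPolynomial.coeff_monomial]
  have : (Multiset.toFinsupp ((x.map toLetter : List Letter) : Multiset Letter) =
      Multiset.toFinsupp ((w.map toLetter : List Letter) : Multiset Letter)) ↔
      similar w x = true := by
    rw [Multiset.toFinsupp.injective.eq_iff, Multiset.coe_eq_coe, similar, List.isPerm_iff]
    constructor
    · intro h
      have := h.map code
      rw [map_code_toLetter, map_code_toLetter] at this
      exact this.symm
    · exact fun h => (h.map _).symm
  simp only [this]

/-- The sum of the coefficients in `L` of the words with the letters of `w`. -/
def classSum (L : List (Word × Poly)) (w : Word) : Poly :=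
  L.foldr (fun e p => bif similar w e.1 then Poly.add e.2 p else p) []

theorem coeffAt_combo (w : Word) (L : List (Word × Poly)) :
    coeffAt w (abelianize (combo χ L)) = ev χ (classSum L w) := by
  induction L with
  | nil => simp [combo, classSum, coeffAt]
  | cons e L ih =>
    have h1 : classSum (e :: L) w =
      bif similar w e.1 then Poly.add e.2 (classSum L w) else classSum L w := rfl
    have h2 : combo χ (e :: L) = ev χ e.2 • word (e.1.map toLetter) + combo χ L := by simp [combo]
    rw [h1, h2, map_add, map_smul, coeffAt_add, coeffAt_smul, coeffAt_word, ih]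
    cases similar w e.1 <;> simp

/-! ### The initial data -/

/-- A polynomial in the space spanned by the words of `L`. -/
theorem eq_sum_repr {a : NPoly} {L : List Word} (hL : L.Nodup)
    (h : ∀ w, wordBasis.repr a w ≠ 0 → w.map code ∈ L) :
    a = (L.map fun w => wordBasis.repr a (w.map toLetter) • word (w.map toLetter)).sum := by
  conv_lhs => rw [sum_repr a]
  rw [Finsupp.sum]
  have hs : (wordBasis.repr a).support ⊆ (L.toFinset.image (List.map toLetter)) := fun w hw => by
    rw [Finset.mem_image]
    exact ⟨w.map code, List.mem_toFinset.mpr (h w (Finsupp.mem_support_iff.mp hw)),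
      map_toLetter_code w⟩
  rw [Finset.sum_subset hs fun w _ hw => by
      rw [Finsupp.notMem_support_iff.mp hw, zero_smul],
    Finset.sum_image fun x _ y _ hxy => map_toLetter_injective hxy, List.sum_toFinset _ hL]

/-- The words of `L` with the indeterminates `ps` as coefficients. -/
def generic (ps : List ℕ) (L : List (Word × Poly)) : List (Word × Poly) :=
  List.zipWith (fun p e => (e.1, [(p, Q.one)])) ps L

/-- The coefficients in `L` are the indeterminates `ps`, except that some of them are eliminated
with the help of the scalar reduction `f`. -/
def isReduced (ps : List ℕ) (L f : List (Word × Poly)) : Bool :=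
  (List.zip ps L).all fun e => Cert.eqv e.2.2 [(e.1, Q.one)] ||
    Cert.eqv (Poly.add e.2.2 (classSum (generic ps L) e.2.1))
      (Poly.add [(e.1, Q.one)] (classSum f e.2.1))

theorem combo_generic {ps : List ℕ} {L : List (Word × Poly)} (hl : L.length ≤ ps.length) {a : NPoly}
    (hL : (L.map Prod.fst).Nodup) (h : ∀ w, wordBasis.repr a w ≠ 0 → w.map code ∈ L.map Prod.fst)
    (hχ : ∀ e ∈ List.zip ps L, χ e.1 = wordBasis.repr a (e.2.1.map toLetter)) :
    combo χ (generic ps L) = a := by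
  conv_rhs => rw [eq_sum_repr hL h]
  clear h hL
  rw [combo, generic]
  congr 1
  induction ps generalizing L with
  | nil =>
    cases L with
    | nil => rfl
    | cons e L => simp at hl
  | cons p ps ih =>
    cases L with
    | nil => rfl
    | cons e L =>
      rw [List.zipWith_cons_cons, List.map_cons, List.map_cons, List.map_cons,
        ih (by simpa using hl) fun x hx => hχ x (by rw [List.zip_cons_cons]; exact .tail _ hx)]
      congr 2
      rw [← hχ (p, e) (by rw [List.zip_cons_cons]; exact .head _)]
      simp [Q.one, Q.val]

theorem combo_reduced (h4 : χ 4 = -3) {ps : List ℕ} {L f : List (Word × Poly)}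
    (hl : L.length ≤ ps.length) {a : NPoly}
    (hL : (L.map Prod.fst).Nodup) (h : ∀ w, wordBasis.repr a w ≠ 0 → w.map code ∈ L.map Prod.fst)
    (hχ : ∀ e ∈ List.zip ps L, χ e.1 = wordBasis.repr a (e.2.1.map toLetter))
    (hf : abelianize a = abelianize (combo χ f)) (hr : isReduced ps L f = true) :
    combo χ L = a := by
  have hg := combo_generic hl hL h hχ
  have hc : ∀ e ∈ List.zip ps L, ev χ e.2.2 = χ e.1 := by
    intro e he
    have h1 : ev χ [(e.1, Q.one)] = χ e.1 := by simp [Q.one, Q.val]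
    have := List.all_eq_true.mp hr e he
    rw [Bool.or_eq_true] at this
    rcases this with h2 | h2
    · rw [Cert.ev_eqv h4 h2, h1]
    · have h3 := Cert.ev_eqv h4 h2
      rw [ev_add, ev_add, h1, ← coeffAt_combo, ← coeffAt_combo, hg, hf] at h3
      exact add_right_cancel h3
  rw [← hg, combo, combo, generic]
  congr 1
  clear hχ h hL hr hg
  induction ps generalizing L with
  | nil =>
    cases L with
    | nil => rfl
    | cons e L => simp at hl
  | cons p ps ih =>
    cases L with
    | nil => rfl
    | cons e L =>
      rw [List.zipWith_cons_cons, List.map_cons, List.map_cons,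
        ih (by simpa using hl) fun x hx => hc x (by rw [List.zip_cons_cons]; exact .tail _ hx)]
      congr 2
      rw [hc (p, e) (by rw [List.zip_cons_cons]; exact .head _)]
      simp [Q.one, Q.val]

def primes : List ℕ :=
  [11, 13, 17, 19, 23, 29, 31, 37, 41, 43, 47, 53, 59, 61, 67, 71, 73, 79, 83, 89, 97, 101, 103,
    107, 109, 113, 127, 131, 137, 139, 149, 151, 157, 163, 167, 173, 179, 181, 191, 193, 197, 199,
    211, 223, 227, 229, 233, 239, 241, 251, 257, 263, 269, 271, 277, 281, 283, 293, 307, 311, 313,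
    317, 331, 337, 347, 349, 353, 359, 367, 373, 379, 383, 389, 397, 401, 409, 419, 421, 431, 433,
    439, 443, 449, 457, 461, 463, 467, 479, 487, 491, 499, 503, 509, 521, 523, 541, 547, 557, 563,
    569, 571, 577, 587, 593, 599, 601, 607, 613, 617, 619]

theorem prime_of_mem : ∀ p ∈ [2, 3, 5, 7, 997, 991] ++ primes, p.Prime := by
  intro p hp
  have h : ∀ p ∈ [2, 3, 5, 7, 997, 991] ++ primes, Nat.blt 1 p && (List.range 32).all (fun d =>
      Nat.ble p (d + 2) || !Nat.beq (p % (d + 2)) 0) := by decide +kernel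
  have hb : ∀ p ∈ [2, 3, 5, 7, 997, 991] ++ primes, p < 1024 := by decide +kernel
  have h1 := h p hp
  have h2 := hb p hp
  rw [Bool.and_eq_true, List.all_eq_true] at h1
  rw [Nat.prime_def_le_sqrt]
  refine ⟨Nat.ble_eq.mp h1.1, fun m hm hs hd => ?_⟩
  have h3 : m * m ≤ p := Nat.le_sqrt.mp hs
  have h4 : m < 32 := by nlinarith
  have h5 := h1.2 (m - 2) (List.mem_range.mpr (by omega))
  rw [show m - 2 + 2 = m by omega, Nat.mod_eq_zero_of_dvd hd] at h5
  have h6 : Nat.ble p m = true := by simpa using h5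
  have := Nat.ble_eq.mp h6
  have := Nat.mul_le_mul_right m hm
  omega

theorem map_fst_zip_sublist {α β : Type*} (l : List α) (r : List β) :
    ((List.zip l r).map Prod.fst).Sublist l := by
  induction l generalizing r with
  | nil => simp
  | cons a l ih =>
    cases r with
    | nil => simp
    | cons b r => simpa using ih r

theorem nodup_primes : ([2, 3, 5, 7, 997, 991] ++ primes).Nodup := by decide +kernel

/-- The data of a classification problem: the weights, the scalar system and the general
non-Abelian system without `u_xx`, `-v_xx`. -/
structure Data : Type where
  W : Weights
  f : List (Word × Poly) × List (Word × Poly)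
  F : List (Word × Poly) × List (Word × Poly)

namespace Data

def full₀ (d : Data) : List (Word × Poly) := ([4], Poly.const 1) :: d.F.1

def full₁ (d : Data) : List (Word × Poly) := ([5], Poly.const (-1)) :: d.F.2

/-- The indeterminates; `2`, `3`, `5`, `7` stand for the square root of `-3`, the parameter `β` and
the coefficients of the derivatives of highest order in the symmetry. -/
def isValid (d : Data) : Bool :=
  Nat.blt 0 d.W.p && Nat.blt 0 d.W.q && Nat.blt 0 d.W.r &&
  Nat.ble (d.F.1.length + d.F.2.length) primes.length &&
  ((d.W.admitted 2 0).all fun w => (d.full₀.map Prod.fst).contains w) &&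
  ((d.W.admitted 2 1).all fun w => (d.full₁.map Prod.fst).contains w) &&
  decide (d.full₀.map Prod.fst).Nodup && decide (d.full₁.map Prod.fst).Nodup &&
  isReduced (997 :: primes) d.full₀ d.f.1 &&
  isReduced (991 :: primes.drop d.F.1.length) d.full₁ d.f.2

/-- The data describe the scalar system `f` with the parameter `β`. -/
def Describes (d : Data) (β : ℂ) (f : CSystem) : Prop :=
  ∀ χ : ℕ →* ℂ, χ 3 = β → f 0 = abelianize (combo χ d.f.1) ∧ f 1 = abelianize (combo χ d.f.2)

theorem exists_monoidHom (d : Data) (hd : d.isValid = true) {β : ℂ} {f : CSystem}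
    (hf : d.Describes β f) {F : NSystem} (hF : F.ab = f)
    (hh : ∀ e : ℝ, (d.W.bal = false → e = 0) → F.IsHomogeneous 2 (d.W.real e)) (A B : ℂ) :
    ∃ χ : ℕ →* ℂ, χ 2 = iSqrt3 ∧ χ 3 = β ∧ χ 5 = A ∧ χ 7 = B ∧
      F 0 = combo χ d.full₀ ∧ F 1 = combo χ d.full₁ := by
  simp only [isValid, Bool.and_eq_true] at hd
  obtain ⟨⟨⟨⟨⟨⟨⟨⟨⟨hp, hq⟩, hr⟩, hlen⟩, h0⟩, h1⟩, hn0⟩, hn1⟩, hr0⟩, hr1⟩ := hd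
  have hp : 0 < d.W.p := Nat.ble_eq.mp hp
  have hq : 0 < d.W.q := Nat.ble_eq.mp hq
  have hr : 0 < d.W.r := Nat.ble_eq.mp hr
  have hlen : d.F.1.length + d.F.2.length ≤ primes.length := Nat.ble_eq.mp hlen
  let c : Fin 2 → Word × Poly → ℂ := fun k e => wordBasis.repr (F k) (e.1.map toLetter)
  let cs : List ℂ := d.F.1.map (c 0) ++ d.F.2.map (c 1)
  obtain ⟨χ, hχ⟩ := NonAbelian.exists_monoidHom (List.zip ([2, 3, 5, 7, 997, 991] ++ primes)
    ([iSqrt3, β, A, B, c 0 ([4], []), c 1 ([5], [])] ++ cs))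
    (fun e he => prime_of_mem _ (List.of_mem_zip he).1)
    (by
      exact nodup_primes.sublist (map_fst_zip_sublist _ _))
  have hz : List.zip ([2, 3, 5, 7, 997, 991] ++ primes)
      ([iSqrt3, β, A, B, c 0 ([4], []), c 1 ([5], [])] ++ cs) =
      [(2, iSqrt3), (3, β), (5, A), (7, B), (997, c 0 ([4], [])), (991, c 1 ([5], []))] ++
        List.zip primes cs := rfl
  rw [hz] at hχ
  have hχ' : ∀ e ∈ List.zip primes cs, χ e.1 = e.2 := fun e he =>
    hχ e (List.mem_append_right _ he)
  have hcs : List.zip primes cs = (List.zip (primes.take d.F.1.length) (d.F.1.map (c 0))) ++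
      List.zip (primes.drop d.F.1.length) (d.F.2.map (c 1)) := by
    conv_lhs => rw [← List.take_append_drop d.F.1.length primes]
    exact List.zip_append (by simp; omega)
  have h2 : χ 2 = iSqrt3 := hχ (2, iSqrt3) (by simp)
  have hs : iSqrt3 ^ 2 = -3 := by
    rw [iSqrt3, mul_pow, Complex.I_sq, ← Complex.ofReal_pow, Real.sq_sqrt (by norm_num)]
    norm_num
  have h4 : χ 4 = -3 := by
    rw [show 4 = 2 ^ 2 by norm_num, map_pow, h2, hs]
  have h3 : χ 3 = β := hχ (3, β) (by simp)
  refine ⟨χ, h2, h3, hχ (5, A) (by simp), hχ (7, B) (by simp), ?_, ?_⟩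
  · refine (combo_reduced h4 (ps := 997 :: primes) (f := d.f.1) ?_ (of_decide_eq_true hn0) ?_ ?_ ?_
      hr0).symm
    · simp [full₀]; omega
    · intro w hw
      have := (d.W.admits_of_repr hr hh 0 hw).mem hp hq hr
      simpa using List.all_eq_true.mp h0 _ this
    · intro e he
      rw [full₀, List.zip_cons_cons] at he
      rcases List.mem_cons.mp he with rfl | he
      · exact hχ (997, c 0 ([4], [])) (by simp)
      · refine hχ' (e.1, c 0 e.2) ?_
        rw [hcs]
        refine List.mem_append_left _ ?_
        rw [List.zip_map_right]
        refine List.mem_map.mpr ⟨e, ?_, rfl⟩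
        have h := List.zip_append (l₁ := primes.take d.F.1.length) (l₂ := d.F.1)
          (r₁ := primes.drop d.F.1.length) (r₂ := []) (by simp; omega)
        rw [List.take_append_drop, List.append_nil, List.zip_nil_right, List.append_nil] at h
        rwa [← h]
    · rw [← (hf χ h3).1, ← hF]; rfl
  · refine (combo_reduced h4 (ps := 991 :: primes.drop d.F.1.length) (f := d.f.2) ?_
      (of_decide_eq_true hn1) ?_ ?_ ?_ hr1).symm
    · simp [full₁]; omega
    · intro w hw
      have := (d.W.admits_of_repr hr hh 1 hw).mem hp hq hr
      simpa using List.all_eq_true.mp h1 _ this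
    · intro e he
      rw [full₁, List.zip_cons_cons] at he
      rcases List.mem_cons.mp he with rfl | he
      · exact hχ (991, c 1 ([5], [])) (by simp)
      · refine hχ' (e.1, c 1 e.2) ?_
        rw [hcs]
        refine List.mem_append_right _ ?_
        rw [List.zip_map_right]
        exact List.mem_map.mpr ⟨e, he, rfl⟩
    · rw [← (hf χ h3).2, ← hF]; rfl

end Data


open NonAbelian.Poly

/-! ### Linearity in the symmetry -/

theorem flow_smul (c : ℂ) (G : NSystem) (a : NPoly) : (c • G).flow a = c • G.flow a := by
  rw [← LinearMap.smul_apply]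
  refine DFunLike.congr_fun (word_ext fun w => ?_) a
  rw [LinearMap.smul_apply]
  induction w with
  | nil => simp [flow_one]
  | cons p w ih =>
    simp only [word_cons, flow_mul, flow_ι, ih, Pi.smul_apply, map_smul, smul_add,
      smul_mul_assoc, mul_smul_comm]

theorem NSystem.IsSymmetry.smul {F G : NSystem} (h : F.IsSymmetry G) (c : ℂ) :
    F.IsSymmetry (c • G) := fun a => by
  rw [flow_smul, flow_smul, map_smul, h a]

theorem NSystem.IsHomogeneous.smul {G : NSystem} {μ : ℝ} {ν : Fin 2 → ℝ}
    (h : G.IsHomogeneous μ ν) (c : ℂ) : (c • G).IsHomogeneous μ ν := fun τ hτ k => by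
  rw [Pi.smul_apply, map_smul, h τ hτ k, smul_comm]

/-! ### The order of a symmetry -/

namespace Weights

theorem sym_nil_eq_zero (W : Weights) {n k : ℕ} (h : 0 < W.total n k) {a : NPoly}
    (ha : a ∈ W.space n k) : sym [] a = 0 := by
  induction ha using Submodule.span_induction with
  | zero => simp
  | add a b _ _ ha hb => rw [map_add, ha, hb, add_zero]
  | smul c a _ ha => rw [map_smul, ha, smul_zero]
  | mem a ha =>
    obtain ⟨w, hw, rfl⟩ := ha
    cases w with
    | nil => have := hw.1; simp [ofWord] at this; omega
    | cons p w => rw [sym_word]; rfl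

theorem sym_single_eq (W : Weights) (hr : 0 < W.r) {n k : ℕ} {a : NPoly} (ha : a ∈ W.space n k)
    (x : ℤ) : sym [(k, x)] a = sym [(k, 1)] a * (x : ℂ) ^ n := by
  induction ha using Submodule.span_induction with
  | zero => simp
  | add a b _ _ ha hb => rw [map_add, ha, hb, map_add, add_mul]
  | smul c a _ ha => rw [map_smul, ha, map_smul, smul_eq_mul, smul_eq_mul, mul_assoc]
  | mem a ha =>
    obtain ⟨w, hw, rfl⟩ := ha
    rw [sym_word, sym_word]
    match w, hw with
    | [], _ => simp [wordValue]
    | [p], hw =>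
      have h := hw.1
      simp only [wordValue]
      split_ifs with hk
      · have h2 : W.letter p.1 + W.r * p.2 = W.r * n + W.letter k := by
          simpa [ofWord, total] using h
        rw [par_val _ _ hk W] at h2
        have h3 : W.r * p.2 = W.r * n := by omega
        rw [Nat.eq_of_mul_eq_mul_left hr h3]
        simp
      · simp
    | p :: q :: w, _ => simp [wordValue]

/-- The point at which the symbol is the coefficient of `w`. -/
def point (w : Word) : Pt := w.map fun l => (l % 2, if l / 2 = 0 then 0 else 1)

theorem wordValue_point_zero {w : Word} (h : w.countP (fun l => Nat.ble 2 l) = 0)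
    (x : List Letter) : wordValue (point w) x = if x = w.map toLetter then 1 else 0 := by
  induction w generalizing x with
  | nil => cases x <;> simp [point, wordValue]
  | cons l w ih =>
    rw [List.countP_cons] at h
    have hl : l / 2 = 0 := by
      by_contra hl
      have : Nat.ble 2 l = true := Nat.ble_eq.mpr (by omega)
      rw [this] at h
      simp at h
    cases x with
    | nil => simp [point, wordValue]
    | cons p x =>
      have ih := ih (by omega) x
      simp only [point, List.map_cons, wordValue, hl, if_true] at ih ⊢
      rw [ih]
      obtain ⟨c, m⟩ := p
      by_cases hc : c = par (l % 2)
      · by_cases hm : m = 0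
        · simp [hc, hm, toLetter, hl]
        · simp [hc, hm, toLetter, hl]
      · simp [hc, toLetter]

theorem wordValue_point (W : Weights) (hr : 0 < W.r) {w : Word}
    (h : w.countP (fun l => Nat.ble 2 l) = 1) (x : List Letter)
    (hx : W.ofWord x = W.ofWord (w.map toLetter)) :
    wordValue (point w) x = if x = w.map toLetter then 1 else 0 := by
  induction w generalizing x with
  | nil => simp at h
  | cons l w ih =>
    rw [List.countP_cons] at h
    cases x with
    | nil => simp [point, wordValue]
    | cons p x =>
      have hs : wordValue (point (l :: w)) (p :: x) = if p.1 = par (l % 2) then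
        (((if l / 2 = 0 then 0 else 1 : ℤ) : ℂ)) ^ p.2 * wordValue (point w) x else 0 := by
        simp [point, wordValue]
      rw [hs]
      simp only [ofWord, List.map_cons, List.sum_cons] at hx
      obtain ⟨c, m⟩ := p
      by_cases hc : c = par (l % 2)
      · rw [if_pos hc]
        subst hc
        by_cases hl : l / 2 = 0
        · have hb : Nat.ble 2 l = false := by
            rw [Bool.eq_false_iff]; intro hb; have := Nat.ble_eq.mp hb; omega
          rw [hb] at h
          by_cases hm : m = 0
          · subst hm
            rw [if_pos hl, ih (by simpa using h) x (by
              simp only [toLetter, hl] at hx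
              simp only [ofWord]; omega)]
            simp [toLetter, hl]
          · simp [hl, hm, toLetter]
        · have hb : Nat.ble 2 l = true := Nat.ble_eq.mpr (by omega)
          rw [hb] at h
          rw [if_neg hl, wordValue_point_zero (by simpa using h)]
          by_cases hw : x = w.map toLetter
          · subst hw
            simp only [toLetter] at hx
            have h3 : W.r * m = W.r * (l / 2) := by omega
            simp [toLetter, Nat.eq_of_mul_eq_mul_left hr h3]
          · simp [hw]
      · rw [if_neg hc, if_neg]
        simp [toLetter, hc]

theorem repr_eq_sym (W : Weights) (hr : 0 < W.r) {n k : ℕ} {a : NPoly} (ha : a ∈ W.space n k)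
    {w : Word} (h : w.countP (fun l => Nat.ble 2 l) = 1)
    (hw : W.ofWord (w.map toLetter) = W.total n k) :
    wordBasis.repr a (w.map toLetter) = sym (point w) a := by
  induction ha using Submodule.span_induction with
  | zero => simp
  | add a b _ _ ha hb => rw [map_add, map_add, Finsupp.add_apply, ha, hb]
  | smul c a _ ha => rw [map_smul, map_smul, Finsupp.smul_apply, ha]
  | mem a ha =>
    obtain ⟨x, hx, rfl⟩ := ha
    rw [sym_word, repr_word, W.wordValue_point hr h x (hx.1.trans hw.symm), Finsupp.single_apply]

/-- The words of the weight of the equation `k` in a symmetry of order `n` that contain a derivative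
of order at least `n`. -/
def leading (W : Weights) (n k : ℕ) : List Word :=
  ((List.range (2 * (W.total n k + 1))).filter fun l =>
      Nat.ble n (l / 2) && Nat.ble (W.ofCode l) (W.total n k)).flatMap fun l =>
    (List.range (W.total n k - W.ofCode l + 1)).flatMap fun j =>
      (W.words j j).flatMap fun x => (W.words (W.total n k - W.ofCode l - j)
        (W.total n k - W.ofCode l - j)).map fun y => x ++ l :: y

theorem mem_leading (W : Weights) (hp : 0 < W.p) (hq : 0 < W.q) (hr : 0 < W.r) {n k : ℕ} {w : Word}
    (hw : (w.map W.ofCode).sum = W.total n k) {l : ℕ} (hl : l ∈ w) (hn : n ≤ l / 2) :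
    w ∈ W.leading n k := by
  obtain ⟨x, y, rfl⟩ := List.append_of_mem hl
  simp only [List.map_append, List.map_cons, List.sum_append, List.sum_cons] at hw
  refine List.mem_flatMap.mpr ⟨l, ?_, ?_⟩
  · rw [List.mem_filter, List.mem_range, Bool.and_eq_true]
    have h1 : 1 * (l / 2) ≤ W.r * (l / 2) := Nat.mul_le_mul_right _ hr
    have h2 : W.ofCode l = W.letter (l % 2) + W.r * (l / 2) := rfl
    exact ⟨by omega, Nat.ble_eq.mpr hn, Nat.ble_eq.mpr (by omega)⟩
  · refine List.mem_flatMap.mpr ⟨(x.map W.ofCode).sum, List.mem_range.mpr (by omega), ?_⟩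
    refine List.mem_flatMap.mpr ⟨x, W.mem_words hp hq hr _ _ _ rfl le_rfl, ?_⟩
    exact List.mem_map.mpr ⟨y, W.mem_words hp hq hr _ _ _ (by omega) le_rfl, rfl⟩

end Weights

theorem mem_adjoin_of_repr {a : NPoly} {n : ℕ}
    (h : ∀ w, wordBasis.repr a w ≠ 0 → ∀ p ∈ w, p.2 < n) :
    a ∈ Algebra.adjoin ℂ {a | ∃ p : Fin 2 × ℕ, p.2 < n ∧ a = FreeAlgebra.ι ℂ p} := by
  rw [sum_repr a]
  refine Subalgebra.sum_mem _ fun w hw => Subalgebra.smul_mem _ (Subalgebra.list_prod_mem _ ?_) _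
  intro x hx
  obtain ⟨p, hp, rfl⟩ := List.mem_map.mp hx
  exact Algebra.subset_adjoin ⟨p, h w (Finsupp.mem_support_iff.mp hw) p hp, rfl⟩

/-! ### Classification -/

namespace Data

noncomputable def know (d : Data) (p q : Poly) : Know :=
  ⟨(Trie.ofList d.F.1, Trie.ofList d.F.2), (p, q)⟩

/-- The linear combination `L` of relations is the polynomial `q` in the coefficients `5`, `7` of
the derivatives of order `n`. -/
noncomputable def leadCheck (d : Data) (n : ℕ) (L : List (ℕ × ℕ × ℕ)) (q : Poly) : Bool :=
  match combine d.W n (d.know [(5, Q.one)] [(7, Q.one)]) L with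
  | none => false
  | some p => Cert.eqv p q

/-- The coefficients of the words with derivatives of order at least `n` in a symmetry vanish if
those of `u_n` and `v_n` vanish. -/
noncomputable def orderCheck (d : Data) (n : ℕ) : Bool :=
  [0, 1].all fun k => ((d.W.leading n k).filter (d.W.isBalanced k)).all fun w =>
    Nat.beq (w.countP (fun l => Nat.ble 2 l)) 1 &&
      match symbol d.W n (d.know [] []) 30 k (Weights.point w) with
      | none => false
      | some p => Cert.eqv p []

structure Symmetric (d : Data) (β : ℂ) (f : CSystem) (n : ℕ) (F G : NSystem) : Prop where
  valid : d.isValid = true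
  describes : d.Describes β f
  ab : F.ab = f
  hom : ∀ e : ℝ, (d.W.bal = false → e = 0) → F.IsHomogeneous 2 (d.W.real e)
  symm : F.IsSymmetry G
  homG : ∀ e : ℝ, (d.W.bal = false → e = 0) → G.IsHomogeneous n (d.W.real e)

variable {d : Data} {β : ℂ} {f : CSystem} {n : ℕ} {F G : NSystem}

theorem Symmetric.smul (h : d.Symmetric β f n F G) (c : ℂ) : d.Symmetric β f n F (c • G) :=
  { h with symm := h.symm.smul c, homG := fun e he => (h.homG e he).smul c }

/-- The coefficients of `u_n` in the first and of `v_n` in the second component. -/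
noncomputable def lead (G : NSystem) (k : Fin 2) : ℂ := sym [(k, 1)] (G k)

theorem lead_smul (c : ℂ) (G : NSystem) (k : Fin 2) : lead (c • G) k = c * lead G k := by
  simp [lead]

theorem pos_of_isValid (hd : d.isValid = true) : 0 < d.W.p ∧ 0 < d.W.q ∧ 0 < d.W.r := by
  simp only [isValid, Bool.and_eq_true] at hd
  obtain ⟨⟨⟨⟨⟨⟨⟨⟨⟨hp, hq⟩, hr⟩, -⟩, -⟩, -⟩, -⟩, -⟩, -⟩, -⟩ := hd
  exact ⟨Nat.ble_eq.mp hp, Nat.ble_eq.mp hq, Nat.ble_eq.mp hr⟩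

theorem total_pos (hd : d.isValid = true) (n k : ℕ) : 0 < d.W.total n k := by
  obtain ⟨hp, hq, -⟩ := pos_of_isValid hd
  refine Nat.lt_of_lt_of_le ?_ (Nat.le_add_left _ _)
  cases k <;> simp [Weights.letter, hp, hq]

theorem space_par (W : Weights) (n k : ℕ) : W.space n (par k) = W.space n k := by
  cases k with
  | zero => rfl
  | succ k =>
    have : ∀ w, W.Admits n (k + 1) w ↔ W.Admits n (par (k + 1) : Fin 2) w := by
      intro w
      simp [Weights.Admits, par, Weights.total, Weights.letter]
    simp only [Weights.space, this]

theorem Symmetric.exists_data (h : d.Symmetric β f n F G) :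
    ∃ (χ : ℕ →* ℂ) (F' : NSystem), χ 2 = iSqrt3 ∧ χ 3 = β ∧ χ 5 = lead G 0 ∧ χ 7 = lead G 1 ∧
      F = heat + F' ∧ SymmetryData χ d.W n F' G (lead G) ∧
      ∀ p q, ev χ p = lead G 0 → ev χ q = lead G 1 → (d.know p q).Models χ F' (lead G) := by
  obtain ⟨hp, hq, hr⟩ := pos_of_isValid h.valid
  obtain ⟨χ, h2, h3, h5, h7, hF0, hF1⟩ := d.exists_monoidHom h.valid h.describes h.ab h.hom
    (lead G 0) (lead G 1)
  have hs : iSqrt3 ^ 2 = -3 := by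
    rw [iSqrt3, mul_pow, Complex.I_sq, ← Complex.ofReal_pow, Real.sq_sqrt (by norm_num)]
    norm_num
  have h4 : χ 4 = -3 := by
    rw [show 4 = 2 ^ 2 by norm_num, map_pow, h2, hs]
  have e0 : F 0 = heat 0 + combo χ d.F.1 := by
    rw [hF0]; simp [combo, full₀, heat, u, toLetter, par]
  have e1 : F 1 = heat 1 + combo χ d.F.2 := by
    rw [hF1]; simp [combo, full₁, heat, v, toLetter, par]
  let F' : NSystem := ![combo χ d.F.1, combo χ d.F.2]
  have hF' : F = heat + F' := by
    funext k
    fin_cases k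
    · exact e0
    · exact e1
  have hval : ∀ (p q : Poly) k, ((d.know p q).sys k).value χ = F' (par k) := fun p q k => by
    cases k with
    | zero => exact Trie.value_ofList _
    | succ k => exact Trie.value_ofList _
  refine ⟨χ, F', h2, h3, h5, h7, hF', ⟨h4, hr, hF' ▸ h.symm, fun k => ?_, fun k => ?_, fun k => ?_,
    fun k x => ?_⟩, fun p q hp' hq' => ⟨fun k M => ?_, hval p q, fun k => ?_⟩⟩
  · have h1 := d.W.sym_nil_eq_zero (total_pos h.valid 2 k) (d.W.mem_space hr h.hom k)
    rw [hF', Pi.add_apply, map_add] at h1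
    have h0 : sym [] (heat k) = 0 := by
      have := sym_nil_mul (k, 2) 1
      rw [heat_apply, map_smul, ← mul_one (FreeAlgebra.ι ℂ (k, 2)), this, smul_zero]
    rwa [h0, zero_add] at h1
  · exact d.W.sym_nil_eq_zero (total_pos h.valid n k) (d.W.mem_space hr h.homG k)
  · rw [← space_par]; exact d.W.mem_space hr h.homG _
  · have := d.W.mem_space hr h.homG (par k)
    rw [space_par] at this
    rw [d.W.sym_single_eq hr this, lead]
    have hpar : par (par k : Fin 2) = par k := by cases k <;> rfl
    have : wordValue [(k, 1)] = wordValue [((par k : Fin 2), 1)] := by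
      funext w
      rcases w with _ | ⟨p, _ | ⟨p', w⟩⟩ <;> simp [wordValue, hpar]
    rw [sym, this, sym]
  · rw [← hval p q k]
    cases k with
    | zero => exact Trie.symbolAt_ofList _ _
    | succ k => exact Trie.symbolAt_ofList _ _
  · cases k with
    | zero => exact hp'
    | succ k => exact hq'

theorem Symmetric.lead_relation (h : d.Symmetric β f n F G) {L : List (ℕ × ℕ × ℕ)} {q : Poly}
    (hL : d.leadCheck n L q = true) :
    ∃ χ : ℕ →* ℂ, χ 5 = lead G 0 ∧ χ 7 = lead G 1 ∧ ev χ q = 0 := by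
  obtain ⟨χ, F', -, -, h5, h7, -, H, hm⟩ := h.exists_data
  refine ⟨χ, h5, h7, ?_⟩
  unfold leadCheck at hL
  split at hL
  · cases hL
  · rename_i p hp
    rw [← Cert.ev_eqv H.four hL]
    exact has_combine H (hm _ _ (by simp [Q.one, Q.val, h5]) (by simp [Q.one, Q.val, h7])) L p hp

theorem Symmetric.lead_ne_zero (h : d.Symmetric β f n F G) (hn : G.HasOrder n)
    (hc : d.orderCheck n = true) (h0 : lead G 0 = 0) (h1 : lead G 1 = 0) : False := by
  obtain ⟨χ, F', -, -, -, -, -, H, hm⟩ := h.exists_data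
  obtain ⟨hp, hq, hr⟩ := pos_of_isValid h.valid
  refine hn.2 fun k => mem_adjoin_of_repr fun w hw p hpw => ?_
  by_contra hlt
  have hadm := d.W.admits_of_repr hr h.homG k hw
  have hmem := hadm.mem hp hq hr
  have hwt : ((w.map code).map d.W.ofCode).sum = d.W.total n k := by
    rw [← Weights.ofWord_code, hadm.1]
  have hlead := d.W.mem_leading hp hq hr hwt (List.mem_map_of_mem hpw) (by
    have : code p / 2 = p.2 := by simp only [code]; have := p.1.isLt; omega
    omega)
  have hk : (k : ℕ) ∈ [0, 1] := by fin_cases k <;> simp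
  have := List.all_eq_true.mp (List.all_eq_true.mp hc k hk) _
    (List.mem_filter.mpr ⟨hlead, (List.mem_filter.mp hmem).2⟩)
  rw [Bool.and_eq_true] at this
  have hpk : par (k : ℕ) = k := by fin_cases k <;> rfl
  have h3 := d.W.repr_eq_sym hr (d.W.mem_space hr h.homG k) (Nat.eq_of_beq_eq_true this.1)
    (by rw [map_toLetter_code, hadm.1])
  rw [map_toLetter_code] at h3
  refine hw (h3.trans ?_)
  have h4 := this.2
  split at h4
  · cases h4
  · rename_i q hq
    have := has_symbol H (hm [] [] h0.symm h1.symm) 30 k _ q hq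
    rw [hpk] at this
    rw [← this, Cert.ev_eqv H.four h4]; rfl

theorem Symmetric.classify (h : d.Symmetric β f n F G) {targets : List Cert.Sys} {C : Cert}
    {p q : Poly}
    (hpq : ∀ χ : ℕ →* ℂ, χ 5 = lead G 0 → χ 7 = lead G 1 → ev χ p = lead G 0 ∧ ev χ q = lead G 1)
    (hc : Cert.check d.W n targets C (d.know p q) [] = true) :
    ∃ T ∈ targets, ∃ χ : ℕ →* ℂ, χ 2 = iSqrt3 ∧ χ 3 = β ∧
      F 0 = u 2 + combo χ T.1 ∧ F 1 = -v 2 + combo χ T.2 := by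
  obtain ⟨χ, F', h2, h3, h5, h7, hF, H, hm⟩ := h.exists_data
  obtain ⟨hp, hq⟩ := hpq χ h5 h7
  obtain ⟨T, hT, e0, e1⟩ := Cert.check_sound H targets C _ [] (hm p q hp hq) rfl hc
  refine ⟨T, hT, χ, h2, h3, ?_, ?_⟩
  · rw [hF, ← e0]; simp [heat]
  · rw [hF, ← e1]; simp [heat]

end Data


/-! ### Differential polynomials with explicit coefficients -/

/-- Polynomials in the generators of an algebra, with coefficients in `ℤ[√-3]`: `node l a b` stands
for the sum of `b` and the product of the generator with the number `l` and `a`, `one x y` for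
`x + y √-3`. -/
inductive NP : Type
  | nil : NP
  | one (x y : ℤ) : NP
  | node (l : ℕ) (a b : NP) : NP

noncomputable section

namespace NP

def force {α : Type} (p : NP) : (NP → α) → α :=
  NP.rec (motive := fun _ => (NP → α) → α) (fun k => k nil)
    (fun x y k => seqZ x fun x => seqZ y fun y => k (one x y))
    (fun l _ _ iha ihb k => seqN l fun l => iha fun a => ihb fun b => k (node l a b)) p

def addOne (x y : ℤ) (p : NP) : NP :=
  NP.rec (motive := fun _ => NP) (one x y) (fun x' y' => one (Int.add x x') (Int.add y y'))
    (fun l a _ _ ih => node l a ih) p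

def add (p : NP) : NP → NP :=
  NP.rec (motive := fun _ => NP → NP) (fun q => q) addOne
    (fun l a b iha ihb q => NP.rec (motive := fun _ => NP) (node l a b)
      (fun x y => node l a (ihb (one x y)))
      (fun m c d _ ihd => bif Nat.blt l m then node l a (ihb (node m c d)) else
        bif Nat.blt m l then node m c ihd else node l (iha c) (ihb d)) q) p

def smul (x y : ℤ) (p : NP) : NP :=
  NP.rec (motive := fun _ => NP) nil
    (fun x' y' => one (Int.sub (Int.mul x x') (Int.mul 3 (Int.mul y y')))
      (Int.add (Int.mul x y') (Int.mul y x')))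
    (fun l _ _ iha ihb => node l iha ihb) p

/-- Product with the generator `l`; the factors of a product are sorted if `c` holds. -/
def push (c : Bool) (l : ℕ) (p : NP) : NP :=
  bif c then NP.rec (motive := fun _ => NP) nil (fun x y => node l (one x y) nil)
    (fun m a b iha ihb => bif Nat.blt m l then node m iha ihb else node l (node m a b) nil) p
  else node l p nil

def mul (c : Bool) (p q : NP) : NP :=
  NP.rec (motive := fun _ => NP) nil (fun x y => smul x y q)
    (fun l _ _ iha ihb => bif c then add (push c l iha) ihb else node l iha ihb) p

/-- The derivation with the values `h` on the generators. -/
def der (c : Bool) (h : ℕ → NP) (p : NP) : NP :=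
  NP.rec (motive := fun _ => NP) nil (fun _ _ => nil)
    (fun l a _ iha ihb => add (mul c (h l) a) (add (push c l iha) ihb)) p

def isZero (p : NP) : Bool :=
  NP.rec (motive := fun _ => Bool) true
    (fun x y => Int.beq' x 0 && Int.beq' y 0) (fun _ _ _ iha ihb => iha && ihb) p

/-- All generators of `p` have numbers less than `N`. -/
def isBelow (N : ℕ) (p : NP) : Bool :=
  NP.rec (motive := fun _ => Bool) true (fun _ _ => true)
    (fun l _ _ iha ihb => Nat.blt l N && (iha && ihb)) p

/-- The polynomials `p`, `q` and their derivatives up to the order `n`, passed to `k`. -/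
def table {α : Type} (c : Bool) (n : ℕ) : NP → NP → (List NP → α) → α :=
  Nat.rec (motive := fun _ => NP → NP → (List NP → α) → α) (fun _ _ k => k [])
    (fun _ ih p q k => p.force fun p => q.force fun q =>
      ih (der c (fun l => bif Nat.blt l 2 then nil else node (l + 2) (one 1 0) nil) p)
        (der c (fun l => bif Nat.blt l 2 then nil else node (l + 2) (one 1 0) nil) q)
        fun T => k (p :: q :: T)) n

def lookup (T : List NP) (l : ℕ) : NP :=
  List.rec (motive := fun _ => ℕ → NP) (fun _ => nil)
    (fun p _ ih l => Nat.rec (motive := fun _ => NP) p (fun l _ => ih l) l) T l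

/-- The difference of the derivatives of `p` along `S` and of `q` along `T`. -/
def bracket (c : Bool) (S T : List NP) (p q : NP) : NP :=
  add (der c (lookup (nil :: nil :: S)) p) (smul (-1) 0 (der c (lookup (nil :: nil :: T)) q))

/-- The commutator of the systems `F` and `G` of orders at most `m` and `n`, passed to `k`. -/
def brackets {α : Type} (c : Bool) (m n : ℕ) (F G : NP × NP) (k : NP → NP → α) : α :=
  table c (n + 1) F.1 F.2 fun S => table c (m + 1) G.1 G.2 fun T =>
    k (bracket c S T G.1 F.1) (bracket c S T G.2 F.2)

def bounded (m n : ℕ) (F G : NP × NP) : Bool :=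
  (isBelow (2 * m + 4) F.1 && isBelow (2 * m + 4) F.2) &&
    (isBelow (2 * n + 4) G.1 && isBelow (2 * n + 4) G.2)

variable {A : Type*} [Ring A] [Algebra ℂ A] (φ : ℕ → A)

def eval : NP → A
  | nil => 0
  | one x y => algebraMap ℂ A (x + y * iSqrt3)
  | node l a b => φ l * eval a + eval b

theorem eval_one (x y : ℤ) : eval φ (one x y) = algebraMap ℂ A (x + y * iSqrt3) := rfl

theorem eval_node (l : ℕ) (a b : NP) : eval φ (node l a b) = φ l * eval φ a + eval φ b := rfl

theorem force_eq {α : Type} (p : NP) (k : NP → α) : p.force k = k p := by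
  induction p generalizing k with
  | nil => rfl
  | one x y =>
    have : (one x y).force k = seqZ x fun x => seqZ y fun y => k (one x y) := rfl
    rw [this, seqZ_eq, seqZ_eq]
  | node l a b iha ihb =>
    have : (node l a b).force k = seqN l fun l => a.force fun a => b.force fun b =>
      k (node l a b) := rfl
    rw [this, seqN_eq, iha, ihb]

theorem eval_addOne (x y : ℤ) (p : NP) : eval φ (addOne x y p) = eval φ (one x y) + eval φ p := by
  induction p with
  | nil => simp [addOne, eval]
  | one x' y' =>
    have : addOne x y (one x' y') = one (x + x') (y + y') := rfl
    rw [this, eval_one, eval_one, eval_one, ← map_add]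
    congr 1
    push_cast
    ring
  | node l a b _ ih =>
    have : addOne x y (node l a b) = node l a (addOne x y b) := rfl
    rw [this, eval_node, ih, eval_node]
    abel

theorem eval_add (p q : NP) : eval φ (add p q) = eval φ p + eval φ q := by
  induction p generalizing q with
  | nil => simp [add, eval]
  | one x y => exact eval_addOne φ x y q
  | node l a b iha ihb =>
    induction q with
    | nil => simp [add, eval]
    | one x y =>
      have : add (node l a b) (one x y) = node l a (add b (one x y)) := rfl
      rw [this, eval_node, ihb, eval_node]
      abel
    | node m c d _ ihd =>
      have : add (node l a b) (node m c d) = bif Nat.blt l m then node l a (add b (node m c d)) else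
        bif Nat.blt m l then node m c (add (node l a b) d) else
          node l (add a c) (add b d) := rfl
      rw [this]
      cases h1 : Nat.blt l m with
      | true =>
        rw [cond_true, eval_node, ihb, eval_node, eval_node]
        abel
      | false =>
        cases h2 : Nat.blt m l with
        | true =>
          rw [cond_false, cond_true, eval_node, ihd, eval_node, eval_node]
          abel
        | false =>
          have h : l = m := by
            have e1 : ¬ l < m := fun hl => by
              rw [show Nat.blt l m = true from Nat.ble_eq.mpr hl] at h1; cases h1
            have e2 : ¬ m < l := fun hl => by
              rw [show Nat.blt m l = true from Nat.ble_eq.mpr hl] at h2; cases h2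
            omega
          rw [cond_false, cond_false, eval_node, iha, ihb, eval_node, eval_node, h, mul_add]
          abel

theorem _root_.NonAbelian.iSqrt3_sq : iSqrt3 ^ 2 = -3 := by
  rw [iSqrt3, mul_pow, Complex.I_sq, ← Complex.ofReal_pow, Real.sq_sqrt (by norm_num)]
  norm_num

theorem eval_smul (x y : ℤ) (p : NP) :
    eval φ (smul x y p) = (x + y * iSqrt3 : ℂ) • eval φ p := by
  induction p with
  | nil => simp [smul, eval]
  | one x' y' =>
    have : smul x y (one x' y') = one (x * x' - 3 * (y * y')) (x * y' + y * x') := rfl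
    rw [this, eval_one, eval_one, Algebra.smul_def, ← map_mul]
    congr 1
    push_cast
    linear_combination (-(y * y' : ℂ)) * iSqrt3_sq
  | node l a b iha ihb =>
    have : smul x y (node l a b) = node l (smul x y a) (smul x y b) := rfl
    rw [this, eval_node, iha, ihb, eval_node, smul_add, mul_smul_comm]

variable {c : Bool} (hc : c = true → ∀ a b : A, a * b = b * a)
include hc

theorem eval_push (l : ℕ) (p : NP) : eval φ (push c l p) = φ l * eval φ p := by
  cases c with
  | false => rw [push, cond_false, eval_node, eval, add_zero]
  | true =>
    induction p with
    | nil => simp [push, eval]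
    | one x y =>
      have : push true l (one x y) = node l (one x y) nil := rfl
      rw [this, eval_node, eval, eval, add_zero]
    | node m a b iha ihb =>
      have : push true l (node m a b) = bif Nat.blt m l then node m (push true l a) (push true l b)
        else node l (node m a b) nil := rfl
      rw [this]
      cases Nat.blt m l with
      | true =>
        rw [cond_true, eval_node, eval_node, iha, ihb, mul_add, ← mul_assoc, ← mul_assoc,
          hc rfl (φ m)]
      | false => rw [cond_false, eval_node φ l, eval, add_zero]

theorem eval_mul (p q : NP) : eval φ (mul c p q) = eval φ p * eval φ q := by
  induction p with
  | nil => simp [mul, eval]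
  | one x y =>
    have : mul c (one x y) q = smul x y q := rfl
    rw [this, eval_smul, eval_one, Algebra.smul_def]
  | node l a b iha ihb =>
    have : mul c (node l a b) q = bif c then add (push c l (mul c a q)) (mul c b q) else
      node l (mul c a q) (mul c b q) := rfl
    rw [this]
    have h : eval φ (node l (mul c a q) (mul c b q)) = eval φ (node l a b) * eval φ q := by
      rw [eval_node, iha, ihb, eval_node, add_mul, mul_assoc]
    cases hcc : c with
    | false => rw [cond_false, ← hcc]; exact h
    | true => rw [cond_true, ← hcc, eval_add, eval_push φ hc, ← h, eval_node]

omit hc in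
theorem isBelow_mono {N : ℕ} {p : NP} : isBelow N p = true → ∀ M, N ≤ M → isBelow M p = true := by
  induction p with
  | nil => intros; rfl
  | one => intros; rfl
  | node l a b iha ihb =>
    intro h M hM
    have : ∀ K, isBelow K (node l a b) = (Nat.blt l K && (isBelow K a && isBelow K b)) := fun _ => rfl
    rw [this, Bool.and_eq_true, Bool.and_eq_true] at h ⊢
    refine ⟨Nat.ble_eq.mpr ((Nat.ble_eq.mp h.1).trans hM), iha h.2.1 M hM, ihb h.2.2 M hM⟩

theorem eval_der {δ : A →ₗ[ℂ] A} (hδ : ∀ a b, δ (a * b) = δ a * b + a * δ b) (h : ℕ → NP)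
    {N : ℕ} {p : NP} (hp : isBelow N p = true) (hh : ∀ l < N, eval φ (h l) = δ (φ l)) :
    eval φ (der c h p) = δ (eval φ p) := by
  induction p with
  | nil => simp [der, eval]
  | one x y =>
    have h1 : δ 1 = 0 := by simpa using hδ 1 1
    rw [eval_one, Algebra.algebraMap_eq_smul_one, map_smul, h1, smul_zero]
    rfl
  | node l a b iha ihb =>
    have h1 : isBelow N (node l a b) = (Nat.blt l N && (isBelow N a && isBelow N b)) := rfl
    rw [h1, Bool.and_eq_true, Bool.and_eq_true] at hp
    have : der c h (node l a b) = add (mul c (h l) a) (add (push c l (der c h a)) (der c h b)) := rfl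
    rw [this, eval_add, eval_add, eval_mul φ hc, eval_push φ hc, iha hp.2.1, ihb hp.2.2, eval_node,
      map_add, hδ, hh l (Nat.ble_eq.mp hp.1)]
    abel

omit hc in
theorem exists_below (p : NP) : ∃ N, isBelow N p = true := by
  induction p with
  | nil => exact ⟨0, rfl⟩
  | one => exact ⟨0, rfl⟩
  | node l a b iha ihb =>
    obtain ⟨N, hN⟩ := iha
    obtain ⟨M, hM⟩ := ihb
    refine ⟨max (l + 1) (max N M), ?_⟩
    have : ∀ K, isBelow K (node l a b) = (Nat.blt l K && (isBelow K a && isBelow K b)) := fun _ => rfl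
    rw [this, Bool.and_eq_true, Bool.and_eq_true]
    exact ⟨Nat.ble_eq.mpr (by simp), isBelow_mono hN _ (by simp), isBelow_mono hM _ (by simp)⟩

omit hc in
theorem eval_isZero {p : NP} (h : isZero p = true) : eval φ p = 0 := by
  induction p with
  | nil => rfl
  | one x y =>
    have : isZero (one x y) = (Int.beq' x 0 && Int.beq' y 0) := rfl
    rw [this, Bool.and_eq_true, Int.beq'_eq, Int.beq'_eq] at h
    obtain ⟨hx, hy⟩ := h
    subst hx hy
    simp [eval]
  | node l a b iha ihb =>
    have : isZero (node l a b) = (isZero a && isZero b) := rfl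
    rw [this, Bool.and_eq_true] at h
    rw [eval, iha h.1, ihb h.2, mul_zero, add_zero]

variable {φ} {d : A →ₗ[ℂ] A} (hd : ∀ a b, d (a * b) = d a * b + a * d b)
  (h0 : ∀ l < 2, d (φ l) = 0) (h2 : ∀ l, d (φ (l + 2)) = φ (l + 4))
include hd h0 h2

theorem table_eq (n : ℕ) (p q : NP) : ∃ T : List NP,
    (∀ i < n, eval φ (lookup T (2 * i)) = (d ^ i) (eval φ p) ∧
      eval φ (lookup T (2 * i + 1)) = (d ^ i) (eval φ q)) ∧
    ∀ (α : Type) (k : List NP → α), table c n p q k = k T := by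
  induction n generalizing p q with
  | zero => exact ⟨[], by simp, fun _ _ => rfl⟩
  | succ n ih =>
    have hD : ∀ p, eval φ (der c (fun l => bif Nat.blt l 2 then nil else
        node (l + 2) (one 1 0) nil) p) = d (eval φ p) := by
      intro p
      obtain ⟨N, hN⟩ := exists_below p
      refine eval_der φ hc hd _ hN fun l _ => ?_
      match l with
      | 0 => exact (h0 0 (by omega)).symm
      | 1 => exact (h0 1 (by omega)).symm
      | l + 2 =>
        rw [h2]
        have : Nat.blt (l + 2) 2 = false := rfl
        simp [this, eval]
    obtain ⟨T, hT, h⟩ := ih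
      (der c (fun l => bif Nat.blt l 2 then nil else node (l + 2) (one 1 0) nil) p)
      (der c (fun l => bif Nat.blt l 2 then nil else node (l + 2) (one 1 0) nil) q)
    refine ⟨p :: q :: T, fun i hi => ?_, fun α k => ?_⟩
    · cases i with
      | zero => exact ⟨rfl, rfl⟩
      | succ i =>
        have := hT i (by omega)
        rw [hD, hD] at this
        rw [pow_succ, Module.End.mul_apply, Module.End.mul_apply]
        exact this
    · have : table c (n + 1) p q k = p.force fun p => q.force fun q =>
        table c n (der c (fun l => bif Nat.blt l 2 then nil else node (l + 2) (one 1 0) nil) p)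
        (der c (fun l => bif Nat.blt l 2 then nil else node (l + 2) (one 1 0) nil) q)
          fun T => k (p :: q :: T) := rfl
      rw [this, force_eq, force_eq, h]

omit hc hd h0 h2 in
/-- The entries of a table are the derivatives of the generators. -/
theorem eval_lookup {T : List NP} {n : ℕ} {p q : NP}
    (hT : ∀ i < n, eval φ (lookup T (2 * i)) = (d ^ i) (eval φ p) ∧
      eval φ (lookup T (2 * i + 1)) = (d ^ i) (eval φ q)) {δ : A →ₗ[ℂ] A}
    (hδ0 : ∀ l < 2, δ (φ l) = 0)
    (hδ : ∀ i, δ (φ (2 * i + 2)) = (d ^ i) (eval φ p) ∧ δ (φ (2 * i + 3)) = (d ^ i) (eval φ q))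
    {l : ℕ} (hl : l < 2 * n + 2) : eval φ (lookup (nil :: nil :: T) l) = δ (φ l) := by
  match l, hl with
  | 0, _ => exact (hδ0 0 (by omega)).symm
  | 1, _ => exact (hδ0 1 (by omega)).symm
  | l + 2, hl =>
    have h : lookup (nil :: nil :: T) (l + 2) = lookup T l := rfl
    rw [h]
    rcases Nat.even_or_odd' l with ⟨i, rfl | rfl⟩
    · rw [(hT i (by omega)).1, (hδ i).1]
    · rw [(hT i (by omega)).2, (hδ i).2]

theorem eval_brackets {m n : ℕ} {F G : NP × NP} (h : bounded m n F G = true)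
    {δ ε : A →ₗ[ℂ] A} (hδ : ∀ a b, δ (a * b) = δ a * b + a * δ b)
    (hε : ∀ a b, ε (a * b) = ε a * b + a * ε b)
    (hδ0 : ∀ l < 2, δ (φ l) = 0) (hε0 : ∀ l < 2, ε (φ l) = 0)
    (hδF : ∀ i, δ (φ (2 * i + 2)) = (d ^ i) (eval φ F.1) ∧
      δ (φ (2 * i + 3)) = (d ^ i) (eval φ F.2))
    (hεG : ∀ i, ε (φ (2 * i + 2)) = (d ^ i) (eval φ G.1) ∧
      ε (φ (2 * i + 3)) = (d ^ i) (eval φ G.2)) :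
    ∃ p q : NP, eval φ p = δ (eval φ G.1) - ε (eval φ F.1) ∧
      eval φ q = δ (eval φ G.2) - ε (eval φ F.2) ∧
      ∀ (α : Type) (k : NP → NP → α), brackets c m n F G k = k p q := by
  obtain ⟨S, hS, hS'⟩ := table_eq hc hd h0 h2 (n + 1) F.1 F.2
  obtain ⟨T, hT, hT'⟩ := table_eq hc hd h0 h2 (m + 1) G.1 G.2
  have h1 : ∀ K L : NP, isBelow (2 * (n + 1) + 2) K = true → isBelow (2 * (m + 1) + 2) L = true →
      eval φ (bracket c S T K L) = δ (eval φ K) - ε (eval φ L) := by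
    intro K L hK hL
    rw [bracket, eval_add, eval_smul, eval_der φ hc hδ _ hK fun l hl => eval_lookup hS hδ0 hδF hl,
      eval_der φ hc hε _ hL fun l hl => eval_lookup hT hε0 hεG hl]
    push_cast
    simp [sub_eq_add_neg]
  simp only [bounded, Bool.and_eq_true] at h
  obtain ⟨⟨h3, h4⟩, h5, h6⟩ := h
  refine ⟨_, _, h1 _ _ h5 h3, h1 _ _ h6 h4, fun α k => ?_⟩
  rw [brackets, hS', hT']

end NP

end


noncomputable section

/-! ### Flows and commutators -/

theorem leibniz_ext {δ ε : NPoly →ₗ[ℂ] NPoly}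
    (hδ : ∀ a b, δ (a * b) = δ a * b + a * δ b) (hε : ∀ a b, ε (a * b) = ε a * b + a * ε b)
    (H : ∀ p : Letter, δ (FreeAlgebra.ι ℂ p) = ε (FreeAlgebra.ι ℂ p)) (a : NPoly) :
    δ a = ε a := by
  induction a using FreeAlgebra.induction with
  | grade0 r =>
    have h1 : δ 1 = 0 := by simpa using hδ 1 1
    have h2 : ε 1 = 0 := by simpa using hε 1 1
    rw [Algebra.algebraMap_eq_smul_one, map_smul, map_smul, h1, h2]
  | grade1 p => exact H p
  | mul a b ha hb => rw [hδ, hε, ha, hb]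
  | add a b ha hb => rw [map_add, map_add, ha, hb]

theorem D_mul (a b : NPoly) : D (a * b) = D a * b + a * D b := der_mul _ a b

theorem D_ι (p : Letter) : D (FreeAlgebra.ι ℂ p) = FreeAlgebra.ι ℂ (p.1, p.2 + 1) := der_ι _ p

/-- The commutator of two derivations, as a linear map. -/
def bracketMap (δ ε : NPoly →ₗ[ℂ] NPoly) : NPoly →ₗ[ℂ] NPoly := δ ∘ₗ ε - ε ∘ₗ δ

theorem bracketMap_mul {δ ε : NPoly →ₗ[ℂ] NPoly} (hδ : ∀ a b, δ (a * b) = δ a * b + a * δ b)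
    (hε : ∀ a b, ε (a * b) = ε a * b + a * ε b) (a b : NPoly) :
    bracketMap δ ε (a * b) = bracketMap δ ε a * b + a * bracketMap δ ε b := by
  simp only [bracketMap, LinearMap.sub_apply, LinearMap.comp_apply, hδ, hε, map_add, sub_mul,
    mul_sub]
  abel

theorem flow_D (F : NSystem) (a : NPoly) : F.flow (D a) = D (F.flow a) := by
  have h := leibniz_ext
    (bracketMap_mul (flow_mul F) D_mul) (ε := 0) (by simp) (fun p => ?_) a
  · simpa [bracketMap, sub_eq_zero] using h
  · simp only [bracketMap, LinearMap.sub_apply, LinearMap.comp_apply, D_ι, flow_ι,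
      LinearMap.zero_apply, pow_succ', Module.End.mul_apply, sub_self]

theorem flow_D_pow (F : NSystem) (n : ℕ) (a : NPoly) : F.flow ((D ^ n) a) = (D ^ n) (F.flow a) := by
  induction n with
  | zero => rfl
  | succ n ih => rw [pow_succ', Module.End.mul_apply, flow_D, ih, Module.End.mul_apply]

theorem NSystem.isSymmetry_of {F G : NSystem} (h : ∀ k, F.flow (G k) = G.flow (F k)) :
    F.IsSymmetry G := by
  intro a
  have := leibniz_ext
    (bracketMap_mul (flow_mul F) (flow_mul G)) (ε := 0) (by simp) (fun p => ?_) a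
  · simpa [bracketMap, sub_eq_zero] using this
  · simp only [bracketMap, LinearMap.sub_apply, LinearMap.comp_apply, flow_ι, flow_D_pow, h,
      sub_self, LinearMap.zero_apply]

theorem cD_X (p : Letter) : cD (MvPolynomial.X p : CPoly) = MvPolynomial.X (p.1, p.2 + 1) := by
  simp [cD]

theorem CSystem.flow_X (f : CSystem) (p : Letter) :
    f.flow (MvPolynomial.X p) = cD^[p.2] (f p.1) := by
  simp [CSystem.flow]

theorem CSystem.flow_cD (f : CSystem) (a : CPoly) : f.flow (cD a) = cD (f.flow a) := by
  have h : ⁅f.flow, cD⁆ = 0 := by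
    refine MvPolynomial.derivation_ext fun p => ?_
    rw [Derivation.commutator_apply, cD_X, flow_X, flow_X, Function.iterate_succ_apply', sub_self]
    rfl
  have := DFunLike.congr_fun h a
  rwa [Derivation.commutator_apply, Derivation.zero_apply, sub_eq_zero] at this

theorem CSystem.isSymmetry_of {f g : CSystem} (h : ∀ k, f.flow (g k) = g.flow (f k)) :
    f.IsSymmetry g := by
  have hD : ∀ (f : CSystem) (n : ℕ) a, f.flow (cD^[n] a) = cD^[n] (f.flow a) := by
    intro f n a
    induction n with
    | zero => rfl
    | succ n ih => rw [Function.iterate_succ_apply', flow_cD, ih, Function.iterate_succ_apply']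
  have h : ⁅f.flow, g.flow⁆ = 0 := by
    refine MvPolynomial.derivation_ext fun p => ?_
    rw [Derivation.commutator_apply, flow_X, flow_X, hD, hD, h, sub_self]
    rfl
  intro a
  have := DFunLike.congr_fun h a
  rwa [Derivation.commutator_apply, Derivation.zero_apply, sub_eq_zero] at this

theorem abelianize_ι (p : Letter) : abelianize (FreeAlgebra.ι ℂ p) = MvPolynomial.X p := by
  simp [abelianize]

theorem abelianize_surjective : Function.Surjective abelianize := by
  intro f
  induction f using MvPolynomial.induction_on with
  | C a => exact ⟨algebraMap ℂ _ a, by rw [AlgHom.commutes]; rfl⟩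
  | add f g hf hg =>
    obtain ⟨a, rfl⟩ := hf
    obtain ⟨b, rfl⟩ := hg
    exact ⟨a + b, map_add _ _ _⟩
  | mul_X f p hf =>
    obtain ⟨a, rfl⟩ := hf
    exact ⟨a * FreeAlgebra.ι ℂ p, by rw [map_mul, abelianize_ι]⟩

theorem abelianize_leibniz {δ : NPoly →ₗ[ℂ] NPoly} {d : Derivation ℂ CPoly CPoly}
    (hδ : ∀ a b, δ (a * b) = δ a * b + a * δ b)
    (h : ∀ p, abelianize (δ (FreeAlgebra.ι ℂ p)) = d (MvPolynomial.X p)) (a : NPoly) :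
    abelianize (δ a) = d (abelianize a) := by
  induction a using FreeAlgebra.induction with
  | grade0 r =>
    have h1 : δ 1 = 0 := by simpa using hδ 1 1
    have h2 : δ (algebraMap ℂ _ r) = 0 := by
      rw [Algebra.algebraMap_eq_smul_one, map_smul, h1, smul_zero]
    rw [h2, map_zero, AlgHom.commutes, Derivation.map_algebraMap]
  | grade1 p => rw [h, abelianize_ι]
  | mul a b ha hb =>
    rw [hδ, map_add, map_mul, map_mul, ha, hb, map_mul, Derivation.leibniz, smul_eq_mul,
      smul_eq_mul]
    ring
  | add a b ha hb => rw [map_add, map_add, ha, hb, map_add, map_add]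

theorem abelianize_D (a : NPoly) : abelianize (D a) = cD (abelianize a) :=
  abelianize_leibniz D_mul (fun p => by rw [D_ι, abelianize_ι, cD_X]) a

theorem abelianize_flow (F : NSystem) (a : NPoly) :
    abelianize (F.flow a) = F.ab.flow (abelianize a) := by
  refine abelianize_leibniz (flow_mul F) (fun p => ?_) a
  rw [flow_ι, CSystem.flow_X]
  generalize p.2 = n
  induction n with
  | zero => rfl
  | succ n ih => rw [pow_succ', Module.End.mul_apply, abelianize_D, ih, Function.iterate_succ_apply']

theorem NSystem.IsSymmetry.ab {F G : NSystem} (h : F.IsSymmetry G) : F.ab.IsSymmetry G.ab := by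
  intro a
  obtain ⟨a, rfl⟩ := abelianize_surjective a
  rw [← abelianize_flow, ← abelianize_flow, ← abelianize_flow, ← abelianize_flow, h]

theorem NSystem.IsHomogeneous.ab {F : NSystem} {μ : ℝ} {ν : Fin 2 → ℝ} (h : F.IsHomogeneous μ ν) :
    F.ab.IsHomogeneous μ ν := by
  intro τ hτ k
  rw [NSystem.ab, cScale_abelianize, h τ hτ k, map_smul]

theorem ab_mem_adjoin {a : NPoly} {p : ℕ → Prop}
    (h : a ∈ Algebra.adjoin ℂ {a | ∃ l : Letter, p l.2 ∧ a = FreeAlgebra.ι ℂ l}) :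
    abelianize a ∈ Algebra.adjoin ℂ {a : CPoly | ∃ l : Letter, p l.2 ∧ a = MvPolynomial.X l} := by
  have := Subalgebra.mem_map.mpr ⟨a, h, (rfl : abelianize a = abelianize a)⟩
  rw [AlgHom.map_adjoin] at this
  refine Algebra.adjoin_mono ?_ this
  rintro _ ⟨_, ⟨l, hl, rfl⟩, rfl⟩
  exact ⟨l, hl, abelianize_ι l⟩

/-! ### Systems given by lists of terms -/

/-- The term with the word `w` and the coefficient `(x + y √-3) β ^ k` is `(w, k, x, y)`. -/
abbrev Term : Type := Word × ℕ × ℤ × ℤ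

namespace Term

/-- `x + y √-3` times the monomial `m`. -/
def coeff (m : ℕ) (x y : ℤ) : Poly :=
  (bif Int.beq' y 0 then [] else [(2 * m, Q.ofInt y)]) ++
    bif Int.beq' x 0 then [] else [(m, Q.ofInt x)]

theorem ev_coeff {χ : ℕ →* ℂ} (h : χ 2 = iSqrt3) (m : ℕ) (x y : ℤ) :
    (coeff m x y).ev χ = (x + y * iSqrt3) * χ m := by
  have key : ∀ (m : ℕ) (x : ℤ), (bif Int.beq' x 0 then [] else [(m, Q.ofInt x)] : Poly).ev χ =
      x * χ m := by
    intro m x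
    cases hx : Int.beq' x 0 with
    | true =>
      rw [Int.beq'_eq] at hx
      simp [hx]
    | false => simp
  have happ : ∀ p q : Poly, Poly.ev χ (p ++ q) = p.ev χ + q.ev χ := by
    intro p q
    induction p with
    | nil => simp
    | cons e p ih => rw [List.cons_append, Poly.ev_cons, ih, Poly.ev_cons, add_assoc]
  rw [coeff, happ, key, key, map_mul, h]
  ring

/-- The coefficient as a polynomial in `√-3` and `β`, which correspond to the primes 2 and 3. -/
def toPair (t : Term) : Word × Poly :=
  (t.1, coeff (3 ^ t.2.1) t.2.2.1 t.2.2.2)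

def toNP (c : Bool) (t : Term) : NP :=
  Nat.rec (motive := fun _ => NP)
    (List.rec (motive := fun _ => NP) (.one t.2.2.1 t.2.2.2) (fun l _ ih => .push c (l + 2) ih) t.1)
    (fun _ ih => .push c 0 ih) t.2.1

def sum (c : Bool) (L : List Term) : NP :=
  List.rec (motive := fun _ => NP) .nil (fun t _ ih => .add (t.toNP c) ih) L

def decodeWord (fuel : ℕ) : ℕ → Word :=
  Nat.rec (motive := fun _ => ℕ → Word) (fun _ => []) (fun _ ih n =>
    bif Nat.beq n 0 then [] else (n % 16 - 1) :: ih (n / 16)) fuel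

/-- The term with the given code. -/
def decode (n : ℕ) : Term :=
  bif Nat.beq (n % 2) 0 then (decodeWord 16 (n / 64), 0, Pt.unzigzag (n / 2 % 32), 0) else
  bif Nat.beq (n % 4) 1 then
    (decodeWord 16 (n / 65536), 0, Pt.unzigzag (n / 4 % 128), Pt.unzigzag (n / 512 % 128))
  else (decodeWord 16 (n / 33554432), n / 4194304 % 8, Pt.unzigzag (n / 4096 % 1024),
    Pt.unzigzag (n / 4 % 1024))

/-- The system of terms with the given codes. -/
def system (L K : List ℕ) : List Term × List Term := (L.map decode, K.map decode)

/-- The values of the generators for the parameter `β`. -/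
def gen (β : ℂ) : ℕ → NPoly
  | 0 => algebraMap ℂ NPoly β
  | 1 => 0
  | l + 2 => FreeAlgebra.ι ℂ (toLetter l)

variable {χ : ℕ →* ℂ}

theorem ev_toPair (h : χ 2 = iSqrt3) (t : Term) :
    t.toPair.2.ev χ = (t.2.2.1 + t.2.2.2 * iSqrt3) * χ 3 ^ t.2.1 := by
  rw [toPair, ev_coeff h, map_pow]

variable {A : Type*} [Ring A] [Algebra ℂ A] (π : NPoly →ₐ[ℂ] A) {c : Bool}
  (hc : c = true → ∀ a b : A, a * b = b * a)
include hc

theorem eval_toNP (h : χ 2 = iSqrt3) (t : Term) : (t.toNP c).eval (fun l => π (gen (χ 3) l)) =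
    π (t.toPair.2.ev χ • word (t.1.map toLetter)) := by
  obtain ⟨w, k, x, y⟩ := t
  rw [ev_toPair h]
  induction k with
  | zero =>
    simp only [pow_zero, mul_one]
    induction w with
    | nil =>
      have : toNP c ([], 0, x, y) = .one x y := rfl
      rw [this, NP.eval_one, List.map_nil, word_nil, map_smul, map_one,
        Algebra.algebraMap_eq_smul_one]
    | cons l w ih =>
      have : toNP c (l :: w, 0, x, y) = .push c (l + 2) (toNP c (w, 0, x, y)) := rfl
      rw [this, NP.eval_push _ hc, ih, List.map_cons, word_cons, ← map_mul, mul_smul_comm]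
      rfl
  | succ k ih =>
    have : toNP c (w, k + 1, x, y) = .push c 0 (toNP c (w, k, x, y)) := rfl
    rw [this, NP.eval_push _ hc, ih, ← map_mul]
    simp only [gen, pow_succ, ← Algebra.smul_def, smul_smul]
    congr 2
    ring

theorem eval_sum (h : χ 2 = iSqrt3) (L : List Term) :
    (sum c L).eval (fun l => π (gen (χ 3) l)) = π (combo χ (L.map toPair)) := by
  induction L with
  | nil => simp [sum, combo, NP.eval]
  | cons t L ih =>
    have : sum c (t :: L) = .add (t.toNP c) (sum c L) := rfl
    rw [this, NP.eval_add, eval_toNP π hc h, ih, ← map_add]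
    simp [combo, toPair]

end Term

/-- The system with the given lists of terms. -/
def sysOf (χ : ℕ →* ℂ) (F : List Term × List Term) : NSystem :=
  ![combo χ (F.1.map Term.toPair), combo χ (F.2.map Term.toPair)]

/-- The commutator of the systems `F` and `G` of orders at most `m` and `n` satisfies `k`. -/
def checkBrackets (c : Bool) (m n : ℕ) (F G : List Term × List Term) (k : NP → NP → Bool) : Bool :=
  NP.bounded m n (Term.sum c F.1, Term.sum c F.2) (Term.sum c G.1, Term.sum c G.2) &&
    NP.brackets c m n (Term.sum c F.1, Term.sum c F.2) (Term.sum c G.1, Term.sum c G.2) k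

/-- The systems of orders at most `m` and `n` commute. -/
def commutes (c : Bool) (m n : ℕ) (F G : List Term × List Term) : Bool :=
  checkBrackets c m n F G fun p q => p.isZero && q.isZero

theorem toLetter_two_mul (i : ℕ) : toLetter (2 * i) = (0, i) ∧ toLetter (2 * i + 1) = (1, i) := by
  constructor
  · have := toLetter_code (0, i)
    simpa [code] using this
  · have := toLetter_code (1, i)
    simpa [code] using this

variable {χ : ℕ →* ℂ} (hχ : χ 2 = iSqrt3) {m n : ℕ} {F G : List Term × List Term}
include hχ

theorem isSymmetry_of_commutes (h : commutes false m n F G = true) :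
    (sysOf χ F).IsSymmetry (sysOf χ G) := by
  rw [commutes, checkBrackets, Bool.and_eq_true] at h
  have hc : false = true → ∀ a b : NPoly, a * b = b * a := by simp
  have hs : ∀ L, (Term.sum false L).eval (Term.gen (χ 3)) = combo χ (L.map Term.toPair) :=
    fun L => Term.eval_sum (AlgHom.id ℂ NPoly) hc hχ L
  have hδ0 : ∀ F : NSystem, ∀ l < 2, F.flow (Term.gen (χ 3) l) = 0 := by
    intro F l hl
    interval_cases l
    · rw [Term.gen, Algebra.algebraMap_eq_smul_one, map_smul, flow_one, smul_zero]
    · exact map_zero _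
  have hδF : ∀ F : List Term × List Term, ∀ i,
      (sysOf χ F).flow (Term.gen (χ 3) (2 * i + 2)) = (D ^ i) (combo χ (F.1.map Term.toPair)) ∧
      (sysOf χ F).flow (Term.gen (χ 3) (2 * i + 3)) = (D ^ i) (combo χ (F.2.map Term.toPair)) := by
    intro F i
    constructor
    · rw [Term.gen, (toLetter_two_mul i).1, flow_ι]; rfl
    · rw [Term.gen, (toLetter_two_mul i).2, flow_ι]; rfl
  have := NP.eval_brackets (φ := Term.gen (χ 3)) hc D_mul ?_ ?_ h.1 (flow_mul (sysOf χ F))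
    (flow_mul (sysOf χ G)) (hδ0 _) (hδ0 _) ?_ ?_
  · obtain ⟨p, q, hp, hq, hk⟩ := this
    have h2 := h.2
    rw [hk, Bool.and_eq_true] at h2
    rw [NP.eval_isZero _ h2.1] at hp
    rw [NP.eval_isZero _ h2.2] at hq
    simp only [hs] at hp hq
    exact NSystem.isSymmetry_of (Fin.forall_fin_two.mpr
      ⟨sub_eq_zero.mp hp.symm, sub_eq_zero.mp hq.symm⟩)
  · intro l hl
    interval_cases l
    · have : D 1 = 0 := by simpa using D_mul 1 1
      rw [Term.gen, Algebra.algebraMap_eq_smul_one, map_smul, this, smul_zero]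
    · exact map_zero _
  · intro l
    rw [Term.gen, Term.gen, D_ι, ← toLetter_code ((toLetter l).1, (toLetter l).2 + 1)]
    congr 2
    rw [show code ((toLetter l).1, (toLetter l).2 + 1) = code (toLetter l) + 2 by
      simp [code]; ring, code_toLetter]
  · simpa only [hs] using hδF F
  · simpa only [hs] using hδF G

theorem exists_of_checkBrackets {k : NP → NP → Bool} (h : checkBrackets true m n F G k = true) :
    ∃ p q : NP, k p q = true ∧ p.eval (fun l => abelianize (Term.gen (χ 3) l)) =
        (sysOf χ F).ab.flow ((sysOf χ G).ab 0) - (sysOf χ G).ab.flow ((sysOf χ F).ab 0) ∧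
      q.eval (fun l => abelianize (Term.gen (χ 3) l)) =
        (sysOf χ F).ab.flow ((sysOf χ G).ab 1) - (sysOf χ G).ab.flow ((sysOf χ F).ab 1) := by
  rw [checkBrackets, Bool.and_eq_true] at h
  have hc : true = true → ∀ a b : CPoly, a * b = b * a := fun _ => mul_comm
  have hs := fun L => Term.eval_sum abelianize hc hχ L
  have hl : ∀ (d : Derivation ℂ CPoly CPoly) (a b : CPoly),
      d.toLinearMap (a * b) = d.toLinearMap a * b + a * d.toLinearMap b := by
    intro d a b
    have := d.leibniz a b
    rw [smul_eq_mul, smul_eq_mul] at this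
    rw [mul_comm (d.toLinearMap a), add_comm]
    exact this
  have hδ0 : ∀ (d : Derivation ℂ CPoly CPoly), ∀ l < 2,
      d.toLinearMap (abelianize (Term.gen (χ 3) l)) = 0 := by
    intro d l hl
    interval_cases l
    · rw [Term.gen, AlgHom.commutes]; exact d.map_algebraMap _
    · simp [Term.gen]
  have hi : ∀ i a, (cD.toLinearMap ^ i) a = cD^[i] a := by
    intro i a
    rw [Module.End.pow_apply]
    rfl
  have hδF : ∀ F : List Term × List Term, ∀ i,
      (sysOf χ F).ab.flow.toLinearMap (abelianize (Term.gen (χ 3) (2 * i + 2))) =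
        (cD.toLinearMap ^ i) (abelianize (combo χ (F.1.map Term.toPair))) ∧
      (sysOf χ F).ab.flow.toLinearMap (abelianize (Term.gen (χ 3) (2 * i + 3))) =
        (cD.toLinearMap ^ i) (abelianize (combo χ (F.2.map Term.toPair))) := by
    intro F i
    constructor
    · rw [Term.gen, (toLetter_two_mul i).1, abelianize_ι, hi]
      exact CSystem.flow_X _ _
    · rw [Term.gen, (toLetter_two_mul i).2, abelianize_ι, hi]
      exact CSystem.flow_X _ _
  have := NP.eval_brackets (φ := fun l => abelianize (Term.gen (χ 3) l)) hc (hl cD) (hδ0 cD) ?_ h.1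
    (hl (sysOf χ F).ab.flow) (hl (sysOf χ G).ab.flow) (hδ0 _) (hδ0 _) ?_ ?_
  · obtain ⟨p, q, hp, hq, hk⟩ := this
    have h2 := h.2
    rw [hk] at h2
    simp only [hs] at hp hq
    exact ⟨p, q, h2, hp, hq⟩
  · intro l
    simp only [Term.gen, abelianize_ι]
    refine (cD_X _).trans ?_
    rw [← toLetter_code ((toLetter l).1, (toLetter l).2 + 1)]
    congr 2
    rw [show code ((toLetter l).1, (toLetter l).2 + 1) = code (toLetter l) + 2 by
      simp [code]; ring, code_toLetter]
  · simpa only [hs] using hδF F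
  · simpa only [hs] using hδF G

theorem isSymmetry_ab_of_commutes (h : commutes true m n F G = true) :
    (sysOf χ F).ab.IsSymmetry (sysOf χ G).ab := by
  obtain ⟨p, q, h2, hp, hq⟩ := exists_of_checkBrackets hχ h
  rw [Bool.and_eq_true] at h2
  rw [NP.eval_isZero _ h2.1] at hp
  rw [NP.eval_isZero _ h2.2] at hq
  exact CSystem.isSymmetry_of (Fin.forall_fin_two.mpr
    ⟨sub_eq_zero.mp hp.symm, sub_eq_zero.mp hq.symm⟩)

end


noncomputable section

/-! ### Weights of scalar systems -/

theorem degree_perm (ν : Fin 2 → ℝ) {w x : List Letter} (h : w.Perm x) : degree ν w = degree ν x :=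
  (h.map _).sum_eq

theorem degree_eq_of_coeffAt {ν : Fin 2 → ℝ} {f : CPoly} {d : ℝ}
    (h : ∀ τ : ℝ, 0 < τ → cScale ν τ f = ((τ ^ d : ℝ) : ℂ) • f) {w : Word}
    (hw : coeffAt w f ≠ 0) : degree ν (w.map toLetter) = d := by
  have key : ∀ τ : ℝ, 0 < τ → ∀ a, coeffAt w (abelianize (nScale ν τ a)) =
      ((τ ^ degree ν (w.map toLetter) : ℝ) : ℂ) * coeffAt w (abelianize a) := by
    intro τ hτ a
    let C : CPoly →ₗ[ℂ] ℂ :=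
      { toFun := coeffAt w, map_add' := coeffAt_add w, map_smul' := coeffAt_smul w }
    suffices h : (C ∘ₗ abelianize.toLinearMap) ∘ₗ (nScale ν τ).toLinearMap =
        ((τ ^ degree ν (w.map toLetter) : ℝ) : ℂ) • (C ∘ₗ abelianize.toLinearMap) from
      DFunLike.congr_fun h a
    refine word_ext fun x => ?_
    simp only [LinearMap.comp_apply, AlgHom.toLinearMap_apply, nScale_word ν hτ, map_smul,
      LinearMap.smul_apply]
    change _ • coeffAt w _ = _ • coeffAt w _
    rw [← map_toLetter_code x, coeffAt_word]
    split
    · rename_i hs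
      rw [degree_perm ν ((List.isPerm_iff.mp hs).map toLetter)]
    · simp
  obtain ⟨a, rfl⟩ := abelianize_surjective f
  have h2 := key 2 two_pos a
  rw [← cScale_abelianize, h 2 two_pos, coeffAt_smul] at h2
  have h3 := mul_right_cancel₀ hw h2
  have h4 : (2 : ℝ) ^ d = 2 ^ degree ν (w.map toLetter) := by exact_mod_cast h3
  have := congrArg (Real.logb 2) h4
  simpa using this.symm

theorem degree_sub (ν ν' : Fin 2 → ℝ) (w : List Letter) : degree ν w = degree ν' w +
    (w.countP (fun p => p.1 = 0) * (ν 0 - ν' 0) +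
      (w.length - w.countP (fun p => p.1 = 0)) * (ν 1 - ν' 1)) := by
  induction w with
  | nil => simp [degree]
  | cons p w ih =>
    simp only [degree, List.map_cons, List.sum_cons, List.countP_cons, List.length_cons] at ih ⊢
    rw [ih]
    obtain ⟨c, m⟩ := p
    fin_cases c
    · simp; ring
    · simp; ring

namespace Weights

def admitsWord (W : Weights) (n k : ℕ) (w : Word) : Bool :=
  Nat.beq (w.map W.ofCode).sum (W.total n k) && W.isBalanced k w

theorem isHomogeneous_combo (W : Weights) (hr : 0 < W.r) {n : ℕ} {k : Fin 2} {χ : ℕ →* ℂ}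
    {L : List (Word × Poly)} (h : L.all (fun e => W.admitsWord n k e.1) = true) {e : ℝ}
    (he : W.bal = false → e = 0) {τ : ℝ} (hτ : 0 < τ) :
    nScale (W.real e) τ (combo χ L) = ((τ ^ (n + W.real e k) : ℝ) : ℂ) • combo χ L := by
  induction L with
  | nil => simp [combo]
  | cons t L ih =>
    rw [List.all_cons, Bool.and_eq_true] at h
    have h2 : combo χ (t :: L) = Poly.ev χ t.2 • word (t.1.map toLetter) + combo χ L := by simp [combo]
    rw [h2, map_add, ih h.2, map_smul, nScale_word _ hτ,
      (W.admits_iff hr n k _).1 (admits_of_check h.1) e he, smul_add, smul_comm]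

end Weights

theorem ev_ne_zero_of_isConst {χ : ℕ →* ℂ} {p : Poly} (h : Cert.isConst p = true) :
    Poly.ev χ p ≠ 0 := by
  unfold Cert.isConst at h
  split at h
  · rename_i m c
    rw [Bool.and_eq_true] at h
    have : c.isZero = false := by simpa using h.2
    simpa [Nat.eq_of_beq_eq_true h.1] using Q.val_ne_zero this
  · cases h

namespace Data

def hasMonomial (d : Data) (k : ℕ) (w : Word) : Bool :=
  Cert.isConst (classSum (bif Nat.beq k 0 then d.f.1 else d.f.2) w) && d.W.admitsWord 2 k w

/-- The number of letters `u` or `v` in `w` minus the number of letters `u` or `v` in the unknown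
`k`. -/
def excess (k : ℕ) (w : Word) : ℤ × ℤ :=
  ((w.countP fun l => Nat.beq (l % 2) 0) - (bif Nat.beq k 0 then 1 else 0),
    (w.length - (w.countP fun l => Nat.beq (l % 2) 0 : ℕ)) - (bif Nat.beq k 0 then 0 else 1))

/-- The scalar system is homogeneous with the weights of `d` only, because it contains the monomials
`w` and `x` in the equations `k` and `l`. -/
def pins (d : Data) (k l : ℕ) (w x : Word) : Bool :=
  Nat.blt 0 d.W.r && Nat.blt k 2 && Nat.blt l 2 &&
  d.f.1.all (fun e => d.W.admitsWord 2 0 e.1) && d.f.2.all (fun e => d.W.admitsWord 2 1 e.1) &&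
  d.hasMonomial 0 [4] && d.hasMonomial k w && d.hasMonomial l x &&
  bif d.W.bal then !decide ((excess k w).1 = 0) && decide ((excess k w).1 = (excess k w).2) else
    !decide ((excess k w).1 * (excess l x).2 = (excess l x).1 * (excess k w).2)

variable {d : Data} {β : ℂ} {f : CSystem}

theorem exists_param (β : ℂ) : ∃ χ : ℕ →* ℂ, χ 2 = iSqrt3 ∧ χ 3 = β := by
  obtain ⟨χ, h⟩ := NonAbelian.exists_monoidHom [(2, iSqrt3), (3, β)] (by
    intro e he
    simp at he
    rcases he with rfl | rfl <;> norm_num) (by simp)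
  exact ⟨χ, h (2, iSqrt3) (by simp), h (3, β) (by simp)⟩

theorem isHomogeneous_of_pins {k l : ℕ} {w x : Word} (h : d.pins k l w x = true)
    (hf : d.Describes β f) {e : ℝ} (he : d.W.bal = false → e = 0) :
    f.IsHomogeneous 2 (d.W.real e) := by
  simp only [pins, Bool.and_eq_true] at h
  obtain ⟨χ, -, h3⟩ := exists_param β
  obtain ⟨e0, e1⟩ := hf χ h3
  intro τ hτ k
  have hr := Nat.ble_eq.mp h.1.1.1.1.1.1.1.1
  fin_cases k
  · have := d.W.isHomogeneous_combo hr (χ := χ) (n := 2) (k := 0) h.1.1.1.1.1.2 he hτ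
    simp only [Fin.zero_eta]
    rw [e0, cScale_abelianize, this, map_smul]
    norm_num
  · have := d.W.isHomogeneous_combo hr (χ := χ) (n := 2) (k := 1) h.1.1.1.1.2 he hτ
    simp only [Fin.mk_one]
    rw [e1, cScale_abelianize, this, map_smul]
    norm_num

theorem degree_of_hasMonomial {k : Fin 2} {w : Word} (hr : 0 < d.W.r)
    (h : d.hasMonomial k w = true) (hf : d.Describes β f) {μ : ℝ} {ν : Fin 2 → ℝ}
    (hh : f.IsHomogeneous μ ν) :
    ((excess k w).1 : ℝ) * (ν 0 - d.W.real 0 0) + (excess k w).2 * (ν 1 - d.W.real 0 1) = μ - 2 := by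
  rw [hasMonomial, Bool.and_eq_true] at h
  obtain ⟨χ, -, h3⟩ := exists_param β
  have e := hf χ h3
  have hne : coeffAt w (f k) ≠ 0 := by
    have : f k = abelianize (combo χ (bif Nat.beq k 0 then d.f.1 else d.f.2)) := by
      fin_cases k
      · exact e.1
      · exact e.2
    rw [this, coeffAt_combo]
    exact ev_ne_zero_of_isConst h.1
  have h1 := degree_eq_of_coeffAt (fun τ hτ => hh τ hτ k) hne
  have h2 := (d.W.admits_iff hr 2 k _).1 (Weights.admits_of_check h.2) 0 fun _ => rfl
  rw [degree_sub ν (d.W.real 0), h2, List.length_map] at h1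
  have h4 : ((w.map toLetter).countP fun p => p.1 = 0) = w.countP fun l => Nat.beq (l % 2) 0 := by
    rw [← Weights.countP_code, map_code_toLetter]
  rw [h4] at h1
  fin_cases k
  · simp [excess] at h1 ⊢
    linarith
  · simp [excess] at h1 ⊢
    linarith

theorem weights_of_pins {k l : ℕ} {w x : Word} (h : d.pins k l w x = true)
    (hf : d.Describes β f) {μ : ℝ} {ν : Fin 2 → ℝ} (hh : f.IsHomogeneous μ ν) :
    μ = 2 ∧ ∃ e : ℝ, (d.W.bal = false → e = 0) ∧ ν = d.W.real e := by
  simp only [pins, Bool.and_eq_true] at h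
  obtain ⟨⟨⟨⟨⟨⟨⟨⟨hr, hk⟩, hl⟩, -⟩, -⟩, h4⟩, hw⟩, hx⟩, hdet⟩ := h
  have hr := Nat.ble_eq.mp hr
  have hk := Nat.ble_eq.mp hk
  have hl := Nat.ble_eq.mp hl
  have e4 := degree_of_hasMonomial (k := 0) hr h4 hf hh
  have ew := degree_of_hasMonomial (k := ⟨k, hk⟩) hr hw hf hh
  have ex := degree_of_hasMonomial (k := ⟨l, hl⟩) hr hx hf hh
  have hμ : μ = 2 := by
    simp [excess] at e4
    linarith
  refine ⟨hμ, ?_⟩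
  rw [hμ, sub_self] at ew ex
  simp only at ew ex
  set s := ν 0 - d.W.real 0 0 with hs
  set t := ν 1 - d.W.real 0 1 with ht
  have hreal : ∀ e, d.W.real e 0 = d.W.real 0 0 + e ∧ d.W.real e 1 = d.W.real 0 1 - e := by
    intro e
    simp [Weights.real]
  refine ⟨s, ?_, ?_⟩
  · intro hb
    rw [hb, cond_false] at hdet
    have hdet : (excess k w).1 * (excess l x).2 ≠ (excess l x).1 * (excess k w).2 := by
      simpa using hdet
    have hdet' : ((excess k w).1 * (excess l x).2 - (excess l x).1 * (excess k w).2 : ℝ) ≠ 0 := by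
      rw [sub_ne_zero]
      exact_mod_cast hdet
    refine (mul_eq_zero.mp (?_ : _ * s = 0)).resolve_left hdet'
    linear_combination ((excess l x).2 : ℝ) * ew - ((excess k w).2 : ℝ) * ex
  · have hts : t = -s := by
      cases hb : d.W.bal with
      | true =>
        rw [hb, cond_true, Bool.and_eq_true] at hdet
        have h1 : (excess k w).1 ≠ 0 := by simpa using hdet.1
        have h2 : (excess k w).1 = (excess k w).2 := by simpa using hdet.2
        have h1' : ((excess k w).1 : ℝ) ≠ 0 := by exact_mod_cast h1
        rw [← h2, ← mul_add] at ew
        linarith [(mul_eq_zero.mp ew).resolve_left h1']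
      | false =>
        rw [hb, cond_false] at hdet
        have hdet : (excess k w).1 * (excess l x).2 ≠ (excess l x).1 * (excess k w).2 := by
          simpa using hdet
        have hdet' : ((excess k w).1 * (excess l x).2 - (excess l x).1 * (excess k w).2 : ℝ) ≠ 0 := by
          rw [sub_ne_zero]
          exact_mod_cast hdet
        have h1 := (mul_eq_zero.mp (show _ * s = 0 by
          linear_combination ((excess l x).2 : ℝ) * ew - ((excess k w).2 : ℝ) * ex)).resolve_left hdet'
        have h2 := (mul_eq_zero.mp (show _ * t = 0 by
          linear_combination ((excess k w).1 : ℝ) * ex - ((excess l x).1 : ℝ) * ew)).resolve_left hdet'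
        rw [h1, h2, neg_zero]
    funext i
    fin_cases i
    · change ν 0 = d.W.real s 0
      rw [(hreal s).1]; linarith
    · change ν 1 = d.W.real s 1
      rw [(hreal s).2]; linarith

/-! ### Existence and nonexistence of symmetries -/

/-- The terms of `G` are homogeneous of order `n`. -/
def admitsTerms (d : Data) (n : ℕ) (G : List Term × List Term) : Bool :=
  Nat.blt 0 d.W.r && G.1.all (fun t => d.W.admitsWord n 0 t.1) &&
    G.2.all (fun t => d.W.admitsWord n 1 t.1)

/-- The order of `G` is `n`, and the coefficient of `u_n` in the first equation is `c`. -/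
def hasOrder (n : ℕ) (c : ℤ) (G : List Term × List Term) : Bool :=
  !decide (c = 0) && G.1.all (fun t => t.1.all fun l => Nat.ble l (2 * n + 1)) &&
    G.2.all (fun t => t.1.all fun l => Nat.ble l (2 * n + 1)) &&
    Cert.eqv (classSum (G.1.map Term.toPair) [2 * n]) (Poly.const c)

variable {χ : ℕ →* ℂ} {n : ℕ} {G : List Term × List Term}

theorem isHomogeneous_of_admitsTerms (h : d.admitsTerms n G = true) {e : ℝ}
    (he : d.W.bal = false → e = 0) : (sysOf χ G).IsHomogeneous n (d.W.real e) := by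
  simp only [admitsTerms, Bool.and_eq_true] at h
  intro τ hτ k
  have hr := Nat.ble_eq.mp h.1.1
  have hall : ∀ (k : ℕ) (L : List Term), L.all (fun t => d.W.admitsWord n k t.1) = true →
      (L.map Term.toPair).all (fun e => d.W.admitsWord n k e.1) = true := by
    intro k L h
    rw [List.all_map]
    exact h
  fin_cases k
  · exact d.W.isHomogeneous_combo hr (hall 0 _ h.1.2) he hτ
  · exact d.W.isHomogeneous_combo hr (hall 1 _ h.2) he hτ

theorem combo_mem_adjoin {L : List Term} {n : ℕ}
    (h : L.all (fun t => t.1.all fun l => Nat.ble l (2 * n + 1)) = true) :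
    combo χ (L.map Term.toPair) ∈
      Algebra.adjoin ℂ {a | ∃ p : Letter, p.2 ≤ n ∧ a = FreeAlgebra.ι ℂ p} := by
  unfold combo
  refine Subalgebra.list_sum_mem _ fun x hx => ?_
  obtain ⟨e, he, rfl⟩ := List.mem_map.mp hx
  obtain ⟨t, ht, rfl⟩ := List.mem_map.mp he
  refine Subalgebra.smul_mem _ (Subalgebra.list_prod_mem _ ?_) _
  intro x hx
  obtain ⟨p, hp, rfl⟩ := List.mem_map.mp hx
  obtain ⟨l, hl, rfl⟩ := List.mem_map.mp hp
  refine Algebra.subset_adjoin ⟨_, ?_, rfl⟩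
  have h1 := Nat.ble_eq.mp (List.all_eq_true.mp (List.all_eq_true.mp h t ht) l hl)
  have h2 := code_toLetter l
  rw [code] at h2
  omega

theorem coeffAt_eq_zero_of_mem_adjoin {f : CPoly} {n : ℕ}
    (h : f ∈ Algebra.adjoin ℂ {a : CPoly | ∃ p : Letter, p.2 < n ∧ a = MvPolynomial.X p}) :
    coeffAt [2 * n] f = 0 := by
  have hs : {a : CPoly | ∃ p : Letter, p.2 < n ∧ a = MvPolynomial.X p} =
      MvPolynomial.X '' {p : Letter | p.2 < n} := by
    ext a
    simp only [Set.mem_ofPred_eq, Set.mem_image, eq_comm]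
  rw [hs] at h
  have h : f ∈ MvPolynomial.supported ℂ {p : Letter | p.2 < n} := h
  rw [MvPolynomial.mem_supported] at h
  by_contra hne
  have h1 := MvPolynomial.mem_support_iff.mpr hne
  have h2 : toLetter (2 * n) ∈ f.vars := by
    rw [MvPolynomial.mem_vars_iff_mem_support]
    refine ⟨_, h1, ?_⟩
    rw [Finsupp.mem_support_iff, Multiset.toFinsupp_apply]
    simp
  have h3 := h h2
  rw [(toLetter_two_mul n).1] at h3
  simp at h3

theorem hasOrder_of_check (hχ : χ 2 = iSqrt3) {c : ℤ} (h : hasOrder n c G = true) :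
    (sysOf χ G).HasOrder n ∧ (sysOf χ G).ab.HasOrder n := by
  simp only [hasOrder, Bool.and_eq_true] at h
  obtain ⟨⟨⟨hc, h0⟩, h1⟩, hl⟩ := h
  have hc : c ≠ 0 := by simpa using hc
  have h4 : χ 4 = -3 := by
    rw [show 4 = 2 * 2 from rfl, map_mul, hχ, ← sq, iSqrt3_sq]
  have hmem : ∀ k, sysOf χ G k ∈
      Algebra.adjoin ℂ {a | ∃ p : Letter, p.2 ≤ n ∧ a = FreeAlgebra.ι ℂ p} := by
    intro k
    fin_cases k
    · exact combo_mem_adjoin h0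
    · exact combo_mem_adjoin h1
  have hne : ¬ ∀ k, (sysOf χ G).ab k ∈
      Algebra.adjoin ℂ {a : CPoly | ∃ p : Letter, p.2 < n ∧ a = MvPolynomial.X p} := by
    intro h
    have h2 := coeffAt_eq_zero_of_mem_adjoin (h 0)
    have h3 := coeffAt_combo (χ := χ) [2 * n] (G.1.map Term.toPair)
    rw [Cert.ev_eqv h4 hl, Poly.ev_const] at h3
    have : coeffAt [2 * n] ((sysOf χ G).ab 0) = c := h3
    rw [this] at h2
    exact hc (by exact_mod_cast h2)
  refine ⟨⟨hmem, fun h => hne fun k => ?_⟩, fun k => ?_, hne⟩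
  · exact ab_mem_adjoin (p := fun m => m < n) (h k)
  · exact ab_mem_adjoin (p := fun m => m ≤ n) (hmem k)

variable {k l : ℕ} {w x : Word} {c : ℤ} (hp : d.pins k l w x = true) (hd : d.Describes β f)
  (hχ : χ 2 = iSqrt3)
include hp hd

theorem isHomogeneous_of_weights (hG : d.admitsTerms n G = true) {μ : ℝ}
    {ν : Fin 2 → ℝ} (h : f.IsHomogeneous μ ν) : (sysOf χ G).IsHomogeneous n ν := by
  obtain ⟨-, e, he, rfl⟩ := weights_of_pins hp hd h
  exact isHomogeneous_of_admitsTerms hG he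

include hχ

theorem isHomSymmetry (hG : d.admitsTerms n G = true) (ho : hasOrder n c G = true)
    (hs : f.IsSymmetry (sysOf χ G).ab) : f.IsHomSymmetry n (sysOf χ G).ab :=
  ⟨hs, (hasOrder_of_check hχ ho).2, fun _ _ h => (isHomogeneous_of_weights hp hd hG h).ab⟩

/-- A non-Abelian system with an explicit symmetry is an analog of its scalar reduction. -/
theorem isAnalog {F : NSystem} (hF : F.ab = f) {a : ℂ} (ha : a ≠ 0) {F' : List Term × List Term}
    (hF' : a • F = sysOf χ F') (hc : commutes false 2 n F' G = true)
    (h2 : d.admitsTerms 2 F' = true)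
    (hG : d.admitsTerms n G = true) (ho : hasOrder n c G = true)
    (hmin : n = 3 ∨ n = 4 ∧ ∀ g, ¬ f.IsHomSymmetry 3 g) : f.IsMinOrder n ∧ IsAnalog f F := by
  have hF'' : F = a⁻¹ • sysOf χ F' := by rw [← hF', smul_smul, inv_mul_cancel₀ ha, one_smul]
  have hs : F.IsSymmetry (sysOf χ G) := by
    intro b
    rw [hF'', flow_smul, flow_smul, isSymmetry_of_commutes hχ hc, map_smul]
  have hG' := isHomSymmetry hp hd hχ hG ho (hF ▸ hs.ab)
  have hmin' : f.IsMinOrder n := by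
    refine ⟨⟨?_, _, hG'⟩, ?_⟩
    · rcases hmin with rfl | ⟨rfl, -⟩ <;> norm_num
    · rintro m ⟨hm, g, hg⟩
      rcases hmin with rfl | ⟨rfl, hmin⟩
      · exact hm
      · by_contra hlt
        obtain rfl : m = 3 := by omega
        exact hmin g hg
  refine ⟨hmin', hF, fun μ ν h => ?_, n, sysOf χ G, hmin', hs, (hasOrder_of_check hχ ho).1,
    fun μ ν h => isHomogeneous_of_weights hp hd hG h, hG'⟩
  have h1 := isHomogeneous_of_weights (χ := χ) hp hd h2 h
  rw [(weights_of_pins hp hd h).1, hF'']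
  exact_mod_cast h1.smul _

omit hχ

/-- An analog provides data for the classification. -/
theorem symmetric_of_isAnalog (hv : d.isValid = true) {F : NSystem} (h : IsAnalog f F) :
    ∃ n G, f.IsMinOrder n ∧ G.HasOrder n ∧ d.Symmetric β f n F G := by
  obtain ⟨hF, hh, n, G, hn, hs, ho, hG, -⟩ := h
  exact ⟨n, G, hn, ho, hv, hd, hF, fun e he => hh _ _ (isHomogeneous_of_pins hp hd he), hs,
    fun e he => hG _ _ (isHomogeneous_of_pins hp hd he)⟩

end Data

end


noncomputable section

/-! ### Exclusion of scalar symmetries -/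

namespace NP

/-- The terms of a polynomial in the values of the generators. -/
def terms (p : NP) : List (Word × Poly) :=
  NP.rec (motive := fun _ => List (Word × Poly)) []
    (fun x y => [([], Term.coeff 1 x y)])
    (fun l _ _ iha ihb => (bif Nat.beq l 0 then
      iha.map fun e => (e.1, Poly.mul [(3, Q.one)] e.2) else bif Nat.beq l 1 then [] else
        iha.map fun e => ((l - 2) :: e.1, e.2)) ++ ihb) p

variable {χ : ℕ →* ℂ}

theorem combo_append (L K : List (Word × Poly)) : combo χ (L ++ K) = combo χ L + combo χ K := by
  simp [combo]

theorem eval_eq_combo {A : Type*} [Ring A] [Algebra ℂ A] (π : NPoly →ₐ[ℂ] A)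
    (hχ : χ 2 = iSqrt3) (p : NP) :
    p.eval (fun l => π (Term.gen (χ 3) l)) = π (combo χ p.terms) := by
  induction p with
  | nil => simp [eval, terms, combo]
  | one x y =>
    simp [eval_one, terms, combo, Term.ev_coeff hχ, Algebra.algebraMap_eq_smul_one]
  | node l a b iha ihb =>
    have h : terms (node l a b) = (bif Nat.beq l 0 then
      (terms a).map fun e => (e.1, Poly.mul [(3, Q.one)] e.2) else bif Nat.beq l 1 then [] else
        (terms a).map fun e => ((l - 2) :: e.1, e.2)) ++ terms b := rfl
    rw [h, eval_node, iha, ihb, combo_append, map_add, ← map_mul]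
    congr 2
    match l with
    | 0 =>
      simp only [Term.gen, combo, Nat.beq_refl, cond_true, List.map_map, Function.comp_def,
        Poly.ev_mul, ← Algebra.smul_def, List.smul_sum, smul_smul]
      simp
    | 1 => simp [Term.gen, combo]
    | l + 2 =>
      simp only [Term.gen, combo, Nat.beq, cond_false, List.map_map, Function.comp_def,
        List.map_cons, word_cons, ← List.sum_map_mul_left, mul_smul_comm, Nat.add_sub_cancel]

end NP

theorem CSystem.flow_add (f g : CSystem) (a : CPoly) : (f + g).flow a = f.flow a + g.flow a := by
  have hD : ∀ (n : ℕ) (a b : CPoly), cD^[n] (a + b) = cD^[n] a + cD^[n] b := by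
    intro n a b
    induction n with
    | zero => rfl
    | succ n ih => simp only [Function.iterate_succ_apply', ih, map_add]
  have h : (f + g).flow = f.flow + g.flow := by
    refine MvPolynomial.derivation_ext fun p => ?_
    rw [Derivation.add_apply, flow_X, flow_X, flow_X, ← hD]
    rfl
  rw [h, Derivation.add_apply]

theorem CSystem.flow_smul (c : ℂ) (f : CSystem) (a : CPoly) : (c • f).flow a = c • f.flow a := by
  have hD : ∀ (n : ℕ) (a : CPoly), cD^[n] (c • a) = c • cD^[n] a := by
    intro n a
    induction n with
    | zero => rfl
    | succ n ih => simp only [Function.iterate_succ_apply', ih, Derivation.map_smul]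
  have h : (c • f).flow = c • f.flow := by
    refine MvPolynomial.derivation_ext fun p => ?_
    rw [Derivation.smul_apply, flow_X, flow_X, ← hD]
    rfl
  rw [h, Derivation.smul_apply]

/-- The commutator with `f`, as a linear map. -/
def CSystem.bracketMap (f : CSystem) (k : Fin 2) : CSystem →ₗ[ℂ] CPoly where
  toFun g := f.flow (g k) - g.flow (f k)
  map_add' g h := by
    simp only [Pi.add_apply, map_add, flow_add]
    abel
  map_smul' c g := by
    simp only [Pi.smul_apply, flow_smul, RingHom.id_apply, smul_sub]
    congr 1
    exact map_smul f.flow.toLinearMap c (g k)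

def coeffMap (w : Word) : CPoly →ₗ[ℂ] ℂ where
  toFun := coeffAt w
  map_add' := coeffAt_add w
  map_smul' := coeffAt_smul w

/-- The linear functional with the given coefficients at the monomials of the equations. -/
def functional (L : List (ℕ × Word × Q)) : (Fin 2 → CPoly) →ₗ[ℂ] ℂ :=
  (L.map fun e => e.2.2.val • (coeffMap e.2.1 ∘ₗ
    LinearMap.proj (bif Nat.beq e.1 0 then (0 : Fin 2) else 1))).sum

def pairing (L : List (ℕ × Word × Q)) (p q : List (Word × Poly)) : Poly :=
  List.rec (motive := fun _ => Poly) [] (fun e _ ih => Poly.add (Poly.mul [(1, e.2.2)]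
    (classSum (bif Nat.beq e.1 0 then p else q) e.2.1)) ih) L

theorem ev_pairing {χ : ℕ →* ℂ} (L : List (ℕ × Word × Q)) (p q : List (Word × Poly)) :
    (pairing L p q).ev χ = functional L ![abelianize (combo χ p), abelianize (combo χ q)] := by
  induction L with
  | nil => rfl
  | cons e L ih =>
    have h : pairing (e :: L) p q = Poly.add (Poly.mul [(1, e.2.2)]
      (classSum (bif Nat.beq e.1 0 then p else q) e.2.1)) (pairing L p q) := rfl
    rw [h, Poly.ev_add, ih, Poly.ev_mul, Poly.ev_cons, Poly.ev_nil, map_one, mul_one, add_zero, ← coeffAt_combo, functional, functional,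
      List.map_cons, List.sum_cons, LinearMap.add_apply]
    congr 1
    cases Nat.beq e.1 0 <;> rfl

namespace Data

/-- The system with the word `w` in the equation `k` and zero in the other one. -/
def elementary (k : ℕ) (w : Word) : List Term × List Term :=
  bif Nat.beq k 0 then ([(w, 0, 1, 0)], []) else ([], [(w, 0, 1, 0)])

def admittedUpTo (d : Data) (n k : ℕ) : List Word :=
  (d.W.admitted n k).filter fun w => w.all fun l => Nat.ble l (2 * n + 1)

/-- The functional `L` of the commutator with `F` is the coefficient of the word `x` of the equation
`l` for the symmetries of order `n`. -/
def excludes (d : Data) (n : ℕ) (F : List Term × List Term) (l : ℕ) (x : Word)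
    (L : List (ℕ × Word × Q)) : Bool :=
  Nat.blt 0 d.W.p && Nat.blt 0 d.W.q && Nat.blt 0 d.W.r && [0, 1].all fun k =>
  (d.admittedUpTo n k).all fun w =>
    checkBrackets true 2 n F (elementary k w) fun p q => Cert.eqv (pairing L p.terms q.terms)
      (bif Nat.beq k l && similar x w then Poly.const 1 else [])

theorem vars_of_mem_adjoin {f : CPoly} {n : ℕ}
    (h : f ∈ Algebra.adjoin ℂ {a : CPoly | ∃ p : Letter, p.2 ≤ n ∧ a = MvPolynomial.X p})
    {m : Letter →₀ ℕ} (hm : m ∈ f.support) {p : Letter} (hp : p ∈ m.support) : p.2 ≤ n := by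
  have hs : {a : CPoly | ∃ p : Letter, p.2 ≤ n ∧ a = MvPolynomial.X p} =
      MvPolynomial.X '' {p : Letter | p.2 ≤ n} := by
    ext a
    simp only [Set.mem_ofPred_eq, Set.mem_image, eq_comm]
  rw [hs] at h
  have h : f ∈ MvPolynomial.supported ℂ {p : Letter | p.2 ≤ n} := h
  rw [MvPolynomial.mem_supported] at h
  exact h ((MvPolynomial.mem_vars_iff_mem_support _).mpr ⟨m, hm, hp⟩)

theorem sysOf_elementary {χ : ℕ →* ℂ} (hχ : χ 2 = iSqrt3) (k : Fin 2) (w : Word) :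
    (sysOf χ (elementary k w)).ab = Pi.single k (abelianize (word (w.map toLetter))) := by
  have h : combo χ [Term.toPair (w, 0, 1, 0)] = word (w.map toLetter) := by
    simp [combo, Term.toPair, Term.ev_coeff hχ]
  have h0 : combo χ [] = 0 := rfl
  funext j
  fin_cases k <;> fin_cases j <;> simp [elementary, sysOf, NSystem.ab, h, h0]


variable {d : Data} {f g : CSystem} {χ : ℕ →* ℂ} {n : ℕ}

theorem exists_word (hp : 0 < d.W.p) (hq : 0 < d.W.q) (hr : 0 < d.W.r)
    (ho : ∀ k, g k ∈ Algebra.adjoin ℂ {a | ∃ p : Letter, p.2 ≤ n ∧ a = MvPolynomial.X p})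
    (hg : ∀ e : ℝ, (d.W.bal = false → e = 0) → g.IsHomogeneous n (d.W.real e)) {k : Fin 2}
    {m : Letter →₀ ℕ} (hm : m ∈ (g k).support) : ∃ w ∈ d.admittedUpTo n k,
      Multiset.toFinsupp ((w.map toLetter : List Letter) : Multiset Letter) = m := by
  set w := (Finsupp.toMultiset m).toList with hw
  have hwm : Multiset.toFinsupp (w : Multiset Letter) = m := by
    rw [hw, Multiset.coe_toList]
    simp
  have hadm : d.W.Admits n k w := by
    refine (d.W.admits_iff hr n k w).2 fun e he => ?_
    have := degree_eq_of_coeffAt (w := w.map code) (fun τ hτ => hg e he τ hτ k) (by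
      rw [coeffAt, map_toLetter_code, hwm]
      exact MvPolynomial.mem_support_iff.mp hm)
    rwa [map_toLetter_code] at this
  refine ⟨w.map code, List.mem_filter.mpr ⟨hadm.mem hp hq hr, ?_⟩, by rw [map_toLetter_code, hwm]⟩
  refine List.all_eq_true.mpr fun l hl => Nat.ble_eq.mpr ?_
  obtain ⟨p, hp, rfl⟩ := List.mem_map.mp hl
  have := vars_of_mem_adjoin (ho k) hm (p := p) (by
    rw [← hwm, Multiset.toFinsupp_support]
    simpa using hp)
  have := p.1.isLt
  rw [code]
  omega

theorem coeffAt_eq_zero_of_excludes (hχ : χ 2 = iSqrt3) {F : List Term × List Term}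
    (hF : f = (sysOf χ F).ab) {l : Fin 2} {x : Word} {L : List (ℕ × Word × Q)}
    (h : d.excludes n F l x L = true) (hs : f.IsSymmetry g)
    (ho : ∀ k, g k ∈ Algebra.adjoin ℂ {a | ∃ p : Letter, p.2 ≤ n ∧ a = MvPolynomial.X p})
    (hg : ∀ e : ℝ, (d.W.bal = false → e = 0) → g.IsHomogeneous n (d.W.real e)) :
    coeffAt x (g l) = 0 := by
  simp only [excludes, Bool.and_eq_true] at h
  obtain ⟨⟨⟨hp, hq⟩, hr⟩, h⟩ := h
  have hp := Nat.ble_eq.mp hp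
  have hq := Nat.ble_eq.mp hq
  have hr := Nat.ble_eq.mp hr
  let Φ : CSystem →ₗ[ℂ] ℂ := functional L ∘ₗ LinearMap.pi f.bracketMap
  let Ψ : CSystem →ₗ[ℂ] ℂ := coeffMap x ∘ₗ LinearMap.proj l
  have h0 : Φ g = 0 := by
    have : LinearMap.pi f.bracketMap g = 0 := by
      funext k
      have h2 : ∀ f : CSystem, f k = f.flow (MvPolynomial.X (k, 0)) := fun f =>
        (CSystem.flow_X f (k, 0)).symm
      refine sub_eq_zero.mpr ?_
      rw [h2 g, h2 f, hs]
    rw [LinearMap.comp_apply, this, map_zero]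
  suffices key : Φ g = Ψ g from key.symm.trans h0
  have hsum : g = ∑ k, ∑ m ∈ (g k).support,
      (g k).coeff m • (Pi.single k (MvPolynomial.monomial m 1) : CSystem) := by
    funext j
    rw [Finset.sum_apply, Finset.sum_eq_single j]
    · conv_lhs => rw [(g j).as_sum]
      rw [Finset.sum_apply]
      refine Finset.sum_congr rfl fun m _ => ?_
      simp [MvPolynomial.smul_monomial]
    · intro k _ hk
      rw [Finset.sum_apply]
      exact Finset.sum_eq_zero fun m _ => by simp [hk.symm]
    · simp
  rw [hsum, map_sum, map_sum]
  refine Finset.sum_congr rfl fun k _ => ?_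
  rw [map_sum, map_sum]
  refine Finset.sum_congr rfl fun m hm => ?_
  rw [map_smul, map_smul]
  congr 1
  obtain ⟨w, hw, hwm⟩ := exists_word hp hq hr ho hg hm
  have hword : abelianize (word (w.map toLetter)) = MvPolynomial.monomial m 1 := by
    rw [abelianize_word, hwm]
  have hk : (k : ℕ) ∈ [0, 1] := by fin_cases k <;> simp
  have h1 := List.all_eq_true.mp (List.all_eq_true.mp h k hk) _ hw
  obtain ⟨p, q, hpq, e0, e1⟩ := exists_of_checkBrackets hχ h1
  have h4 : χ 4 = -3 := by
    rw [show 4 = 2 * 2 from rfl, map_mul, hχ, ← sq, iSqrt3_sq]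
  have h2 := Cert.ev_eqv h4 hpq
  rw [ev_pairing, ← NP.eval_eq_combo abelianize hχ, ← NP.eval_eq_combo abelianize hχ, e0, e1,
    sysOf_elementary hχ, ← hF, hword] at h2
  have h3 : Φ (Pi.single k (MvPolynomial.monomial m 1)) = functional L
      ![f.flow ((Pi.single k (MvPolynomial.monomial m 1) : CSystem) 0) -
        CSystem.flow (Pi.single k (MvPolynomial.monomial m 1)) (f 0),
        f.flow ((Pi.single k (MvPolynomial.monomial m 1) : CSystem) 1) -
        CSystem.flow (Pi.single k (MvPolynomial.monomial m 1)) (f 1)] := by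
    rw [LinearMap.comp_apply]
    congr 1
    funext j
    fin_cases j <;> rfl
  rw [h3, h2]
  change _ = coeffAt x ((Pi.single k (MvPolynomial.monomial m 1) : CSystem) l)
  by_cases hkl : k = l
  · subst hkl
    rw [Pi.single_eq_same, ← hword, coeffAt_word]
    rw [show Nat.beq (k : ℕ) k = true from Nat.beq_refl _, Bool.true_and]
    cases similar x w <;> simp
  · have : Nat.beq k l = false := by
      rw [Bool.eq_false_iff]
      intro h
      exact hkl (Fin.ext (Nat.eq_of_beq_eq_true h))
    rw [this, Pi.single_eq_of_ne (Ne.symm hkl)]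
    simp [coeffAt]

/-- There is no symmetry of order `n`, since the coefficients of all derivatives of order `n` in a
symmetry vanish. -/
theorem not_isHomSymmetry {k l : ℕ} {w x : Word} (hp : d.pins k l w x = true) {β : ℂ}
    (hv : d.isValid = true) (hd : d.Describes β f) (hχ : χ 2 = iSqrt3) {F : List Term × List Term}
    (hF : f = (sysOf χ F).ab) {T : List (ℕ × Word × List (ℕ × Word × Q))}
    (hT : T.all (fun e => d.excludes n F e.1 e.2.1 e.2.2) = true)
    (hn : [0, 1].all (fun k => (d.admittedUpTo n k).all fun w => w.all (fun l => Nat.blt l (2 * n)) ||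
        T.any fun e => Nat.beq e.1 k && Cert.beqN e.2.1 w) = true) (g : CSystem) :
    ¬ f.IsHomSymmetry n g := by
  rintro ⟨hs, ⟨ho, hno⟩, hh⟩
  have hg : ∀ e : ℝ, (d.W.bal = false → e = 0) → g.IsHomogeneous n (d.W.real e) :=
    fun e he => hh _ _ (isHomogeneous_of_pins hp hd he)
  refine hno fun k => ?_
  have hset : {a : CPoly | ∃ p : Letter, p.2 < n ∧ a = MvPolynomial.X p} =
      MvPolynomial.X '' {p : Letter | p.2 < n} := by
    ext a
    simp only [Set.mem_ofPred_eq, Set.mem_image, eq_comm]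
  rw [hset]
  change g k ∈ MvPolynomial.supported ℂ {p : Letter | p.2 < n}
  rw [MvPolynomial.mem_supported]
  intro p hpv
  obtain ⟨m, hm, hpm⟩ := (MvPolynomial.mem_vars_iff_mem_support _).mp hpv
  have hpos := pos_of_isValid hv
  obtain ⟨w, hw, hwm⟩ := exists_word hpos.1 hpos.2.1 hpos.2.2 ho hg hm
  have hk : (k : ℕ) ∈ [0, 1] := by fin_cases k <;> simp
  have h1 := List.all_eq_true.mp (List.all_eq_true.mp hn k hk) _ hw
  rw [Bool.or_eq_true] at h1
  rcases h1 with h1 | h1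
  · rw [← hwm, Multiset.toFinsupp_support, Multiset.mem_toFinset, Multiset.mem_coe,
      List.mem_map] at hpm
    obtain ⟨l, hl, rfl⟩ := hpm
    have h2 := Nat.ble_eq.mp (List.all_eq_true.mp h1 l hl)
    have h3 := code_toLetter l
    rw [code] at h3
    change (toLetter l).2 < n
    omega
  · exfalso
    obtain ⟨e, he, h2⟩ := List.any_eq_true.mp h1
    rw [Bool.and_eq_true] at h2
    have h3 := List.all_eq_true.mp hT e he
    obtain ⟨k', x, L⟩ := e
    obtain rfl : k' = k := Nat.eq_of_beq_eq_true h2.1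
    obtain rfl : x = w := Cert.beqN_eq h2.2
    have := coeffAt_eq_zero_of_excludes hχ hF h3 hs ho hg
    rw [coeffAt, hwm] at this
    exact MvPolynomial.mem_support_iff.mp hm this

/-- `G` is a homogeneous symmetry of `F`, noncommutative if `b` is `false`. -/
def isSymmetric (d : Data) (b : Bool) (n : ℕ) (c : ℤ) (F G : List Term × List Term) : Bool :=
  commutes b 2 n F G && (d.admitsTerms 2 F && (d.admitsTerms n G && hasOrder n c G))

theorem isHomSymmetry_of_isSymmetric {k l : ℕ} {w x : Word} (hp : d.pins k l w x = true) {β : ℂ}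
    (hd : d.Describes β f) (hχ : χ 2 = iSqrt3) {F G : List Term × List Term}
    (hF : f = (sysOf χ F).ab) {c : ℤ} (h : d.isSymmetric true n c F G = true) :
    f.IsHomSymmetry n (sysOf χ G).ab := by
  simp only [isSymmetric, Bool.and_eq_true] at h
  exact isHomSymmetry hp hd hχ h.2.2.1 h.2.2.2 (hF ▸ isSymmetry_ab_of_commutes hχ h.1)

theorem isAnalog_of_isSymmetric {k l : ℕ} {w x : Word} (hp : d.pins k l w x = true) {β : ℂ}
    (hd : d.Describes β f) (hχ : χ 2 = iSqrt3) {F : NSystem} (hf : F.ab = f) {a : ℂ} (ha : a ≠ 0)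
    {F' G : List Term × List Term} (hF : a • F = sysOf χ F') {c : ℤ}
    (h : d.isSymmetric false n c F' G = true)
    (hmin : n = 3 ∨ n = 4 ∧ ∀ g, ¬ f.IsHomSymmetry 3 g) : f.IsMinOrder n ∧ IsAnalog f F := by
  simp only [isSymmetric, Bool.and_eq_true] at h
  exact isAnalog hp hd hχ hf ha hF h.1 h.2.1 h.2.2.1 h.2.2.2 hmin

end Data

end


noncomputable section

/-! ### Scalings of the unknowns -/

section Rescale

variable (c : Fin 2 → ℂ)

/-- The substitution `u ↦ u / c 0`, `v ↦ v / c 1`. -/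
def nSubst : NPoly →ₐ[ℂ] NPoly :=
  FreeAlgebra.lift ℂ (fun p : Letter => (c p.1)⁻¹ • FreeAlgebra.ι ℂ p)

/-- The substitution `u ↦ u / c 0`, `v ↦ v / c 1`. -/
def cSubst : CPoly →ₐ[ℂ] CPoly :=
  MvPolynomial.aeval (fun p : Letter => (c p.1)⁻¹ • (MvPolynomial.X p : CPoly))

def CSystem.rescale (f : CSystem) : CSystem := fun k => c k • cSubst c (f k)

theorem nSubst_ι (p : Letter) : nSubst c (FreeAlgebra.ι ℂ p) = (c p.1)⁻¹ • FreeAlgebra.ι ℂ p := by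
  simp [nSubst]

theorem cSubst_X (p : Letter) :
    cSubst c (MvPolynomial.X p) = (c p.1)⁻¹ • (MvPolynomial.X p : CPoly) := by
  simp [cSubst]

theorem NSystem.rescale_apply (F : NSystem) (k : Fin 2) : F.rescale c k = c k • nSubst c (F k) := rfl

theorem abelianize_nSubst (a : NPoly) : abelianize (nSubst c a) = cSubst c (abelianize a) := by
  rw [← AlgHom.comp_apply, ← AlgHom.comp_apply]
  refine DFunLike.congr_fun (FreeAlgebra.hom_ext (funext fun p => ?_)) a
  simp only [Function.comp_apply, AlgHom.comp_apply, nSubst_ι, map_smul, abelianize_ι, cSubst_X]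

theorem NSystem.ab_rescale (F : NSystem) : (F.rescale c).ab = F.ab.rescale c := by
  funext k
  rw [NSystem.ab, rescale_apply, map_smul, abelianize_nSubst]
  rfl

theorem nSubst_nSubst (c' : Fin 2 → ℂ) (a : NPoly) :
    nSubst c' (nSubst c a) = nSubst (c' * c) a := by
  rw [← AlgHom.comp_apply]
  refine DFunLike.congr_fun (FreeAlgebra.hom_ext (funext fun p => ?_)) a
  simp only [Function.comp_apply, AlgHom.comp_apply, nSubst_ι, map_smul, smul_smul, Pi.mul_apply,
    mul_inv_rev]

theorem cSubst_cSubst (c' : Fin 2 → ℂ) (a : CPoly) :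
    cSubst c' (cSubst c a) = cSubst (c' * c) a := by
  rw [← AlgHom.comp_apply]
  refine DFunLike.congr_fun (MvPolynomial.algHom_ext fun p => ?_) a
  simp only [AlgHom.comp_apply, cSubst_X, map_smul, smul_smul, Pi.mul_apply, mul_inv_rev]

theorem nSubst_one (a : NPoly) : nSubst 1 a = a := by
  refine DFunLike.congr_fun (g := AlgHom.id ℂ NPoly) (FreeAlgebra.hom_ext (funext fun p => ?_)) a
  simp [nSubst_ι]

theorem cSubst_one (a : CPoly) : cSubst 1 a = a := by
  refine DFunLike.congr_fun (g := AlgHom.id ℂ CPoly) (MvPolynomial.algHom_ext fun p => ?_) a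
  simp [cSubst_X]

theorem NSystem.rescale_rescale (c' : Fin 2 → ℂ) (F : NSystem) :
    (F.rescale c).rescale c' = F.rescale (c' * c) := by
  funext k
  rw [rescale_apply, rescale_apply, map_smul, nSubst_nSubst, smul_smul, rescale_apply, Pi.mul_apply]

theorem CSystem.rescale_rescale (c' : Fin 2 → ℂ) (f : CSystem) :
    (f.rescale c).rescale c' = f.rescale (c' * c) := by
  funext k
  simp only [rescale, map_smul, cSubst_cSubst, smul_smul, Pi.mul_apply]

theorem NSystem.rescale_one (F : NSystem) : F.rescale 1 = F := by
  funext k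
  rw [rescale_apply, nSubst_one, Pi.one_apply, one_smul]

theorem CSystem.rescale_one (f : CSystem) : f.rescale 1 = f := by
  funext k
  rw [rescale, cSubst_one, Pi.one_apply, one_smul]

variable {c} (hc : ∀ k, c k ≠ 0)
include hc

theorem inv_mul_eq_one : c⁻¹ * c = 1 := funext fun k => inv_mul_cancel₀ (hc k)

theorem NSystem.rescale_inv (F : NSystem) : (F.rescale c).rescale c⁻¹ = F := by
  rw [rescale_rescale, inv_mul_eq_one hc, rescale_one]

theorem CSystem.rescale_inv (f : CSystem) : (f.rescale c).rescale c⁻¹ = f := by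
  rw [rescale_rescale, inv_mul_eq_one hc, rescale_one]

omit hc in
theorem D_nSubst (a : NPoly) : D (nSubst c a) = nSubst c (D a) := by
  induction a using FreeAlgebra.induction with
  | grade0 r =>
    have : D (algebraMap ℂ _ r) = 0 := by
      have : D 1 = 0 := by simpa using D_mul 1 1
      rw [Algebra.algebraMap_eq_smul_one, map_smul, this, smul_zero]
    rw [AlgHom.commutes, this, map_zero]
  | grade1 p => rw [nSubst_ι, map_smul, D_ι, nSubst_ι]
  | mul a b ha hb => rw [map_mul, D_mul, ha, hb, D_mul, map_add, map_mul, map_mul]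
  | add a b ha hb => rw [map_add, map_add, ha, hb, map_add, map_add]

omit hc in
theorem D_pow_nSubst (n : ℕ) (a : NPoly) : (D ^ n) (nSubst c a) = nSubst c ((D ^ n) a) := by
  induction n with
  | zero => rfl
  | succ n ih => rw [pow_succ', Module.End.mul_apply, ih, D_nSubst, Module.End.mul_apply]

theorem NSystem.flow_rescale (F : NSystem) (a : NPoly) :
    (F.rescale c).flow (nSubst c a) = nSubst c (F.flow a) := by
  induction a using FreeAlgebra.induction with
  | grade0 r =>
    have : ∀ F : NSystem, F.flow (algebraMap ℂ _ r) = 0 := by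
      intro F
      rw [Algebra.algebraMap_eq_smul_one, map_smul, flow_one, smul_zero]
    rw [AlgHom.commutes, this, this, map_zero]
  | grade1 p =>
    rw [nSubst_ι, map_smul, flow_ι, flow_ι, rescale_apply, map_smul, D_pow_nSubst, smul_smul,
      inv_mul_cancel₀ (hc p.1), one_smul]
  | mul a b ha hb => rw [map_mul, flow_mul, ha, hb, flow_mul, map_add, map_mul, map_mul]
  | add a b ha hb => rw [map_add, map_add, ha, hb, map_add, map_add]

theorem NSystem.IsSymmetry.rescale {F G : NSystem} (h : F.IsSymmetry G) :
    (F.rescale c).IsSymmetry (G.rescale c) := by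
  intro a
  have : nSubst c (nSubst c⁻¹ a) = a := by
    rw [nSubst_nSubst, mul_comm, inv_mul_eq_one hc, nSubst_one]
  rw [← this, flow_rescale hc, flow_rescale hc, flow_rescale hc, flow_rescale hc, h]

omit hc in
theorem cD_cSubst (a : CPoly) : cD (cSubst c a) = cSubst c (cD a) := by
  obtain ⟨a, rfl⟩ := abelianize_surjective a
  rw [← abelianize_nSubst, ← abelianize_D, D_nSubst, abelianize_nSubst, abelianize_D]

theorem CSystem.flow_rescale (f : CSystem) (a : CPoly) :
    (f.rescale c).flow (cSubst c a) = cSubst c (f.flow a) := by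
  obtain ⟨a, rfl⟩ := abelianize_surjective a
  choose F hF using fun k => abelianize_surjective (f k)
  have hF : NSystem.ab F = f := funext hF
  rw [← hF, ← NSystem.ab_rescale, ← abelianize_nSubst, ← abelianize_flow,
    NSystem.flow_rescale hc, abelianize_nSubst, abelianize_flow]

theorem CSystem.IsSymmetry.rescale {f g : CSystem} (h : f.IsSymmetry g) :
    (f.rescale c).IsSymmetry (g.rescale c) := by
  intro a
  have : cSubst c (cSubst c⁻¹ a) = a := by
    rw [cSubst_cSubst, mul_comm, inv_mul_eq_one hc, cSubst_one]
  rw [← this, flow_rescale hc, flow_rescale hc, flow_rescale hc, flow_rescale hc, h]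

omit hc

theorem NSystem.IsHomogeneous.rescale {F : NSystem} {μ : ℝ} {ν : Fin 2 → ℝ}
    (h : F.IsHomogeneous μ ν) : (F.rescale c).IsHomogeneous μ ν := by
  have key : ∀ τ a, nScale ν τ (nSubst c a) = nSubst c (nScale ν τ a) := by
    intro τ a
    rw [← AlgHom.comp_apply, ← AlgHom.comp_apply]
    refine DFunLike.congr_fun (FreeAlgebra.hom_ext (funext fun p => ?_)) a
    simp only [Function.comp_apply, AlgHom.comp_apply, nSubst_ι, map_smul, nScale,
      FreeAlgebra.lift_ι_apply]
    rw [smul_comm]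
  intro τ hτ k
  rw [rescale_apply, map_smul, key, h τ hτ k, map_smul, smul_comm]

theorem CSystem.IsHomogeneous.rescale {f : CSystem} {μ : ℝ} {ν : Fin 2 → ℝ}
    (h : f.IsHomogeneous μ ν) : (f.rescale c).IsHomogeneous μ ν := by
  have key : ∀ τ a, cScale ν τ (cSubst c a) = cSubst c (cScale ν τ a) := by
    intro τ a
    rw [← AlgHom.comp_apply, ← AlgHom.comp_apply]
    refine DFunLike.congr_fun (MvPolynomial.algHom_ext fun p => ?_) a
    simp only [AlgHom.comp_apply, cSubst_X, map_smul, cScale, MvPolynomial.aeval_X]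
    rw [smul_comm]
  intro τ hτ k
  rw [CSystem.rescale, map_smul, key, h τ hτ k, map_smul, smul_comm]

theorem nSubst_mem_adjoin {a : NPoly} {p : ℕ → Prop}
    (h : a ∈ Algebra.adjoin ℂ {a | ∃ l : Letter, p l.2 ∧ a = FreeAlgebra.ι ℂ l}) (b : ℂ) :
    b • nSubst c a ∈ Algebra.adjoin ℂ {a | ∃ l : Letter, p l.2 ∧ a = FreeAlgebra.ι ℂ l} := by
  refine Subalgebra.smul_mem _ ?_ b
  have := Subalgebra.mem_map.mpr ⟨a, h, (rfl : nSubst c a = nSubst c a)⟩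
  rw [AlgHom.map_adjoin] at this
  refine Algebra.adjoin_le ?_ this
  rintro _ ⟨_, ⟨l, hl, rfl⟩, rfl⟩
  change nSubst c _ ∈ _
  rw [nSubst_ι]
  have hm : FreeAlgebra.ι ℂ l ∈ Algebra.adjoin ℂ
      {a | ∃ l : Letter, p l.2 ∧ a = FreeAlgebra.ι ℂ l} := Algebra.subset_adjoin ⟨l, hl, rfl⟩
  exact Subalgebra.smul_mem _ hm _

theorem cSubst_mem_adjoin {a : CPoly} {p : ℕ → Prop}
    (h : a ∈ Algebra.adjoin ℂ {a : CPoly | ∃ l : Letter, p l.2 ∧ a = MvPolynomial.X l}) (b : ℂ) :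
    b • cSubst c a ∈ Algebra.adjoin ℂ {a : CPoly | ∃ l : Letter, p l.2 ∧ a = MvPolynomial.X l} := by
  refine Subalgebra.smul_mem _ ?_ b
  have := Subalgebra.mem_map.mpr ⟨a, h, (rfl : cSubst c a = cSubst c a)⟩
  rw [AlgHom.map_adjoin] at this
  refine Algebra.adjoin_le ?_ this
  rintro _ ⟨_, ⟨l, hl, rfl⟩, rfl⟩
  rw [cSubst_X]
  have hm : MvPolynomial.X l ∈ Algebra.adjoin ℂ
      {a : CPoly | ∃ l : Letter, p l.2 ∧ a = MvPolynomial.X l} :=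
    Algebra.subset_adjoin ⟨l, hl, rfl⟩
  exact Subalgebra.smul_mem _ hm _

include hc

theorem NSystem.HasOrder.rescale {F : NSystem} {n : ℕ} (h : F.HasOrder n) :
    (F.rescale c).HasOrder n := by
  refine ⟨fun k => nSubst_mem_adjoin (p := fun m => m ≤ n) (h.1 k) _, fun h' => h.2 fun k => ?_⟩
  rw [← F.rescale_inv hc]
  exact nSubst_mem_adjoin (p := fun m => m < n) (h' k) _

theorem CSystem.HasOrder.rescale {f : CSystem} {n : ℕ} (h : f.HasOrder n) :
    (f.rescale c).HasOrder n := by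
  refine ⟨fun k => cSubst_mem_adjoin (p := fun m => m ≤ n) (h.1 k) _, fun h' => h.2 fun k => ?_⟩
  rw [← f.rescale_inv hc]
  exact cSubst_mem_adjoin (p := fun m => m < n) (h' k) _

theorem CSystem.isHomogeneous_rescale {f : CSystem} {μ : ℝ} {ν : Fin 2 → ℝ} :
    (f.rescale c).IsHomogeneous μ ν ↔ f.IsHomogeneous μ ν :=
  ⟨fun h => f.rescale_inv hc ▸ h.rescale, fun h => h.rescale⟩

theorem CSystem.IsHomSymmetry.rescale {f g : CSystem} {n : ℕ} (h : f.IsHomSymmetry n g) :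
    (f.rescale c).IsHomSymmetry n (g.rescale c) :=
  ⟨h.1.rescale hc, h.2.1.rescale hc, fun μ ν h' =>
    (h.2.2 μ ν ((isHomogeneous_rescale hc).1 h')).rescale⟩

theorem CSystem.IsMinOrder.rescale {f : CSystem} {n : ℕ} (h : f.IsMinOrder n) :
    (f.rescale c).IsMinOrder n := by
  obtain ⟨⟨h2, g, hg⟩, h⟩ := h
  refine ⟨⟨h2, _, hg.rescale hc⟩, ?_⟩
  rintro m ⟨hm, g, hg⟩
  have := hg.rescale (c := c⁻¹) fun k => inv_ne_zero (hc k)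
  rw [f.rescale_inv hc] at this
  exact h ⟨hm, _, this⟩

theorem IsAnalog.rescale {f : CSystem} {F : NSystem} (h : IsAnalog f F) :
    IsAnalog (f.rescale c) (F.rescale c) := by
  obtain ⟨hF, hh, n, G, hn, hs, ho, hG, hg⟩ := h
  refine ⟨by rw [NSystem.ab_rescale, hF], fun μ ν h => ?_, n, G.rescale c, hn.rescale hc,
    hs.rescale hc, ho.rescale hc, fun μ ν h => ?_, ?_⟩
  · exact (hh μ ν ((CSystem.isHomogeneous_rescale hc).1 h)).rescale
  · exact (hG μ ν ((CSystem.isHomogeneous_rescale hc).1 h)).rescale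
  · rw [NSystem.ab_rescale]
    exact hg.rescale hc

theorem isAnalog_rescale {f : CSystem} {F : NSystem} :
    IsAnalog (f.rescale c) (F.rescale c) ↔ IsAnalog f F := by
  refine ⟨fun h => ?_, fun h => h.rescale hc⟩
  have := h.rescale (c := c⁻¹) fun k => inv_ne_zero (hc k)
  rwa [f.rescale_inv hc, F.rescale_inv hc] at this

end Rescale

/-! ### The involution -/

theorem abelianize_star (a : NPoly) : abelianize (star a) = abelianize a := by
  induction a using FreeAlgebra.induction with
  | grade0 r => rw [FreeAlgebra.star_algebraMap]
  | grade1 p => rw [FreeAlgebra.star_ι]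
  | mul a b ha hb => rw [star_mul, map_mul, ha, hb, map_mul, mul_comm]
  | add a b ha hb => rw [star_add, map_add, ha, hb, map_add]

theorem NSystem.ab_involution (F : NSystem) : F.involution.ab = F.ab :=
  funext fun k => abelianize_star (F k)

theorem NSystem.involution_involution (F : NSystem) : F.involution.involution = F :=
  funext fun k => star_star (F k)

theorem D_star (a : NPoly) : D (star a) = star (D a) := by
  induction a using FreeAlgebra.induction with
  | grade0 r =>
    have : D (algebraMap ℂ _ r) = 0 := by
      have : D 1 = 0 := by simpa using D_mul 1 1
      rw [Algebra.algebraMap_eq_smul_one, map_smul, this, smul_zero]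
    rw [FreeAlgebra.star_algebraMap, this, star_zero]
  | grade1 p => rw [FreeAlgebra.star_ι, D_ι, FreeAlgebra.star_ι]
  | mul a b ha hb => rw [star_mul, D_mul, ha, hb, D_mul, star_add, star_mul, star_mul, add_comm]
  | add a b ha hb => rw [star_add, map_add, ha, hb, map_add, star_add]

theorem D_pow_star (n : ℕ) (a : NPoly) : (D ^ n) (star a) = star ((D ^ n) a) := by
  induction n with
  | zero => rfl
  | succ n ih => rw [pow_succ', Module.End.mul_apply, ih, D_star, Module.End.mul_apply]

theorem NSystem.flow_involution (F : NSystem) (a : NPoly) :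
    F.involution.flow (star a) = star (F.flow a) := by
  induction a using FreeAlgebra.induction with
  | grade0 r =>
    have : ∀ F : NSystem, F.flow (algebraMap ℂ _ r) = 0 := by
      intro F
      rw [Algebra.algebraMap_eq_smul_one, map_smul, flow_one, smul_zero]
    rw [FreeAlgebra.star_algebraMap, this, this, star_zero]
  | grade1 p => rw [FreeAlgebra.star_ι, flow_ι, flow_ι, involution, D_pow_star]
  | mul a b ha hb => rw [star_mul, flow_mul, ha, hb, flow_mul, star_add, star_mul, star_mul, add_comm]
  | add a b ha hb => rw [star_add, map_add, ha, hb, map_add, star_add]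

theorem NSystem.IsSymmetry.involution {F G : NSystem} (h : F.IsSymmetry G) :
    F.involution.IsSymmetry G.involution := by
  intro a
  rw [← star_star a, flow_involution, flow_involution, flow_involution, flow_involution, h]

theorem star_smul_free (c : ℂ) (a : NPoly) : star (c • a) = c • star a := by
  rw [Algebra.smul_def, star_mul, FreeAlgebra.star_algebraMap, Algebra.smul_def]
  exact (Algebra.commutes c (star a)).symm

theorem NSystem.IsHomogeneous.involution {F : NSystem} {μ : ℝ} {ν : Fin 2 → ℝ}
    (h : F.IsHomogeneous μ ν) : F.involution.IsHomogeneous μ ν := by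
  have key : ∀ τ a, nScale ν τ (star a) = star (nScale ν τ a) := by
    intro τ a
    induction a using FreeAlgebra.induction with
    | grade0 r => rw [FreeAlgebra.star_algebraMap, AlgHom.commutes, FreeAlgebra.star_algebraMap]
    | grade1 p =>
      rw [FreeAlgebra.star_ι, nScale, FreeAlgebra.lift_ι_apply, star_smul_free, FreeAlgebra.star_ι]
    | mul a b ha hb => rw [star_mul, map_mul, ha, hb, map_mul, star_mul]
    | add a b ha hb => rw [star_add, map_add, ha, hb, map_add, star_add]
  intro τ hτ k
  rw [NSystem.involution, key, h τ hτ k, star_smul_free]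

theorem star_mem_adjoin {a : NPoly} {p : ℕ → Prop}
    (h : a ∈ Algebra.adjoin ℂ {a | ∃ l : Letter, p l.2 ∧ a = FreeAlgebra.ι ℂ l}) :
    star a ∈ Algebra.adjoin ℂ {a | ∃ l : Letter, p l.2 ∧ a = FreeAlgebra.ι ℂ l} := by
  induction h using Algebra.adjoin_induction with
  | mem x hx =>
    obtain ⟨l, hl, rfl⟩ := hx
    rw [FreeAlgebra.star_ι]
    exact Algebra.subset_adjoin ⟨l, hl, rfl⟩
  | algebraMap r =>
    rw [FreeAlgebra.star_algebraMap]
    exact Subalgebra.algebraMap_mem _ r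
  | add x y _ _ hx hy =>
    rw [star_add]
    exact Subalgebra.add_mem _ hx hy
  | mul x y _ _ hx hy =>
    rw [star_mul]
    exact Subalgebra.mul_mem _ hy hx

theorem NSystem.HasOrder.involution {F : NSystem} {n : ℕ} (h : F.HasOrder n) :
    F.involution.HasOrder n := by
  refine ⟨fun k => star_mem_adjoin (p := fun m => m ≤ n) (h.1 k), fun h' => h.2 fun k => ?_⟩
  rw [← F.involution_involution]
  exact star_mem_adjoin (p := fun m => m < n) (h' k)

theorem IsAnalog.involution {f : CSystem} {F : NSystem} (h : IsAnalog f F) :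
    IsAnalog f F.involution := by
  obtain ⟨hF, hh, n, G, hn, hs, ho, hG, hg⟩ := h
  refine ⟨by rw [F.ab_involution, hF], fun μ ν h => (hh μ ν h).involution, n, G.involution, hn,
    hs.involution, ho.involution, fun μ ν h => (hG μ ν h).involution, ?_⟩
  rwa [G.ab_involution]

/-! ### Equivalence -/

theorem isAnalog_of_equivalent {F G : NSystem} (h : Equivalent F G) (hG : IsAnalog G.ab G) :
    IsAnalog F.ab F := by
  obtain ⟨c, hc, rfl | rfl⟩ := h
  · rw [NSystem.ab_rescale]
    exact hG.rescale hc
  · rw [NSystem.ab_involution, NSystem.ab_rescale]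
    exact (hG.rescale hc).involution

theorem equivalent_rescale {F G : NSystem} {c : Fin 2 → ℂ} (hc : ∀ k, c k ≠ 0) :
    Equivalent (F.rescale c) G ↔ Equivalent F G := by
  have key : ∀ {F : NSystem} {c : Fin 2 → ℂ}, (∀ k, c k ≠ 0) → Equivalent F G →
      Equivalent (F.rescale c) G := by
    rintro F c hc ⟨c', hc', rfl | rfl⟩
    · exact ⟨c * c', fun k => mul_ne_zero (hc k) (hc' k), .inl (NSystem.rescale_rescale _ _ _)⟩
    · refine ⟨c * c', fun k => mul_ne_zero (hc k) (hc' k), .inr ?_⟩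
      rw [← NSystem.rescale_rescale]
      have : ∀ a, nSubst c (star a) = star (nSubst c a) := by
        intro a
        induction a using FreeAlgebra.induction with
        | grade0 r => rw [FreeAlgebra.star_algebraMap, AlgHom.commutes, FreeAlgebra.star_algebraMap]
        | grade1 p => rw [FreeAlgebra.star_ι, nSubst_ι, star_smul_free, FreeAlgebra.star_ι]
        | mul a b ha hb => rw [star_mul, map_mul, ha, hb, map_mul, star_mul]
        | add a b ha hb => rw [star_add, map_add, ha, hb, map_add, star_add]
      funext k
      rw [NSystem.rescale_apply, NSystem.involution, this, ← star_smul_free]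
      rfl
  refine ⟨fun h => ?_, key hc⟩
  have := key (c := c⁻¹) (fun k => inv_ne_zero (hc k)) h
  rwa [F.rescale_inv hc] at this

theorem AnalogsAre.of_rescale {f : CSystem} {c : Fin 2 → ℂ} (hc : ∀ k, c k ≠ 0)
    {l : List NSystem} (h : AnalogsAre (f.rescale c) l) : AnalogsAre f l := by
  intro F
  rw [← isAnalog_rescale hc, h, NSystem.ab_rescale]
  have h1 : F.ab.rescale c = f.rescale c ↔ F.ab = f := by
    refine ⟨fun h => ?_, fun h => by rw [h]⟩
    rw [← F.ab.rescale_inv hc, h, f.rescale_inv hc]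
  rw [h1]
  refine and_congr_right fun _ => ?_
  simp only [equivalent_rescale hc]

theorem NoAnalogs.of_rescale {f : CSystem} {c : Fin 2 → ℂ} (hc : ∀ k, c k ≠ 0)
    (h : NoAnalogs (f.rescale c)) : NoAnalogs f :=
  fun _ hF => h _ (hF.rescale hc)

end


noncomputable section

/-! ### Equality of linear combinations of words -/

/-- The coefficient of the word `w`. -/
def wordSum (L : List (Word × Poly)) (w : Word) : Poly :=
  List.rec (motive := fun _ => Poly) []
    (fun e _ ih => bif Cert.beqN e.1 w then Poly.add e.2 ih else ih) L

def negTerms (L : List (Word × Poly)) : List (Word × Poly) := L.map fun e => (e.1, e.2.neg)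

/-- The linear combinations are equal. -/
def equalCombo (L K : List (Word × Poly)) : Bool :=
  (L ++ negTerms K).all fun e => (Poly.red (wordSum (L ++ negTerms K) e.1)).isEmpty

variable {χ : ℕ →* ℂ}

theorem beqN_self (l : Word) : Cert.beqN l l = true := by
  induction l with
  | nil => rfl
  | cons a l ih =>
    have : Cert.beqN (a :: l) (a :: l) = (Nat.beq a a && Cert.beqN l l) := rfl
    rw [this, ih, show Nat.beq a a = true from Nat.beq_refl a]
    rfl

theorem repr_combo (L : List (Word × Poly)) (w : Word) :
    wordBasis.repr (combo χ L) (w.map toLetter) = (wordSum L w).ev χ := by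
  induction L with
  | nil => simp [combo, wordSum]
  | cons e L ih =>
    have h1 : wordSum (e :: L) w =
      bif Cert.beqN e.1 w then Poly.add e.2 (wordSum L w) else wordSum L w := rfl
    have h2 : combo χ (e :: L) = e.2.ev χ • word (e.1.map toLetter) + combo χ L := by simp [combo]
    rw [h1, h2, map_add, map_smul, repr_word, Finsupp.add_apply, ih, Finsupp.smul_apply]
    cases h : Cert.beqN e.1 w with
    | true =>
      rw [Cert.beqN_eq h]
      simp
    | false =>
      have : e.1.map toLetter ≠ w.map toLetter := fun h' => by
        rw [map_toLetter_injective h', beqN_self] at h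
        cases h
      simp [this]

theorem combo_negTerms (L : List (Word × Poly)) : combo χ (negTerms L) = -combo χ L := by
  induction L with
  | nil => simp [combo, negTerms]
  | cons e L ih =>
    simp only [combo, negTerms, List.map_cons, List.sum_cons, Poly.ev_neg, neg_smul, neg_add] at ih ⊢
    rw [ih]

theorem combo_eq_of_equalCombo (h4 : χ 4 = -3) {L K : List (Word × Poly)}
    (h : equalCombo L K = true) : combo χ L = combo χ K := by
  rw [← sub_eq_zero, sub_eq_add_neg, ← combo_negTerms, ← NP.combo_append]
  refine wordBasis.repr.injective (Finsupp.ext fun w => ?_)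
  rw [← map_toLetter_code w, repr_combo, map_zero, Finsupp.zero_apply]
  by_cases hw : ∃ e ∈ L ++ negTerms K, e.1 = w.map code
  · obtain ⟨e, he, hew⟩ := hw
    have := List.all_eq_true.mp h e he
    rw [← hew, ← Poly.ev_red h4]
    exact Poly.ev_isEmpty this
  · have : ∀ M : List (Word × Poly), (∀ e ∈ M, e.1 ≠ w.map code) → wordSum M (w.map code) = [] := by
      intro M hM
      induction M with
      | nil => rfl
      | cons e M ih =>
        have h1 : wordSum (e :: M) (w.map code) = bif Cert.beqN e.1 (w.map code) then
          Poly.add e.2 (wordSum M (w.map code)) else wordSum M (w.map code) := rfl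
        have h2 : Cert.beqN e.1 (w.map code) = false := by
          rw [Bool.eq_false_iff]
          exact fun h => hM e (by simp) (Cert.beqN_eq h)
        rw [h1, h2, cond_false, ih fun e he => hM e (by simp [he])]
    rw [this _ fun e he he' => hw ⟨e, he, he'⟩, Poly.ev_nil]

/-! ### Explicit expressions -/

/-- Linear combinations of words, with the operations of the free algebra. -/
structure Lin : Type where
  terms : List (Word × Poly)

namespace Lin

def mulTerms (L K : List (Word × Poly)) : List (Word × Poly) :=
  L.flatMap fun a => K.map fun b => (a.1 ++ b.1, Poly.mul a.2 b.2)

def smulTerms (p : Poly) (L : List (Word × Poly)) : List (Word × Poly) :=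
  L.map fun e => (e.1, Poly.mul p e.2)

/-- The derivatives of a word. -/
def derWord : Word → List Word
  | [] => []
  | l :: w => ((l + 2) :: w) :: (derWord w).map (l :: ·)

def derTerms (L : List (Word × Poly)) : List (Word × Poly) :=
  L.flatMap fun a => (derWord a.1).map fun w => (w, a.2)

def u (n : ℕ) : Lin := ⟨[([2 * n], Poly.const 1)]⟩

def v (n : ℕ) : Lin := ⟨[([2 * n + 1], Poly.const 1)]⟩

def D (a : Lin) : Lin := ⟨derTerms a.terms⟩

instance : Add Lin := ⟨fun a b => ⟨a.terms ++ b.terms⟩⟩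

instance : Neg Lin := ⟨fun a => ⟨negTerms a.terms⟩⟩

instance : Sub Lin := ⟨fun a b => ⟨a.terms ++ negTerms b.terms⟩⟩

instance : Mul Lin := ⟨fun a b => ⟨mulTerms a.terms b.terms⟩⟩

instance : SMul Poly Lin := ⟨fun p a => ⟨smulTerms p a.terms⟩⟩

instance : Bracket Lin Lin := ⟨fun a b => a * b - b * a⟩

instance (n : ℕ) [n.AtLeastTwo] : OfNat Lin n := ⟨⟨[([], Poly.const n)]⟩⟩

instance : Pow Lin ℕ := ⟨fun a n => Nat.rec ⟨[([], Poly.const 1)]⟩ (fun _ ih => ih * a) n⟩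

def eval (χ : ℕ →* ℂ) (a : Lin) : NPoly := combo χ a.terms

@[simp] theorem eval_u (n : ℕ) : (u n).eval χ = NonAbelian.u n := by
  simp [eval, u, combo, (toLetter_two_mul n).1, NonAbelian.u]

@[simp] theorem eval_v (n : ℕ) : (v n).eval χ = NonAbelian.v n := by
  simp [eval, v, combo, (toLetter_two_mul n).2, NonAbelian.v]

@[simp] theorem eval_add (a b : Lin) : (a + b).eval χ = a.eval χ + b.eval χ :=
  NP.combo_append _ _

@[simp] theorem eval_neg (a : Lin) : (-a).eval χ = -a.eval χ := combo_negTerms _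

@[simp] theorem eval_sub (a b : Lin) : (a - b).eval χ = a.eval χ - b.eval χ := by
  rw [sub_eq_add_neg, ← eval_neg, ← eval_add]
  rfl

@[simp] theorem eval_smul (p : Poly) (a : Lin) : (p • a).eval χ = p.ev χ • a.eval χ := by
  change combo χ (smulTerms p a.terms) = _
  simp only [eval, combo, smulTerms, List.map_map, Function.comp_def, Poly.ev_mul, List.smul_sum,
    smul_smul]

@[simp] theorem eval_mul (a b : Lin) : (a * b).eval χ = a.eval χ * b.eval χ := by
  change combo χ (mulTerms a.terms b.terms) = combo χ a.terms * combo χ b.terms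
  induction a.terms with
  | nil => simp [mulTerms, combo]
  | cons e L ih =>
    have h1 : mulTerms (e :: L) b.terms =
      (b.terms.map fun b => (e.1 ++ b.1, Poly.mul e.2 b.2)) ++ mulTerms L b.terms := rfl
    have h2 : combo χ (e :: L) = e.2.ev χ • word (e.1.map toLetter) + combo χ L := by simp [combo]
    rw [h1, NP.combo_append, ih, h2, add_mul]
    congr 1
    simp only [combo, List.map_map, Function.comp_def, Poly.ev_mul, ← List.sum_map_mul_left,
      List.map_append, word_append, smul_mul_smul_comm]

@[simp] theorem eval_lie (a b : Lin) : ⁅a, b⁆.eval χ = ⁅a.eval χ, b.eval χ⁆ := by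
  rw [Ring.lie_def, ← eval_mul, ← eval_mul, ← eval_sub]
  rfl

@[simp] theorem eval_ofNat (n : ℕ) [n.AtLeastTwo] :
    (no_index (OfNat.ofNat n) : Lin).eval χ = (OfNat.ofNat n : NPoly) := by
  change combo χ [([], Poly.const n)] = _
  simp only [combo, List.map_cons, List.map_nil, word_nil, List.sum_cons, List.sum_nil, add_zero,
    Poly.ev_const, Algebra.smul_def, mul_one, Int.cast_natCast, map_natCast]
  exact Nat.cast_ofNat

@[simp] theorem eval_pow (a : Lin) (n : ℕ) : (a ^ n).eval χ = a.eval χ ^ n := by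
  induction n with
  | zero =>
    change combo χ [([], Poly.const 1)] = _
    simp [combo]
  | succ n ih =>
    rw [pow_succ, ← ih, ← eval_mul]
    rfl

@[simp] theorem eval_D (a : Lin) : (D a).eval χ = NonAbelian.D (a.eval χ) := by
  have hw : ∀ w : Word, NonAbelian.D (word (w.map toLetter)) =
      ((derWord w).map fun x => word (x.map toLetter)).sum := by
    intro w
    induction w with
    | nil =>
      have : NonAbelian.D 1 = 0 := by simpa using D_mul 1 1
      simpa [derWord] using this
    | cons l w ih =>
      have h2 : toLetter (l + 2) = ((toLetter l).1, (toLetter l).2 + 1) := by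
        rw [← toLetter_code ((toLetter l).1, (toLetter l).2 + 1)]
        congr 1
        rw [show code ((toLetter l).1, (toLetter l).2 + 1) = code (toLetter l) + 2 by
          simp [code]; ring, code_toLetter]
      rw [List.map_cons, word_cons, D_mul, D_ι, ih, derWord, List.map_cons, List.sum_cons,
        List.map_cons, word_cons, h2, List.map_map, ← List.sum_map_mul_left]
      simp [Function.comp_def]
  change combo χ (derTerms a.terms) = NonAbelian.D (combo χ a.terms)
  induction a.terms with
  | nil => simp [derTerms, combo]
  | cons e L ih =>
    have h1 : derTerms (e :: L) = ((derWord e.1).map fun w => (w, e.2)) ++ derTerms L := rfl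
    have h2 : combo χ (e :: L) = e.2.ev χ • word (e.1.map toLetter) + combo χ L := by simp [combo]
    rw [h1, NP.combo_append, ih, h2, map_add, map_smul, hw]
    congr 1
    simp only [combo, List.map_map, Function.comp_def, List.smul_sum]

end Lin

/-- A system written as an explicit expression is given by a list of terms. -/
theorem smul_eq_sysOf (hχ : χ 2 = iSqrt3) {F : NSystem} {a b : Lin} {c : ℤ}
    {F' : List Term × List Term} (h0 : F 0 = a.eval χ) (h1 : F 1 = b.eval χ)
    (h : (equalCombo (F'.1.map Term.toPair) (Lin.smulTerms (Poly.const c) a.terms) &&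
      equalCombo (F'.2.map Term.toPair) (Lin.smulTerms (Poly.const c) b.terms)) = true) :
    (c : ℂ) • F = sysOf χ F' := by
  have h4 : χ 4 = -3 := by
    rw [show 4 = 2 * 2 from rfl, map_mul, hχ, ← sq, iSqrt3_sq]
  rw [Bool.and_eq_true] at h
  have e : ∀ a : Lin, combo χ (Lin.smulTerms (Poly.const c) a.terms) = (c : ℂ) • a.eval χ :=
    fun a => (Lin.eval_smul (Poly.const c) a).trans (by rw [Poly.ev_const])
  funext k
  fin_cases k
  · exact (congrArg _ h0).trans ((e a).symm.trans (combo_eq_of_equalCombo h4 h.1).symm)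
  · exact (congrArg _ h1).trans ((e b).symm.trans (combo_eq_of_equalCombo h4 h.2).symm)

/-! ### Comparison with the results of the classification -/

/-- The cube root of unity `(-1 + √-3) / 2`. -/
def omega : Poly := [(2, ⟨1, 0, 1⟩), (1, ⟨0, 1, 1⟩)]

def polyPow (p : Poly) (n : ℕ) : Poly :=
  Nat.rec (motive := fun _ => Poly) (Poly.const 1) (fun _ ih => Poly.mul p ih) n

/-- The scaling of `u`, `v` with the powers of the cube root of unity with the exponents `j`, `2 j`,
and the reversal of the words if `r` holds. -/
def transform (r : Bool) (j k : ℕ) (L : List (Word × Poly)) : List (Word × Poly) :=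
  L.map fun e => (bif r then e.1.reverse else e.1, Poly.mul e.2 (polyPow omega
    ((bif Nat.beq k 0 then j else 2 * j) + (e.1.map fun l => bif Nat.beq (l % 2) 0 then 2 * j else j).sum)))

/-- The scaling factors. -/
def factors (χ : ℕ →* ℂ) (j : ℕ) : Fin 2 → ℂ := ![omega.ev χ ^ j, omega.ev χ ^ (2 * j)]

theorem ev_polyPow (p : Poly) (n : ℕ) : (polyPow p n).ev χ = p.ev χ ^ n := by
  induction n with
  | zero => simp [polyPow]
  | succ n ih =>
    have : polyPow p (n + 1) = Poly.mul p (polyPow p n) := rfl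
    rw [this, Poly.ev_mul, ih, pow_succ']

theorem omega_cube (hχ : χ 2 = iSqrt3) : omega.ev χ ^ 3 = 1 := by
  have h : omega.ev χ = (iSqrt3 - 1) / 2 := by
    simp [omega, Q.val, hχ]
    ring
  rw [h]
  linear_combination ((iSqrt3 - 3) / 8) * iSqrt3_sq

theorem factors_ne_zero (hχ : χ 2 = iSqrt3) (j : ℕ) (k : Fin 2) : factors χ j k ≠ 0 := by
  have : omega.ev χ ≠ 0 := fun h => by simpa [h] using omega_cube hχ
  fin_cases k
  · exact pow_ne_zero _ this
  · exact pow_ne_zero _ this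

theorem factors_inv (hχ : χ 2 = iSqrt3) (j l : ℕ) : (factors χ j (toLetter l).1)⁻¹ =
    omega.ev χ ^ (bif Nat.beq (l % 2) 0 then 2 * j else j) := by
  refine inv_eq_of_mul_eq_one_right ?_
  have h3 : ∀ m, omega.ev χ ^ (3 * m) = 1 := fun m => by rw [pow_mul, omega_cube hχ, one_pow]
  rcases Nat.even_or_odd' l with ⟨i, rfl | rfl⟩
  · have : Nat.beq (2 * i % 2) 0 = true := by simp
    rw [this, (toLetter_two_mul i).1]
    change omega.ev χ ^ j * omega.ev χ ^ (2 * j) = 1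
    rw [← pow_add, ← h3 j]
    ring
  · have : Nat.beq ((2 * i + 1) % 2) 0 = false := by
      rw [show (2 * i + 1) % 2 = 1 by omega]
      rfl
    rw [this, (toLetter_two_mul i).2]
    change omega.ev χ ^ (2 * j) * omega.ev χ ^ j = 1
    rw [← pow_add, ← h3 j]
    ring

theorem lift_smul_word (c : Letter → ℂ) (w : List Letter) :
    FreeAlgebra.lift ℂ (fun p => c p • FreeAlgebra.ι ℂ p) (word w) = (w.map c).prod • word w := by
  induction w with
  | nil => simp
  | cons p w ih =>
    rw [word_cons, map_mul, ih, FreeAlgebra.lift_ι_apply, smul_mul_smul_comm, List.map_cons,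
      List.prod_cons]

theorem star_word (w : List Letter) : star (word w) = word w.reverse := by
  induction w with
  | nil => simp
  | cons p w ih =>
    rw [word_cons, star_mul, ih, FreeAlgebra.star_ι, List.reverse_cons, word_append]
    simp

theorem combo_transform (hχ : χ 2 = iSqrt3) (r : Bool) (j : ℕ) (k : Fin 2)
    (L : List (Word × Poly)) : combo χ (transform r j k L) =
      bif r then star (factors χ j k • FreeAlgebra.lift ℂ (fun p : Letter =>
        (factors χ j p.1)⁻¹ • FreeAlgebra.ι ℂ p) (combo χ L)) else
      factors χ j k • FreeAlgebra.lift ℂ (fun p : Letter =>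
        (factors χ j p.1)⁻¹ • FreeAlgebra.ι ℂ p) (combo χ L) := by
  have hk : factors χ j k = omega.ev χ ^ (bif Nat.beq k 0 then j else 2 * j) := by
    fin_cases k <;> rfl
  have hw : ∀ w : Word, ((w.map toLetter).map fun p : Letter => (factors χ j p.1)⁻¹).prod =
      omega.ev χ ^ (w.map fun l => bif Nat.beq (l % 2) 0 then 2 * j else j).sum := by
    intro w
    induction w with
    | nil => simp
    | cons l w ih =>
      simp only [List.map_cons, List.prod_cons, List.sum_cons, pow_add, factors_inv hχ] at ih ⊢
      rw [ih]
  induction L with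
  | nil => cases r <;> simp [transform, combo]
  | cons e L ih =>
    have h2 : combo χ (e :: L) = e.2.ev χ • word (e.1.map toLetter) + combo χ L := by simp [combo]
    have h1 : combo χ (transform r j k (e :: L)) = (Poly.mul e.2 (polyPow omega
        ((bif Nat.beq k 0 then j else 2 * j) +
          (e.1.map fun l => bif Nat.beq (l % 2) 0 then 2 * j else j).sum))).ev χ •
        word ((bif r then e.1.reverse else e.1).map toLetter) + combo χ (transform r j k L) := by
      simp [combo, transform]
    rw [h1, ih, h2, map_add, map_smul, lift_smul_word (fun p => (factors χ j p.1)⁻¹), hw,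
      Poly.ev_mul, ev_polyPow, pow_add, ← hk]
    cases r with
    | true =>
      simp only [cond_true, smul_add, star_add, star_smul_free, star_word, smul_smul,
        List.map_reverse]
      congr 2
      ring
    | false =>
      simp only [cond_false, smul_add, smul_smul]
      congr 2
      ring

/-- The candidate `(F, c, F')`, where `c • F` has the list of terms `F'`, is the result `T` of the
classification up to the scaling with the exponent `j` and the involution. -/
def isMatch (T : Cert.Sys) (e : NSystem × ℤ × (List Term × List Term)) (r : Bool) (j : ℕ) : Bool :=
  equalCombo (Lin.smulTerms (Poly.const e.2.1) (([4], Poly.const 1) :: T.1))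
    (transform r j 0 (e.2.2.1.map Term.toPair)) &&
  equalCombo (Lin.smulTerms (Poly.const e.2.1) (([5], Poly.const (-1)) :: T.2))
    (transform r j 1 (e.2.2.2.map Term.toPair))

theorem eq_of_isMatch (hχ : χ 2 = iSqrt3) {T : Cert.Sys}
    {e : NSystem × ℤ × (List Term × List Term)} {r : Bool} {j : ℕ} (h : isMatch T e r j = true)
    (he : (e.2.1 : ℂ) • e.1 = sysOf χ e.2.2) (hne : e.2.1 ≠ 0) {F : NSystem}
    (h0 : F 0 = u 2 + combo χ T.1) (h1 : F 1 = -v 2 + combo χ T.2) :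
    F = (bif r then (e.1.rescale (factors χ j)).involution else e.1.rescale (factors χ j)) := by
  have h4 : χ 4 = -3 := by
    rw [show 4 = 2 * 2 from rfl, map_mul, hχ, ← sq, iSqrt3_sq]
  have hne' : (e.2.1 : ℂ) ≠ 0 := by exact_mod_cast hne
  rw [isMatch, Bool.and_eq_true] at h
  have e0 := combo_eq_of_equalCombo h4 h.1
  have e1 := combo_eq_of_equalCombo h4 h.2
  have hl : ∀ L : List (Word × Poly), combo χ (Lin.smulTerms (Poly.const e.2.1) L) =
      (e.2.1 : ℂ) • combo χ L :=
    fun L => (Lin.eval_smul (Poly.const e.2.1) ⟨L⟩).trans (by rw [Poly.ev_const]; rfl)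
  have f0 : combo χ (([4], Poly.const 1) :: T.1) = F 0 := by
    rw [h0]
    simp [combo, (toLetter_two_mul 2).1, u]
  have f1 : combo χ (([5], Poly.const (-1)) :: T.2) = F 1 := by
    rw [h1]
    simp [combo, (toLetter_two_mul 2).2, v]
  have g : ∀ k, combo χ ((![e.2.2.1, e.2.2.2] k).map Term.toPair) = (e.2.1 : ℂ) • e.1 k := by
    intro k
    have := congrFun he k
    rw [Pi.smul_apply] at this
    rw [this]
    fin_cases k <;> rfl
  have key : ∀ k : Fin 2, (e.2.1 : ℂ) • F k = (e.2.1 : ℂ) •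
      (bif r then (e.1.rescale (factors χ j)).involution else e.1.rescale (factors χ j)) k := by
    intro k
    have h5 : (e.2.1 : ℂ) • F k =
        combo χ (transform r j k ((![e.2.2.1, e.2.2.2] k).map Term.toPair)) := by
      fin_cases k
      · exact (congrArg _ f0.symm).trans ((hl _).symm.trans e0)
      · exact (congrArg _ f1.symm).trans ((hl _).symm.trans e1)
    rw [h5, combo_transform hχ, g]
    cases r with
    | true =>
      simp only [cond_true, map_smul, star_smul_free, NSystem.involution, NSystem.rescale]
      rw [smul_comm]
    | false =>
      simp only [cond_false, map_smul, NSystem.rescale]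
      rw [smul_comm]
  funext k
  exact smul_right_injective _ hne' (key k)

def matchesAll (targets : List Cert.Sys) (cands : List (NSystem × ℤ × (List Term × List Term)))
    (js : List ℕ) : Bool :=
  targets.all fun T => cands.any fun e => js.any fun j =>
    isMatch T e false j || isMatch T e true j

theorem exists_of_matchesAll (hχ : χ 2 = iSqrt3) {targets : List Cert.Sys}
    {cands : List (NSystem × ℤ × (List Term × List Term))} {js : List ℕ}
    (h : matchesAll targets cands js = true)
    (hc : ∀ e ∈ cands, e.2.1 ≠ 0 ∧ (e.2.1 : ℂ) • e.1 = sysOf χ e.2.2) {F : NSystem}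
    (hT : ∃ T ∈ targets, F 0 = u 2 + combo χ T.1 ∧ F 1 = -v 2 + combo χ T.2) :
    ∃ e ∈ cands, ∃ j ∈ js, F = e.1.rescale (factors χ j) ∨
      F = (e.1.rescale (factors χ j)).involution := by
  obtain ⟨T, hT, h0, h1⟩ := hT
  have h2 := List.all_eq_true.mp h T hT
  obtain ⟨e, he, h3⟩ := List.any_eq_true.mp h2
  obtain ⟨j, hj, h4⟩ := List.any_eq_true.mp h3
  obtain ⟨hne, hs⟩ := hc e he
  rw [Bool.or_eq_true] at h4
  refine ⟨e, he, j, hj, ?_⟩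
  rcases h4 with h4 | h4
  · exact .inl (eq_of_isMatch hχ h4 hs hne h0 h1)
  · exact .inr (eq_of_isMatch hχ h4 hs hne h0 h1)

/-! ### Scalar reductions -/

/-- The scalar reductions of the linear combinations are equal for the value `b` of the parameter. -/
def equalAb (b : ℤ) (L K : List (Word × Poly)) : Bool :=
  (L ++ negTerms K).all fun e => (Poly.red (Poly.subst 3 (bif decide (b = 0) then [] else Poly.const b)
    (classSum (L ++ negTerms K) e.1))).isEmpty

theorem abelianize_eq_of_equalAb (h4 : χ 4 = -3) {b : ℤ} (hb : χ 3 = b)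
    {L K : List (Word × Poly)} (h : equalAb b L K = true) :
    abelianize (combo χ L) = abelianize (combo χ K) := by
  have hL : ∀ (M : List (Word × Poly)) (w : Word), (∀ e ∈ M, similar w e.1 = false) →
      classSum M w = [] := by
    intro M w hM
    induction M with
    | nil => rfl
    | cons e M ih =>
      have h1 : classSum (e :: M) w =
        bif similar w e.1 then Poly.add e.2 (classSum M w) else classSum M w := rfl
      rw [h1, hM e (by simp), cond_false, ih fun e he => hM e (by simp [he])]
  have hcong : ∀ (M : List (Word × Poly)) (w x : Word), similar w x = true →
      classSum M w = classSum M x := by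
    intro M w x hx
    induction M with
    | nil => rfl
    | cons e M ih =>
      have h1 : ∀ w, classSum (e :: M) w =
        bif similar w e.1 then Poly.add e.2 (classSum M w) else classSum M w := fun _ => rfl
      have h2 : similar w e.1 = similar x e.1 := by
        have := List.isPerm_iff.mp hx
        rw [similar, similar, Bool.eq_iff_iff, List.isPerm_iff, List.isPerm_iff]
        exact ⟨this.symm.trans, this.trans⟩
      rw [h1, h1, h2, ih]
  rw [← sub_eq_zero, ← map_sub, sub_eq_add_neg, ← combo_negTerms, ← NP.combo_append]
  refine MvPolynomial.ext _ _ fun m => ?_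
  rw [MvPolynomial.coeff_zero]
  have hm : m = Multiset.toFinsupp
      ((((Finsupp.toMultiset m).toList.map code).map toLetter : List Letter) : Multiset Letter) := by
    rw [map_toLetter_code, Multiset.coe_toList]
    simp
  set w := (Finsupp.toMultiset m).toList.map code
  rw [hm]
  change coeffAt w _ = 0
  rw [coeffAt_combo]
  by_cases hw : ∃ e ∈ L ++ negTerms K, similar w e.1 = true
  · obtain ⟨e, he, hew⟩ := hw
    have := List.all_eq_true.mp h e he
    have hb' : χ 3 = Poly.ev χ (bif decide (b = 0) then [] else Poly.const b) := by
      rw [hb]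
      by_cases h : b = 0 <;> simp [h]
    rw [hcong _ _ _ hew, ← Poly.ev_subst χ hb', ← Poly.ev_red h4]
    exact Poly.ev_isEmpty this
  · rw [hL _ _ fun e he => by
      rw [Bool.eq_false_iff]
      exact fun h => hw ⟨e, he, h⟩, Poly.ev_nil]

theorem Data.ab_eq_of_equalAb (hχ : χ 2 = iSqrt3) {b : ℤ} (hb : χ 3 = b) {d : Data} {f : CSystem}
    (hd : d.Describes b f) {F : NSystem} {c : ℤ} (hc : c ≠ 0) {F' : List Term × List Term}
    (hF : (c : ℂ) • F = sysOf χ F')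
    (h : (equalAb b (F'.1.map Term.toPair) (Lin.smulTerms (Poly.const c) d.f.1) &&
      equalAb b (F'.2.map Term.toPair) (Lin.smulTerms (Poly.const c) d.f.2)) = true) :
    F.ab = f := by
  have h4 : χ 4 = -3 := by
    rw [show 4 = 2 * 2 from rfl, map_mul, hχ, ← sq, iSqrt3_sq]
  have hc' : (c : ℂ) ≠ 0 := by exact_mod_cast hc
  rw [Bool.and_eq_true] at h
  have hl : ∀ L : List (Word × Poly), combo χ (Lin.smulTerms (Poly.const c) L) =
      (c : ℂ) • combo χ L :=
    fun L => (Lin.eval_smul (Poly.const c) ⟨L⟩).trans (by rw [Poly.ev_const]; rfl)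
  obtain ⟨e0, e1⟩ := hd χ hb
  have h0 := abelianize_eq_of_equalAb h4 hb h.1
  have h1 := abelianize_eq_of_equalAb h4 hb h.2
  rw [hl, map_smul, ← e0] at h0
  rw [hl, map_smul, ← e1] at h1
  have key : ∀ k, (c : ℂ) • F.ab k = (c : ℂ) • f k := by
    intro k
    have : (c : ℂ) • F.ab k = abelianize (sysOf χ F' k) := by
      rw [← hF, Pi.smul_apply, map_smul]
      rfl
    rw [this]
    fin_cases k
    · exact h0
    · exact h1
  funext k
  exact smul_right_injective _ hc' (key k)

theorem Data.eq_ab_sysOf (hχ : χ 2 = iSqrt3) {β : ℂ} (hb : χ 3 = β) {d : Data} {f : CSystem}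
    (hd : d.Describes β f) {F' : List Term × List Term}
    (h : (equalCombo d.f.1 (F'.1.map Term.toPair) && equalCombo d.f.2 (F'.2.map Term.toPair)) =
      true) : f = (sysOf χ F').ab := by
  have h4 : χ 4 = -3 := by
    rw [show 4 = 2 * 2 from rfl, map_mul, hχ, ← sq, iSqrt3_sq]
  rw [Bool.and_eq_true] at h
  obtain ⟨e0, e1⟩ := hd χ hb
  funext k
  fin_cases k
  · exact e0.trans (congrArg _ (combo_eq_of_equalCombo h4 h.1))
  · exact e1.trans (congrArg _ (combo_eq_of_equalCombo h4 h.2))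

end


noncomputable section

/-! ### Codes of certificates and of systems with undetermined coefficients -/

namespace Cert

def decodeEntry (e : ℕ) : ℕ × ℕ × ℕ :=
  bif Nat.beq (e % 4) 0 then (2, 0, e / 4) else
  bif Nat.beq (e % 4) 1 then (1, 0, e / 4) else
  bif Nat.beq (e % 4) 2 then (e / 4 % 16, e / 64 % 16, e / 1024) else
    seqN (2 ^ (e / 4 % 256)) fun w => seqN (e / 1024) fun r => (r % w, r / w % w, r / (w * w))

def decodeTerm (e : ℕ) : ℕ × Q :=
  bif Nat.beq (e % 2) 0 then
    (e / 256, (Q.ofInt (Pt.unzigzag (e / 2 % 128))))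
  else seqN (2 ^ (e / 2 % 256)) fun w => seqN (e / 512) fun r =>
    (r / (w * w), { Q.ofInt (Pt.unzigzag (r % w)) with den := r / w % w })

/-- Two polynomials and a stack of certificates. -/
abbrev State : Type := Poly × Poly × List Cert

def pushEntry (e : ℕ × ℕ × ℕ) (s : State) : State :=
  match s with
  | (p, q, eval L t :: r) => (p, q, eval (e :: L) t :: r)
  | (p, q, t :: r) => (p, q, eval [e] t :: r)
  | (p, q, []) => (p, q, [])

def pushNode (n : ℕ) (s : State) : State :=
  match n, s with
  | 0, (p, _, r) => ([], p, r)
  | 1, (p, q, t₁ :: t₂ :: r) => ([], [], split p q t₁ t₂ :: r)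
  | 2, (p, _, t :: r) => ([], [], mul p t :: r)
  | 3, ((_, c) :: _, q, t :: r) => ([], [], root c q t :: r)
  | 4, (p, q, r) => (p, q, contra :: r)
  | n + 5, (p, q, r) => (p, q, leaf n :: r)
  | _, s => s

/-- One step of the decoding of a certificate, from the last number to the first. -/
def step (n : ℕ) (s : State) : State :=
  bif Nat.beq (n % 4) 0 then pushEntry (decodeEntry (n / 4)) s else
  bif Nat.beq (n % 4) 1 then
    match s with
    | (p, q, t :: r) => (p, q, solve (n / 4) t :: r)
    | s => s
  else bif Nat.beq (n % 4) 2 then (decodeTerm (n / 4) :: s.1, s.2) else pushNode (n / 4) s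

/-- The certificate with the given code. -/
def decode (L : List ℕ) : Cert :=
  match (L.foldr step ([], [], [])).2.2 with
  | [] => contra
  | t :: _ => t

end Cert

namespace Data

/-- The words of `L` with undetermined coefficients, such that the scalar reduction is `f`. -/
def fill (f : List (Word × Poly)) (L : List (Word × ℕ)) : List (Word × Poly) :=
  L.map fun e => (e.1,
    match L.filter fun e' => similar e.1 e'.1 with
    | [] => []
    | e' :: K => bif Nat.beq e.2 e'.2 then
        K.foldl (fun p e' => (e'.2, ⟨0, 1, 0⟩) :: p) (classSum f e.1)
      else [(e.2, ⟨1, 0, 0⟩)])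

/-- The data with the words of the codes `L₀` and `L₁`. -/
def ofWords (W : Weights) (f : List (Word × Poly) × List (Word × Poly)) (L₀ L₁ : List ℕ) : Data :=
  ⟨W, f, (fill f.1 ((L₀.map (Term.decodeWord 16)).zip primes),
    fill f.2 ((L₁.map (Term.decodeWord 16)).zip (primes.drop L₀.length)))⟩

/-- The coefficients of `F`, divided by `c + 1`, for the words of the data. -/
def target (d : Data) (c : ℕ) (r : Bool) (j : ℕ) (F : List Term × List Term) : Cert.Sys :=
  let T (k : ℕ) (L : List (Word × Poly)) (K : List Term) :=
    (Trie.ofList (L.map fun e => (e.1, Poly.red (wordSum (Lin.smulTerms [(1, ⟨1, 0, c⟩)]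
      (transform r j k (K.map Term.toPair))) e.1)))).terms
  (T 0 d.F.1 F.1, T 1 d.F.2 F.2)

def dataS1 : Data := ofWords ⟨1, 1, 1, true⟩
    ([([4], [(1, ⟨1, 0, 0⟩)]), ([0, 0, 1], [(1, ⟨2, 0, 0⟩)])], [([5], [(1, ⟨0, 1, 0⟩)]), ([0, 1,
    1], [(1, ⟨0, 2, 0⟩)])])
    [529, 289, 274]
    [545, 530, 290]

theorem isValid_dataS1 : dataS1.isValid = true := by decide +kernel

theorem orderCheck_dataS1 : dataS1.orderCheck 3 = true := by decide +kernel

def dataS2 : Data := ofWords ⟨1, 1, 1, false⟩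
    ([([4], [(1, ⟨1, 0, 0⟩)]), ([0, 2], [(1, ⟨2, 0, 0⟩)]), ([0, 3], [(1, ⟨2, 0, 0⟩)]), ([1, 2],
    [(1, ⟨2, 0, 0⟩)])], [([5], [(1, ⟨0, 1, 0⟩)]), ([0, 3], [(1, ⟨2, 0, 0⟩)]), ([1, 2], [(1, ⟨2, 0,
    0⟩)]), ([1, 3], [(1, ⟨2, 0, 0⟩)])])
    [273, 529, 289, 545, 49, 65, 274, 530, 290, 546, 50, 66, 19, 35, 20, 36, 6]
    [273, 529, 289, 545, 49, 65, 274, 530, 290, 546, 50, 66, 19, 35, 20, 36, 5]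

theorem isValid_dataS2 : dataS2.isValid = true := by decide +kernel

theorem orderCheck_dataS2 : dataS2.orderCheck 3 = true := by decide +kernel

def dataS3 : Data := ofWords ⟨2, 1, 1, false⟩
    ([([4], [(1, ⟨1, 0, 0⟩)]), ([0, 3], [(1, ⟨2, 0, 0⟩)]), ([1, 2], [(1, ⟨2, 0, 0⟩)])], [([5], [(1,
    ⟨0, 1, 0⟩)]), ([1, 3], [(1, ⟨2, 0, 0⟩)]), ([2], [(1, ⟨2, 0, 0⟩)])])
    [17, 545, 65, 530, 290, 8738, 1058, 50, 578, 98, 35, 20, 548, 68, 38, 8]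
    [33, 18, 546, 66, 3, 36]

theorem isValid_dataS3 : dataS3.isValid = true := by decide +kernel

theorem orderCheck_dataS3 : dataS3.orderCheck 3 = true := by decide +kernel

def dataS4 : Data := ofWords ⟨1, 1, 1, false⟩
    ([([4], [(1, ⟨1, 0, 0⟩)]), ([0, 2], [(1, ⟨2, 0, 0⟩)]), ([1, 2], [(1, ⟨2, 0, 0⟩)])], [([5], [(1,
    ⟨0, 1, 0⟩)]), ([0, 3], [(1, ⟨2, 0, 0⟩)]), ([1, 3], [(1, ⟨2, 0, 0⟩)])])
    [273, 529, 289, 545, 49, 65, 274, 530, 290, 546, 50, 66, 19, 35, 20, 36, 6]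
    [273, 529, 289, 545, 49, 65, 274, 530, 290, 546, 50, 66, 19, 35, 20, 36, 5]

theorem isValid_dataS4 : dataS4.isValid = true := by decide +kernel

theorem orderCheck_dataS4 : dataS4.orderCheck 3 = true := by decide +kernel

def dataS5 : Data := ofWords ⟨1, 1, 2, true⟩
    ([([4], [(1, ⟨1, 0, 0⟩)]), ([0, 0, 0, 1, 1], [(3, ⟨1, 0, 0⟩), (1, ⟨0, 2, 0⟩)]), ([0, 0, 3],
    [(1, ⟨2, 0, 0⟩)]), ([0, 1, 2], [(3, ⟨2, 0, 0⟩)])], [([5], [(1, ⟨0, 1, 0⟩)]), ([0, 0, 1, 1, 1],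
    [(3, ⟨0, 1, 0⟩), (1, ⟨2, 0, 0⟩)]), ([0, 1, 3], [(3, ⟨2, 0, 0⟩)]), ([1, 1, 2], [(1, ⟨2, 0,
    0⟩)])])
    [139537, 135697, 74257, 1041, 135457, 74017, 70177, 801, 561, 321, 135442, 74002, 70162, 786,
    69922, 306, 531, 291, 276]
    [139793, 139553, 135713, 74273, 1057, 577, 139538, 135698, 74258, 1042, 135458, 74018, 70178,
    802, 562, 322, 547, 532, 292]

theorem isValid_dataS5 : dataS5.isValid = true := by decide +kernel

theorem orderCheck_dataS5 : dataS5.orderCheck 3 = true := by decide +kernel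

def dataS501 : Data := ofWords ⟨1, 1, 2, true⟩
    ([([4], [(1, ⟨1, 0, 0⟩)]), ([0, 1, 2], [(1, ⟨2, 0, 0⟩)])], [([5], [(1, ⟨0, 1, 0⟩)]), ([0, 1,
    3], [(1, ⟨2, 0, 0⟩)])])
    [139537, 135697, 74257, 1041, 135457, 74017, 70177, 801, 561, 321, 135442, 74002, 70162, 786,
    69922, 306, 531, 291, 276]
    [139793, 139553, 135713, 74273, 1057, 577, 139538, 135698, 74258, 1042, 135458, 74018, 70178,
    802, 562, 322, 547, 532, 292]

theorem isValid_dataS501 : dataS501.isValid = true := by decide +kernel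

theorem orderCheck_dataS501 : dataS501.orderCheck 3 = true := by decide +kernel

def dataB1 : Data := ofWords ⟨2, 2, 1, false⟩
    ([([4], [(1, ⟨1, 0, 0⟩)]), ([0, 0], [(1, ⟨1, 0, 0⟩)]), ([0, 1], [(1, ⟨2, 0, 0⟩)]), ([1, 1],
    [(1, ⟨1, 0, 0⟩)])], [([5], [(1, ⟨0, 1, 0⟩)]), ([0, 0], [(1, ⟨0, 1, 0⟩)]), ([0, 1], [(1, ⟨0, 2,
    0⟩)]), ([1, 1], [(1, ⟨0, 1, 0⟩)])])
    [17, 33, 18, 34, 6]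
    [17, 33, 18, 34, 5]

theorem isValid_dataB1 : dataB1.isValid = true := by decide +kernel

theorem orderCheck_dataB1_3 : dataB1.orderCheck 3 = true := by decide +kernel

theorem orderCheck_dataB1_4 : dataB1.orderCheck 4 = true := by decide +kernel

def dataB2 : Data := ofWords ⟨3, 2, 1, false⟩
    ([([4], [(1, ⟨1, 0, 0⟩)]), ([1, 3], [(1, ⟨2, 0, 0⟩)])], [([5], [(1, ⟨0, 1, 0⟩)]), ([2], [(1,
    ⟨1, 0, 0⟩)])])
    [33, 18, 66, 36, 8]
    [34, 3]

theorem isValid_dataB2 : dataB2.isValid = true := by decide +kernel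

theorem orderCheck_dataB2 : dataB2.orderCheck 4 = true := by decide +kernel

def dataB3 : Data := ofWords ⟨1, 1, 1, false⟩
    ([([4], [(1, ⟨1, 0, 0⟩)]), ([0, 0, 0], [(1, ⟨0, 6, 0⟩)]), ([0, 0, 1], [(1, ⟨0, 18, 0⟩)]), ([0,
    1, 1], [(1, ⟨0, 18, 0⟩)]), ([0, 3], [(1, ⟨6, 0, 0⟩)]), ([1, 1, 1], [(1, ⟨0, 6, 0⟩)]), ([1, 3],
    [(1, ⟨6, 0, 0⟩)])], [([5], [(1, ⟨0, 1, 0⟩)]), ([0, 0, 0], [(1, ⟨6, 0, 0⟩)]), ([0, 0, 1], [(1,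
    ⟨18, 0, 0⟩)]), ([0, 1, 1], [(1, ⟨18, 0, 0⟩)]), ([0, 2], [(1, ⟨6, 0, 0⟩)]), ([1, 1, 1], [(1,
    ⟨6, 0, 0⟩)]), ([1, 2], [(1, ⟨6, 0, 0⟩)])])
    [273, 529, 289, 545, 49, 65, 274, 530, 290, 546, 50, 66, 19, 35, 20, 36, 6]
    [273, 529, 289, 545, 49, 65, 274, 530, 290, 546, 50, 66, 19, 35, 20, 36, 5]

theorem isValid_dataB3 : dataB3.isValid = true := by decide +kernel

theorem orderCheck_dataB3 : dataB3.orderCheck 4 = true := by decide +kernel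

def dataB4 : Data := ofWords ⟨1, 1, 1, false⟩
    ([([4], [(1, ⟨1, 0, 0⟩)]), ([1, 3], [(1, ⟨2, 0, 0⟩)])], [([5], [(1, ⟨0, 1, 0⟩)]), ([0, 2], [(1,
    ⟨2, 0, 0⟩)])])
    [273, 529, 289, 545, 49, 65, 274, 530, 290, 546, 50, 66, 19, 35, 20, 36, 6]
    [273, 529, 289, 545, 49, 65, 274, 530, 290, 546, 50, 66, 19, 35, 20, 36, 5]

theorem isValid_dataB4 : dataB4.isValid = true := by decide +kernel

theorem orderCheck_dataB4 : dataB4.orderCheck 4 = true := by decide +kernel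

def dataL1 : Data := ofWords ⟨1, 1, 1, false⟩
    ([([4], [(1, ⟨1, 0, 0⟩)]), ([0, 0, 1], [(1, ⟨2, 0, 0⟩)]), ([0, 1, 1], [(1, ⟨2, 0, 0⟩)]), ([0,
    2], [(1, ⟨2, 0, 0⟩)]), ([0, 3], [(1, ⟨2, 0, 0⟩)]), ([1, 2], [(1, ⟨2, 0, 0⟩)])], [([5], [(1,
    ⟨0, 1, 0⟩)]), ([0, 0, 1], [(1, ⟨0, 2, 0⟩)]), ([0, 1, 1], [(1, ⟨0, 2, 0⟩)]), ([0, 3], [(1, ⟨0,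
    2, 0⟩)]), ([1, 2], [(1, ⟨0, 2, 0⟩)]), ([1, 3], [(1, ⟨0, 2, 0⟩)])])
    [273, 529, 289, 545, 49, 65, 274, 530, 290, 546, 50, 66, 19, 35, 20, 36, 6]
    [273, 529, 289, 545, 49, 65, 274, 530, 290, 546, 50, 66, 19, 35, 20, 36, 5]

theorem isValid_dataL1 : dataL1.isValid = true := by decide +kernel

theorem orderCheck_dataL1 : dataL1.orderCheck 3 = true := by decide +kernel

def dataL2 : Data := ofWords ⟨2, 1, 1, false⟩
    ([([4], [(1, ⟨1, 0, 0⟩)]), ([0, 0], [(1, ⟨1, 0, 0⟩)]), ([0, 1, 1], [(1, ⟨2, 0, 0⟩)]), ([0, 3],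
    [(1, ⟨2, 0, 0⟩)]), ([1, 2], [(1, ⟨2, 0, 0⟩)])], [([5], [(1, ⟨0, 1, 0⟩)]), ([1, 3], [(1, ⟨0, 2,
    0⟩)]), ([2], [(1, ⟨0, 1, 0⟩)])])
    [17, 545, 65, 530, 290, 8738, 1058, 50, 578, 98, 35, 20, 548, 68, 38, 8]
    [33, 18, 546, 66, 3, 36]

theorem isValid_dataL2 : dataL2.isValid = true := by decide +kernel

theorem orderCheck_dataL2 : dataL2.orderCheck 3 = true := by decide +kernel

def dataL3 : Data := ofWords ⟨1, 1, 2, true⟩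
    ([([4], [(1, ⟨1, 0, 0⟩)]), ([0, 0, 0, 1, 1], [(3, ⟨0, 1, 0⟩)]), ([0, 0, 3], [(1, ⟨2, 0, 0⟩)]),
    ([0, 1, 2], [(1, ⟨2, 0, 0⟩)])], [([5], [(1, ⟨0, 1, 0⟩)]), ([0, 0, 1, 1, 1], [(3, ⟨1, 0, 0⟩)]),
    ([0, 1, 3], [(3, ⟨2, 0, 0⟩)]), ([1, 1, 2], [(3, ⟨2, 0, 0⟩)])])
    [139537, 135697, 74257, 1041, 135457, 74017, 70177, 801, 561, 321, 135442, 74002, 70162, 786,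
    69922, 306, 531, 291, 276]
    [139793, 139553, 135713, 74273, 1057, 577, 139538, 135698, 74258, 1042, 135458, 74018, 70178,
    802, 562, 322, 547, 532, 292]

theorem isValid_dataL3 : dataL3.isValid = true := by decide +kernel

theorem orderCheck_dataL3 : dataL3.orderCheck 3 = true := by decide +kernel

def dataL4 : Data := ofWords ⟨1, 2, 3, false⟩
    ([([4], [(1, ⟨1, 0, 0⟩)]), ([0, 0, 0, 1, 1], [(1, ⟨2, 0, 0⟩)]), ([0, 0, 3], [(1, ⟨4, 0, 0⟩)]),
    ([0, 1, 1, 1], [(1, ⟨1, 0, 0⟩)]), ([0, 1, 2], [(1, ⟨4, 0, 0⟩)]), ([1, 3], [(1, ⟨3, 0, 0⟩)])],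
    [([5], [(1, ⟨0, 1, 0⟩)]), ([0, 0, 1, 1, 1], [(1, ⟨0, 2, 0⟩)]), ([0, 1, 3], [(1, ⟨0, 2, 0⟩)]),
    ([1, 1, 1, 1], [(1, ⟨0, 1, 0⟩)]), ([1, 1, 2], [(1, ⟨0, 2, 0⟩)])])
    [17895697, 2167057, 1184017, 1122577, 139537, 12561, 1118737, 135697, 74257, 4881, 1041,
    1118497, 135457, 74017, 70177, 8737, 801, 4401, 561, 321, 1118482, 135442, 74002, 70162, 8722,
    786, 69922, 8482, 4642, 306, 66, 4371, 531, 291, 276, 36]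
    [286331153, 34672913, 18944273, 17961233, 2232593, 200977, 17899793, 2171153, 1188113, 78097,
    16657, 17895953, 2167313, 1184273, 1122833, 139793, 12817, 70417, 8977, 5137, 17895713,
    2167073, 1184033, 1122593, 139553, 12577, 1118753, 135713, 74273, 4897, 1057, 69937, 8497,
    4657, 4417, 577, 81, 17895698, 2167058, 1184018, 1122578, 139538, 12562, 1118738, 135698,
    74258, 4882, 1042, 1118498, 135458, 74018, 70178, 8738, 802, 4402, 562, 322, 69907, 8467,
    4627, 4387, 547, 51, 4372, 532, 292, 21]

theorem isValid_dataL4 : dataL4.isValid = true := by decide +kernel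

theorem orderCheck_dataL4_3 : dataL4.orderCheck 3 = true := by decide +kernel

theorem orderCheck_dataL4_4 : dataL4.orderCheck 4 = true := by decide +kernel

def dataL5 : Data := ofWords ⟨1, 1, 1, false⟩
    ([([4], [(1, ⟨1, 0, 0⟩)]), ([0, 2], [(1, ⟨4, 0, 0⟩)]), ([1, 3], [(1, ⟨2, 0, 0⟩)])], [([5], [(1,
    ⟨0, 1, 0⟩)]), ([0, 0, 1], [(1, ⟨0, 3, 0⟩)]), ([0, 3], [(1, ⟨0, 2, 0⟩)]), ([1, 1, 1], [(1, ⟨0,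
    1, 0⟩)]), ([1, 2], [(1, ⟨0, 2, 0⟩)])])
    [273, 529, 289, 545, 49, 65, 274, 530, 290, 546, 50, 66, 19, 35, 20, 36, 6]
    [273, 529, 289, 545, 49, 65, 274, 530, 290, 546, 50, 66, 19, 35, 20, 36, 5]

theorem isValid_dataL5 : dataL5.isValid = true := by decide +kernel

theorem orderCheck_dataL5 : dataL5.orderCheck 3 = true := by decide +kernel

theorem lead_dataS1 : dataS1.leadCheck 3 [(2, 0, 1131016), (2, 0, 1082632), (2, 0, 1081876)] [(7,
    ⟨0, 2, 0⟩), (5, ⟨2, 0, 0⟩)] = true := by decide +kernel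

theorem lead_dataS2 : dataS2.leadCheck 3 [(2, 0, 1131016), (2, 0, 1082632), (2, 0, 1081876)] [(7,
    ⟨0, 2, 0⟩), (5, ⟨2, 0, 0⟩)] = true := by decide +kernel

theorem lead_dataS3 : dataS3.leadCheck 3 [(2, 0, 1081864)] [(7, ⟨0, 9, 1⟩), (5, ⟨9, 0, 1⟩)] = true
    := by decide +kernel

theorem lead_dataS4 : dataS4.leadCheck 3 [(2, 0, 17672), (2, 0, 16916)] [(7, ⟨2, 0, 0⟩), (5, ⟨0,
    2, 0⟩)] = true := by decide +kernel

theorem lead_dataS5 : dataS5.leadCheck 3 [(2, 0, 1098760), (2, 0, 1114888), (2, 0, 1098256), (2,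
    0, 1082128), (2, 0, 1114636), (2, 0, 1082380)] [(7, ⟨0, 4, 0⟩), (5, ⟨4, 0, 0⟩)] = true := by
    decide +kernel

theorem lead_dataS501 : dataS501.leadCheck 3 [(2, 0, 1131016), (2, 0, 1082632), (2, 0, 1081876)]
    [(7, ⟨2, 0, 0⟩), (5, ⟨0, 2, 0⟩)] = true := by decide +kernel

theorem lead_dataL3 : dataL3.leadCheck 3 [(2, 0, 1130504), (2, 0, 1049864), (2, 0, 1131008), (2,
    0, 1082624), (2, 0, 1049108), (2, 0, 1081364)] [(7, ⟨0, 2, 0⟩), (5, ⟨2, 0, 0⟩)] = true := by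
    decide +kernel

theorem lead_dataL5 : dataL5.leadCheck 3 [(2, 0, 16654), (2, 0, 17158)] [(7, ⟨472, 0, 2256⟩), (5,
    ⟨236, 0, 2256⟩)] = true := by decide +kernel

theorem lead_dataB1_3 : dataB1.leadCheck 3 [(2, 0, 16654), (2, 0, 17158)] [(7, ⟨104, 0, 182⟩), (5,
    ⟨52, 0, 182⟩)] = true := by decide +kernel

theorem lead_dataB1_3'' : dataB1.leadCheck 3 [(2, 0, 17672), (2, 0, 16916)] [(7, ⟨0, 2, 0⟩), (5,
    ⟨2, 0, 0⟩)] = true := by decide +kernel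

theorem lead_dataB1_4 : dataB1.leadCheck 4 [(2, 0, 16654), (2, 0, 17158)] [(7, ⟨236, 0, 2256⟩),
    (5, ⟨236, 0, 2256⟩)] = true := by decide +kernel

theorem lead_dataB2 : dataB2.leadCheck 4 [(2, 0, 16654), (2, 0, 17158)] [(7, ⟨0, 12128, 205386⟩),
    (5, ⟨0, 12128, 205386⟩)] = true := by decide +kernel

theorem lead_dataB3 : dataB3.leadCheck 4 [(2, 0, 16654), (2, 0, 17158)] [(7, ⟨0, 36384, 205386⟩),
    (5, ⟨0, 36384, 205386⟩)] = true := by decide +kernel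

theorem lead_dataB4 : dataB4.leadCheck 4 [(2, 0, 16654), (2, 0, 17158)] [(7, ⟨0, 12128, 205386⟩),
    (5, ⟨0, 12128, 205386⟩)] = true := by decide +kernel

theorem lead_dataL4_3 : dataL4.leadCheck 3 [(2, 0, 16654), (2, 0, 17158)] [(7, ⟨708, 0, 2256⟩),
    (5, ⟨354, 0, 2256⟩)] = true := by decide +kernel

theorem lead_dataL4_3' : dataL4.leadCheck 3 [(2, 0, 1130504), (2, 0, 1049864), (2, 0, 1131008),
    (2, 0, 1082624), (2, 0, 1049108), (2, 0, 1081364)] [(7, ⟨0, 4, 0⟩), (5, ⟨4, 0, 0⟩)] = true :=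
    by decide +kernel

theorem lead_dataL4_4 : dataL4.leadCheck 4 [(2, 0, 16654), (2, 0, 17158)] [(7, ⟨0, 18192,
    205386⟩), (5, ⟨0, 18192, 205386⟩)] = true := by decide +kernel

end Data

end


namespace Data

/-! ### Explicit symmetries -/

def sysS1' : List Term × List Term :=
    Term.system [324, 18504] [386, 33926]

def symS1' : List Term × List Term :=
    Term.system [452, 18636, 51276] [516, 34060, 66700]

theorem isSymmetric_S1' : dataS1.isSymmetric false 3 (1) sysS1' symS1' = true := by
  decide +kernel

def sysS2' : List Term × List Term :=
    Term.system [324, 1224, 1288, 3208, 17544, 18502] [386, 2248, 2312, 4168, 33928, 34886]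

def symS2' : List Term × List Term :=
    Term.system [452, 1356, 3276, 3340, 5260, 17612, 17676, 18636, 18700, 19608, 20556, 20620,
    50316, 51340, 279692, 280716, 296010, 297034] [516, 2442, 4298, 4362, 6218, 33996, 34060,
    35020, 35084, 35916, 35980, 36952, 66636, 67660, 541836, 542860, 558154, 559178]

theorem isSymmetric_S2' : dataS2.isSymmetric false 3 (1) sysS2' symS2' = true := by
  decide +kernel

def sysS2'' : List Term × List Term :=
    Term.system [324, 1288, 3144, 3208, 17542, 18504] [386, 1288, 2312, 3208, 18568, 33926]

def symS2'' : List Term × List Term :=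
    Term.system [452, 3276, 3340, 5196, 5260, 17676, 18636, 18700, 20556, 20620, 50252, 50316,
    51288, 51340, 279690, 280714, 296012, 297036] [516, 1418, 2442, 3338, 4362, 17676, 18700,
    19596, 34072, 35084, 35980, 50316, 51340, 66700, 280716, 297100, 541834, 558218]

theorem isSymmetric_S2'' : dataS2.isSymmetric false 3 (1) sysS2'' symS2'' = true := by
  decide +kernel

def sysS3' : List Term × List Term :=
    Term.system [324, 1288, 3208] [200, 386, 1160, 2118, 2312]

def symS3' : List Term × List Term :=
    Term.system [452, 1228, 3148, 3340, 5260, 18700, 20620, 51340] [516, 1292, 2252, 2442, 3212,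
    4172, 4362, 18572, 34890, 35084]

theorem isSymmetric_S3' : dataS3.isSymmetric false 3 (1) sysS3' symS3' = true := by
  decide +kernel

def sysS4' : List Term × List Term :=
    Term.system [324, 1224, 2248] [386, 4168, 4232]

def symS4' : List Term × List Term :=
    Term.system [452, 1356, 2380, 3276, 17612, 18636, 33996, 35020] [516, 4362, 6218, 6282, 66636,
    66700, 67660, 67724]

theorem isSymmetric_S4' : dataS4.isSymmetric false 3 (1) sysS4' symS4' = true := by
  decide +kernel

def sysS4'' : List Term × List Term :=
    Term.system [324, 1288, 3144, 3208, 4166, 17542, 18512, 33862] [386, 1288, 2246, 2312, 3208,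
    18568, 33934, 34888]

def symS4'' : List Term × List Term :=
    Term.system [452, 3276, 3340, 4298, 5196, 5260, 17676, 18636, 18700, 20620, 33994, 36938,
    50252, 50316, 51276, 51340, 66634, 66698, 279690, 280652, 280714, 296012, 296076, 297036,
    541770, 541834, 542796, 558154] [516, 1418, 2442, 3338, 4300, 4362, 17676, 18634, 18700,
    19596, 34060, 35018, 35084, 35914, 50316, 51340, 66700, 67658, 280716, 296074, 297036, 297100,
    541834, 542794, 542858, 558156, 558218, 559180]

theorem isSymmetric_S4'' : dataS4.isSymmetric false 3 (1) sysS4'' symS4'' = true := by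
  decide +kernel

def sysS512' : List Term × List Term :=
    Term.system [324, 18632, 20552, 51272] [386, 34056, 35976, 66696]

def symS512' : List Term × List Term :=
    Term.system [452, 18764, 20684, 51416, 53324, 84044, 4737240, 4739160, 4769880, 5261400,
    13125720] [516, 34186, 36106, 66838, 68746, 99466, 8684824, 8686744, 8717464, 9208984,
    17073304]

theorem isSymmetric_S512' : dataS5.isSymmetric false 3 (1) sysS512' symS512' = true := by
  decide +kernel

def sysS512'' : List Term × List Term :=
    Term.system [324, 18632, 33992, 66632, 4752456, 8930374] [386, 35016, 66696, 67656, 8930438,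
    8946760]

def symS512'' : List Term × List Term :=
    Term.system [452, 18764, 34124, 36044, 51404, 66764, 68684, 4737228, 4752600, 4754508,
    4785228, 8669388, 8684748, 8717388, 8932426, 13141068, 17073228, 17318988, 1212712012,
    1216644172, 2219344972, 2223522890, 2286191690, 2286437450] [516, 37066, 66826, 67786, 69706,
    99466, 100426, 8930572, 8931532, 8946892, 8963212, 8964172, 9454732, 9471050, 17073292,
    17074252, 17319064, 17320012, 2286191754, 2286192714, 2286437514, 2286453836, 2290370636,
    2290385996]

theorem isSymmetric_S512'' : dataS5.isSymmetric false 3 (1) sysS512'' symS512'' = true := by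
  decide +kernel

def sysS501' : List Term × List Term :=
    Term.system [324, 51272] [386, 34056]

def symS501' : List Term × List Term :=
    Term.system [452, 51404, 84044, 13125708] [516, 34186, 66826, 8684812]

theorem isSymmetric_S501' : dataS501.isSymmetric false 3 (1) sysS501' symS501' = true := by
  decide +kernel

def sysS501'' : List Term × List Term :=
    Term.system [324, 17672, 20550, 50312, 4475014, 4490376, 4491336, 4737094] [386, 18696, 35974,
    51336, 4491400, 4737158, 8669318, 8684680]

def symS501'' : List Term × List Term :=
    Term.system [452, 19724, 20682, 50444, 52364, 53322, 83084, 4475148, 4491468, 4493386,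
    4523148, 4737226, 4999306, 5014668, 5260426, 12878988, 12879948, 13125706, 1145587850,
    1149535372, 1149536332, 1149781132, 1149782090, 1212695690] [516, 18826, 20746, 36108, 51466,
    53386, 68748, 4493450, 4737292, 4739212, 4754570, 4769932, 8669452, 8684810, 9193610,
    12880012, 17057932, 17073290, 1149536396, 1212696714, 1216628874, 1216644236, 2219329674,
    2223261836]

theorem isSymmetric_S501'' : dataS501.isSymmetric false 3 (1) sysS501'' symS501'' = true := by
  decide +kernel

def sysS501''' : List Term × List Term :=
    Term.system [324, 18632, 20552, 33990, 51272, 66630, 8669254, 8684624, 8930374] [386, 34056,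
    35014, 35976, 66696, 67654, 8685640, 8931406, 8946760]

def symS501''' : List Term × List Term :=
    Term.system [452, 18764, 20684, 34122, 36042, 51416, 53324, 66762, 68682, 84044, 4737240,
    4739160, 4752586, 4754506, 4769880, 4785226, 5261400, 5276746, 8669398, 8671306, 8684748,
    8686680, 8702038, 8932426, 9193546, 9208908, 13125720, 13141066, 17057866, 17073226, 17318988,
    2219329622, 2219344972, 2223261772, 2223277156, 2223522902, 2286191702, 2286437452] [516,
    34186, 36106, 37068, 66838, 67788, 68746, 69708, 99466, 100428, 8684824, 8685770, 8686744,
    8687690, 8717464, 8718422, 8930570, 8931530, 8932490, 8933452, 8946892, 8963210, 9208984,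
    9209930, 9454730, 9455704, 9471050, 17073304, 17074262, 17319050, 17320012, 2223278168,
    2223523914, 2286192714, 2286438498, 2286453848, 2290370648, 2290385994]

theorem isSymmetric_S501''' : dataS501.isSymmetric false 3 (1) sysS501''' symS501''' = true := by
  decide +kernel

def sysS510' : List Term × List Term :=
    Term.system [324, 20552, 4737094] [386, 35976, 8684680]

def symS510' : List Term × List Term :=
    Term.system [452, 20684, 53324, 4737226, 13125706] [516, 36106, 68746, 8684810, 17073290]

theorem isSymmetric_S510' : dataS5.isSymmetric false 3 (1) sysS510' symS510' = true := by
  decide +kernel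

def sysS510'' : List Term × List Term :=
    Term.system [324, 33992, 51270, 66632, 8669254, 8684616, 8930374] [386, 34054, 35016, 67656,
    8685640, 8931398, 8946760]

def symS510'' : List Term × List Term :=
    Term.system [452, 34124, 36044, 51402, 66764, 68684, 84042, 8669386, 8684748, 8686668,
    8702038, 8932426, 9193546, 9208908, 13125708, 13141066, 17057866, 17318988, 2219329612,
    2219344970, 2223261770, 2223522892, 2286191692, 2286437450] [516, 34188, 37066, 66828, 67786,
    69706, 100426, 8684812, 8685770, 8687690, 8718422, 8930570, 8933452, 8946892, 9455692,
    9471050, 17074250, 17320012, 2223278154, 2223523916, 2286192716, 2286453834, 2290370634,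
    2290385996]

theorem isSymmetric_S510'' : dataS5.isSymmetric false 3 (1) sysS510'' symS510'' = true := by
  decide +kernel

def sysB2' : List Term × List Term :=
    Term.system [332, 1180161, 2163713, 2359833, 4326425] [204, 394]

def symB2' : List Term × List Term :=
    Term.system [598, 1226, 3146, 4526, 6446, 37014, 1443841, 2427413, 2623533, 3410965, 4393493,
    5377045, 6358529, 8521261, 19006465, 35717633, 35914773, 69337621] [470, 664, 1290, 2250,
    3210, 4170, 4376, 2490905, 6423577]

theorem isSymmetric_B2' : dataB2.isSymmetric false 4 (-6) sysB2' symB2' = true := by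
  decide +kernel

def sysB3' : List Term × List Term :=
    Term.system [324, 17494, 17558, 18518, 18582, 33878, 33942, 34902, 34966, 1311257, 2359833,
    4260889, 4326425] [386, 17496, 17560, 18520, 18584, 33880, 33944, 34904, 34968, 1246233,
    2294809, 3211801, 3277337]

def symB3' : List Term × List Term :=
    Term.system [578, 4502, 6422, 17752, 17816, 18776, 18840, 20720, 21592, 21656, 22616, 22680,
    34136, 34200, 35160, 35224, 37104, 37976, 38040, 39000, 39064, 50390, 51414, 53360, 53424,
    66838, 67862, 83032, 83096, 84056, 84120, 99416, 99480, 100440, 100504, 1573909, 2622485,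
    3539989, 4523565, 5507117, 6488597, 8454677, 8520213, 20122137, 20187673, 21236761, 36899353,
    36964889, 38013977, 51645465, 52694041, 53546009, 53611545, 68356633, 69405209, 70323225,
    70388761, 71371289, 71436825, 286457997, 287506573, 303235213, 304283789, 554893453,
    555942029, 571670669, 572719245, 823197837, 823263373, 824246413, 824311949, 839975053,
    840040589, 841023629, 841089165] [644, 3414, 5334, 17750, 17814, 18774, 18838, 19758, 21590,
    21654, 22614, 22678, 34134, 34198, 35158, 35222, 36142, 37974, 38038, 38998, 39062, 50392,
    51416, 66840, 67864, 68718, 68782, 83030, 83094, 84054, 84118, 99414, 99478, 100438, 100502,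
    1507861, 2556437, 3541037, 4522517, 5506069, 6489645, 7406613, 7472149, 20122645, 21170709,
    21236245, 36899861, 37947925, 38013461, 51644949, 52693525, 53545493, 53611029, 54594581,
    54660117, 68357141, 69405717, 71371797, 71437333, 286523533, 287572109, 303300749, 304349325,
    554958989, 556007565, 571736205, 572784781, 1091633293, 1091698829, 1092681869, 1092747405,
    1108410509, 1108476045, 1109459085, 1109524621]

theorem isSymmetric_B3' : dataB3.isSymmetric false 4 (-1) sysB3' symB3' = true := by
  decide +kernel

def sysB3'' : List Term × List Term :=
    Term.system [324, 17494, 33942, 34966, 1246721, 1311769, 2295297, 2359833, 3213313, 3278849,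
    4260377, 4326425, 17962497, 18940045, 19011117, 34674689, 35723309] [386, 17496, 18520, 34968,
    1246233, 1312769, 2294297, 2361345, 3211801, 3277849, 4261377, 4326913, 17963057, 19011585,
    34674225, 34734225, 35722753]

def symB3'' : List Term × List Term :=
    Term.system [578, 4502, 6422, 39062, 51440, 51480, 66862, 67800, 67862, 1511425, 1573397,
    2560001, 2622485, 3475457, 3541525, 4526125, 5441025, 5508653, 6491157, 7409153, 7474689,
    8455189, 8520213, 18156713, 18231341, 19208433, 19279921, 20203661, 21171513, 21246001,
    22085821, 22157549, 23134449, 23205937, 34936465, 35002417, 35981993, 36051041, 36902445,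
    36974685, 37951169, 38020121, 38868717, 38928573, 39917105, 51645461, 53614637, 54594361,
    54663361, 68356629, 70338189, 70397533, 71380529, 71442969, 85002921, 85072017, 86054641,
    86117545, 101789229, 101848625, 102837809, 102897249, 286469633, 286532969, 287542785,
    287574745, 288442509, 288520337, 289518437, 289552965, 303240845, 303313185, 304310853,
    304352473, 305244589, 305309837, 306255789, 306327837, 319899277, 319964817, 320972717,
    321025677, 336704869, 336748829, 337713581, 337775461, 554899085, 554970913, 555966237,
    556025489, 556877969, 556943793, 557932317, 557979281, 571673813, 571741841, 572731165,
    572793417, 573667469, 573720721, 574688613, 574760005, 588347025, 588400561, 589407885,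
    589448849, 605109317, 605165713, 606154525, 606216773, 823209985, 823269517, 824252557,
    824314581, 840011777, 840065309, 841051205, 841101597, 1091642217, 1091711265, 1092693793,
    1092753553, 1108413657, 1108494481, 1109461721, 1109533769, 4581377681, 4582426909,
    4599138305, 4599203985, 4850861709, 4866524673, 4866627505, 4867638785, 8876279953,
    8876327197, 8877412637, 8893104417, 8894142897, 8894189569, 9144715037, 9144799005,
    9145763981, 9161492113, 9161575937, 9162541057, 2346160025891, 2354213388291, 2354246942723,
    2483062108447, 2483095077439, 2483599273987, 2492188913667, 4545182696003, 4553236643843]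
    [644, 3414, 5334, 21592, 50392, 50454, 51440, 66774, 66862, 1507861, 1576449, 2556949,
    2625025, 3542573, 4525077, 4589057, 5507605, 6492205, 6555649, 7406613, 7471637, 8458241,
    8523777, 18159709, 18221733, 19208237, 19273357, 20128789, 20190909, 21180513, 21239345,
    22156845, 23134401, 23205617, 34943021, 35002605, 35991601, 36048037, 36909101, 36965685,
    37963921, 38869037, 38928621, 39917809, 39977153, 52693529, 53551637, 53620269, 54603361,
    54675089, 69405721, 70326461, 70388533, 71374897, 85005917, 85077549, 86054445, 86126129,
    101780645, 101848813, 102832269, 102894245, 286467145, 286535965, 287512721, 287574741,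
    288432709, 288492389, 289490577, 289568397, 303253649, 303325469, 304296225, 304355469,
    305207441, 305291549, 306268081, 306333329, 319890501, 319959325, 320935569, 321010245,
    336677009, 336767117, 337725873, 337803409, 554896089, 554986565, 555953953, 556013709,
    556871453, 556931501, 557950605, 558016429, 571673817, 571772929, 572728169, 572796929,
    573652037, 573748581, 574715537, 574768781, 588320101, 588388269, 589389597, 589476709,
    605124749, 605202861, 606161041, 606226573, 823206473, 823266521, 824264337, 824314585,
    839980689, 840053025, 841035553, 841098601, 1091645213, 1091725893, 1092706077, 1092783617,
    1108413653, 1108481677, 1109464717, 1109536257, 4581378049, 4582379009, 4582426253,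
    4598155409, 4599156513, 4599203617, 4849766401, 4849850797, 4850778397, 4866543905,
    4867555617, 4867639437, 8876279297, 8877365165, 8877393409, 8893056657, 9144715405,
    9144780801, 9161492769, 9162540685, 2483632828419, 2491685012035, 4544679968771,
    4553270198275, 4553772630591, 4553806774559, 4682622529539, 4682656083971, 4690708857123]

theorem isSymmetric_B3'' : dataB3.isSymmetric false 4 (-1) sysB3'' symB3'' = true := by
  decide +kernel

def sysB4' : List Term × List Term :=
    Term.system [332, 18504, 2360345, 4325913, 17957893, 34669061] [394, 33926, 1245721, 3212313,
    19005961, 35718153]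

def symB4' : List Term × List Term :=
    Term.system [610, 18798, 20694, 22614, 53334, 84078, 279766, 297238, 299158, 559318, 591958,
    803926, 821398, 1083478, 2624069, 4587661, 4737110, 6553741, 8522821, 18221593, 20187669,
    22153753, 34936833, 36902913, 38865945, 51648001, 52625549, 53614081, 68360193, 70323221,
    85071361, 101780505, 557976597, 571738645, 605162005, 1092750357, 4598137369, 4599121409,
    4849796609, 4866508801, 8877312001, 8893039641] [676, 34224, 36120, 38040, 68760, 99504,
    279830, 312470, 541910, 543830, 559382, 803990, 1066070, 1083542, 1510469, 3473549, 5439629,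
    7408197, 8684696, 19273729, 21239809, 23202837, 35981845, 37947929, 39914005, 52697089,
    54660121, 68419729, 69408257, 71374337, 86117397, 102831617, 287509525, 305203733, 320932885,
    839977493, 4850844693, 4866574337, 8877377537, 8894088705, 9144763905, 9145745941]

theorem isSymmetric_B4' : dataB4.isSymmetric false 4 (-9) sysB4' symB4' = true := by
  decide +kernel

def sysB4'' : List Term × List Term :=
    Term.system [332, 18518, 1247233, 1312257, 2295809, 2360345, 3212801, 3278337, 4261889,
    4325913, 17957913, 19007489, 34669081, 35718657] [394, 33944, 1245721, 1312257, 2295809,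
    2360833, 3212313, 3278337, 4261889, 4327425, 17958401, 19005973, 34670593, 35718165]

def symB4'' : List Term × List Term :=
    Term.system [610, 39086, 50392, 51416, 299182, 312472, 543832, 591982, 1519105, 1579009,
    2567681, 2624069, 3479041, 3551233, 4475030, 4539905, 4587661, 4737110, 4753494, 5445633,
    5523457, 6499841, 6553741, 7417857, 7483393, 8459777, 8522821, 8930390, 18156153, 18221733,
    19202241, 19276309, 20122133, 20188005, 21168465, 21248585, 22085869, 22154037, 23134545,
    23211569, 34936881, 34998805, 35982457, 36050481, 36903005, 36965077, 37954681, 38016513,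
    38866229, 38928621, 39923761, 51648045, 52696673, 53546005, 53614173, 54591825, 54665849,
    68360237, 68419725, 69408865, 70323557, 70388949, 71384137, 71440385, 85003385, 85071409,
    86048961, 86116985, 101780645, 101846037, 102835221, 102897713, 286459905, 286531121,
    287514625, 287576113, 288429613, 288501249, 289497133, 289547337, 303238701, 303308289,
    304291885, 304350721, 305219073, 305281557, 306256013, 319887405, 320948225, 321007617,
    336682541, 336729693, 337712781, 337772685, 554895361, 554959993, 555942469, 556011569,
    556927657, 557914205, 557976601, 571671061, 571740697, 572721245, 572785689, 573648385,
    573707825, 574685325, 574753301, 588328961, 588385449, 589380629, 589436977, 605102665,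
    605162009, 606211093, 823199233, 823264769, 824250413, 824312853, 839982593, 840041541,
    841031213, 841090653, 1091641393, 1091699321, 1092689921, 1092752409, 1108414001, 1108479537,
    1109460993, 1109525017, 4581360665, 4582344285, 4598071441, 4598141465, 4599121457,
    4599187993, 4849731677, 4849801217, 4850844229, 4866508849, 4866575433, 4867622913,
    8876261913, 8877315585, 8877379073, 8893043737, 8894089801, 8894156289, 9144766465,
    9145746501, 9161477145, 9161543681, 9162524161] [676, 21616, 66838, 67862, 299160, 312494,
    543854, 591960, 1510469, 1585153, 2561537, 2633729, 3473549, 3557377, 4491416, 4533761,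
    4593665, 5439629, 5517313, 6505985, 6559233, 7408197, 7477249, 8465921, 8531457, 8668312,
    8684696, 8946776, 18159149, 18222197, 19204633, 19273773, 20125185, 20194421, 21170905,
    21239905, 22163501, 23134449, 23203129, 34939417, 34996413, 35981993, 36047477, 36911685,
    36962637, 37948265, 38013465, 38874669, 38928717, 39914297, 39977201, 51648605, 52625553,
    52697137, 53549057, 53623877, 54594777, 54660457, 68359773, 69408305, 70328949, 70385997,
    71374433, 71437337, 85006381, 85074969, 86051865, 86117545, 101780085, 101843133, 102831661,
    102894709, 286458393, 286525021, 287511577, 287573013, 288427029, 288489613, 289478705,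
    289550337, 303238705, 303301701, 304284281, 304350721, 305203737, 305272413, 306252969,
    319883797, 320932889, 321004617, 336664113, 336738837, 337709737, 337784321, 554895361,
    554966573, 555950081, 556011565, 556930701, 557923349, 557991937, 571674161, 571743745,
    572727345, 572786177, 573645385, 573726253, 574697473, 574756909, 588316813, 588388493,
    589371485, 589455405, 605105665, 605177345, 606213677, 823198745, 823264769, 824250417,
    824315953, 839979545, 840048129, 841024633, 841096753, 1091635293, 1091706925, 1092682309,
    1092755457, 1108410901, 1108479533, 1109460993, 1109526529, 4581361153, 4582346753,
    4582411285, 4598137929, 4599123969, 4849733121, 4849797701, 4850848789, 4866510337,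
    4866577921, 4867621397, 8876263425, 8877313093, 8877377581, 8893039177, 8894093313,
    8894154849, 9144699413, 9144763949, 9145750037, 9145811085, 9161541217, 9162523669]

theorem isSymmetric_B4'' : dataB4.isSymmetric false 4 (-9) sysB4'' symB4'' = true := by
  decide +kernel

def sysL1' : List Term × List Term :=
    Term.system [324, 1224, 2248, 4168, 18504, 34888] [386, 1286, 2310, 3206, 17542, 33926]

def symL1' : List Term × List Term :=
    Term.system [450, 1354, 2378, 3274, 4298, 6210, 17610, 18634, 20550, 33994, 35018, 36934,
    51266, 67650, 280642, 297026, 542786, 559170] [5252, 19592, 35976, 50308, 66692, 279684,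
    296068, 541828, 558212]

theorem isSymmetric_L1' : dataL1.isSymmetric false 3 (-1) sysL1' symL1' = true := by
  decide +kernel

def sysL2' : List Term × List Term :=
    Term.system [324, 1092, 2248, 4168, 34888] [194, 386, 1156, 2114, 2310]

def symL2' : List Term × List Term :=
    Term.system [456, 2392, 3140, 4312, 6216, 33860, 35032, 36944, 67656, 559176] [322, 2246,
    3204, 4162, 33924, 34882]

theorem isSymmetric_L2' : dataL2.isSymmetric false 3 (2) sysL2' symL2' = true := by
  decide +kernel

def sysL310' : List Term × List Term :=
    Term.system [324, 18632, 20552] [386]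

def symL310' : List Term × List Term :=
    Term.system [452, 18764, 20684, 51404, 53324, 4737228, 4739148] [516]

theorem isSymmetric_L310' : dataL3.isSymmetric false 3 (1) sysL310' symL310' = true := by
  decide +kernel

def sysL310'' : List Term × List Term :=
    Term.system [324, 33992, 66632, 8684616, 8930374] [386, 34054, 35016, 35974, 67656, 8685640,
    8930438, 8931398, 8946760]

def symL310'' : List Term × List Term :=
    Term.system [452, 34124, 36044, 66764, 68684, 8684748, 8686668, 8932426, 17318988, 2223522892,
    2286437450] [516, 34188, 36108, 37066, 66828, 67786, 68748, 69706, 100426, 8684812, 8685770,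
    8686732, 8687690, 8718422, 8932490, 8933452, 8946892, 8964172, 9209930, 9455692, 9471050,
    17074250, 17319052, 17320012, 2223278154, 2223522956, 2223523916, 2286437514, 2286453834,
    2290385996]

theorem isSymmetric_L310'' : dataL3.isSymmetric false 3 (1) sysL310'' symL310'' = true := by
  decide +kernel

def sysS5 : List Term × List Term :=
    Term.system [324, 66632, 8930374, 26881310723, 4682088980483] [386, 51336, 8946760,
    35471245315, 4690678910979]

def symS5 : List Term × List Term :=
    Term.system [452, 68696, 13141078, 27451744259, 44061188099, 6889702211587, 6889706381315,
    9080135532547, 1200813301067779, 1200813305249795] [516, 68758, 17335382, 36544991235,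
    52651118595, 6890239082499, 9088725467139, 9088729636867, 1200950740025347, 1200950744199171]

theorem isSymmetric_S5 : dataS5.isSymmetric true 3 (1) sysS5 symS5 = true := by
  decide +kernel

def sysL3 : List Term × List Term :=
    Term.system [324, 51272, 66632, 4682088976387] [386, 26914865155, 35471245315, 4690678915075]

def symL3 : List Term × List Term :=
    Term.system [452, 52364, 68696, 84044, 13141068, 17318988, 9080135507971, 1200813301043203,
    1200813305237507] [516, 36041699331, 36544991235, 52651118595, 6890239057923, 6890243252227,
    9088729636867, 1200950740000771, 1200950744195075]

theorem isSymmetric_L3 : dataL3.isSymmetric true 3 (1) sysL3 symL3 = true := by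
  decide +kernel

def sysL5 : List Term × List Term :=
    Term.system [324, 3152, 4232] [386, 3206, 4166, 33866, 34946]

def symL5 : List Term × List Term :=
    Term.system [454, 3310, 4362, 5230, 6282, 51338, 67670, 51445949] [516, 4300, 5260, 6220,
    51324, 66636, 67724, 541796, 559180]

theorem isSymmetric_L5 : dataL5.isSymmetric true 3 (-2) sysL5 symL5 = true := by
  decide +kernel

def sysB1 : List Term × List Term :=
    Term.system [324, 1092, 2120, 2180] [386, 1090, 2118, 2178]

def symB1 : List Term × List Term :=
    Term.system [586, 3298, 4310, 4362, 5230, 5294, 6230, 6294, 17486, 33902, 34926, 34958] [652,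
    3276, 4312, 4388, 5208, 5272, 6256, 6320, 17488, 33904, 34928, 34960]

theorem isSymmetric_B1 : dataB1.isSymmetric true 4 (-3) sysB1 symB1 = true := by
  decide +kernel

def sysL4 : List Term × List Term :=
    Term.system [324, 4236, 51280, 66640, 559172, 8930376] [386, 51334, 67654, 559234, 8946758]

def symL4 : List Term × List Term :=
    Term.system [578, 6422, 8330, 68862, 101486, 116830, 132174, 1345674, 1607790, 25707646,
    87163037, 88146077, 210274402, 1126301861, 1143013589, 13725925741, 18271502509, 22046376157,
    36650370122, 284039381181, 586401727574, 3445118533981, 4544361726237, 9226160992259] [644,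
    69856, 86168, 101544, 102504, 116872, 133200, 1607820, 13404328, 17859688, 21530728, 25724008,
    210274444, 277383268, 18020892897, 36650386508, 586405921880, 3445135311041, 4544630161537]

theorem isSymmetric_L4 : dataL4.isSymmetric true 4 (-1) sysL4 symL4 = true := by
  decide +kernel

def sysB2 : List Term × List Term :=
    Term.system [324, 4232] [196, 386]

def functionalsB2 : List (ℕ × Word × List (ℕ × Word × Q)) :=
    [(0, [6], [(1, [3, 5], ⟨0, 2, 2⟩), (0, [5, 5], ⟨0, 1, 0⟩), (0, [3, 7], ⟨7, 0, 5⟩), (1, [0, 2],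
    ⟨0, 8, 2⟩), (0, [2, 2], ⟨8, 0, 2⟩), (1, [1, 4], ⟨4, 0, 2⟩), (0, [3, 4], ⟨2, 0, 2⟩), (1, [1,
    7], ⟨1, 0, 2⟩), (1, [8], ⟨7, 0, 2⟩)]), (1, [7], [(1, [3, 5], ⟨1, 0, 2⟩), (0, [5, 5], ⟨1, 0,
    0⟩), (0, [3, 7], ⟨0, 5, 5⟩), (1, [0, 2], ⟨4, 0, 2⟩), (0, [2, 2], ⟨0, 4, 2⟩), (1, [1, 4], ⟨0,
    2, 2⟩), (0, [3, 4], ⟨0, 1, 2⟩), (1, [1, 7], ⟨0, 2, 2⟩), (1, [8], ⟨0, 2, 2⟩)])]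

theorem excludes_B2 : functionalsB2.all (fun e => dataB2.excludes 3 sysB2 e.1 e.2.1 e.2.2) = true := by
  decide +kernel

theorem admittedUpTo_B2 : [0, 1].all (fun k => (dataB2.admittedUpTo 3 k).all fun w =>
    w.all (fun l => Nat.blt l (2 * 3)) ||
      functionalsB2.any fun e => Nat.beq e.1 k && Cert.beqN e.2.1 w) = true := by
  decide +kernel

def sysB3 : List Term × List Term :=
    Term.system [324, 4184, 4248, 17494, 34966, 34668685, 35717261] [386, 3160, 3224, 17496,
    34968, 34668689, 35717265]

def functionalsB3 : List (ℕ × Word × List (ℕ × Word × Q)) :=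
    [(0, [6], [(1, [1, 9], ⟨0, 1, 17⟩), (1, [4, 4], ⟨1, 0, 8⟩), (1, [0, 8], ⟨0, 1, 17⟩), (1, [2,
    6], ⟨0, 1, 17⟩), (1, [3, 6], ⟨1, 0, 17⟩), (1, [1, 8], ⟨0, 1, 17⟩), (1, [4, 5], ⟨0, 1, 17⟩),
    (1, [2, 7], ⟨1, 0, 17⟩), (1, [10], ⟨0, 1, 5⟩)]), (0, [7], [(1, [10], ⟨1, 0, 1⟩), (1, [1, 9],
    ⟨0, 1, 5⟩)]), (1, [6], [(1, [10], ⟨1, 0, 1⟩)]), (1, [7], [(1, [1, 9], ⟨1, 0, 8⟩), (1, [4, 4],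
    ⟨1, 0, 8⟩), (1, [0, 8], ⟨0, 1, 17⟩), (1, [2, 6], ⟨0, 1, 17⟩), (1, [3, 6], ⟨0, 1, 8⟩), (1, [1,
    8], ⟨1, 0, 8⟩), (1, [4, 5], ⟨1, 0, 8⟩), (1, [2, 7], ⟨0, 1, 8⟩), (1, [10], ⟨0, 1, 5⟩)])]

theorem excludes_B3 : functionalsB3.all (fun e => dataB3.excludes 3 sysB3 e.1 e.2.1 e.2.2) = true := by
  decide +kernel

theorem admittedUpTo_B3 : [0, 1].all (fun k => (dataB3.admittedUpTo 3 k).all fun w =>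
    w.all (fun l => Nat.blt l (2 * 3)) ||
      functionalsB3.any fun e => Nat.beq e.1 k && Cert.beqN e.2.1 w) = true := by
  decide +kernel

def sysB4 : List Term × List Term :=
    Term.system [324, 4232] [386, 3144]

def functionalsB4 : List (ℕ × Word × List (ℕ × Word × Q)) :=
    [(0, [6], [(1, [4, 4], ⟨2, 0, 2⟩), (0, [3, 7], ⟨1, 0, 5⟩), (0, [1, 9], ⟨1, 0, 5⟩), (0, [5, 5],
    ⟨0, 1, 2⟩), (1, [0, 8], ⟨0, 1, 2⟩), (1, [2, 6], ⟨0, 1, 2⟩)]), (0, [7], [(1, [0, 9], ⟨0, 1,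
    1⟩)]), (1, [6], [(1, [1, 9], ⟨1, 0, 1⟩)]), (1, [7], [(1, [4, 4], ⟨0, 1, 2⟩), (0, [3, 7], ⟨0,
    1, 2⟩), (0, [1, 9], ⟨0, 1, 2⟩), (0, [5, 5], ⟨2, 0, 2⟩), (1, [0, 8], ⟨1, 0, 5⟩), (1, [2, 6],
    ⟨1, 0, 5⟩)])]

theorem excludes_B4 : functionalsB4.all (fun e => dataB4.excludes 3 sysB4 e.1 e.2.1 e.2.2) = true := by
  decide +kernel

theorem admittedUpTo_B4 : [0, 1].all (fun k => (dataB4.admittedUpTo 3 k).all fun w =>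
    w.all (fun l => Nat.blt l (2 * 3)) ||
      functionalsB4.any fun e => Nat.beq e.1 k && Cert.beqN e.2.1 w) = true := by
  decide +kernel

end Data


namespace Data

/-! ### The classification of the solutions -/

def certS1 : Cert := .decode
    [68737572944, 19812959965464, 117, 78568264208, 93, 68719739200, 69, 74123059280, 53, 23]

noncomputable def targetsS1 : List Cert.Sys :=
    [dataS1.target 0 false 0 sysS1']

set_option maxRecDepth 100000 in
theorem check_S1 : Cert.check dataS1.W 3 targetsS1 certS1
    (dataS1.know [(1, ⟨1, 0, 0⟩)] [(1, ⟨1, 0, 0⟩)]) [] = true := by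
  decide +kernel

def certS2 : Cert := .decode
    [278960, 557, 283104, 285, 19149440, 19952068, 19174020, 19943872, 629, 19435712, 18117072,
    19952064, 269, 19952064, 4637970968, 165, 19174016, 4637970984, 149, 5173778472, 4840413224,
    5041592440, 4437760136, 5171681416, 4834121864, 429, 20210064, 18907856, 605, 20201872,
    18883280, 597, 18907856, 4569793064, 357, 17850752, 7, 60434, 3, 60554, 1314, 237, 18117072,
    7, 62482, 3, 62610, 1306, 245, 1125392400, 453, 1091321984, 125, 1091064016, 437, 1108357120,
    69, 23, 245, 1141121216, 125, 1157640336, 453, 1108611280, 437, 1125122176, 69, 27, 237,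
    18117072, 7, 62482, 3, 62610, 1306, 245, 1142161616, 453, 1158680704, 125, 1107312832, 69,
    1124356240, 437, 31, 245, 1074286800, 453, 1108357184, 125, 1125392464, 437, 1074544768, 69,
    35]

noncomputable def targetsS2 : List Cert.Sys :=
    [dataS2.target 0 false 0 sysS2'', dataS2.target 0 true 0 sysS2', dataS2.target 0 false 0
    sysS2', dataS2.target 0 true 0 sysS2'']

set_option maxRecDepth 100000 in
theorem check_S2 : Cert.check dataS2.W 3 targetsS2 certS2
    (dataS2.know [(1, ⟨1, 0, 0⟩)] [(1, ⟨1, 0, 0⟩)]) [] = true := by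
  decide +kernel

def certS3 : Cert := .decode
    [18137536, 19173588, 18117076, 19177664, 269, 5107730472, 4637972696, 4908439768, 4908550184,
    5228167495772, 4975544568, 4909484280, 93, 17601152, 4749282201692, 5026240483420, 4908549032,
    5107729320, 19435716, 405, 19952064, 4908438168, 4637971096, 19174016, 213, 4908548760,
    4908439720, 4643209864, 4749282836572, 77, 19174016, 4908438040, 237, 18117072, 19173584, 165,
    19173584, 7, 48146, 3, 48266, 1314, 189, 17305600, 317, 23, 189, 16781440, 317, 27]

noncomputable def targetsS3 : List Cert.Sys :=
    [dataS3.target 0 false 0 sysS3', dataS3.target 0 true 0 sysS3']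

set_option maxRecDepth 100000 in
theorem check_S3 : Cert.check dataS3.W 3 targetsS3 certS3
    (dataS3.know [(1, ⟨1, 0, 0⟩)] [(1, ⟨1, 0, 0⟩)]) [] = true := by
  decide +kernel

def certS4 : Cert := .decode
    [278960, 557, 283104, 285, 17879440, 18883284, 17334996, 429, 18137536, 17601156, 19149444,
    165, 19943872, 19149440, 629, 20201872, 18883280, 605, 18883280, 4569793368, 4840411928, 357,
    19149440, 4637971288, 4908548888, 149, 17580160, 17322196, 597, 17322368, 4840412968,
    4569794328, 4908549928, 4637972248, 245, 17850752, 7, 60434, 3, 60554, 1314, 237, 18907856, 7,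
    68626, 3, 68794, 1410, 269, 1124094096, 453, 1125126272, 125, 1191198928, 437, 1108611456, 69,
    23, 269, 1159491600, 453, 1092649088, 125, 1141657744, 437, 1107312832, 69, 27, 237, 18907856,
    7, 68626, 3, 68794, 1402, 269, 1108607184, 453, 1107574976, 125, 1125122512, 437, 1174687872,
    69, 31, 269, 1076138192, 453, 1142448192, 125, 1141657744, 437, 1125122176, 69, 35]

noncomputable def targetsS4 : List Cert.Sys :=
    [dataS4.target 0 true 0 sysS4', dataS4.target 0 false 0 sysS4'', dataS4.target 0 false 0
    sysS4', dataS4.target 0 true 0 sysS4'']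

set_option maxRecDepth 100000 in
theorem check_S4 : Cert.check dataS4.W 3 targetsS4 certS4
    (dataS4.know [(1, ⟨1, 0, 0⟩)] [(1, ⟨1, 0, 0⟩)]) [] = true := by
  decide +kernel

def certS5 : Cert := .decode
    [73014722752, 73015238724, 68770865220, 69860864004, 17875922370856, 18417090314520,
    73014714560, 285, 68803903680, 17867335565592, 73082339520, 18713306743080, 17875922370856,
    18691771121944, 333, 74105749648, 69877641236, 70885048452, 69877112964, 69828096020,
    70885060628, 437, 74121752656, 17613730119736, 68803899472, 74088722512, 70934081600,
    73015234688, 70868275332, 669, 72008081408, 71958528212, 69844606976, 69860339920,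
    74106011860, 69826793680, 165, 69793763536, 18146572423448, 18696193999128, 73015763012,
    73098854468, 74088714452, 68803891412, 18434000736312, 70934073540, 68787376256, 68786860164,
    725, 74172600464, 15, 1122, 3, 1472526, 1423374, 1128462, 505870, 3090, 717, 74104971472,
    69794279556, 68737573072, 72024850576, 74156085264, 72024596560, 73032007808, 72025112660,
    71957496016, 693, 74156089424, 74123059284, 68786860164, 72024592532, 70934331584,
    72024596564, 71942021204, 549, 69794279888, 73098854468, 73015763012, 74089238736,
    71957500052, 17867335565368, 69861113984, 70867239108, 73098858500, 68737314948, 317,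
    74089246848, 73015763008, 69861113988, 68803907712, 68770861188, 74123059284, 73032540368,
    653, 73098854464, 70867239104, 69794279552, 7, 62482, 3, 62506, 1122, 245, 68737314944,
    17596752646216, 7, 3090, 3, 3114, 1122, 13, 69878423696, 18421120012584, 7, 74770, 3, 9596958,
    1066, 293, 73032540368, 7, 44050, 3, 5664798, 1066, 173, 339282184135296, 19, 173,
    335157875454672, 605, 317415281672400, 597, 290480585965648, 525, 282167726097024, 413,
    304293132152976, 405, 339132985381008, 389, 281759520928320, 269, 339341190672592, 557,
    281750963257536, 237, 294816254538064, 213, 303743308963904, 189, 286218768892368, 453,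
    317358424215552, 125, 312952944070784, 93, 317416339968384, 69, 286159900263056, 509,
    321339891409232, 117, 317006304534528, 53, 23, 293, 69878423696, 173, 335157875454672, 605,
    317415281672400, 597, 286083563127632, 453, 281544786706560, 413, 286431386579216, 557,
    285873023488208, 269, 281826090577936, 525, 285873040003280, 237, 294816254538064, 213,
    285941742702720, 189, 285876244713488, 509, 282167726097024, 125, 321339891409232, 117,
    338865572336272, 405, 285941759475840, 389, 312952944070784, 93, 281544786714624, 69,
    285952665223680, 53, 27, 13, 68737315024, 293, 71957500048, 7, 44050, 3, 44082, 1114, 173,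
    312540493271440, 605, 308760921248080, 597, 290480585965648, 525, 307935264411920, 413,
    286431386579216, 557, 286159900263056, 405, 281474993754240, 269, 281476050718848, 237,
    294816254538064, 213, 312272042103296, 189, 285880676024784, 509, 285941793292304, 389,
    282167726097024, 125, 285874097225856, 117, 286150133035008, 93, 321333447643264, 53,
    321825139081488, 453, 285952665223680, 69, 31, 173, 308760921248080, 597, 281476067491968,
    413, 335157875454672, 605, 304297479766736, 453, 281474993754240, 269, 290480585965648, 525,
    285941793034256, 389, 281476050718848, 237, 338662583726416, 557, 294816254538064, 213,
    338796736426640, 405, 285873023488128, 189, 321543868776464, 509, 294669133283408, 125,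
    321339891409232, 117, 285878426030208, 93, 285874113741008, 69, 285952665223680, 53, 35, 245,
    69794279552, 293, 68787646656, 173, 69794537680, 7, 3090, 3, 3122, 1114, 13, 281476067491968,
    413, 303819614613776, 389, 285873023488128, 189, 285880676024784, 509, 281543730008064, 125,
    290272143740928, 405, 281543712968832, 117, 285873073815632, 557, 286079181914192, 453,
    303744569864576, 93, 294670206763088, 69, 317006304534528, 53, 281474993754240, 605,
    281476050718848, 597, 281476067233920, 525, 321402167644304, 269, 299971304247376, 237,
    294816254538064, 213, 39, 13, 334396591485776, 597, 330201531719760, 453, 335149367824784,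
    413, 281684423787216, 525, 281543713226960, 405, 303819614613776, 389, 290271086514240, 237,
    303743308963904, 189, 281544770715728, 509, 321339891409232, 117, 281543730008064, 213,
    285878426030208, 93, 285874113741008, 69, 317006304534528, 53, 290271069999168, 605,
    281544786706640, 557, 285952665223680, 269, 281622231163216, 125, 43]

noncomputable def targetsS5 : List Cert.Sys :=
    [dataS5.target 0 false 0 sysS510', dataS5.target 0 false 0 sysS510'', dataS5.target 0 false 0
    sysS512'', dataS5.target 0 false 0 sysS512', dataS5.target 0 true 0 sysS510'', dataS5.target 0
    true 0 sysS512'']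

set_option maxRecDepth 100000 in
theorem check_S5 : Cert.check dataS5.W 3 targetsS5 certS5
    (dataS5.know [(1, ⟨1, 0, 0⟩)] [(1, ⟨1, 0, 0⟩)]) [] = true := by
  decide +kernel

def certS501 : Cert := .decode
    [68803641552, 18692034318872, 18692168536616, 68803637396, 68804153616, 669, 69877113296,
    18146575520040, 69877133456, 17879954165864, 17879953133672, 437, 68736790864, 69794287828,
    73014726868, 17601045512488, 70883750224, 69860348116, 725, 74089238736, 74138525776,
    70868013252, 68753309888, 285, 73082339520, 15, 157726, 3, 85002, 62482, 333, 69860339840,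
    74155565060, 69861638276, 70884786368, 69860872196, 165, 70883758288, 18966847180856,
    18983756550200, 68803891408, 74088714448, 17613931462712, 73048260928, 73015763008, 693,
    74172600464, 15, 159774, 3, 183314, 166922, 140306, 1050, 717, 74088456528, 549, 74122002768,
    653, 69794545792, 18417157427496, 18966710898968, 293, 69793763536, 7, 62482, 3, 62506, 44074,
    245, 71940972880, 7, 80914, 3, 80946, 1114, 317, 69794537680, 7, 44050, 3, 44074, 1114, 173,
    299754441429440, 269, 281478284481104, 605, 282380143996944, 413, 321884194349504, 189,
    282368481956304, 597, 303808925679696, 453, 286286599438672, 405, 304229730779264, 237,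
    334254858084800, 213, 316865593237824, 125, 339132985381008, 389, 321813310390864, 93,
    290480585965648, 525, 321344235425808, 69, 312606176575504, 557, 312261523284432, 509,
    286562385167184, 117, 317006304534528, 53, 23, 173, 299754441429440, 269, 281478284481104,
    605, 307935197053376, 213, 282376017039824, 597, 321884194349504, 189, 282234129760528, 413,
    338662500622784, 237, 282167726097024, 125, 281826090577936, 525, 286431386579216, 557,
    308349812891904, 117, 285874147557392, 405, 285941776257024, 93, 281684491112576, 453,
    281544786714624, 69, 286079198433296, 389, 285874097233920, 53, 286080255655952, 509, 27, 317,
    69794537680, 7, 44050, 3, 44074, 1122, 173, 299754441429440, 269, 312549132485056, 189,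
    281478284481104, 605, 282380143996944, 413, 286705291117136, 405, 286562385167184, 557,
    321543868776464, 597, 285952665223680, 237, 308070622429824, 389, 282368481956304, 525,
    303886300623360, 93, 317006304534528, 69, 316736744735040, 213, 317358424215552, 125,
    330201531719760, 453, 321344235425808, 53, 281888386208512, 509, 334254858084800, 117, 31,
    173, 281478284481104, 605, 299696375484736, 269, 282376017039824, 597, 325529682096656, 413,
    338794637738176, 189, 317079285928192, 237, 307935197053376, 213, 299144575734016, 125,
    329999735878352, 557, 304297479766736, 453, 281826090577936, 525, 281543783490176, 69,
    285874097238032, 405, 286010478956544, 93, 326352084414464, 117, 286080255655952, 509,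
    285941759483904, 53, 321344235425808, 389, 35, 245, 71940972880, 7, 80914, 3, 80946, 1114,
    317, 73014714688, 7, 44050, 3, 44074, 1114, 173, 299754441429440, 269, 281478284481104, 605,
    282380143996944, 413, 321884194349504, 189, 282368481956304, 597, 303808925679696, 453,
    286286599438672, 405, 304229730779264, 237, 334254858084800, 213, 316865593237824, 125,
    339132985381008, 389, 321813310390864, 93, 290480585965648, 525, 321344235425808, 69,
    312606176575504, 557, 312261523284432, 509, 286562385167184, 117, 317006304534528, 53, 23,
    173, 303819614613776, 389, 294678932750992, 605, 304229730779264, 269, 290759623594000, 413,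
    312952944070784, 93, 312549132485056, 189, 303808925679696, 453, 321344235425808, 405,
    304297479766736, 69, 308070622429824, 53, 295502375318352, 597, 299144575734016, 557,
    281488031781568, 237, 281476101046352, 525, 281543729745984, 213, 308421720281856, 125,
    299754441429440, 509, 317079285928192, 117, 39, 317, 73014714688, 7, 44050, 3, 44074, 1122,
    173, 299754441429440, 269, 312549132485056, 189, 281478284481104, 605, 282380143996944, 413,
    286705291117136, 405, 286562385167184, 557, 321543868776464, 597, 285952665223680, 237,
    308070622429824, 389, 282368481956304, 525, 303886300623360, 93, 317006304534528, 69,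
    316736744735040, 213, 317358424215552, 125, 330201531719760, 453, 321344235425808, 53,
    281888386208512, 509, 334254858084800, 117, 31, 173, 325529682096656, 389, 304084927152848,
    605, 304297479766736, 453, 334734871498896, 413, 338794637738176, 189, 321471980253568, 93,
    299144575734016, 125, 312402100122000, 405, 334470698524800, 69, 285952665223680, 269,
    286434658091776, 53, 299696375484736, 237, 281622231163216, 597, 325737904362320, 213,
    295502375318352, 557, 281682209144912, 525, 281543712972864, 117, 329999735878352, 509, 43]

noncomputable def targetsS501 : List Cert.Sys :=
    [dataS501.target 0 false 0 sysS501', dataS501.target 0 true 0 sysS501'', dataS501.target 0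
    true 0 sysS501', dataS501.target 0 false 0 sysS501''', dataS501.target 0 false 0 sysS501'',
    dataS501.target 0 true 0 sysS501''']

set_option maxRecDepth 100000 in
theorem check_S501 : Cert.check dataS501.W 3 targetsS501 certS501
    (dataS501.know [(1, ⟨1, 0, 0⟩)] [(1, ⟨1, 0, 0⟩)]) [] = true := by
  decide +kernel

def certB1 : Cert := .decode
    [17043680, 19]

noncomputable def targetsB1 : List Cert.Sys :=
    []

set_option maxRecDepth 100000 in
theorem check_B1 : Cert.check dataB1.W 4 targetsB1 certB1
    (dataB1.know [(1, ⟨1, 0, 0⟩)] [(1, ⟨0, 1, 0⟩)]) [] = true := by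
  decide +kernel

def certB2 : Cert := .decode
    [17043680, 17567844, 53, 17567840, 7, 19474, 86038, 1034, 3, 667113534, 96542782, 63135806,
    77, 23, 77, 27]

noncomputable def targetsB2 : List Cert.Sys :=
    [dataB2.target 2 false 0 sysB2', dataB2.target 2 true 0 sysB2']

set_option maxRecDepth 100000 in
theorem check_B2 : Cert.check dataB2.W 4 targetsB2 certB2
    (dataB2.know [(1, ⟨1, 0, 0⟩)] [(1, ⟨0, 1, 0⟩)]) [] = true := by
  decide +kernel

def certB3 : Cert := .decode
    [4569793832, 4840260888, 4835050056, 4437760024, 5041592360, 4566680120, 4834121768,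
    5171681304, 597, 310963588224753884, 5475552702844563571935040016956,
    337191338741193627364290535964, 357148286171391925780340085276,
    1428638125419774289502394262060, 1527030180026569728773380510252,
    5707124861443385009856073978428, 5239183526593511268437763543612,
    6105644840027708288039615488572, 5952062903903865800178501411388,
    1329906362657667139305211994668, 1468521797134680520477022130732,
    1448748606429063645695527916076, 5794863861727736346591832875580,
    1507536251185283833203139846700, 83511408492788170209710524, 7, 72722, 3, 5556311716708494,
    2178611996180622, 285, 18100448, 81592096707271891964268, 86350203756784349438316,
    321570792218053460648316, 340603220416103290524028, 85042790770548626772332,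
    21288367808745630097756, 1219842276447977607484, 90981201210402343838060,
    22754523674635349807452, 1385822440714717241660, 4954287474217103409484,
    5470670207491404476748, 5397009331986132644172, 5616010374665905127756, 19, 629, 18883280,
    5173776680, 4840411416, 17334992, 20201876, 19693716, 429, 17334992, 19693716, 605, 17850752,
    18907268, 557, 18117072, 19173588, 285, 18907856, 20210068, 245, 5107728920, 4975542840,
    19173584, 165, 20210064, 19952068, 357, 19174016, 19952068, 149, 4908437800, 5107728664, 7,
    60434, 3, 68986, 60602, 134512710, 237, 19173584, 7, 68626, 2058, 1066, 3, 68994, 2434,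
    134510662, 269, 1158959312, 11, 22939702, 14553142, 453, 1141383296, 11, 22941750, 14551094,
    125, 1158426832, 11, 22939702, 14551094, 437, 1141915776, 11, 22941750, 14553142, 69, 23, 269,
    1158959312, 11, 22941750, 14553142, 453, 1141383296, 11, 22939702, 14551094, 125, 1158426832,
    11, 22941750, 14551094, 437, 1141915776, 11, 22939702, 14553142, 69, 27, 269, 19173584, 7,
    60434, 2074, 3, 60514, 2242, 237, 1158959312, 11, 22939702, 14553142, 453, 1141383296, 11,
    22941750, 14551094, 125, 1158426832, 11, 22939702, 14551094, 437, 1141915776, 11, 22941750,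
    14553142, 69, 31, 237, 1158959312, 11, 22941750, 14553142, 453, 1141383296, 11, 22939702,
    14551094, 125, 1158426832, 11, 22941750, 14551094, 437, 1141915776, 11, 22939702, 14553142,
    69, 35]

noncomputable def targetsB3 : List Cert.Sys :=
    [dataB3.target 0 true 0 sysB3', dataB3.target 0 false 0 sysB3', dataB3.target 0 true 0
    sysB3'', dataB3.target 0 false 0 sysB3'']

set_option maxRecDepth 100000 in
theorem check_B3 : Cert.check dataB3.W 4 targetsB3 certB3
    (dataB3.know [(1, ⟨1, 0, 0⟩)] [(1, ⟨0, 1, 0⟩)]) [] = true := by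
  decide +kernel

def certB4 : Cert := .decode
    [18117072, 19173588, 605, 19693712, 5173776456, 4840411192, 17334996, 429, 20210064,
    4569793096, 4840260152, 18907860, 629, 17850752, 18907268, 269, 19174016, 4908438072,
    19952064, 149, 5107729016, 4908439688, 4505896408, 4975543784, 165, 19952064, 4908438040, 597,
    18907856, 4840260120, 357, 1141916112, 292330438936, 1158959316, 296557269048, 1125396692,
    1108353156, 292194124120, 1192247572, 453, 1125396688, 296557269064, 1158959312, 557,
    1108353156, 292194123832, 1141915780, 309442166920, 296693583944, 437, 1158959312, 1158426832,
    1141915780, 1141383300, 125, 1090523344, 7, 62482, 3, 3685426, 17434, 245, 1157919184,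
    292194124072, 296557269272, 69, 1074004096, 237, 1158426832, 7, 72722, 83990, 1034, 3, 72770,
    1130534, 1082, 285, 23, 285, 27, 69, 1157919184, 296557269144, 292194123944,
    4974243657232322764, 7, 72722, 86038, 1034, 3, 73274, 2242, 1602, 285, 1073754384, 7, 60434,
    3, 1914160565420150, 67530783522934, 237, 1158426832, 11, 1552422, 1026086, 19, 11,
    4697609595006, 245, 296557269288, 292194124056, 7, 60434, 303134, 3, 57038862, 60426, 303134,
    237, 31, 7, 60434, 83990, 1042, 3, 972814, 77846, 14350, 237, 35, 11, 303134, 237, 39, 285,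
    1073754384, 7, 60434, 3, 1914160565420150, 67530783520886, 237, 1158426832, 11, 1550374,
    1026086, 19, 11, 4697609597054, 245, 296557269288, 292194124056, 7, 60434, 88086, 3,
    228143126, 60426, 88086, 237, 43, 7, 60434, 86038, 1034, 3, 3878934, 77846, 14350, 237, 47,
    11, 88086, 237, 51]

noncomputable def targetsB4 : List Cert.Sys :=
    [dataB4.target 2 false 0 sysB4', dataB4.target 2 true 0 sysB4', dataB4.target 2 true 0
    sysB4'', dataB4.target 2 true 1 sysB4'', dataB4.target 2 true 2 sysB4'', dataB4.target 2 false
    0 sysB4'', dataB4.target 2 false 1 sysB4'', dataB4.target 2 false 2 sysB4'']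

set_option maxRecDepth 100000 in
theorem check_B4 : Cert.check dataB4.W 4 targetsB4 certB4
    (dataB4.know [(1, ⟨1, 0, 0⟩)] [(1, ⟨0, 1, 0⟩)]) [] = true := by
  decide +kernel

def certL1 : Cert := .decode
    [295088, 7, 142354, 3, 1009061958, 675946574, 557, 282720, 7, 72722, 3, 66496938078,
    14957109342, 285, 5041591880, 4840414488, 301811818775761116, 292737549311725788, 4577138232,
    4824430420060, 5171680824, 72569180229756, 70404516712572, 70455251013756, 429, 18403728,
    4840411192, 1207247274658951404, 1170950196802810092, 605, 18883280, 20201872, 70404513665148,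
    75900729630844, 597, 18907856, 4741681758300, 4569793064, 4743795687516, 357, 17850752, 7,
    60434, 3, 60554, 1314, 237, 17322064, 7, 115730, 3, 7178, 1042, 453, 4568678456, 4300243016,
    4366323768, 4367355976, 1297318169781801196, 4902257960, 4434444632, 5107728920, 4777428248,
    5105632552, 4367352168, 629, 17846400, 16797828, 4366326552, 17580116, 4751346868316, 269,
    17322048, 18997141581932, 18696198897772, 5228168745052, 165, 18137536, 4497408232,
    4637971016, 18163483955308, 149, 17322048, 4749283954780, 7, 62482, 3, 505870, 1042, 245,
    16785728, 7, 31762, 3, 7178, 1042, 125, 1158156416, 72146663278715036, 69, 1107562496, 437,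
    23, 29, 1107296320, 125, 1107562496, 437, 1141637248, 69, 23, 245, 18096336, 17580112, 29,
    1090519168, 19, 29, 17846400, 269, 5107728936, 4643210536, 4505895464, 4975542808, 165,
    19174016, 4643209496, 629, 19174016, 4637970984, 149, 19174016, 7, 62482, 3, 62506, 1122, 245,
    1107300416, 453, 1107296320, 125, 1107558464, 437, 1141637248, 69, 23, 245, 1090519168, 19,
    237, 17834180, 4632608840, 4434427976, 7, 31762, 3, 7186, 1034, 125, 17834176, 7, 68626, 3,
    7194, 1058, 269, 17322240, 18096128, 4565583320, 245, 19435712, 4434444504, 165, 18137536,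
    4366319832, 149, 19149440, 17884462092396, 18975518003308, 629, 17854672, 7, 115730, 3, 7186,
    1034, 453, 1108611200, 77722827909042332, 69, 1090523264, 437, 27, 29, 1074008192, 453,
    1090519168, 69, 1090523264, 437, 27, 29, 17322240, 269, 5107728936, 4643210536, 4505895464,
    4975542808, 165, 19174016, 4643209496, 629, 19174016, 4637970984, 149, 19174016, 7, 62482, 3,
    62506, 1122, 245, 1073746048, 19, 245, 1074008192, 453, 1090519168, 69, 1090523264, 437, 27,
    29, 17322240, 269, 5107728936, 4643210536, 4505895464, 4975542808, 165, 19174016, 4643209496,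
    629, 19174016, 4637970984, 149, 19174016, 7, 62482, 3, 62506, 1122, 245, 1074008192, 19, 245,
    1074008192, 453, 1073746048, 125, 1090523264, 437, 1074004096, 69, 27, 29, 282768, 605,
    282752, 269, 17043680, 4365246760, 285, 4632608840, 18088080, 16797840, 16793812, 17838212,
    125, 4367355960, 4566581544, 4632608824, 17055952, 4434460952, 453, 18104532, 4367355976, 629,
    17584272, 437, 17830080, 165, 18092160, 149, 18096848, 597, 18907856, 4634759320, 429,
    16797840, 4634759448, 357, 16793792, 18096144, 69, 18096144, 16793808, 245, 18104528, 7,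
    60434, 3, 7759902, 1074, 237, 23, 237, 27, 29, 282768, 605, 282720, 285, 282752, 269,
    16801840, 4295077960, 557, 4367356088, 4366323784, 4631597128, 4632608824, 4299210824,
    4434460728, 453, 17838160, 17059984, 629, 17059984, 4637973272, 437, 18907856, 4472172539996,
    429, 17838096, 17059984, 357, 16793808, 18096144, 597, 17318080, 125, 17580160, 69, 17838720,
    245, 17830080, 165, 18092160, 149, 18096144, 7, 60434, 3, 7761950, 1066, 237, 23, 237, 27]

noncomputable def targetsL1 : List Cert.Sys :=
    [dataL1.target 0 true 0 sysL1', dataL1.target 0 false 0 sysL1']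

set_option maxRecDepth 100000 in
theorem check_L1 : Cert.check dataL1.W 3 targetsL1 certL1
    (dataL1.know [(1, ⟨1, 0, 0⟩)] [(7, ⟨1, 0, 0⟩)]) [] = true := by
  decide +kernel

def certL1' : Cert := .decode
    [282768, 605, 282752, 269, 278960, 557, 283104, 285, 4299210824, 18096128, 16797828, 18104452,
    125, 4566564936, 4367351880, 4908549912, 18096196, 165, 17838144, 17059968, 629, 18092160,
    149, 17584272, 453, 17322192, 437, 17838160, 17059984, 597, 16797840, 17059988, 357, 20210064,
    4472172560476, 429, 16793792, 18096128, 245, 17580160, 69, 18096128, 7, 60434, 3, 489486,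
    1042, 237, 23, 237, 27]

noncomputable def targetsL1' : List Cert.Sys :=
    [dataL1.target 0 true 0 sysL1', dataL1.target 0 false 0 sysL1']

set_option maxRecDepth 100000 in
theorem check_L1' : Cert.check dataL1.W 3 targetsL1' certL1'
    (dataL1.know [] [(1, ⟨1, 0, 0⟩)]) [] = true := by
  decide +kernel

def certL2 : Cert := .decode
    [19173584, 7, 7186, 3, 10445962, 6929498, 5420122, 588441630, 3636250, 3224594, 103706, 68722,
    60506, 29, 282768, 317, 19177664, 20105416564844,
    2120578323245812570949666126239685229053558194086479075238348919238506617309585450448550045884,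
    8279592664707283745221936794651179102462887090488780714343732623998785385244623349966870652,
    518484738190949565836124255489815994015479971449855573235257652584981026692944447282681948,
    8291590590647114265037300284025311123969801020078354855319146259529744402341466830691113084,
    8287674178744720446450421326733924816072481202530026371885734915897575782646317137903954044,
    4643209288, 20921259020396, 269, 314626487991533649307312588, 4754648617052,
    19654858652075982673994156, 19683341671399344822931884, 165, 17601152, 80421666623612,
    20921262694508, 19435716, 1259733761434805037072179676, 80544380507017617329440199180,
    1257910927972417649930195420, 405, 17601152, 20105420230764, 19435716, 20921262690412, 237,
    17580096, 17055940, 213, 17830080, 93, 17568000, 77, 19952064, 7, 48146, 3, 48242, 1242, 189,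
    23, 189, 27, 237, 18117072, 7, 7186, 3, 10446114, 6929602, 5420226, 588410910, 3636290,
    3224602, 104002, 68770, 42074, 29, 282768, 317, 19177664, 20105416564844,
    2120578323245812570949666126239685229053558194086479075238348919238506617309585450448550045884,
    8279592664707283745221936794651179102462887090488780714343732623998785385244623349966870652,
    8291590590647114265037300284025311123969801020078354855319146259529744402341466830691113084,
    518484738190949565836124255489815994015479971449855573235257652584981026692944447282681948,
    8287674178744720446450421326733924816072481202530026371885734915897575782646317137903954044,
    4643209288, 20921259020396, 269, 18137536, 80421666627708, 20921262690412,
    1288710088112281946738819949100, 17601156, 19435712, 20126574847558689191989125628,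
    322491842927310316113893921308, 405, 17601152, 20105420230764, 18434066894956, 17884445302892,
    213, 4366319976, 4908551448, 20921269903468, 4500504872, 93, 5107728584, 20105413447788,
    4578417959960748, 77, 19952064, 4908548440, 165, 19174016, 7, 48146, 3, 48578, 1914, 189, 23,
    189, 27, 165, 353765641940776561531068876, 334578666920877193027822028,
    341827507221377537496080945692, 1288710297901680815014670688812,
    1328314707752256066778045010476, 322025302296089911614393786908, 7, 7186, 3, 2249601086, 29,
    282768, 317, 17601152, 20105420230764, 20921262690412, 19435716, 405, 18137536,
    20921259020396, 20105416564844,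
    2120578323245812570949666126239685229053558194086479075238348919238506617309585450448550045884,
    8279592664707283745221936794651179102462887090488780714343732623998785385244623349966870652,
    518484738190949565836124255489815994015479971449855573235257652584981026692944447282681948,
    8291590590647114265037300284025311123969801020078354855319146259529744402341466830691113084,
    8287674178744720446450421326733924816072481202530026371885734915897575782646317137903954044,
    269, 17580096, 17055940, 213, 17830080, 93, 17568000, 77, 19952064, 7, 48146, 3, 48570, 1922,
    189, 23, 189, 27, 269, 17830080, 18313675435204796, 4719122887938220, 4614040199260,
    4365289960, 4566567272, 5094959091804, 5230317670492, 5026357055580, 405, 19943872,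
    18313672190730428, 18876484705194172, 17601156, 18137536, 213, 18137536, 5107729368,
    4908548840, 17884445315180, 4975542328, 4614036729948, 93, 19435712, 20921262694508,
    71537784029308, 5026356858972, 77, 17055936, 20921272033388, 7, 48146, 3, 396314678, 9392182,
    189, 17305600, 317, 23, 189, 16781440, 317, 27]

noncomputable def targetsL2 : List Cert.Sys :=
    [dataL2.target 0 true 0 sysL2', dataL2.target 0 false 0 sysL2']

set_option maxRecDepth 100000 in
theorem check_L2 : Cert.check dataL2.W 3 targetsL2 certL2
    (dataL2.know [(1, ⟨1, 0, 0⟩)] [(7, ⟨1, 0, 0⟩)]) [] = true := by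
  decide +kernel

def certL2' : Cert := .decode
    [282768, 317, 19177664, 4908440552, 4637973480, 18137536, 269, 17601152, 4637973464,
    4908440536, 4908552152, 19435716, 5107732440, 405, 17580096, 4908440344, 4637973272, 17055940,
    213, 17830080, 93, 17568000, 77, 4637970712, 5026354241628, 165, 18117072, 19173584, 237,
    19173584, 7, 48146, 3, 48266, 1314, 189, 23, 189, 27]

noncomputable def targetsL2' : List Cert.Sys :=
    [dataL2.target 0 true 0 sysL2', dataL2.target 0 false 0 sysL2']

set_option maxRecDepth 100000 in
theorem check_L2' : Cert.check dataL2.W 3 targetsL2' certL2'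
    (dataL2.know [] [(1, ⟨1, 0, 0⟩)]) [] = true := by
  decide +kernel

def certL3 : Cert := .decode
    [73014722752, 73015238724, 68770865220, 69860864004, 17875922370856, 18417090314520,
    73014714560, 285, 69827833856, 69827821760, 74105487488, 69861646340, 69861638276, 165,
    73015234688, 70868283472, 68803633280, 73014730944, 70934081600, 74121752656, 68803899472,
    669, 69844611092, 74105749648, 69861126164, 15, 1066, 3, 111634, 437, 73082339520, 15, 157726,
    3, 85002, 62482, 333, 74172600464, 15, 1122, 3, 1488910, 1472526, 1423374, 1128462, 3090, 725,
    73098858496, 70868013248, 68786860160, 73032007808, 69794537684, 69877113044, 717,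
    73098592384, 69794279552, 69878423700, 69844598912, 17879953080616, 69861113984, 72024592528,
    74104979664, 693, 69794279552, 7, 62482, 3, 74794, 245, 74123059280, 17867401646360,
    18417157427496, 69861130448, 18966644838696, 17596752625944, 18438429872424, 18438295687464,
    653, 74155556992, 74121744516, 293, 72024592528, 73098334340, 17596752625720, 68770861184,
    549, 74156085264, 70934859780, 68787376260, 13, 68770861184, 7, 80914, 3, 80946, 1114, 317,
    71957500048, 7, 44050, 3, 44082, 1114, 173, 312540493271440, 605, 308760921248080, 597,
    286431386579216, 557, 281544786706560, 413, 281826090577936, 525, 299348602147392, 269,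
    285873040003280, 237, 294816254538064, 213, 285876244713488, 509, 285941742702720, 189,
    282167726097024, 125, 285874097225856, 117, 303886300623360, 93, 338796736426640, 405,
    285941759475840, 389, 303808925679696, 453, 321825139081488, 69, 285952665223680, 53, 23, 173,
    281827265491792, 605, 308760921248080, 597, 321619131126480, 557, 290480585965648, 525,
    303808925679696, 453, 290272160514048, 413, 338796736426640, 405, 299348602147392, 269,
    281476084273152, 237, 281543730008064, 213, 312272042103296, 189, 321339891409232, 509,
    312606176575504, 389, 317079285928192, 125, 290339805990912, 117, 303886300623360, 93,
    281544803745792, 69, 290340863213568, 53, 27, 317, 73098334336, 173, 335157875454672, 605,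
    317563626623312, 597, 330140247699536, 557, 290480585965648, 525, 286290779332688, 509,
    303808925679696, 453, 335149367824784, 413, 308213380809088, 405, 338731236618640, 389,
    299348602147392, 269, 281476050718848, 237, 308071698276928, 213, 285873023488128, 189,
    317079285928192, 125, 281543712968832, 117, 285874130522112, 93, 281543713234944, 69,
    285952665223680, 53, 31, 293, 74123059280, 17867401646360, 17596752625944, 18692035330328,
    68803903680, 18142013210904, 18417157427496, 69861130448, 18966644838696, 653, 69794537680,
    68737314948, 17613799342152, 70867239108, 17884449394760, 549, 70934859776, 68787376256,
    70868021312, 13, 70883758464, 68770861188, 17613799342152, 245, 68737314944, 68770861184, 7,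
    80914, 3, 80946, 1114, 317, 73015763008, 7, 44050, 3, 44074, 1122, 173, 303817514557904, 453,
    335149367824784, 413, 317079285928192, 405, 303819614613776, 389, 308071698276928, 213,
    290339789213760, 189, 281544770715728, 509, 317358424215552, 125, 290272143736896, 117,
    294737835982928, 93, 294670206763088, 69, 294737852498000, 53, 290271069999168, 605,
    290271086514240, 597, 285873073815632, 557, 294669133283408, 525, 285952665223680, 269,
    281759520928320, 237, 35, 173, 281827265491792, 605, 308760921248080, 597, 321619131126480,
    557, 290480585965648, 525, 303808925679696, 453, 290272160514048, 413, 338796736426640, 405,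
    299348602147392, 269, 281476084273152, 237, 281543730008064, 213, 312272042103296, 189,
    321339891409232, 509, 312606176575504, 389, 317079285928192, 125, 290339805990912, 117,
    303886300623360, 93, 281544803745792, 69, 290340863213568, 53, 27, 317, 68770861184, 173,
    335157875454672, 605, 317563626623312, 597, 330140247699536, 557, 290480585965648, 525,
    286290779332688, 509, 303808925679696, 453, 335149367824784, 413, 308213380809088, 405,
    338731236618640, 389, 299348602147392, 269, 281476050718848, 237, 308071698276928, 213,
    285873023488128, 189, 317079285928192, 125, 281543712968832, 117, 285874130522112, 93,
    281543713234944, 69, 285952665223680, 53, 31]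

noncomputable def targetsL3 : List Cert.Sys :=
    [dataL3.target 0 false 0 sysL310'', dataL3.target 0 true 0 sysL310', dataL3.target 0 false 0
    sysL310', dataL3.target 0 true 0 sysL310'']

set_option maxRecDepth 100000 in
theorem check_L3 : Cert.check dataL3.W 3 targetsL3 certL3
    (dataL3.know [(1, ⟨1, 0, 0⟩)] [(1, ⟨1, 0, 0⟩)]) [] = true := by
  decide +kernel

def certL4 : Cert := .decode
    [1141915776, 605, 1107837056, 317, 1108353152, 173, 1141916112, 1108361684, 1725, 1192247440,
    1225269392, 2093, 1142702224, 1108361680, 1225277588, 1107857556, 2165, 1175454080,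
    309776614424, 281756399673436, 1196294827335788, 1268836556480620, 1142448132, 275284853416,
    275423199896, 2349, 1108361680, 2277, 1141907920, 1997, 1141391824, 1797, 1225269392, 1517,
    1225277584, 1469, 1225793680, 1109, 1107857552, 2189, 1141411984, 1269, 1141928080, 1397,
    1108381840, 1125, 1143218320, 1493, 68719476912, 2085, 68719485104, 1437, 70866960432, 1085,
    68720009264, 917, 73031254208, 1317588997055496380, 300127888475705131260, 1179535660957804,
    4833541976442667212, 18766859479030776028, 18776143755215716572, 296694628536,
    1273703771814988890380, 1207831339281236156, 5270390590537756876, 4973225030562427084,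
    318711992027986292988, 20486953083850600668, 77812168431743132, 288106792008, 296562508856,
    309444265208, 316868779409500, 288302875784, 300988548216, 288304972920, 317006218358876,
    304018237255772, 18692235641256, 17893102240216, 18313472165269596, 296559412344,
    288103695608, 18691773219624, 17613801406568, 18966716104904, 19140711857463388,
    19140373629050972, 19]

noncomputable def targetsL4 : List Cert.Sys :=
    []

set_option maxRecDepth 100000 in
theorem check_L4 : Cert.check dataL4.W 4 targetsL4 certL4
    (dataL4.know [(1, ⟨1, 0, 0⟩)] [(1, ⟨0, 1, 0⟩)]) [] = true := by
  decide +kernel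

def certL5 : Cert := .decode
    [295088, 557, 282768, 605, 282752, 269, 18137536, 4471111405660, 19]

noncomputable def targetsL5 : List Cert.Sys :=
    []

set_option maxRecDepth 100000 in
theorem check_L5 : Cert.check dataL5.W 3 targetsL5 certL5
    (dataL5.know [(1, ⟨1, 0, 0⟩)] [(1, ⟨0, 1, 1⟩)]) [] = true := by
  decide +kernel

end Data


noncomputable section

/-! ### The listed systems -/

def root : Poly := [(2, ⟨1, 0, 0⟩)]

def rootThird : Poly := [(2, ⟨1, 0, 2⟩)]

def third : Poly := [(1, ⟨1, 0, 2⟩)]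

variable {χ : ℕ →* ℂ}

theorem ev_root (hχ : χ 2 = iSqrt3) : root.ev χ = iSqrt3 := by simp [root, Q.val, hχ]

theorem ev_rootThird (hχ : χ 2 = iSqrt3) : rootThird.ev χ = iSqrt3 / 3 := by
  simp [rootThird, Q.val, hχ]
  ring

theorem ev_third : third.ev χ = 1 / 3 := by
  simp [third, Q.val]
  norm_num

theorem smul_S1' (hχ : χ 2 = iSqrt3) : ((1 : ℤ) : ℂ) • S1' = sysOf χ Data.sysS1' :=
  smul_eq_sysOf hχ (a := Lin.u 2 + 2 * (Lin.u 0 * Lin.v 0 * Lin.u 0))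
    (b := -Lin.v 2 - 2 * (Lin.v 0 * Lin.u 0 * Lin.v 0))
    (by simp [S1']) (by simp [S1']) (by decide +kernel)

theorem smul_S2' (hχ : χ 2 = iSqrt3) : ((1 : ℤ) : ℂ) • S2' = sysOf χ Data.sysS2' :=
  smul_eq_sysOf hχ (a := Lin.u 2 + 2 * (Lin.u 1 * Lin.u 0) + 2 * Lin.D (Lin.v 0 * Lin.u 0) + 2 * ⁅Lin.v 0 *
      Lin.u 0, Lin.u 0⁆)
    (b := -Lin.v 2 + 2 * (Lin.v 1 * Lin.v 0) + 2 * Lin.D (Lin.u 0 * Lin.v 0) + 2 * ⁅Lin.v 0,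
      Lin.u 0 * Lin.v 0⁆)
    (by simp [S2']) (by simp [S2']) (by decide +kernel)

theorem smul_S2'' (hχ : χ 2 = iSqrt3) : ((1 : ℤ) : ℂ) • S2'' = sysOf χ Data.sysS2'' :=
  smul_eq_sysOf hχ (a := Lin.u 2 + 2 * (Lin.u 0 * Lin.u 1) + 2 * Lin.D (Lin.v 0 * Lin.u 0) + 2 * ⁅Lin.u 0,
      Lin.v 0 * Lin.u 0⁆)
    (b := -Lin.v 2 + 2 * (Lin.v 1 * Lin.v 0) + 2 * Lin.D (Lin.v 0 * Lin.u 0) + 2 * ⁅Lin.v 0,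
      Lin.v 0 * Lin.u 0⁆)
    (by simp [S2'']) (by simp [S2'']) (by decide +kernel)

theorem smul_S3' (hχ : χ 2 = iSqrt3) : ((1 : ℤ) : ℂ) • S3' = sysOf χ Data.sysS3' :=
  smul_eq_sysOf hχ (a := Lin.u 2 + 2 * Lin.D (Lin.v 0 * Lin.u 0))
    (b := -Lin.v 2 + 2 * (Lin.v 1 * Lin.v 0) + 2 * Lin.u 1 + 2 * ⁅Lin.v 0, Lin.u 0⁆)
    (by simp [S3']) (by simp [S3']) (by decide +kernel)

theorem smul_S4' (hχ : χ 2 = iSqrt3) : ((1 : ℤ) : ℂ) • S4' = sysOf χ Data.sysS4' :=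
  smul_eq_sysOf hχ (a := Lin.u 2 + 2 * (Lin.u 1 * (Lin.u 0 + Lin.v 0)))
    (b := -Lin.v 2 + 2 * ((Lin.u 0 + Lin.v 0) * Lin.v 1))
    (by simp [S4']) (by simp [S4']) (by decide +kernel)

theorem smul_S4'' (hχ : χ 2 = iSqrt3) : ((1 : ℤ) : ℂ) • S4'' = sysOf χ Data.sysS4'' :=
  smul_eq_sysOf hχ (a := Lin.u 2 + 2 * ((Lin.u 0 + Lin.v 0) * Lin.u 1) + 2 * ⁅Lin.v 1, Lin.u 0⁆ - 2 * (Lin.u 0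
      ^ 2 * Lin.v 0) + 4 * (Lin.u 0 * Lin.v 0 * Lin.u 0) - 2 * (Lin.v 0 * Lin.u 0 ^ 2))
    (b := -Lin.v 2 + 2 * (Lin.v 1 * (Lin.u 0 + Lin.v 0)) + 2 * ⁅Lin.v 0, Lin.u 1⁆ + 2 * (Lin.u 0
      * Lin.v 0 ^ 2) - 4 * (Lin.v 0 * Lin.u 0 * Lin.v 0) + 2 * (Lin.v 0 ^ 2 * Lin.u 0))
    (by simp [S4'']) (by simp [S4'']) (by decide +kernel)

theorem smul_S512' (hχ : χ 2 = iSqrt3) : ((1 : ℤ) : ℂ) • S512' = sysOf χ Data.sysS512' :=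
  smul_eq_sysOf hχ (a := Lin.u 2 + 2 * Lin.D (Lin.u 0 * Lin.v 0 * Lin.u 0))
    (b := -Lin.v 2 + 2 * Lin.D (Lin.v 0 * Lin.u 0 * Lin.v 0))
    (by simp [S512']) (by simp [S512']) (by decide +kernel)

theorem smul_S512'' (hχ : χ 2 = iSqrt3) : ((1 : ℤ) : ℂ) • S512'' = sysOf χ Data.sysS512'' :=
  smul_eq_sysOf hχ (a := Lin.u 2 + 2 * (Lin.u 0 ^ 2 * Lin.v 1) + 2 * (Lin.u 1 * Lin.u 0 * Lin.v 0) + 2 * (Lin.u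
      1 * Lin.v 0 * Lin.u 0) + 2 * ⁅Lin.u 0 ^ 2 * Lin.v 0 ^ 2, Lin.u 0⁆)
    (b := -Lin.v 2 + 2 * (Lin.u 1 * Lin.v 0 ^ 2) + 2 * (Lin.u 0 * Lin.v 0 * Lin.v 1) + 2 *
      (Lin.v 0 * Lin.u 0 * Lin.v 1) - 2 * ⁅Lin.v 0, Lin.u 0 ^ 2 * Lin.v 0 ^ 2⁆)
    (by simp [S512'']) (by simp [S512'']) (by decide +kernel)

theorem smul_S501' (hχ : χ 2 = iSqrt3) : ((1 : ℤ) : ℂ) • S501' = sysOf χ Data.sysS501' :=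
  smul_eq_sysOf hχ (a := Lin.u 2 + 2 * (Lin.u 0 * Lin.v 0 * Lin.u 1))
    (b := -Lin.v 2 + 2 * (Lin.v 1 * Lin.u 0 * Lin.v 0))
    (by simp [S501']) (by simp [S501']) (by decide +kernel)

theorem smul_S501'' (hχ : χ 2 = iSqrt3) : ((1 : ℤ) : ℂ) • S501'' = sysOf χ Data.sysS501'' :=
  smul_eq_sysOf hχ (a := Lin.u 2 + 2 * (Lin.v 0 * Lin.u 0 * Lin.u 1) + 2 * ⁅Lin.v 1 * Lin.u 0 - Lin.v 0 *
      ⁅Lin.v 0, Lin.u 0⁆ * Lin.u 0, Lin.u 0⁆)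
    (b := -Lin.v 2 + 2 * (Lin.v 1 * Lin.v 0 * Lin.u 0) + 2 * ⁅Lin.v 0, Lin.v 0 * Lin.u 1 + Lin.v
      0 * ⁅Lin.v 0, Lin.u 0⁆ * Lin.u 0⁆)
    (by simp [S501'']) (by simp [S501'']) (by decide +kernel)

theorem smul_S501''' (hχ : χ 2 = iSqrt3) : ((1 : ℤ) : ℂ) • S501''' = sysOf χ Data.sysS501''' :=
  smul_eq_sysOf hχ (a := Lin.u 2 + 2 * (Lin.u 1 * Lin.v 0 * Lin.u 0) + 2 * ⁅Lin.u 0 * Lin.v 0, Lin.u 1⁆ + 2 *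
      ⁅Lin.u 0 * Lin.v 1, Lin.u 0⁆ - 2 * (Lin.u 0 * (Lin.u 0 ^ 2 * Lin.v 0 - 2 * (Lin.u 0 *
      Lin.v 0 * Lin.u 0) + Lin.v 0 * Lin.u 0 ^ 2) * Lin.v 0))
    (b := -Lin.v 2 + 2 * (Lin.v 0 * Lin.u 0 * Lin.v 1) + 2 * ⁅Lin.v 1, Lin.u 0 * Lin.v 0⁆ + 2 *
      ⁅Lin.v 0, Lin.u 1 * Lin.v 0⁆ + 2 * (Lin.u 0 * (Lin.u 0 * Lin.v 0 ^ 2 - 2 * (Lin.v 0 *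
      Lin.u 0 * Lin.v 0) + Lin.v 0 ^ 2 * Lin.u 0) * Lin.v 0))
    (by simp [S501''']) (by simp [S501''']) (by decide +kernel)

theorem smul_S510' (hχ : χ 2 = iSqrt3) : ((1 : ℤ) : ℂ) • S510' = sysOf χ Data.sysS510' :=
  smul_eq_sysOf hχ (a := Lin.u 2 + 2 * (Lin.u 0 * Lin.v 1 * Lin.u 0) - 2 * (Lin.u 0 * Lin.v 0 * Lin.u 0 * Lin.v
      0 * Lin.u 0))
    (b := -Lin.v 2 + 2 * (Lin.v 0 * Lin.u 1 * Lin.v 0) + 2 * (Lin.v 0 * Lin.u 0 * Lin.v 0 *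
      Lin.u 0 * Lin.v 0))
    (by simp [S510']) (by simp [S510']) (by decide +kernel)

theorem smul_S510'' (hχ : χ 2 = iSqrt3) : ((1 : ℤ) : ℂ) • S510'' = sysOf χ Data.sysS510'' :=
  smul_eq_sysOf hχ (a := Lin.u 2 + 2 * (Lin.u 0 ^ 2 * Lin.v 1) - 2 * (Lin.u 0 ^ 3 * Lin.v 0 ^ 2) + 2 * ⁅Lin.u 1
      + Lin.u 0 ^ 2 * Lin.v 0, Lin.u 0 * Lin.v 0⁆)
    (b := -Lin.v 2 + 2 * (Lin.u 1 * Lin.v 0 ^ 2) + 2 * (Lin.u 0 ^ 2 * Lin.v 0 ^ 3) - 2 * ⁅Lin.v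
      1 - Lin.u 0 * Lin.v 0 ^ 2, Lin.u 0 * Lin.v 0⁆)
    (by simp [S510'']) (by simp [S510'']) (by decide +kernel)

theorem smul_B2' (hχ : χ 2 = iSqrt3) : ((3 : ℤ) : ℂ) • B2' = sysOf χ Data.sysB2' :=
  smul_eq_sysOf hχ (a := Lin.u 2 + Lin.v 1 * Lin.v 0 + Lin.v 0 * Lin.v 1 + rootThird • ⁅Lin.u 0 - Lin.v 1,
      Lin.v 0⁆)
    (b := -Lin.v 2 + Lin.u 1)
    (by simp [B2', ev_rootThird hχ]) (by simp [B2']) (by decide +kernel)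

theorem smul_B3' (hχ : χ 2 = iSqrt3) : ((1 : ℤ) : ℂ) • B3' = sysOf χ Data.sysB3' :=
  smul_eq_sysOf hχ (a := Lin.u 2 + 3 * ((Lin.u 0 + Lin.v 0) * Lin.v 1) + 3 * (Lin.v 1 * (Lin.u 0 + Lin.v 0)) -
      6 * (Lin.u 0 + Lin.v 0) ^ 3 + root • ⁅Lin.u 0 + Lin.v 0, Lin.v 1⁆)
    (b := -Lin.v 2 + 3 * ((Lin.u 0 + Lin.v 0) * Lin.u 1) + 3 * (Lin.u 1 * (Lin.u 0 + Lin.v 0)) +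
      6 * (Lin.u 0 + Lin.v 0) ^ 3 - root • ⁅Lin.u 0 + Lin.v 0, Lin.u 1⁆)
    (by simp [B3', ev_root hχ]) (by simp [B3', ev_root hχ]) (by decide +kernel)

theorem smul_B3'' (hχ : χ 2 = iSqrt3) : ((1 : ℤ) : ℂ) • B3'' = sysOf χ Data.sysB3'' :=
  smul_eq_sysOf hχ (a := Lin.u 2 + 3 * ((Lin.u 0 + Lin.v 0) * Lin.v 1) + 3 * (Lin.v 1 * (Lin.u 0 + Lin.v 0)) -
      6 * (Lin.u 0 ^ 3 + 3 * (Lin.u 0 * Lin.v 0 * Lin.u 0) + Lin.u 0 * Lin.v 0 ^ 2 + Lin.v 0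
      * Lin.u 0 * Lin.v 0 + Lin.v 0 ^ 2 * Lin.u 0 + Lin.v 0 ^ 3) + root • (⁅Lin.v 1, Lin.u 0
      - Lin.v 0⁆ + 2 * ⁅Lin.u 0 + Lin.v 0, Lin.u 1⁆ + 6 * ⁅Lin.u 0 ^ 2, Lin.v 0⁆ + 6 *
      ⁅Lin.u 0, Lin.v 0 ^ 2⁆))
    (b := -Lin.v 2 + 3 * ((Lin.u 0 + Lin.v 0) * Lin.u 1) + 3 * (Lin.u 1 * (Lin.u 0 + Lin.v 0)) +
      6 * (Lin.u 0 ^ 3 + Lin.u 0 ^ 2 * Lin.v 0 + Lin.u 0 * Lin.v 0 * Lin.u 0 + Lin.v 0 *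
      Lin.u 0 ^ 2 + 3 * (Lin.v 0 * Lin.u 0 * Lin.v 0) + Lin.v 0 ^ 3) + root • (⁅Lin.u 1,
      Lin.u 0 - Lin.v 0⁆ - 2 * ⁅Lin.u 0 + Lin.v 0, Lin.v 1⁆ - 6 * ⁅Lin.u 0 ^ 2, Lin.v 0⁆ - 6
      * ⁅Lin.u 0, Lin.v 0 ^ 2⁆))
    (by simp [B3'', ev_root hχ]) (by simp [B3'', ev_root hχ]) (by decide +kernel)

theorem smul_B4' (hχ : χ 2 = iSqrt3) : ((3 : ℤ) : ℂ) • B4' = sysOf χ Data.sysB4' :=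
  smul_eq_sysOf hχ (a := Lin.u 2 + Lin.v 0 * Lin.v 1 + Lin.v 1 * Lin.v 0 + rootThird • ⁅Lin.v 0, Lin.u 0 ^ 2 -
      Lin.v 1⁆ - third • (Lin.u 0 ^ 2 * Lin.v 0 - 2 * (Lin.u 0 * Lin.v 0 * Lin.u 0) + Lin.v
      0 * Lin.u 0 ^ 2))
    (b := -Lin.v 2 + Lin.u 0 * Lin.u 1 + Lin.u 1 * Lin.u 0 + rootThird • ⁅Lin.u 0, Lin.v 0 ^ 2 +
      Lin.u 1⁆ + third • (Lin.u 0 * Lin.v 0 ^ 2 - 2 * (Lin.v 0 * Lin.u 0 * Lin.v 0) + Lin.v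
      0 ^ 2 * Lin.u 0))
    (by simp [B4', ev_rootThird hχ, ev_third]) (by simp [B4', ev_rootThird hχ, ev_third]) (by decide +kernel)

theorem smul_B4'' (hχ : χ 2 = iSqrt3) : ((3 : ℤ) : ℂ) • B4'' = sysOf χ Data.sysB4'' :=
  smul_eq_sysOf hχ (a := Lin.u 2 + Lin.v 0 * Lin.v 1 + Lin.v 1 * Lin.v 0 + Lin.u 0 ^ 2 * Lin.v 0 - 2 * (Lin.u 0
      * Lin.v 0 * Lin.u 0) + Lin.v 0 * Lin.u 0 ^ 2 - rootThird • (2 * ⁅Lin.u 0 + Lin.v 0,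
      Lin.u 1⁆ + ⁅Lin.v 0 - 2 * Lin.u 0, Lin.v 1⁆ + ⁅Lin.u 0 ^ 2, Lin.v 0⁆ + 2 * ⁅Lin.u 0,
      Lin.v 0 ^ 2⁆))
    (b := -Lin.v 2 + Lin.u 0 * Lin.u 1 + Lin.u 1 * Lin.u 0 - Lin.u 0 * Lin.v 0 ^ 2 + 2 * (Lin.v
      0 * Lin.u 0 * Lin.v 0) - Lin.v 0 ^ 2 * Lin.u 0 + rootThird • (⁅Lin.u 0 - 2 * Lin.v 0,
      Lin.u 1⁆ + 2 * ⁅Lin.u 0 + Lin.v 0, Lin.v 1⁆ + 2 * ⁅Lin.u 0 ^ 2, Lin.v 0⁆ + ⁅Lin.u 0,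
      Lin.v 0 ^ 2⁆))
    (by simp [B4'', ev_rootThird hχ]) (by simp [B4'', ev_rootThird hχ]) (by decide +kernel)

theorem smul_L1' (hχ : χ 2 = iSqrt3) : ((1 : ℤ) : ℂ) • L1' = sysOf χ Data.sysL1' :=
  smul_eq_sysOf hχ (a := Lin.u 2 + 2 * (Lin.u 1 * Lin.u 0) + 2 * Lin.D (Lin.u 0 * Lin.v 0) + 2 * (Lin.u 0 *
      Lin.v 0 * (Lin.u 0 + Lin.v 0)))
    (b := -Lin.v 2 - 2 * (Lin.v 1 * Lin.v 0) - 2 * Lin.D (Lin.v 0 * Lin.u 0) - 2 * (Lin.v 0 *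
      Lin.u 0 * (Lin.u 0 + Lin.v 0)))
    (by simp [L1']) (by simp [L1']) (by decide +kernel)

theorem smul_L2' (hχ : χ 2 = iSqrt3) : ((1 : ℤ) : ℂ) • L2' = sysOf χ Data.sysL2' :=
  smul_eq_sysOf hχ (a := Lin.u 2 + 2 * Lin.D (Lin.u 0 * Lin.v 0) + Lin.u 0 ^ 2 + 2 * (Lin.u 0 * Lin.v 0 ^ 2))
    (b := -Lin.v 2 - Lin.u 1 - 2 * (Lin.v 1 * Lin.v 0) - ⁅Lin.u 0, Lin.v 0⁆)
    (by simp [L2']) (by simp [L2']) (by decide +kernel)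

theorem smul_L310' (hχ : χ 2 = iSqrt3) : ((1 : ℤ) : ℂ) • L310' = sysOf χ Data.sysL310' :=
  smul_eq_sysOf hχ (a := Lin.u 2 + 2 * (Lin.u 0 * Lin.v 1 * Lin.u 0) + 2 * (Lin.u 1 * Lin.v 0 * Lin.u 0))
    (b := -Lin.v 2)
    (by simp [L310']) (by simp [L310']) (by decide +kernel)

theorem smul_L310'' (hχ : χ 2 = iSqrt3) : ((1 : ℤ) : ℂ) • L310'' = sysOf χ Data.sysL310'' :=
  smul_eq_sysOf hχ (a := Lin.u 2 + 2 * (Lin.u 1 * Lin.u 0 * Lin.v 0) + 2 * (Lin.u 0 ^ 2 * Lin.v 1) - 2 * (Lin.u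
      0 ^ 2 * ⁅Lin.u 0, Lin.v 0⁆ * Lin.v 0))
    (b := -Lin.v 2 + 2 * ⁅Lin.u 0 * Lin.v 0, Lin.v 1 - Lin.u 0 * Lin.v 0 ^ 2⁆ + 2 * ⁅Lin.u 1 *
      Lin.v 0 + Lin.u 0 ^ 2 * Lin.v 0 ^ 2, Lin.v 0⁆)
    (by simp [L310'']) (by simp [L310'']) (by decide +kernel)

end


/-! ### The scalar systems -/

theorem abelianize_combo_nil (χ : ℕ →* ℂ) : abelianize (combo χ []) = 0 := by
  rw [combo, List.map_nil, List.sum_nil, map_zero]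

theorem abelianize_combo_cons (χ : ℕ →* ℂ) (w : Word) (p : Poly) (L : List (Word × Poly)) :
    abelianize (combo χ ((w, p) :: L)) =
      Poly.ev χ p • (w.map fun l => (MvPolynomial.X (toLetter l) : CPoly)).prod +
        abelianize (combo χ L) := by
  rw [combo, List.map_cons, List.sum_cons, map_add, map_smul, word, map_list_prod, List.map_map, List.map_map]
  congr 3
  exact List.map_congr_left fun l _ => abelianize_ι _

set_option linter.unusedSimpArgs false
set_option linter.unusedTactic false
set_option linter.unreachableTactic false

namespace Data

theorem describes_dataS1 {β : ℂ} : dataS1.Describes β (S1) := by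
  intro χ hχ
  constructor
  all_goals
    simp only [dataS1, ofWords, S1, abelianize_combo_cons, abelianize_combo_nil, Poly.ev_cons, Poly.ev_nil,
      List.map_cons, List.map_nil, List.prod_cons, List.prod_nil, toLetter, par, Q.val, hχ, map_one,
      cu, cv, MvPolynomial.smul_eq_C_mul]
    simp [sub_eq_add_neg, map_ofNat (MvPolynomial.C (σ := Letter) (R := ℂ))]
    try ring

theorem pins_dataS1 : dataS1.pins 0 0 [0, 0, 1] [0, 0, 1] = true := by decide +kernel

theorem describes_dataS2 {β : ℂ} : dataS2.Describes β (S2) := by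
  intro χ hχ
  constructor
  all_goals
    simp only [dataS2, ofWords, S2, abelianize_combo_cons, abelianize_combo_nil, Poly.ev_cons, Poly.ev_nil,
      List.map_cons, List.map_nil, List.prod_cons, List.prod_nil, toLetter, par, Q.val, hχ, map_one,
      cu, cv, MvPolynomial.smul_eq_C_mul]
    simp [sub_eq_add_neg, map_ofNat (MvPolynomial.C (σ := Letter) (R := ℂ))]
    try ring

theorem pins_dataS2 : dataS2.pins 0 1 [0, 3] [1, 2] = true := by decide +kernel

theorem describes_dataS3 {β : ℂ} : dataS3.Describes β (S3) := by
  intro χ hχ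
  constructor
  all_goals
    simp only [dataS3, ofWords, S3, abelianize_combo_cons, abelianize_combo_nil, Poly.ev_cons, Poly.ev_nil,
      List.map_cons, List.map_nil, List.prod_cons, List.prod_nil, toLetter, par, Q.val, hχ, map_one,
      cu, cv, MvPolynomial.smul_eq_C_mul]
    simp [sub_eq_add_neg, map_ofNat (MvPolynomial.C (σ := Letter) (R := ℂ))]
    try ring

theorem pins_dataS3 : dataS3.pins 0 1 [0, 3] [2] = true := by decide +kernel

theorem describes_dataS4 {β : ℂ} : dataS4.Describes β (S4) := by
  intro χ hχ
  constructor
  all_goals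
    simp only [dataS4, ofWords, S4, abelianize_combo_cons, abelianize_combo_nil, Poly.ev_cons, Poly.ev_nil,
      List.map_cons, List.map_nil, List.prod_cons, List.prod_nil, toLetter, par, Q.val, hχ, map_one,
      cu, cv, MvPolynomial.smul_eq_C_mul]
    simp [sub_eq_add_neg, map_ofNat (MvPolynomial.C (σ := Letter) (R := ℂ))]
    try ring

theorem pins_dataS4 : dataS4.pins 0 0 [0, 2] [1, 2] = true := by decide +kernel

theorem describes_dataS5 {β : ℂ} : dataS5.Describes β (S5 1 β) := by
  intro χ hχ
  constructor
  all_goals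
    simp only [dataS5, ofWords, S5, abelianize_combo_cons, abelianize_combo_nil, Poly.ev_cons, Poly.ev_nil,
      List.map_cons, List.map_nil, List.prod_cons, List.prod_nil, toLetter, par, Q.val, hχ, map_one,
      cu, cv, MvPolynomial.smul_eq_C_mul]
    simp [sub_eq_add_neg, map_ofNat (MvPolynomial.C (σ := Letter) (R := ℂ))]
    try ring

theorem pins_dataS5 : dataS5.pins 0 0 [0, 0, 3] [0, 0, 3] = true := by decide +kernel

theorem describes_dataS501 {β : ℂ} : dataS501.Describes β (S5 0 1) := by
  intro χ hχ
  constructor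
  all_goals
    simp only [dataS501, ofWords, S5, abelianize_combo_cons, abelianize_combo_nil, Poly.ev_cons, Poly.ev_nil,
      List.map_cons, List.map_nil, List.prod_cons, List.prod_nil, toLetter, par, Q.val, hχ, map_one,
      cu, cv, MvPolynomial.smul_eq_C_mul]
    simp [sub_eq_add_neg, map_ofNat (MvPolynomial.C (σ := Letter) (R := ℂ))]
    try ring

theorem pins_dataS501 : dataS501.pins 0 0 [0, 1, 2] [0, 1, 2] = true := by decide +kernel

theorem describes_dataB1 {β : ℂ} : dataB1.Describes β (B1) := by
  intro χ hχ
  constructor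
  all_goals
    simp only [dataB1, ofWords, B1, abelianize_combo_cons, abelianize_combo_nil, Poly.ev_cons, Poly.ev_nil,
      List.map_cons, List.map_nil, List.prod_cons, List.prod_nil, toLetter, par, Q.val, hχ, map_one,
      cu, cv, MvPolynomial.smul_eq_C_mul]
    simp [sub_eq_add_neg, map_ofNat (MvPolynomial.C (σ := Letter) (R := ℂ))]
    try ring

theorem pins_dataB1 : dataB1.pins 0 0 [0, 0] [1, 1] = true := by decide +kernel

theorem describes_dataB2 {β : ℂ} : dataB2.Describes β (B2) := by
  intro χ hχ
  constructor
  all_goals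
    simp only [dataB2, ofWords, B2, abelianize_combo_cons, abelianize_combo_nil, Poly.ev_cons, Poly.ev_nil,
      List.map_cons, List.map_nil, List.prod_cons, List.prod_nil, toLetter, par, Q.val, hχ, map_one,
      cu, cv, MvPolynomial.smul_eq_C_mul]
    simp [sub_eq_add_neg, map_ofNat (MvPolynomial.C (σ := Letter) (R := ℂ))]
    try ring

theorem pins_dataB2 : dataB2.pins 0 1 [1, 3] [2] = true := by decide +kernel

theorem describes_dataB3 {β : ℂ} : dataB3.Describes β (B3) := by
  intro χ hχ
  constructor
  all_goals
    simp only [dataB3, ofWords, B3, abelianize_combo_cons, abelianize_combo_nil, Poly.ev_cons, Poly.ev_nil,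
      List.map_cons, List.map_nil, List.prod_cons, List.prod_nil, toLetter, par, Q.val, hχ, map_one,
      cu, cv, MvPolynomial.smul_eq_C_mul]
    simp [sub_eq_add_neg, map_ofNat (MvPolynomial.C (σ := Letter) (R := ℂ))]
    try ring

theorem pins_dataB3 : dataB3.pins 0 0 [0, 3] [1, 3] = true := by decide +kernel

theorem describes_dataB4 {β : ℂ} : dataB4.Describes β (B4) := by
  intro χ hχ
  constructor
  all_goals
    simp only [dataB4, ofWords, B4, abelianize_combo_cons, abelianize_combo_nil, Poly.ev_cons, Poly.ev_nil,
      List.map_cons, List.map_nil, List.prod_cons, List.prod_nil, toLetter, par, Q.val, hχ, map_one,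
      cu, cv, MvPolynomial.smul_eq_C_mul]
    simp [sub_eq_add_neg, map_ofNat (MvPolynomial.C (σ := Letter) (R := ℂ))]
    try ring

theorem pins_dataB4 : dataB4.pins 0 1 [1, 3] [0, 2] = true := by decide +kernel

theorem describes_dataL1 {β : ℂ} : dataL1.Describes β (L1) := by
  intro χ hχ
  constructor
  all_goals
    simp only [dataL1, ofWords, L1, abelianize_combo_cons, abelianize_combo_nil, Poly.ev_cons, Poly.ev_nil,
      List.map_cons, List.map_nil, List.prod_cons, List.prod_nil, toLetter, par, Q.val, hχ, map_one,
      cu, cv, MvPolynomial.smul_eq_C_mul]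
    simp [sub_eq_add_neg, map_ofNat (MvPolynomial.C (σ := Letter) (R := ℂ))]
    try ring

theorem pins_dataL1 : dataL1.pins 0 0 [0, 2] [1, 2] = true := by decide +kernel

theorem describes_dataL2 {β : ℂ} : dataL2.Describes β (L2) := by
  intro χ hχ
  constructor
  all_goals
    simp only [dataL2, ofWords, L2, abelianize_combo_cons, abelianize_combo_nil, Poly.ev_cons, Poly.ev_nil,
      List.map_cons, List.map_nil, List.prod_cons, List.prod_nil, toLetter, par, Q.val, hχ, map_one,
      cu, cv, MvPolynomial.smul_eq_C_mul]
    simp [sub_eq_add_neg, map_ofNat (MvPolynomial.C (σ := Letter) (R := ℂ))]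
    try ring

theorem pins_dataL2 : dataL2.pins 0 1 [0, 0] [2] = true := by decide +kernel

theorem describes_dataL3 {β : ℂ} : dataL3.Describes β (L3 1 β) := by
  intro χ hχ
  constructor
  all_goals
    simp only [dataL3, ofWords, L3, abelianize_combo_cons, abelianize_combo_nil, Poly.ev_cons, Poly.ev_nil,
      List.map_cons, List.map_nil, List.prod_cons, List.prod_nil, toLetter, par, Q.val, hχ, map_one,
      cu, cv, MvPolynomial.smul_eq_C_mul]
    simp [sub_eq_add_neg, map_ofNat (MvPolynomial.C (σ := Letter) (R := ℂ))]
    try ring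

theorem pins_dataL3 : dataL3.pins 0 0 [0, 0, 3] [0, 0, 3] = true := by decide +kernel

theorem describes_dataL4 {β : ℂ} : dataL4.Describes β (L4) := by
  intro χ hχ
  constructor
  all_goals
    simp only [dataL4, ofWords, L4, abelianize_combo_cons, abelianize_combo_nil, Poly.ev_cons, Poly.ev_nil,
      List.map_cons, List.map_nil, List.prod_cons, List.prod_nil, toLetter, par, Q.val, hχ, map_one,
      cu, cv, MvPolynomial.smul_eq_C_mul]
    simp [sub_eq_add_neg, map_ofNat (MvPolynomial.C (σ := Letter) (R := ℂ))]
    try ring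

theorem pins_dataL4 : dataL4.pins 0 0 [1, 3] [0, 0, 3] = true := by decide +kernel

theorem describes_dataL5 {β : ℂ} : dataL5.Describes β (L5) := by
  intro χ hχ
  constructor
  all_goals
    simp only [dataL5, ofWords, L5, abelianize_combo_cons, abelianize_combo_nil, Poly.ev_cons, Poly.ev_nil,
      List.map_cons, List.map_nil, List.prod_cons, List.prod_nil, toLetter, par, Q.val, hχ, map_one,
      cu, cv, MvPolynomial.smul_eq_C_mul]
    simp [sub_eq_add_neg, map_ofNat (MvPolynomial.C (σ := Letter) (R := ℂ))]
    try ring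

theorem pins_dataL5 : dataL5.pins 0 0 [0, 2] [1, 3] = true := by decide +kernel

end Data


noncomputable section

/-! ### From checks to analogs -/

theorem ab_eq_of_equivalent {F G : NSystem} (h : Equivalent F G) :
    ∃ c : Fin 2 → ℂ, (∀ k, c k ≠ 0) ∧ F.ab = G.ab.rescale c := by
  obtain ⟨c, hc, rfl | rfl⟩ := h
  · exact ⟨c, hc, NSystem.ab_rescale ..⟩
  · exact ⟨c, hc, by rw [NSystem.ab_involution, NSystem.ab_rescale]⟩

theorem analogsAre_of_forall {f : CSystem} {l : List NSystem} (hl : ∀ G ∈ l, IsAnalog f G)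
    (h : ∀ F, IsAnalog f F → ∃ G ∈ l, Equivalent F G) : AnalogsAre f l := by
  refine fun F => ⟨fun hF => ⟨hF.1, h F hF⟩, ?_⟩
  rintro ⟨rfl, G, hG, hFG⟩
  refine isAnalog_of_equivalent hFG ?_
  have := hl G hG
  rwa [this.1]

namespace Data

variable {d : Data} {n k l : ℕ} {w x : Word} {f : CSystem}

theorem isAnalog_of_checks {b : ℤ} (hp : d.pins k l w x = true) (hd : d.Describes b f)
    {F : NSystem} {a : ℤ} (ha : a ≠ 0) {F' G : List Term × List Term}
    (hF : ∀ χ : ℕ →* ℂ, χ 2 = iSqrt3 → (a : ℂ) • F = sysOf χ F') {c : ℤ}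
    (hG : d.isSymmetric false n c F' G = true)
    (hab : (equalAb b (F'.1.map Term.toPair) (Lin.smulTerms (Poly.const a) d.f.1) &&
      equalAb b (F'.2.map Term.toPair) (Lin.smulTerms (Poly.const a) d.f.2)) = true)
    (hmin : n = 3 ∨ n = 4 ∧ ∀ g, ¬ f.IsHomSymmetry 3 g) : f.IsMinOrder n ∧ IsAnalog f F := by
  obtain ⟨χ, h2, h3⟩ := exists_param b
  exact isAnalog_of_isSymmetric hp hd h2 (ab_eq_of_equalAb h2 h3 hd ha (hF χ h2) hab)
    (by exact_mod_cast ha) (hF χ h2) hG hmin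

theorem exists_equivalent_of_target {β : ℂ} {targets : List Cert.Sys}
    {cands : List (NSystem × ℤ × (List Term × List Term))} {js : List ℕ}
    (hm : matchesAll targets cands js = true)
    (hc : ∀ χ : ℕ →* ℂ, χ 2 = iSqrt3 →
      ∀ e ∈ cands, e.2.1 ≠ 0 ∧ (e.2.1 : ℂ) • e.1 = sysOf χ e.2.2) {F : NSystem}
    (hT : ∃ T ∈ targets, ∃ χ : ℕ →* ℂ, χ 2 = iSqrt3 ∧ χ 3 = β ∧
      F 0 = u 2 + combo χ T.1 ∧ F 1 = -v 2 + combo χ T.2) :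
    ∃ G ∈ cands.map (·.1), Equivalent F G := by
  obtain ⟨T, hT, χ, h2, -, h0, h1⟩ := hT
  obtain ⟨e, he, j, -, h⟩ := exists_of_matchesAll h2 hm (hc χ h2) ⟨T, hT, h0, h1⟩
  exact ⟨e.1, List.mem_map_of_mem he, factors χ j, factors_ne_zero h2 j, h⟩

variable {β : ℂ} {F G : NSystem}

/-- The classification when the leading coefficients of the symmetry have the ratio `s`. -/
theorem exists_target (h : d.Symmetric β f n F G) (hn : G.HasOrder n)
    (ho : d.orderCheck n = true) {L : List (ℕ × ℕ × ℕ)} {r q : Poly} (s : ℂ)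
    (hL : d.leadCheck n L r = true) (hr : ∀ χ : ℕ →* ℂ, r.ev χ = 0 → χ 7 = s * χ 5)
    (hq : ∀ χ : ℕ →* ℂ, χ 1 = 1 → q.ev χ = s) {targets : List Cert.Sys} {C : Cert}
    (hC : Cert.check d.W n targets C (d.know [(1, ⟨1, 0, 0⟩)] q) [] = true) :
    ∃ T ∈ targets, ∃ χ : ℕ →* ℂ, χ 2 = iSqrt3 ∧ χ 3 = β ∧
      F 0 = u 2 + combo χ T.1 ∧ F 1 = -v 2 + combo χ T.2 := by
  obtain ⟨χ, h5, h7, h0⟩ := h.lead_relation hL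
  have h1 := hr χ h0
  rw [h5, h7] at h1
  have hne : lead G 0 ≠ 0 := fun h0 => h.lead_ne_zero hn ho h0 (by rw [h1, h0, mul_zero])
  refine (h.smul (lead G 0)⁻¹).classify (fun χ _ _ => ?_) hC
  rw [lead_smul, lead_smul, h1, mul_left_comm, inv_mul_cancel₀ hne, hq χ (map_one χ)]
  simp [Q.val]

/-- The classification when the leading coefficients of the symmetry are not known to be related. -/
theorem exists_target_or (h : d.Symmetric β f n F G) (hn : G.HasOrder n)
    (ho : d.orderCheck n = true) {targets targets' : List Cert.Sys} {C C' : Cert}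
    (hC : Cert.check d.W n targets C (d.know [(1, ⟨1, 0, 0⟩)] [(7, ⟨1, 0, 0⟩)]) [] = true)
    (hC' : Cert.check d.W n targets' C' (d.know [] [(1, ⟨1, 0, 0⟩)]) [] = true) :
    ∃ T ∈ targets ++ targets', ∃ χ : ℕ →* ℂ, χ 2 = iSqrt3 ∧ χ 3 = β ∧
      F 0 = u 2 + combo χ T.1 ∧ F 1 = -v 2 + combo χ T.2 := by
  by_cases h0 : lead G 0 = 0
  · have hne : lead G 1 ≠ 0 := fun h1 => h.lead_ne_zero hn ho h0 h1
    obtain ⟨T, hT, h'⟩ := (h.smul (lead G 1)⁻¹).classify (fun χ _ _ => by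
      rw [lead_smul, lead_smul, h0, inv_mul_cancel₀ hne]
      simp [Q.val]) hC'
    exact ⟨T, List.mem_append_right _ hT, h'⟩
  · obtain ⟨T, hT, h'⟩ := (h.smul (lead G 0)⁻¹).classify (fun χ _ h7 => by
      rw [← h7, lead_smul, inv_mul_cancel₀ h0]
      simp [Q.val]) hC
    exact ⟨T, List.mem_append_left _ hT, h'⟩

theorem symmetric_of_isMinOrder (hp : d.pins k l w x = true) (hd : d.Describes β f)
    (hv : d.isValid = true) (hm : f.IsMinOrder n) (h : IsAnalog f F) :
    ∃ G, G.HasOrder n ∧ d.Symmetric β f n F G := by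
  obtain ⟨m, G, hm', h'⟩ := symmetric_of_isAnalog hp hd hv h
  rw [hm.unique hm']
  exact ⟨G, h'⟩

end Data

end


noncomputable section

open Data

theorem not_isHomSymmetry_B2 (g : CSystem) : ¬ B2.IsHomSymmetry 3 g := by
  obtain ⟨χ, h2, h3⟩ := exists_param 0
  exact not_isHomSymmetry (β := 0) pins_dataB2 isValid_dataB2 describes_dataB2 h2
    (eq_ab_sysOf h2 h3 describes_dataB2 (by decide +kernel)) excludes_B2 admittedUpTo_B2 g

theorem not_isHomSymmetry_B3 (g : CSystem) : ¬ B3.IsHomSymmetry 3 g := by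
  obtain ⟨χ, h2, h3⟩ := exists_param 0
  exact not_isHomSymmetry (β := 0) pins_dataB3 isValid_dataB3 describes_dataB3 h2
    (eq_ab_sysOf h2 h3 describes_dataB3 (by decide +kernel)) excludes_B3 admittedUpTo_B3 g

theorem not_isHomSymmetry_B4 (g : CSystem) : ¬ B4.IsHomSymmetry 3 g := by
  obtain ⟨χ, h2, h3⟩ := exists_param 0
  exact not_isHomSymmetry (β := 0) pins_dataB4 isValid_dataB4 describes_dataB4 h2
    (eq_ab_sysOf h2 h3 describes_dataB4 (by decide +kernel)) excludes_B4 admittedUpTo_B4 g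

theorem isAnalog_S1' : CSystem.IsMinOrder (S1) 3 ∧ IsAnalog (S1) S1' :=
  isAnalog_of_checks (b := 0) (a := 1) pins_dataS1 describes_dataS1
    (by decide) (fun _ => smul_S1') isSymmetric_S1' (by decide +kernel) (.inl rfl)

theorem exists_equivalent_S1 {F : NSystem} (h : IsAnalog (S1) F) :
    ∃ G ∈ [S1'], Equivalent F G := by
  obtain ⟨G, hn, hs⟩ := symmetric_of_isMinOrder (β := 0) pins_dataS1 describes_dataS1
    isValid_dataS1 isAnalog_S1'.1 h
  exact exists_equivalent_of_target (cands := [(S1', 1, sysS1')])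
    (js := [0]) (targets := targetsS1) (by decide +kernel) (fun χ h2 e he => by
    simp only [List.mem_cons, List.not_mem_nil, or_false] at he
    subst he
    exact ⟨by decide, smul_S1' h2⟩)
    (exists_target hs hn orderCheck_dataS1 1 lead_dataS1 (fun χ h => by
      simp only [Poly.ev_cons, Poly.ev_nil, Q.val] at h
      push_cast at h
      linear_combination (1 / -2 : ℂ) * h)
      (fun χ h => by simp [Q.val, h]) check_S1)

theorem analogsAre_S1 : AnalogsAre (S1) [S1'] :=
  analogsAre_of_forall (fun G hG => by
    obtain rfl := List.mem_singleton.mp hG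
    exact isAnalog_S1'.2)
    fun _ => exists_equivalent_S1

theorem isAnalog_S2' : CSystem.IsMinOrder (S2) 3 ∧ IsAnalog (S2) S2' :=
  isAnalog_of_checks (b := 0) (a := 1) pins_dataS2 describes_dataS2
    (by decide) (fun _ => smul_S2') isSymmetric_S2' (by decide +kernel) (.inl rfl)

theorem isAnalog_S2'' : CSystem.IsMinOrder (S2) 3 ∧ IsAnalog (S2) S2'' :=
  isAnalog_of_checks (b := 0) (a := 1) pins_dataS2 describes_dataS2
    (by decide) (fun _ => smul_S2'') isSymmetric_S2'' (by decide +kernel) (.inl rfl)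

theorem exists_equivalent_S2 {F : NSystem} (h : IsAnalog (S2) F) :
    ∃ G ∈ [S2', S2''], Equivalent F G := by
  obtain ⟨G, hn, hs⟩ := symmetric_of_isMinOrder (β := 0) pins_dataS2 describes_dataS2
    isValid_dataS2 isAnalog_S2'.1 h
  exact exists_equivalent_of_target (cands := [(S2', 1, sysS2'), (S2'', 1, sysS2'')])
    (js := [0]) (targets := targetsS2) (by decide +kernel) (fun χ h2 e he => by
    simp only [List.mem_cons, List.not_mem_nil, or_false] at he
    rcases he with rfl | rfl
    · exact ⟨by decide, smul_S2' h2⟩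
    · exact ⟨by decide, smul_S2'' h2⟩)
    (exists_target hs hn orderCheck_dataS2 1 lead_dataS2 (fun χ h => by
      simp only [Poly.ev_cons, Poly.ev_nil, Q.val] at h
      push_cast at h
      linear_combination (1 / -2 : ℂ) * h)
      (fun χ h => by simp [Q.val, h]) check_S2)

theorem analogsAre_S2 : AnalogsAre (S2) [S2', S2''] :=
  analogsAre_of_forall (fun G hG => by
    simp only [List.mem_cons, List.not_mem_nil, or_false] at hG
    rcases hG with rfl | rfl
    · exact isAnalog_S2'.2
    · exact isAnalog_S2''.2)
    fun _ => exists_equivalent_S2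

theorem isAnalog_S3' : CSystem.IsMinOrder (S3) 3 ∧ IsAnalog (S3) S3' :=
  isAnalog_of_checks (b := 0) (a := 1) pins_dataS3 describes_dataS3
    (by decide) (fun _ => smul_S3') isSymmetric_S3' (by decide +kernel) (.inl rfl)

theorem exists_equivalent_S3 {F : NSystem} (h : IsAnalog (S3) F) :
    ∃ G ∈ [S3'], Equivalent F G := by
  obtain ⟨G, hn, hs⟩ := symmetric_of_isMinOrder (β := 0) pins_dataS3 describes_dataS3
    isValid_dataS3 isAnalog_S3'.1 h
  exact exists_equivalent_of_target (cands := [(S3', 1, sysS3')])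
    (js := [0]) (targets := targetsS3) (by decide +kernel) (fun χ h2 e he => by
    simp only [List.mem_cons, List.not_mem_nil, or_false] at he
    subst he
    exact ⟨by decide, smul_S3' h2⟩)
    (exists_target hs hn orderCheck_dataS3 1 lead_dataS3 (fun χ h => by
      simp only [Poly.ev_cons, Poly.ev_nil, Q.val] at h
      push_cast at h
      linear_combination (2 / -9 : ℂ) * h)
      (fun χ h => by simp [Q.val, h]) check_S3)

theorem analogsAre_S3 : AnalogsAre (S3) [S3'] :=
  analogsAre_of_forall (fun G hG => by
    obtain rfl := List.mem_singleton.mp hG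
    exact isAnalog_S3'.2)
    fun _ => exists_equivalent_S3

theorem isAnalog_S4' : CSystem.IsMinOrder (S4) 3 ∧ IsAnalog (S4) S4' :=
  isAnalog_of_checks (b := 0) (a := 1) pins_dataS4 describes_dataS4
    (by decide) (fun _ => smul_S4') isSymmetric_S4' (by decide +kernel) (.inl rfl)

theorem isAnalog_S4'' : CSystem.IsMinOrder (S4) 3 ∧ IsAnalog (S4) S4'' :=
  isAnalog_of_checks (b := 0) (a := 1) pins_dataS4 describes_dataS4
    (by decide) (fun _ => smul_S4'') isSymmetric_S4'' (by decide +kernel) (.inl rfl)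

theorem exists_equivalent_S4 {F : NSystem} (h : IsAnalog (S4) F) :
    ∃ G ∈ [S4', S4''], Equivalent F G := by
  obtain ⟨G, hn, hs⟩ := symmetric_of_isMinOrder (β := 0) pins_dataS4 describes_dataS4
    isValid_dataS4 isAnalog_S4'.1 h
  exact exists_equivalent_of_target (cands := [(S4', 1, sysS4'), (S4'', 1, sysS4'')])
    (js := [0]) (targets := targetsS4) (by decide +kernel) (fun χ h2 e he => by
    simp only [List.mem_cons, List.not_mem_nil, or_false] at he
    rcases he with rfl | rfl
    · exact ⟨by decide, smul_S4' h2⟩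
    · exact ⟨by decide, smul_S4'' h2⟩)
    (exists_target hs hn orderCheck_dataS4 1 lead_dataS4 (fun χ h => by
      simp only [Poly.ev_cons, Poly.ev_nil, Q.val] at h
      push_cast at h
      linear_combination (1 / 2 : ℂ) * h)
      (fun χ h => by simp [Q.val, h]) check_S4)

theorem analogsAre_S4 : AnalogsAre (S4) [S4', S4''] :=
  analogsAre_of_forall (fun G hG => by
    simp only [List.mem_cons, List.not_mem_nil, or_false] at hG
    rcases hG with rfl | rfl
    · exact isAnalog_S4'.2
    · exact isAnalog_S4''.2)
    fun _ => exists_equivalent_S4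

theorem isAnalog_S501' : CSystem.IsMinOrder (S5 0 1) 3 ∧ IsAnalog (S5 0 1) S501' :=
  isAnalog_of_checks (b := 0) (a := 1) pins_dataS501 describes_dataS501
    (by decide) (fun _ => smul_S501') isSymmetric_S501' (by decide +kernel) (.inl rfl)

theorem isAnalog_S501'' : CSystem.IsMinOrder (S5 0 1) 3 ∧ IsAnalog (S5 0 1) S501'' :=
  isAnalog_of_checks (b := 0) (a := 1) pins_dataS501 describes_dataS501
    (by decide) (fun _ => smul_S501'') isSymmetric_S501'' (by decide +kernel) (.inl rfl)

theorem isAnalog_S501''' : CSystem.IsMinOrder (S5 0 1) 3 ∧ IsAnalog (S5 0 1) S501''' :=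
  isAnalog_of_checks (b := 0) (a := 1) pins_dataS501 describes_dataS501
    (by decide) (fun _ => smul_S501''') isSymmetric_S501''' (by decide +kernel) (.inl rfl)

theorem exists_equivalent_S501 {F : NSystem} (h : IsAnalog (S5 0 1) F) :
    ∃ G ∈ [S501', S501'', S501'''], Equivalent F G := by
  obtain ⟨G, hn, hs⟩ := symmetric_of_isMinOrder (β := 0) pins_dataS501 describes_dataS501
    isValid_dataS501 isAnalog_S501'.1 h
  exact exists_equivalent_of_target (cands := [(S501', 1, sysS501'), (S501'', 1, sysS501''), (S501''', 1, sysS501''')])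
    (js := [0]) (targets := targetsS501) (by decide +kernel) (fun χ h2 e he => by
    simp only [List.mem_cons, List.not_mem_nil, or_false] at he
    rcases he with rfl | rfl | rfl
    · exact ⟨by decide, smul_S501' h2⟩
    · exact ⟨by decide, smul_S501'' h2⟩
    · exact ⟨by decide, smul_S501''' h2⟩)
    (exists_target hs hn orderCheck_dataS501 1 lead_dataS501 (fun χ h => by
      simp only [Poly.ev_cons, Poly.ev_nil, Q.val] at h
      push_cast at h
      linear_combination (1 / 2 : ℂ) * h)
      (fun χ h => by simp [Q.val, h]) check_S501)

theorem analogsAre_S501 : AnalogsAre (S5 0 1) [S501', S501'', S501'''] :=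
  analogsAre_of_forall (fun G hG => by
    simp only [List.mem_cons, List.not_mem_nil, or_false] at hG
    rcases hG with rfl | rfl | rfl
    · exact isAnalog_S501'.2
    · exact isAnalog_S501''.2
    · exact isAnalog_S501'''.2)
    fun _ => exists_equivalent_S501

theorem isAnalog_B2' : CSystem.IsMinOrder (B2) 4 ∧ IsAnalog (B2) B2' :=
  isAnalog_of_checks (b := 0) (a := 3) pins_dataB2 describes_dataB2
    (by decide) (fun _ => smul_B2') isSymmetric_B2' (by decide +kernel) (.inr ⟨rfl, not_isHomSymmetry_B2⟩)

theorem exists_equivalent_B2 {F : NSystem} (h : IsAnalog (B2) F) :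
    ∃ G ∈ [B2'], Equivalent F G := by
  obtain ⟨G, hn, hs⟩ := symmetric_of_isMinOrder (β := 0) pins_dataB2 describes_dataB2
    isValid_dataB2 isAnalog_B2'.1 h
  exact exists_equivalent_of_target (cands := [(B2', 3, sysB2')])
    (js := [0]) (targets := targetsB2) (by decide +kernel) (fun χ h2 e he => by
    simp only [List.mem_cons, List.not_mem_nil, or_false] at he
    subst he
    exact ⟨by decide, smul_B2' h2⟩)
    (exists_target hs hn orderCheck_dataB2 (-1) lead_dataB2 (fun χ h => by
      simp only [Poly.ev_cons, Poly.ev_nil, Q.val] at h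
      push_cast at h
      linear_combination (205387 / -12128 : ℂ) * h)
      (fun χ h => by simp [Q.val, h]) check_B2)

theorem analogsAre_B2 : AnalogsAre (B2) [B2'] :=
  analogsAre_of_forall (fun G hG => by
    obtain rfl := List.mem_singleton.mp hG
    exact isAnalog_B2'.2)
    fun _ => exists_equivalent_B2

theorem isAnalog_B3' : CSystem.IsMinOrder (B3) 4 ∧ IsAnalog (B3) B3' :=
  isAnalog_of_checks (b := 0) (a := 1) pins_dataB3 describes_dataB3
    (by decide) (fun _ => smul_B3') isSymmetric_B3' (by decide +kernel) (.inr ⟨rfl, not_isHomSymmetry_B3⟩)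

theorem isAnalog_B3'' : CSystem.IsMinOrder (B3) 4 ∧ IsAnalog (B3) B3'' :=
  isAnalog_of_checks (b := 0) (a := 1) pins_dataB3 describes_dataB3
    (by decide) (fun _ => smul_B3'') isSymmetric_B3'' (by decide +kernel) (.inr ⟨rfl, not_isHomSymmetry_B3⟩)

theorem exists_equivalent_B3 {F : NSystem} (h : IsAnalog (B3) F) :
    ∃ G ∈ [B3', B3''], Equivalent F G := by
  obtain ⟨G, hn, hs⟩ := symmetric_of_isMinOrder (β := 0) pins_dataB3 describes_dataB3
    isValid_dataB3 isAnalog_B3'.1 h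
  exact exists_equivalent_of_target (cands := [(B3', 1, sysB3'), (B3'', 1, sysB3'')])
    (js := [0]) (targets := targetsB3) (by decide +kernel) (fun χ h2 e he => by
    simp only [List.mem_cons, List.not_mem_nil, or_false] at he
    rcases he with rfl | rfl
    · exact ⟨by decide, smul_B3' h2⟩
    · exact ⟨by decide, smul_B3'' h2⟩)
    (exists_target hs hn orderCheck_dataB3 (-1) lead_dataB3 (fun χ h => by
      simp only [Poly.ev_cons, Poly.ev_nil, Q.val] at h
      push_cast at h
      linear_combination (205387 / -36384 : ℂ) * h)
      (fun χ h => by simp [Q.val, h]) check_B3)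

theorem analogsAre_B3 : AnalogsAre (B3) [B3', B3''] :=
  analogsAre_of_forall (fun G hG => by
    simp only [List.mem_cons, List.not_mem_nil, or_false] at hG
    rcases hG with rfl | rfl
    · exact isAnalog_B3'.2
    · exact isAnalog_B3''.2)
    fun _ => exists_equivalent_B3

theorem isAnalog_B4' : CSystem.IsMinOrder (B4) 4 ∧ IsAnalog (B4) B4' :=
  isAnalog_of_checks (b := 0) (a := 3) pins_dataB4 describes_dataB4
    (by decide) (fun _ => smul_B4') isSymmetric_B4' (by decide +kernel) (.inr ⟨rfl, not_isHomSymmetry_B4⟩)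

theorem isAnalog_B4'' : CSystem.IsMinOrder (B4) 4 ∧ IsAnalog (B4) B4'' :=
  isAnalog_of_checks (b := 0) (a := 3) pins_dataB4 describes_dataB4
    (by decide) (fun _ => smul_B4'') isSymmetric_B4'' (by decide +kernel) (.inr ⟨rfl, not_isHomSymmetry_B4⟩)

theorem exists_equivalent_B4 {F : NSystem} (h : IsAnalog (B4) F) :
    ∃ G ∈ [B4', B4''], Equivalent F G := by
  obtain ⟨G, hn, hs⟩ := symmetric_of_isMinOrder (β := 0) pins_dataB4 describes_dataB4
    isValid_dataB4 isAnalog_B4'.1 h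
  exact exists_equivalent_of_target (cands := [(B4', 3, sysB4'), (B4'', 3, sysB4'')])
    (js := [0, 1, 2]) (targets := targetsB4) (by decide +kernel) (fun χ h2 e he => by
    simp only [List.mem_cons, List.not_mem_nil, or_false] at he
    rcases he with rfl | rfl
    · exact ⟨by decide, smul_B4' h2⟩
    · exact ⟨by decide, smul_B4'' h2⟩)
    (exists_target hs hn orderCheck_dataB4 (-1) lead_dataB4 (fun χ h => by
      simp only [Poly.ev_cons, Poly.ev_nil, Q.val] at h
      push_cast at h
      linear_combination (205387 / -12128 : ℂ) * h)
      (fun χ h => by simp [Q.val, h]) check_B4)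

theorem analogsAre_B4 : AnalogsAre (B4) [B4', B4''] :=
  analogsAre_of_forall (fun G hG => by
    simp only [List.mem_cons, List.not_mem_nil, or_false] at hG
    rcases hG with rfl | rfl
    · exact isAnalog_B4'.2
    · exact isAnalog_B4''.2)
    fun _ => exists_equivalent_B4

theorem isAnalog_L1' : CSystem.IsMinOrder (L1) 3 ∧ IsAnalog (L1) L1' :=
  isAnalog_of_checks (b := 0) (a := 1) pins_dataL1 describes_dataL1
    (by decide) (fun _ => smul_L1') isSymmetric_L1' (by decide +kernel) (.inl rfl)

theorem exists_equivalent_L1 {F : NSystem} (h : IsAnalog (L1) F) :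
    ∃ G ∈ [L1'], Equivalent F G := by
  obtain ⟨G, hn, hs⟩ := symmetric_of_isMinOrder (β := 0) pins_dataL1 describes_dataL1
    isValid_dataL1 isAnalog_L1'.1 h
  exact exists_equivalent_of_target (cands := [(L1', 1, sysL1')])
    (js := [0]) (targets := targetsL1 ++ targetsL1') (by decide +kernel) (fun χ h2 e he => by
    simp only [List.mem_cons, List.not_mem_nil, or_false] at he
    subst he
    exact ⟨by decide, smul_L1' h2⟩)
    (exists_target_or hs hn orderCheck_dataL1 check_L1 check_L1')

theorem analogsAre_L1 : AnalogsAre (L1) [L1'] :=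
  analogsAre_of_forall (fun G hG => by
    obtain rfl := List.mem_singleton.mp hG
    exact isAnalog_L1'.2)
    fun _ => exists_equivalent_L1

theorem isAnalog_L2' : CSystem.IsMinOrder (L2) 3 ∧ IsAnalog (L2) L2' :=
  isAnalog_of_checks (b := 0) (a := 1) pins_dataL2 describes_dataL2
    (by decide) (fun _ => smul_L2') isSymmetric_L2' (by decide +kernel) (.inl rfl)

theorem exists_equivalent_L2 {F : NSystem} (h : IsAnalog (L2) F) :
    ∃ G ∈ [L2'], Equivalent F G := by
  obtain ⟨G, hn, hs⟩ := symmetric_of_isMinOrder (β := 0) pins_dataL2 describes_dataL2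
    isValid_dataL2 isAnalog_L2'.1 h
  exact exists_equivalent_of_target (cands := [(L2', 1, sysL2')])
    (js := [0]) (targets := targetsL2 ++ targetsL2') (by decide +kernel) (fun χ h2 e he => by
    simp only [List.mem_cons, List.not_mem_nil, or_false] at he
    subst he
    exact ⟨by decide, smul_L2' h2⟩)
    (exists_target_or hs hn orderCheck_dataL2 check_L2 check_L2')

theorem analogsAre_L2 : AnalogsAre (L2) [L2'] :=
  analogsAre_of_forall (fun G hG => by
    obtain rfl := List.mem_singleton.mp hG
    exact isAnalog_L2'.2)
    fun _ => exists_equivalent_L2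

theorem isAnalog_S512' : CSystem.IsMinOrder (S5 1 2) 3 ∧ IsAnalog (S5 1 2) S512' :=
  isAnalog_of_checks (b := 2) (a := 1) pins_dataS5 (by exact_mod_cast describes_dataS5 (β := 2))
    (by decide) (fun _ => smul_S512') isSymmetric_S512' (by decide +kernel) (.inl rfl)

theorem isAnalog_S512'' : CSystem.IsMinOrder (S5 1 2) 3 ∧ IsAnalog (S5 1 2) S512'' :=
  isAnalog_of_checks (b := 2) (a := 1) pins_dataS5 (by exact_mod_cast describes_dataS5 (β := 2))
    (by decide) (fun _ => smul_S512'') isSymmetric_S512'' (by decide +kernel) (.inl rfl)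

theorem isAnalog_S510' : CSystem.IsMinOrder (S5 1 0) 3 ∧ IsAnalog (S5 1 0) S510' :=
  isAnalog_of_checks (b := 0) (a := 1) pins_dataS5 (by exact_mod_cast describes_dataS5 (β := 0))
    (by decide) (fun _ => smul_S510') isSymmetric_S510' (by decide +kernel) (.inl rfl)

theorem isAnalog_S510'' : CSystem.IsMinOrder (S5 1 0) 3 ∧ IsAnalog (S5 1 0) S510'' :=
  isAnalog_of_checks (b := 0) (a := 1) pins_dataS5 (by exact_mod_cast describes_dataS5 (β := 0))
    (by decide) (fun _ => smul_S510'') isSymmetric_S510'' (by decide +kernel) (.inl rfl)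

theorem isAnalog_L310' : CSystem.IsMinOrder (L3 1 0) 3 ∧ IsAnalog (L3 1 0) L310' :=
  isAnalog_of_checks (b := 0) (a := 1) pins_dataL3 (by exact_mod_cast describes_dataL3 (β := 0))
    (by decide) (fun _ => smul_L310') isSymmetric_L310' (by decide +kernel) (.inl rfl)

theorem isAnalog_L310'' : CSystem.IsMinOrder (L3 1 0) 3 ∧ IsAnalog (L3 1 0) L310'' :=
  isAnalog_of_checks (b := 0) (a := 1) pins_dataL3 (by exact_mod_cast describes_dataL3 (β := 0))
    (by decide) (fun _ => smul_L310'') isSymmetric_L310'' (by decide +kernel) (.inl rfl)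

/-- A scalar system with a symmetry of the third order. -/
theorem isMinOrder_three {f g : CSystem} (h : f.IsHomSymmetry 3 g) : f.IsMinOrder 3 :=
  ⟨⟨by norm_num, g, h⟩, fun _ hm => hm.1⟩

theorem isMinOrder_S5 (β : ℂ) : (S5 1 β).IsMinOrder 3 := by
  obtain ⟨χ, h2, h3⟩ := exists_param β
  exact isMinOrder_three (isHomSymmetry_of_isSymmetric pins_dataS5 describes_dataS5 h2
    (eq_ab_sysOf h2 h3 describes_dataS5 (by decide +kernel)) isSymmetric_S5)

theorem exists_equivalent_S5 {β : ℂ} {F : NSystem} (h : IsAnalog (S5 1 β) F) :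
    ∃ G ∈ [S510', S510'', S512', S512''], Equivalent F G := by
  obtain ⟨G, hn, hs⟩ := symmetric_of_isMinOrder (β := β) pins_dataS5 describes_dataS5
    isValid_dataS5 (isMinOrder_S5 β) h
  exact exists_equivalent_of_target (cands := [(S510', 1, sysS510'), (S510'', 1, sysS510''), (S512', 1, sysS512'), (S512'', 1, sysS512'')])
    (js := [0]) (targets := targetsS5) (by decide +kernel) (fun χ h2 e he => by
    simp only [List.mem_cons, List.not_mem_nil, or_false] at he
    rcases he with rfl | rfl | rfl | rfl
    · exact ⟨by decide, smul_S510' h2⟩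
    · exact ⟨by decide, smul_S510'' h2⟩
    · exact ⟨by decide, smul_S512' h2⟩
    · exact ⟨by decide, smul_S512'' h2⟩)
    (exists_target hs hn orderCheck_dataS5 1 lead_dataS5 (fun χ h => by
      simp only [Poly.ev_cons, Poly.ev_nil, Q.val] at h
      push_cast at h
      linear_combination (1 / -4 : ℂ) * h)
      (fun χ h => by simp [Q.val, h]) check_S5)

theorem isMinOrder_L3 (β : ℂ) : (L3 1 β).IsMinOrder 3 := by
  obtain ⟨χ, h2, h3⟩ := exists_param β
  exact isMinOrder_three (isHomSymmetry_of_isSymmetric pins_dataL3 describes_dataL3 h2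
    (eq_ab_sysOf h2 h3 describes_dataL3 (by decide +kernel)) isSymmetric_L3)

theorem exists_equivalent_L3 {β : ℂ} {F : NSystem} (h : IsAnalog (L3 1 β) F) :
    ∃ G ∈ [L310', L310''], Equivalent F G := by
  obtain ⟨G, hn, hs⟩ := symmetric_of_isMinOrder (β := β) pins_dataL3 describes_dataL3
    isValid_dataL3 (isMinOrder_L3 β) h
  exact exists_equivalent_of_target (cands := [(L310', 1, sysL310'), (L310'', 1, sysL310'')])
    (js := [0]) (targets := targetsL3) (by decide +kernel) (fun χ h2 e he => by
    simp only [List.mem_cons, List.not_mem_nil, or_false] at he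
    rcases he with rfl | rfl
    · exact ⟨by decide, smul_L310' h2⟩
    · exact ⟨by decide, smul_L310'' h2⟩)
    (exists_target hs hn orderCheck_dataL3 1 lead_dataL3 (fun χ h => by
      simp only [Poly.ev_cons, Poly.ev_nil, Q.val] at h
      push_cast at h
      linear_combination (1 / -2 : ℂ) * h)
      (fun χ h => by simp [Q.val, h]) check_L3)

end


noncomputable section

open Data

theorem noAnalogs_L5 : NoAnalogs L5 := by
  intro F h
  obtain ⟨χ, h2, h3⟩ := exists_param 0
  have hm : L5.IsMinOrder 3 := isMinOrder_three (isHomSymmetry_of_isSymmetric (β := 0) pins_dataL5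
    describes_dataL5 h2 (eq_ab_sysOf h2 h3 describes_dataL5 (by decide +kernel)) isSymmetric_L5)
  obtain ⟨G, hn, hs⟩ := symmetric_of_isMinOrder (β := 0) pins_dataL5 describes_dataL5
    isValid_dataL5 hm h
  obtain ⟨T, hT, -⟩ := exists_target hs hn orderCheck_dataL5 (-1 / 2) lead_dataL5
    (fun χ h => by
      simp only [Poly.ev_cons, Poly.ev_nil, Q.val] at h
      push_cast at h
      linear_combination (2257 / 472 : ℂ) * h)
    (fun χ h => by simp [Q.val, h]; norm_num) check_L5
  exact List.not_mem_nil hT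

theorem noAnalogs_B1 : NoAnalogs B1 := by
  intro F h
  obtain ⟨χ, h2, h3⟩ := exists_param 0
  have h4 := isHomSymmetry_of_isSymmetric (β := 0) pins_dataB1 describes_dataB1 h2
    (eq_ab_sysOf h2 h3 describes_dataB1 (by decide +kernel)) isSymmetric_B1
  obtain ⟨n, G, hm, hn, hs⟩ := symmetric_of_isAnalog (β := 0) pins_dataB1 describes_dataB1
    isValid_dataB1 h
  have hle : n ≤ 4 := hm.2 ⟨by norm_num, _, h4⟩
  obtain rfl | rfl : n = 3 ∨ n = 4 := by
    have := hm.1.1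
    omega
  · obtain ⟨χ₁, h5, h7, h0⟩ := hs.lead_relation lead_dataB1_3
    obtain ⟨χ₂, h5', h7', h0'⟩ := hs.lead_relation lead_dataB1_3''
    simp only [Poly.ev_cons, Poly.ev_nil, Q.val, h5, h7] at h0
    simp only [Poly.ev_cons, Poly.ev_nil, Q.val, h5', h7'] at h0'
    push_cast at h0 h0'
    have hb : lead G 1 = 0 := by linear_combination (61 / 52 : ℂ) * h0 + (-1 / 6 : ℂ) * h0'
    have ha : lead G 0 = 0 := by linear_combination (61 / 52 : ℂ) * h0 + (1 / 3 : ℂ) * h0'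
    exact hs.lead_ne_zero hn orderCheck_dataB1_3 ha hb
  · obtain ⟨T, hT, -⟩ := exists_target hs hn orderCheck_dataB1_4 (-1) lead_dataB1_4
      (fun χ h => by
      simp only [Poly.ev_cons, Poly.ev_nil, Q.val] at h
      push_cast at h
      linear_combination (2257 / 236 : ℂ) * h)
      (fun χ h => by simp [Q.val, h]) check_B1
    exact List.not_mem_nil hT

theorem noAnalogs_L4 : NoAnalogs L4 := by
  intro F h
  obtain ⟨χ, h2, h3⟩ := exists_param 0
  have h4 := isHomSymmetry_of_isSymmetric (β := 0) pins_dataL4 describes_dataL4 h2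
    (eq_ab_sysOf h2 h3 describes_dataL4 (by decide +kernel)) isSymmetric_L4
  obtain ⟨n, G, hm, hn, hs⟩ := symmetric_of_isAnalog (β := 0) pins_dataL4 describes_dataL4
    isValid_dataL4 h
  have hle : n ≤ 4 := hm.2 ⟨by norm_num, _, h4⟩
  obtain rfl | rfl : n = 3 ∨ n = 4 := by
    have := hm.1.1
    omega
  · obtain ⟨χ₁, h5, h7, h0⟩ := hs.lead_relation lead_dataL4_3
    obtain ⟨χ₂, h5', h7', h0'⟩ := hs.lead_relation lead_dataL4_3'
    simp only [Poly.ev_cons, Poly.ev_nil, Q.val, h5, h7] at h0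
    simp only [Poly.ev_cons, Poly.ev_nil, Q.val, h5', h7'] at h0'
    push_cast at h0 h0'
    have hb : lead G 1 = 0 := by linear_combination (2257 / 1062 : ℂ) * h0 + (-1 / 12 : ℂ) * h0'
    have ha : lead G 0 = 0 := by linear_combination (2257 / 1062 : ℂ) * h0 + (1 / 6 : ℂ) * h0'
    exact hs.lead_ne_zero hn orderCheck_dataL4_3 ha hb
  · obtain ⟨T, hT, -⟩ := exists_target hs hn orderCheck_dataL4_4 (-1) lead_dataL4_4
      (fun χ h => by
      simp only [Poly.ev_cons, Poly.ev_nil, Q.val] at h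
      push_cast at h
      linear_combination (205387 / -18192 : ℂ) * h)
      (fun χ h => by simp [Q.val, h]) check_L4
    exact List.not_mem_nil hT

/-! ### The systems with parameters -/

theorem CSystem.eval_rescale (f : CSystem) (c : Fin 2 → ℂ) (x : Letter → ℂ) (k : Fin 2) :
    MvPolynomial.eval x (f.rescale c k) =
      c k * MvPolynomial.eval (fun p => (c p.1)⁻¹ * x p) (f k) := by
  have : (MvPolynomial.aeval x).comp (cSubst c) =
      (MvPolynomial.aeval (fun p : Letter => (c p.1)⁻¹ * x p) : CPoly →ₐ[ℂ] ℂ) :=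
    MvPolynomial.algHom_ext fun p => by simp [cSubst_X]
  rw [CSystem.rescale, MvPolynomial.smul_eval]
  exact congrArg _ (DFunLike.congr_fun this (f k))

theorem eq_of_S5_rescale {β b : ℂ} {c : Fin 2 → ℂ} (hc : ∀ k, c k ≠ 0)
    (h : S5 1 β = (S5 1 b).rescale c) : β = b := by
  have h0 := hc 0
  have h1 := hc 1
  have e1 := congrArg (MvPolynomial.eval fun p : Letter => if p = (0, 0) ∨ p = (1, 1) then 1 else 0)
    (congrFun h 0)
  have e2 := congrArg (MvPolynomial.eval fun p : Letter => if p = (0, 0) ∨ p = (1, 0) then 1 else 0)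
    (congrFun h 0)
  rw [CSystem.eval_rescale] at e1 e2
  simp [S5, cu, cv] at e1 e2
  field_simp at e1 e2
  have e3 : c 0 * c 1 = 1 := by linear_combination e1
  rw [← mul_pow, e3] at e2
  linear_combination e2

theorem eq_of_L3_rescale {β b : ℂ} {c : Fin 2 → ℂ} (hc : ∀ k, c k ≠ 0)
    (h : L3 1 β = (L3 1 b).rescale c) : β = b := by
  have h0 := hc 0
  have h1 := hc 1
  have e1 := congrArg (MvPolynomial.eval fun p : Letter => if p = (0, 0) ∨ p = (1, 1) then 1 else 0)
    (congrFun h 0)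
  have e2 := congrArg (MvPolynomial.eval fun p : Letter => if p = (0, 0) ∨ p = (1, 0) then 1 else 0)
    (congrFun h 0)
  rw [CSystem.eval_rescale] at e1 e2
  simp [L3, cu, cv] at e1 e2
  field_simp at e1 e2
  have e3 : c 0 * c 1 = 1 := by linear_combination e1
  rw [← mul_pow, e3] at e2
  linear_combination e2

theorem eq_of_isAnalog_S5 {β b : ℂ} {F G : NSystem} (hF : IsAnalog (S5 1 β) F)
    (hG : IsAnalog (S5 1 b) G) (h : Equivalent F G) : β = b := by
  obtain ⟨c, hc, h⟩ := ab_eq_of_equivalent h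
  rw [hF.1, hG.1] at h
  exact eq_of_S5_rescale hc h

theorem eq_of_isAnalog_L3 {β b : ℂ} {F G : NSystem} (hF : IsAnalog (L3 1 β) F)
    (hG : IsAnalog (L3 1 b) G) (h : Equivalent F G) : β = b := by
  obtain ⟨c, hc, h⟩ := ab_eq_of_equivalent h
  rw [hF.1, hG.1] at h
  exact eq_of_L3_rescale hc h

theorem analogsAre_S512 : AnalogsAre (S5 1 2) [S512', S512''] := by
  refine analogsAre_of_forall (fun G hG => ?_) fun F hF => ?_
  · simp only [List.mem_cons, List.not_mem_nil, or_false] at hG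
    rcases hG with rfl | rfl
    exacts [isAnalog_S512'.2, isAnalog_S512''.2]
  · obtain ⟨G, hG, h⟩ := exists_equivalent_S5 hF
    simp only [List.mem_cons, List.not_mem_nil, or_false] at hG
    rcases hG with rfl | rfl | rfl | rfl
    · exact absurd (eq_of_isAnalog_S5 hF isAnalog_S510'.2 h) two_ne_zero
    · exact absurd (eq_of_isAnalog_S5 hF isAnalog_S510''.2 h) two_ne_zero
    · exact ⟨_, by simp, h⟩
    · exact ⟨_, by simp, h⟩

theorem analogsAre_S510 : AnalogsAre (S5 1 0) [S510', S510''] := by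
  refine analogsAre_of_forall (fun G hG => ?_) fun F hF => ?_
  · simp only [List.mem_cons, List.not_mem_nil, or_false] at hG
    rcases hG with rfl | rfl
    exacts [isAnalog_S510'.2, isAnalog_S510''.2]
  · obtain ⟨G, hG, h⟩ := exists_equivalent_S5 hF
    simp only [List.mem_cons, List.not_mem_nil, or_false] at hG
    rcases hG with rfl | rfl | rfl | rfl
    · exact ⟨_, by simp, h⟩
    · exact ⟨_, by simp, h⟩
    · exact absurd (eq_of_isAnalog_S5 hF isAnalog_S512'.2 h).symm two_ne_zero
    · exact absurd (eq_of_isAnalog_S5 hF isAnalog_S512''.2 h).symm two_ne_zero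

theorem noAnalogs_S5 {β : ℂ} (h0 : β ≠ 0) (h2 : β ≠ 2) : NoAnalogs (S5 1 β) := by
  intro F hF
  obtain ⟨G, hG, h⟩ := exists_equivalent_S5 hF
  simp only [List.mem_cons, List.not_mem_nil, or_false] at hG
  rcases hG with rfl | rfl | rfl | rfl
  · exact h0 (eq_of_isAnalog_S5 hF isAnalog_S510'.2 h)
  · exact h0 (eq_of_isAnalog_S5 hF isAnalog_S510''.2 h)
  · exact h2 (eq_of_isAnalog_S5 hF isAnalog_S512'.2 h)
  · exact h2 (eq_of_isAnalog_S5 hF isAnalog_S512''.2 h)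

theorem analogsAre_L310 : AnalogsAre (L3 1 0) [L310', L310''] := by
  refine analogsAre_of_forall (fun G hG => ?_) fun F => exists_equivalent_L3
  simp only [List.mem_cons, List.not_mem_nil, or_false] at hG
  rcases hG with rfl | rfl
  exacts [isAnalog_L310'.2, isAnalog_L310''.2]

theorem noAnalogs_L3 {β : ℂ} (h0 : β ≠ 0) : NoAnalogs (L3 1 β) := by
  intro F hF
  obtain ⟨G, hG, h⟩ := exists_equivalent_L3 hF
  simp only [List.mem_cons, List.not_mem_nil, or_false] at hG
  rcases hG with rfl | rfl
  · exact h0 (eq_of_isAnalog_L3 hF isAnalog_L310'.2 h)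
  · exact h0 (eq_of_isAnalog_L3 hF isAnalog_L310''.2 h)

theorem S5_rescale {α : ℂ} (hα : α ≠ 0) (β : ℂ) : (S5 α β).rescale ![α, 1] = S5 1 (β / α) := by
  funext k
  refine MvPolynomial.funext fun x => ?_
  rw [CSystem.eval_rescale]
  fin_cases k
  all_goals
    simp [S5, cu, cv]
    field_simp

theorem S5_zero_rescale {β : ℂ} (hβ : β ≠ 0) : (S5 0 β).rescale ![β, 1] = S5 0 1 := by
  funext k
  refine MvPolynomial.funext fun x => ?_
  rw [CSystem.eval_rescale]
  fin_cases k
  all_goals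
    simp [S5, cu, cv]
    field_simp

theorem L3_rescale {α : ℂ} (hα : α ≠ 0) (β : ℂ) : (L3 α β).rescale ![α, 1] = L3 1 (β / α) := by
  funext k
  refine MvPolynomial.funext fun x => ?_
  rw [CSystem.eval_rescale]
  fin_cases k
  all_goals
    simp [L3, cu, cv]
    field_simp

theorem ne_zero_vec {α : ℂ} (hα : α ≠ 0) (k : Fin 2) : (![α, 1] : Fin 2 → ℂ) k ≠ 0 := by
  fin_cases k <;> simp [hα]

end


noncomputable section

/-! ### Non-equivalent systems -/

theorem nSubst_word (c : Fin 2 → ℂ) (w : List Letter) :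
    nSubst c (word w) = (w.map fun p => (c p.1)⁻¹).prod • word w := by
  induction w with
  | nil => simp
  | cons p w ih => simp [word_cons, map_mul, ih, nSubst_ι, smul_smul, mul_comm]

theorem repr_rescale {c : Fin 2 → ℂ} (hc : ∀ k, c k ≠ 0) (F : NSystem) (k : Fin 2)
    (w : List Letter) :
    wordBasis.repr (F.rescale c k) w ≠ 0 ↔ wordBasis.repr (F k) w ≠ 0 := by
  have key : ∀ a, wordBasis.repr (nSubst c a) w =
      (w.map fun p => (c p.1)⁻¹).prod * wordBasis.repr a w := by
    intro a
    suffices h : (wordBasis.coord w) ∘ₗ (nSubst c).toLinearMap =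
        (w.map fun p => (c p.1)⁻¹).prod • wordBasis.coord w from DFunLike.congr_fun h a
    refine word_ext fun x => ?_
    simp only [LinearMap.comp_apply, AlgHom.toLinearMap_apply, nSubst_word, map_smul,
      LinearMap.smul_apply]
    rw [← wordBasis_apply, Module.Basis.coord_apply, Module.Basis.repr_self]
    by_cases h : x = w
    · rw [h]
    · rw [Finsupp.single_eq_of_ne' h, smul_zero, smul_zero]
  have hp : (w.map fun p => (c p.1)⁻¹).prod ≠ 0 := by
    rw [Ne, List.prod_eq_zero_iff, List.mem_map]
    rintro ⟨p, -, h⟩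
    exact inv_ne_zero (hc _) h
  rw [NSystem.rescale_apply, map_smul, Finsupp.smul_apply, key, smul_eq_mul, Ne,
    mul_eq_zero, mul_eq_zero]
  simp [hc k, hp]

theorem repr_star (a : NPoly) (w : List Letter) :
    wordBasis.repr (star a) w = wordBasis.repr a w.reverse := by
  let S : NPoly →ₗ[ℂ] NPoly :=
    { toFun := star, map_add' := star_add, map_smul' := star_smul_free }
  suffices h : (wordBasis.coord w) ∘ₗ S = wordBasis.coord w.reverse from DFunLike.congr_fun h a
  refine word_ext fun x => ?_
  change wordBasis.repr (star (word x)) w = wordBasis.repr (word x) w.reverse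
  rw [star_word, ← wordBasis_apply, ← wordBasis_apply, Module.Basis.repr_self,
    Module.Basis.repr_self]
  by_cases h : x = w.reverse
  · rw [h, List.reverse_reverse, Finsupp.single_eq_same, Finsupp.single_eq_same]
  · rw [Finsupp.single_eq_of_ne' h, Finsupp.single_eq_of_ne']
    rintro rfl
    exact h (List.reverse_reverse x).symm

theorem add_mul_iSqrt3_eq_zero {x y : ℤ} (h : (x : ℂ) + y * iSqrt3 = 0) : x = 0 ∧ y = 0 := by
  have hr := congrArg Complex.re h
  have hi := congrArg Complex.im h
  simp [iSqrt3] at hr hi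
  exact ⟨by exact_mod_cast hr, by exact_mod_cast hi⟩

/-- The terms have different words and nonzero numerical coefficients. -/
def isProper (L : List Term) : Bool :=
  decide (L.map (·.1)).Nodup && L.all fun t => Nat.beq t.2.1 0 &&
    !(decide (t.2.2.1 = 0) && decide (t.2.2.2 = 0))

theorem repr_ne_zero_iff {χ : ℕ →* ℂ} (hχ : χ 2 = iSqrt3) {L : List Term} (hL : isProper L = true)
    (w : Word) : wordBasis.repr (combo χ (L.map Term.toPair)) (w.map toLetter) ≠ 0 ↔
      ∃ t ∈ L, t.1 = w := by
  induction L with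
  | nil => simp [combo]
  | cons t L ih =>
    simp only [isProper, Bool.and_eq_true, decide_eq_true_eq, List.map_cons, List.nodup_cons,
      List.all_cons] at hL
    obtain ⟨⟨h1, h2⟩, ⟨h3, h4⟩, h5⟩ := hL
    have ih := ih (by simp only [isProper, Bool.and_eq_true, decide_eq_true_eq]; exact ⟨h2, h5⟩)
    have hne : (Term.toPair t).2.ev χ ≠ 0 := by
      rw [Term.toPair, Term.ev_coeff hχ, Nat.eq_of_beq_eq_true h3, pow_zero, map_one, mul_one]
      intro h
      obtain ⟨hx, hy⟩ := add_mul_iSqrt3_eq_zero h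
      simp [hx, hy] at h4
    have hs : combo χ ((t :: L).map Term.toPair) =
        (Term.toPair t).2.ev χ • word (t.1.map toLetter) + combo χ (L.map Term.toPair) := rfl
    rw [hs, map_add, map_smul, ← wordBasis_apply, Module.Basis.repr_self, Finsupp.add_apply,
      Finsupp.smul_apply]
    by_cases h : t.1 = w
    · have h0 : wordBasis.repr (combo χ (L.map Term.toPair)) (w.map toLetter) = 0 := by
        by_contra h0
        obtain ⟨t', ht', rfl⟩ := ih.mp h0
        exact h1 (h ▸ List.mem_map_of_mem ht')
      rw [h, Finsupp.single_eq_same, h0, smul_eq_mul, mul_one, add_zero]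
      exact ⟨fun _ => ⟨t, by simp, h⟩, fun _ => hne⟩
    · rw [Finsupp.single_eq_of_ne' (fun h' => h (map_toLetter_injective h')), smul_zero, zero_add, ih]
      simp [h]

/-- Every word of `L`, reversed if `r`, is a word of `K`. -/
def subsumes (r : Bool) (L K : List Term) : Bool :=
  L.all fun t => K.any fun s => Cert.beqN s.1 (bif r then t.1.reverse else t.1)

def sameWords (r : Bool) (F G : List Term × List Term) : Bool :=
  subsumes r F.1 G.1 && (subsumes r F.2 G.2 && (subsumes r G.1 F.1 && subsumes r G.2 F.2))

theorem subsumes_of_iff {r : Bool} {L K : List Term}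
    (h : ∀ w : Word, (∃ t ∈ L, t.1 = w) → ∃ s ∈ K, s.1 = bif r then w.reverse else w) :
    subsumes r L K = true := by
  refine List.all_eq_true.mpr fun t ht => ?_
  obtain ⟨s, hs, h⟩ := h t.1 ⟨t, ht, rfl⟩
  exact List.any_eq_true.mpr ⟨s, hs, by rw [h]; exact beqN_self _⟩

theorem sameWords_of_equivalent {χ : ℕ →* ℂ} (hχ : χ 2 = iSqrt3) {F G : NSystem} {a b : ℂ}
    (ha : a ≠ 0) (hb : b ≠ 0) {F' G' : List Term × List Term} (hF : a • F = sysOf χ F')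
    (hG : b • G = sysOf χ G') (hF' : isProper F'.1 = true ∧ isProper F'.2 = true)
    (hG' : isProper G'.1 = true ∧ isProper G'.2 = true) (h : Equivalent F G) :
    sameWords false F' G' = true ∨ sameWords true F' G' = true := by
  have key : ∀ {H : NSystem} {a : ℂ} {H' : List Term × List Term}, a ≠ 0 → a • H = sysOf χ H' →
      isProper H'.1 = true ∧ isProper H'.2 = true → ∀ w : Word,
      (wordBasis.repr (H 0) (w.map toLetter) ≠ 0 ↔ ∃ t ∈ H'.1, t.1 = w) ∧
      (wordBasis.repr (H 1) (w.map toLetter) ≠ 0 ↔ ∃ t ∈ H'.2, t.1 = w) := by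
    intro H a H' ha hH hH' w
    have hs : ∀ k, wordBasis.repr (sysOf χ H' k) (w.map toLetter) ≠ 0 ↔
        wordBasis.repr (H k) (w.map toLetter) ≠ 0 := by
      intro k
      rw [← hH, Pi.smul_apply, map_smul, Finsupp.smul_apply, smul_eq_mul, Ne, mul_eq_zero]
      simp [ha]
    exact ⟨(hs 0).symm.trans (repr_ne_zero_iff hχ hH'.1 w),
      (hs 1).symm.trans (repr_ne_zero_iff hχ hH'.2 w)⟩
  have kF := key ha hF hF'
  have kG := key hb hG hG'
  simp only [sameWords, Bool.and_eq_true]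
  obtain ⟨c, hc, rfl | rfl⟩ := h
  · left
    simp only [repr_rescale hc] at kF
    have h0 := fun w => (kF w).1.symm.trans (kG w).1
    have h1 := fun w => (kF w).2.symm.trans (kG w).2
    exact ⟨subsumes_of_iff fun w => (h0 w).mp, subsumes_of_iff fun w => (h1 w).mp,
      subsumes_of_iff fun w => (h0 w).mpr, subsumes_of_iff fun w => (h1 w).mpr⟩
  · right
    have hr : ∀ k (w : Word), wordBasis.repr ((G.rescale c).involution k) (w.map toLetter) ≠ 0 ↔
        wordBasis.repr (G k) (w.reverse.map toLetter) ≠ 0 := by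
      intro k w
      rw [NSystem.involution, repr_star, repr_rescale hc, List.map_reverse]
    have h0 := fun w => (kF w).1.symm.trans ((hr 0 w).trans (kG w.reverse).1)
    have h1 := fun w => (kF w).2.symm.trans ((hr 1 w).trans (kG w.reverse).2)
    refine ⟨subsumes_of_iff fun w => (h0 w).mp, subsumes_of_iff fun w => (h1 w).mp,
      subsumes_of_iff fun w h => (h0 w.reverse).mpr ?_,
      subsumes_of_iff fun w h => (h1 w.reverse).mpr ?_⟩ <;>
    rwa [List.reverse_reverse]

/-- The systems do not have the same words, even after reversing the words of one of them. -/
def apart (F G : List Term × List Term) : Bool :=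
  !(sameWords false F G || sameWords true F G)

theorem pairwise_not_equivalent {l : List (NSystem × ℤ × (List Term × List Term))}
    (hl : ∀ χ : ℕ →* ℂ, χ 2 = iSqrt3 →
      ∀ e ∈ l, e.2.1 ≠ 0 ∧ (e.2.1 : ℂ) • e.1 = sysOf χ e.2.2)
    (hr : (l.all fun e => isProper e.2.2.1 && isProper e.2.2.2) = true)
    (h : (l.map (·.2.2)).Pairwise fun F G => apart F G = true) :
    (l.map (·.1)).Pairwise fun F G => ¬ Equivalent F G := by
  obtain ⟨χ, h2, -⟩ := Data.exists_param 0
  rw [List.pairwise_map] at h ⊢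
  refine h.imp_of_mem fun {e e'} he he' h' hE => ?_
  obtain ⟨ha, hF⟩ := hl χ h2 e he
  obtain ⟨hb, hG⟩ := hl χ h2 e' he'
  have hF' := (Bool.and_eq_true _ _).mp (List.all_eq_true.mp hr e he)
  have hG' := (Bool.and_eq_true _ _).mp (List.all_eq_true.mp hr e' he')
  rcases sameWords_of_equivalent h2 (by exact_mod_cast ha) (by exact_mod_cast hb) hF hG hF' hG' hE
    with h | h <;> simp [apart, h] at h'

end


noncomputable section

/-- The listed systems with their coefficients, up to integer factors. -/
def listed : List (NSystem × ℤ × (List Term × List Term)) :=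
  [(S1', 1, Data.sysS1'),
    (S2', 1, Data.sysS2'),
    (S2'', 1, Data.sysS2''),
    (S3', 1, Data.sysS3'),
    (S4', 1, Data.sysS4'),
    (S4'', 1, Data.sysS4''),
    (S512', 1, Data.sysS512'),
    (S512'', 1, Data.sysS512''),
    (S501', 1, Data.sysS501'),
    (S501'', 1, Data.sysS501''),
    (S501''', 1, Data.sysS501'''),
    (S510', 1, Data.sysS510'),
    (S510'', 1, Data.sysS510''),
    (B2', 3, Data.sysB2'),
    (B3', 1, Data.sysB3'),
    (B3'', 1, Data.sysB3''),
    (B4', 3, Data.sysB4'),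
    (B4'', 3, Data.sysB4''),
    (L1', 1, Data.sysL1'),
    (L2', 1, Data.sysL2'),
    (L310', 1, Data.sysL310'),
    (L310'', 1, Data.sysL310'')]

theorem smul_listed (χ : ℕ →* ℂ) (hχ : χ 2 = iSqrt3) :
    ∀ e ∈ listed, e.2.1 ≠ 0 ∧ (e.2.1 : ℂ) • e.1 = sysOf χ e.2.2 := by
  intro e he
  simp only [listed, List.mem_cons, List.not_mem_nil, or_false] at he
  rcases he with rfl | rfl | rfl | rfl | rfl | rfl | rfl | rfl | rfl | rfl | rfl | rfl | rfl | rfl | rfl | rfl | rfl | rfl | rfl | rfl | rfl | rfl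
  · exact ⟨by decide, smul_S1' hχ⟩
  · exact ⟨by decide, smul_S2' hχ⟩
  · exact ⟨by decide, smul_S2'' hχ⟩
  · exact ⟨by decide, smul_S3' hχ⟩
  · exact ⟨by decide, smul_S4' hχ⟩
  · exact ⟨by decide, smul_S4'' hχ⟩
  · exact ⟨by decide, smul_S512' hχ⟩
  · exact ⟨by decide, smul_S512'' hχ⟩
  · exact ⟨by decide, smul_S501' hχ⟩
  · exact ⟨by decide, smul_S501'' hχ⟩
  · exact ⟨by decide, smul_S501''' hχ⟩
  · exact ⟨by decide, smul_S510' hχ⟩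
  · exact ⟨by decide, smul_S510'' hχ⟩
  · exact ⟨by decide, smul_B2' hχ⟩
  · exact ⟨by decide, smul_B3' hχ⟩
  · exact ⟨by decide, smul_B3'' hχ⟩
  · exact ⟨by decide, smul_B4' hχ⟩
  · exact ⟨by decide, smul_B4'' hχ⟩
  · exact ⟨by decide, smul_L1' hχ⟩
  · exact ⟨by decide, smul_L2' hχ⟩
  · exact ⟨by decide, smul_L310' hχ⟩
  · exact ⟨by decide, smul_L310'' hχ⟩

theorem isProper_listed :
    (listed.all fun e => isProper e.2.2.1 && isProper e.2.2.2) = true := by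
  decide +kernel

theorem apart_listed : (listed.map (·.2.2)).Pairwise fun F G => apart F G = true := by
  decide +kernel

end

end NonAbelian

open NonAbelian in
theorem theorem4 :
    AnalogsAre S1 [S1'] ∧
    AnalogsAre S2 [S2', S2''] ∧
    AnalogsAre S3 [S3'] ∧
    AnalogsAre S4 [S4', S4''] ∧
    (∀ α : ℂ, α ≠ 0 → AnalogsAre (S5 α (2 * α)) [S512', S512'']) ∧
    (∀ β : ℂ, β ≠ 0 → AnalogsAre (S5 0 β) [S501', S501'', S501''']) ∧
    (∀ α : ℂ, α ≠ 0 → AnalogsAre (S5 α 0) [S510', S510'']) ∧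
    (∀ α β : ℂ, α ≠ 0 → β ≠ 0 → β ≠ 2 * α → NoAnalogs (S5 α β)) ∧
    NoAnalogs B1 ∧
    AnalogsAre B2 [B2'] ∧
    AnalogsAre B3 [B3', B3''] ∧
    AnalogsAre B4 [B4', B4''] ∧
    AnalogsAre L1 [L1'] ∧
    AnalogsAre L2 [L2'] ∧
    (∀ α : ℂ, α ≠ 0 → AnalogsAre (L3 α 0) [L310', L310'']) ∧
    (∀ α β : ℂ, α ≠ 0 → β ≠ 0 → NoAnalogs (L3 α β)) ∧
    NoAnalogs L4 ∧
    NoAnalogs L5 ∧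
    [S1', S2', S2'', S3', S4', S4'', S512', S512'', S501', S501'', S501''', S510', S510'',
      B2', B3', B3'', B4', B4'', L1', L2', L310', L310''].Pairwise
        (fun F G => ¬ Equivalent F G) := by
  refine ⟨analogsAre_S1, analogsAre_S2, analogsAre_S3, analogsAre_S4, fun α hα => ?_,
    fun β hβ => ?_, fun α hα => ?_, fun α β hα hβ h => ?_, noAnalogs_B1, analogsAre_B2,
    analogsAre_B3, analogsAre_B4, analogsAre_L1, analogsAre_L2, fun α hα => ?_,
    fun α β hα hβ => ?_, noAnalogs_L4, noAnalogs_L5,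
    pairwise_not_equivalent smul_listed isProper_listed apart_listed⟩
  · refine AnalogsAre.of_rescale (ne_zero_vec hα) ?_
    rw [S5_rescale hα, mul_div_cancel_right₀ _ hα]
    exact analogsAre_S512
  · refine AnalogsAre.of_rescale (ne_zero_vec hβ) ?_
    rw [S5_zero_rescale hβ]
    exact analogsAre_S501
  · refine AnalogsAre.of_rescale (ne_zero_vec hα) ?_
    rw [S5_rescale hα, zero_div]
    exact analogsAre_S510
  · refine NoAnalogs.of_rescale (ne_zero_vec hα) ?_
    rw [S5_rescale hα]
    refine noAnalogs_S5 (div_ne_zero hβ hα) fun h' => h ?_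
    rwa [div_eq_iff hα] at h'
  · refine AnalogsAre.of_rescale (ne_zero_vec hα) ?_
    rw [L3_rescale hα, zero_div]
    exact analogsAre_L310
  · refine NoAnalogs.of_rescale (ne_zero_vec hα) ?_
    rw [L3_rescale hα]
    exact noAnalogs_L3 (div_ne_zero hβ hα)
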